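/- **Setting.** A virtual link $L$ is given by a Gauss diagram: signed classical crossings and, for each component, the cyclic word of its over- and under-passages (a component may have none). *Generalized Alexander (JKS) polynomial.* Take one generator for each semi-arc of $L$ (each arc between consecutive classical passages; one for each crossing-free component). At each crossing of sign $\varepsilon=\pm1$ impose $o_{\rm out}=t^{\varepsilon}o_{\rm in}$ for the over-strand and $u_{\rm out}=s^{\varepsilon}u_{\rm in}+(1-(st)^{\varepsilon})\,o_{\rm in}$ for the under-strand. Then $G_L(s,t)\in\mathbb Z[s^{\pm1},t^{\pm1}]$ is the determinant of the resulting square relation matrix (with a zero row for each crossing-free component); as a link invariant it is defined up to units $\pm s^it^j$. *Surface diagrams.* Let $\Sigma$ be a closed connected oriented surface of genus $g>0$ and $\Omega=(x_1,y_1,\dots,x_g,y_g)$ simple closed curves meeting only in a base point $\infty$, with $x_i\cdot y_j=\delta_{ij}$, $x_i\cdot x_j=y_i\cdot y_j=0$, that cut $\Sigma$ into a polygon with boundary $\prod_i x_i^{-1}y_i^{-1}x_iy_i$. Let $D$ be a link diagram on $\Sigma$ transverse to $\Omega$ and missing $\infty$. It is a diagram of $L$ if its Gauss diagram is that of $L$.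 *Homotopy $\mathrm{Zh}$-construction.* $\mathrm{Zh}_\Omega(D)$ is the prismatic link in the plane whose components of colour $\alpha$ have the crossings of $D$ and, moreover, pass under a strand of colour $y_i$ (resp. $x_i$) wherever $D$ crosses $x_i$ (resp. $y_i$), the sign of this crossing being $D\cdot x_i$ (resp. $-D\cdot y_i$) there. For each $z\in\Omega$ the over-crossing arcs of colour $z$ are joined in an arbitrary way to exactly one component of colour $z$; all other crossings are virtual. *Prismatic $U_q(\mathfrak{gl}(1|1))$ polynomial.* $\widetilde Q^{1|1}_\Omega(W)\in\mathbb Z[q^{\pm1},x_i^{\pm1},y_i^{\pm1}]$ is the value of the following functor on a planar diagram $W$ of a prismatic link, composed from bottom to top of elementary tangles. The colour $\alpha$ is the space $V$ with even basis vector $e_1$ and odd basis vector $e_2$, each colour in $\Omega$ is trivial, and, writing $e_{ij}=e_i\otimes e_j$: - positive crossing (upward $\alpha$-strands): $e_{11}\mapsto q^{-1}e_{11}$, $e_{12}\mapsto e_{21}$, $e_{21}\mapsto e_{12}+(q^{-1}-q)e_{21}$, $e_{22}\mapsto -q\,e_{22}$; negative crossing: the inverse; - virtual $\alpha\alpha$-crossing: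 $e_{11}\mapsto e_{11}$, $e_{12}\mapsto q^{-1}e_{21}$, $e_{21}\mapsto q\,e_{12}$, $e_{22}\mapsto -e_{22}$; other virtual crossings: the flip; - a $z$-coloured strand over an $\alpha$-strand with sign $\varepsilon$: $e_1\mapsto e_1$, $e_2\mapsto z^{-\varepsilon}e_2$; - $\alpha$-coloured cups and caps, read from left to right: $\cup_{\uparrow\downarrow}\mapsto e_{11}+e_{22}$, $\cup_{\downarrow\uparrow}\mapsto q^{-1}(e_{11}-e_{22})$, $\cap_{\downarrow\uparrow}\colon e_{11},e_{22}\mapsto 1$, $\cap_{\uparrow\downarrow}\colon e_{11}\mapsto q,\ e_{22}\mapsto -q$, and $e_{12},e_{21}\mapsto0$ for the caps; those with a colour in $\Omega$ are trivial. *CSW polynomial.* $D$ gives a link in $\Sigma\times[0,1]$, again denoted $D$, with complement $X$. Let $\varphi:\pi_1(X)\to\langle t\rangle\times H_1(\Sigma)$ send positive meridians to $t$ and the curves of $\Omega$ on $\Sigma\times\{1\}$ to their homology classes. The Alexander module $A(D)$ over $\mathbb Z[\langle t\rangle\times H_1(\Sigma)]$ is the first homology of the corresponding cover of $X$ relative to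 the preimage of $\Sigma\times\{1\}$; equivalently, it is obtained from the infinite cyclic cover of the complement of the lift of $D$ to $\widetilde\Sigma\times[0,1]$, where $\widetilde\Sigma$ is the universal cover of $\Sigma$, by passing from $\pi_1(\Sigma)$ to $H_1(\Sigma)$. The CSW polynomial $\Delta^0_D(t,x_1,y_1,\dots,x_g,y_g)$ is a generator of the zeroth elementary ideal of $A(D)$. **Theorem 7.2.** For every virtual link $L$ there are a closed connected oriented surface $\Sigma$ of genus $g>0$, a diagram $D$ of $L$ on $\Sigma$ and a symplectic basis $\Omega=(x_1,y_1,\dots,x_g,y_g)$, as above, with the following properties. 1. $\mathrm{Zh}_\Omega(D)$ has a planar diagram, and for every planar diagram $W$ of $\mathrm{Zh}_\Omega(D)$, however the arcs of each colour are joined up, there is an integer $k$ with $$\widetilde Q^{1|1}_\Omega(W)(q^{-1},w^{-1},\dots,w^{-1})=\pm q^{k}\,G_L(q^{-2}w^{-1},w).$$ 2. The zeroth elementary ideal of $A(D)$ is principal, so that $\Delta_D^0$ exists, and for each choice of $\Delta_D^0$ $$\Delta^0_D(q^2,w,w,\dots,w)\doteq G_L(q^{-2}w^{-1},w)$$ up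 to multiplication by a unit of $\mathbb Z[q^{\pm1},w^{\pm1}]$. In particular, $G_L$ is, after a change of variables and up to units, a specialization of the CSW polynomial. -/

import Mathlib

namespace PrismaticLink

/-! ### Colours and decorated Gauss codes -/

/-- The symplectic palette `x₁, y₁, …, x_g, y_g`: `Sum.inl i` is `xᵢ` and `Sum.inr i` is `yᵢ`. -/
abbrev Palette (g : ℕ) : Type := Fin g ⊕ Fin g

/-- Colour of a strand: `none` is the distinguished colour `α` of the link itself, and `some z` is
the colour `z ∈ Ω`. -/
abbrev Color (g : ℕ) : Type := Option (Palette g)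

/-- The sign `±1` encoded by a Boolean (`true` is `+1`). -/
def sgn (b : Bool) : ℤ := if b then 1 else -1

/-- What an `α`-strand meets: `over c ε` and `under c ε` are the over- and the under-passage of the
classical crossing with label `c` and sign `ε`, and `omega z ε` is an under-passage
at a crossing of sign `ε` whose over-strand has colour `z`. -/
inductive Letter (g : ℕ) : Type
  | over (c : ℕ) (ε : Bool)
  | under (c : ℕ) (ε : Bool)
  | omega (z : Palette g) (ε : Bool)

/-- A decorated Gauss code: one cyclic word of letters for each component. The empty word is a
component without crossings. -/
abbrev Code (g : ℕ) : Type := List (List (Letter g))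

/-- Renaming of the classical crossings. -/
def Letter.relabel {g : ℕ} (σ : ℕ → ℕ) : Letter g → Letter g
  | .over c ε => .over (σ c) ε
  | .under c ε => .under (σ c) ε
  | .omega z ε => .omega z ε

/-- Is the letter a passage through a classical crossing? -/
def Letter.isClassical {g : ℕ} : Letter g → Bool
  | .omega _ _ => false
  | _ => true

/-- Forget the crossings with `Ω`-coloured strands. -/
def Code.erase {g : ℕ} (C : Code g) : Code g := C.map (List.filter Letter.isClassical)

/-- The (decorated) Gauss diagram of a code: unordered components, each up to rotation. -/
def Code.diagram {g : ℕ} (C : Code g) : Multiset (Cycle (Letter g)) :=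
  Multiset.ofList (C.map fun w => Cycle.ofList w)

/-- Equality of (decorated) Gauss diagrams up to the names of the classical crossings. -/
def Code.Equivalent {g : ℕ} (C C' : Code g) : Prop :=
  ∃ σ : Equiv.Perm ℕ, Code.diagram (C.map (List.map (Letter.relabel σ))) = Code.diagram C'

/-! ### Virtual links -/

/-- A virtual link diagram, recorded by its Gauss diagram (that is, up to detour moves): signed
classical crossings and, for each component, the cyclic word of its passages
`(c, true)` (over) and `(c, false)` (under). Each passage occurs exactly once; the empty word is a
component without classical crossings. -/
structure VirtualLink where
  n : ℕ
  sign : Fin n → Bool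
  comps : List (List (Fin n × Bool))
  nodup : comps.flatten.Nodup
  complete : ∀ p : Fin n × Bool, p ∈ comps.flatten

/-- The Gauss code of `L`, as a decorated code without `Ω`-crossings. -/
def VirtualLink.code (L : VirtualLink) (g : ℕ) : Code g :=
  L.comps.map (List.map fun p =>
    if p.2 then Letter.over p.1 (L.sign p.1) else Letter.under p.1 (L.sign p.1))

/-! ### Laurent polynomials -/

/-- The Laurent monomial with exponent `a`, as a unit of the Laurent polynomial ring `ℤ[A]`. -/
noncomputable def mono {A : Type*} [AddCommGroup A] (a : A) : (AddMonoidAlgebra ℤ A)ˣ :=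
  (AddMonoidAlgebra.of ℤ A).toHomUnits (Multiplicative.ofAdd a)

/-- `ℤ[u^±¹, x₁^±¹, y₁^±¹, …, x_g^±¹, y_g^±¹]`, where `u` is `q` (for the quantum polynomial)
or `t` (for the CSW polynomial, where this ring is `ℤ[ℤ × H₁(Σ)]`). -/
abbrev LaurentPalette (g : ℕ) : Type := AddMonoidAlgebra ℤ (ℤ × (Palette g → ℤ))

/-- `ℤ[u^±¹, v^±¹]`, used with `(u, v) = (s, t)` and with `(u, v) = (q, w)`. -/
abbrev LaurentTwo : Type := AddMonoidAlgebra ℤ (ℤ × ℤ)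

/-- The unit `u`. -/
noncomputable def uVar (g : ℕ) : (LaurentPalette g)ˣ := mono ((1, 0) : ℤ × (Palette g → ℤ))

/-- The unit `z`, for `z` in the palette. -/
noncomputable def zVar {g : ℕ} (z : Palette g) : (LaurentPalette g)ˣ :=
  mono ((0, Pi.single z 1) : ℤ × (Palette g → ℤ))

/-! ### The generalized Alexander polynomial -/

namespace VirtualLink

/-- The passage that follows a given one on its component. -/
def next (L : VirtualLink) : Equiv.Perm (Fin L.n × Bool) := (L.comps.map List.formPerm).prod

/-- The relations of the Alexander biquandle module. The semi-arc that leaves the passage `p` is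
named `p`, so the one that enters `p` is `L.next⁻¹ p`. At a crossing of sign `ε`, the outgoing
over-arc is `t^ε` times the incoming over-arc, and the outgoing under-arc is `s^ε` times the
incoming under-arc plus `1 - (st)^ε` times the incoming over-arc. -/
noncomputable def transfer (L : VirtualLink) :
    Matrix (Fin L.n × Bool) (Fin L.n × Bool) LaurentTwo := fun p =>
  let s : LaurentTwoˣ := mono ((1, 0) : ℤ × ℤ)
  let t : LaurentTwoˣ := mono ((0, 1) : ℤ × ℤ)
  let ε := sgn (L.sign p.1)
  if p.2 then Pi.single (L.next⁻¹ (p.1, true)) ((t ^ ε : LaurentTwoˣ) : LaurentTwo)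
  else Pi.single (L.next⁻¹ (p.1, false)) ((s ^ ε : LaurentTwoˣ) : LaurentTwo)
    + Pi.single (L.next⁻¹ (p.1, true)) (1 - (((s * t) ^ ε : LaurentTwoˣ) : LaurentTwo))

/-- The generalized Alexander polynomial `G_L(s,t)`, normalised as the determinant of the square
relation matrix; a component without crossings gives a generator without a relation. -/
noncomputable def gap (L : VirtualLink) : LaurentTwo :=
  (Matrix.fromBlocks (1 - L.transfer) 0 0
    (0 : Matrix (Fin (L.comps.count [])) (Fin (L.comps.count [])) LaurentTwo)).det

end VirtualLink

/-- The change of variables `G(s,t) ↦ G(q⁻² w⁻¹, w)`. -/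
noncomputable def gapSubst : LaurentTwo →+* LaurentTwo :=
  AddMonoidAlgebra.mapDomainRingHom ℤ
    ({ toFun := fun a => (-2 * a.1, -a.1 + a.2)
       map_zero' := by simp
       map_add' := fun a b => by ext <;> simp <;> ring } : ℤ × ℤ →+ ℤ × ℤ)

/-! ### Planar prismatic tangle words -/

/-- Elementary prismatic tangles, read from bottom to top. A classical crossing has both strands
oriented upwards and coloured `α`; the over-strand of `pos` goes from bottom left to top right, that
of `neg` from bottom right to top left. `virt c d` is a virtual crossing of two upward strands
coloured `c` (bottom left) and `d` (bottom right). `overPos z` and `overNeg z` are the positive and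
the negative crossing of upward strands at which a `z`-coloured strand passes over an `α`-strand.
`cupR`/`cupL` create the pair (up, down)/(down, up), and `capR`/`capL` close the pair
(down, up)/(up, down). -/
inductive Piece (g : ℕ) : Type
  | pos
  | neg
  | virt (c d : Color g)
  | overPos (z : Palette g)
  | overNeg (z : Palette g)
  | cupR (c : Color g)
  | cupL (c : Color g)
  | capR (c : Color g)
  | capL (c : Color g)

/-- A layer `(n, P)` of a tangle: the piece `P` with `n` vertical strands to its left. -/
abbrev Layer (g : ℕ) : Type := ℕ × Piece g

/-- A tangle diagram as a stack of layers, from bottom to top. -/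
abbrev Word (g : ℕ) : Type := List (Layer g)

/-- The pieces allowed for the part of a classical diagram inside a disc. -/
def Piece.isPlain {g : ℕ} : Piece g → Prop
  | .pos => True
  | .neg => True
  | .virt _ _ => False
  | .overPos _ => False
  | .overNeg _ => False
  | .cupR c => c = none
  | .cupL c => c = none
  | .capR c => c = none
  | .capL c => c = none

/-- A strand cut by a horizontal line. Below the line the strand runs from its downward point
to an upward point; both ends carry the same identifier `arc`, and
the letters met in between are stored at the upward end. -/
structure Pt (g : ℕ) where
  color : Color g
  up : Bool
  arc : ℕ ⊕ (Palette g × ℕ)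
  word : List (Letter g)

/-- The points on a horizontal line, from left to right, and the closed components below it. -/
structure State (g : ℕ) where
  pts : List (Pt g)
  closed : List (Color g × List (Letter g))

/-- Does the strand go upwards with colour `c`? -/
abbrev Pt.IsUp {g : ℕ} (p : Pt g) (c : Color g) : Prop := p.up = true ∧ p.color = c

/-- Does the strand go downwards with colour `c`? -/
abbrev Pt.IsDown {g : ℕ} (p : Pt g) (c : Color g) : Prop := p.up = false ∧ p.color = c

/-- Record a letter at the upward end of a strand. -/
def Pt.meet {g : ℕ} (p : Pt g) (x : Letter g) : Pt g := { p with word := p.word ++ [x] }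

/-- Close the upward end `u` with the downward end `d`; `rest` are the other points. -/
def State.join {g : ℕ} (u d : Pt g) (rest : List (Pt g))
    (closed : List (Color g × List (Letter g))) : State g :=
  if u.arc = d.arc then ⟨rest, closed ++ [(u.color, u.word)]⟩
  else ⟨rest.map fun p =>
    if p.up = true ∧ p.arc = d.arc then { p with arc := u.arc, word := u.word ++ p.word } else p,
    closed⟩

/-- Put one layer on top; `k` is a fresh number. The result is `none` if the layer does not fit. -/
def State.step {g : ℕ} (S : State g) (k : ℕ) (ℓ : Layer g) : Option (State g) :=
  if ℓ.1 ≤ S.pts.length then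
    let l := S.pts.take ℓ.1
    match ℓ.2, S.pts.drop ℓ.1 with
    | .pos, p :: p' :: r =>
      if p.IsUp none ∧ p'.IsUp none then
        some ⟨l ++ p'.meet (.under k true) :: p.meet (.over k true) :: r, S.closed⟩ else none
    | .neg, p :: p' :: r =>
      if p.IsUp none ∧ p'.IsUp none then
        some ⟨l ++ p'.meet (.over k false) :: p.meet (.under k false) :: r, S.closed⟩ else none
    | .virt c d, p :: p' :: r =>
      if p.IsUp c ∧ p'.IsUp d then some ⟨l ++ p' :: p :: r, S.closed⟩ else none
    | .overPos z, p :: p' :: r =>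
      if p.IsUp (some z) ∧ p'.IsUp none then
        some ⟨l ++ p'.meet (.omega z true) :: p :: r, S.closed⟩ else none
    | .overNeg z, p :: p' :: r =>
      if p.IsUp none ∧ p'.IsUp (some z) then
        some ⟨l ++ p' :: p.meet (.omega z false) :: r, S.closed⟩ else none
    | .cupR c, r => some ⟨l ++ ⟨c, true, .inl k, []⟩ :: ⟨c, false, .inl k, []⟩ :: r, S.closed⟩
    | .cupL c, r => some ⟨l ++ ⟨c, false, .inl k, []⟩ :: ⟨c, true, .inl k, []⟩ :: r, S.closed⟩
    | .capR c, d :: u :: r =>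
      if d.IsDown c ∧ u.IsUp c then some (State.join u d (l ++ r) S.closed) else none
    | .capL c, u :: d :: r =>
      if u.IsUp c ∧ d.IsDown c then some (State.join u d (l ++ r) S.closed) else none
    | _, _ => none
  else none

/-- Put a word on top; the layers are numbered from `k` on, and the number of a layer is the label
of its crossing. -/
def State.run {g : ℕ} : State g → ℕ → Word g → Option (State g)
  | S, _, [] => some S
  | S, k, ℓ :: W => (S.step k ℓ).bind fun S' => State.run S' (k + 1) W

/-- The word `W` is the diagram of a prismatic link with the components `cs`: it is composable
and has no free ends. -/
def Word.IsLink {g : ℕ} (W : Word g) (cs : List (Color g × List (Letter g))) : Prop :=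
  State.run ⟨[], []⟩ 0 W = some ⟨[], cs⟩

/-- The decorated Gauss code of the `α`-coloured components. -/
def linkCode {g : ℕ} (cs : List (Color g × List (Letter g))) : Code g :=
  (cs.filter fun c => c.1 = none).map Prod.snd

/-! ### Diagrams on a surface with a symplectic basis -/

/-- The crossing with an `Ω`-strand that the homotopy `Zh`-construction puts where the diagram `D`
crosses the curve `z`, where `b` says whether the intersection number `D · z` is `+1`:
at `xᵢ` one finds a strand of colour `yᵢ`, at `yᵢ` one of colour `xᵢ`. -/
def sideLetter {g : ℕ} (z : Palette g) (b : Bool) : Letter g :=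
  match z with
  | .inl i => .omega (.inr i) b
  | .inr i => .omega (.inl i) (!b)

/-- The `j`-th intersection point with the curve `z`, seen on one of the two sides of the polygon
that are labelled `z`; `up` says that the diagram enters the polygon there. -/
def sidePt {g : ℕ} (z : Palette g) (up : Bool) (p : Bool × ℕ) : Pt g :=
  ⟨none, up, .inr (z, p.2), if up then [sideLetter z p.1] else []⟩

/-- The boundary points on the side `z` (where the polygon lies to the left of `z`). -/
def forwardSide {g : ℕ} (z : Palette g) (l : List Bool) : List (Pt g) :=
  l.zipIdx.map fun p => sidePt z (!p.1) p

/-- The boundary points on the side `z⁻¹` (where the polygon lies to the right of `z`). -/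
def backwardSide {g : ℕ} (z : Palette g) (l : List Bool) : List (Pt g) :=
  (l.zipIdx.map fun p => sidePt z p.1 p).reverse

/-- The boundary of the polygon, cut open at the base point and laid out on a line from left to
right: `x₁⁻¹ y₁⁻¹ x₁ y₁ ⋯ x_g⁻¹ y_g⁻¹ x_g y_g`, read counterclockwise. -/
def boundary {g : ℕ} (pts : Palette g → List Bool) : List (Pt g) :=
  (List.finRange g).flatMap fun i =>
    backwardSide (.inl i) (pts (.inl i)) ++ backwardSide (.inr i) (pts (.inr i)) ++
    forwardSide (.inl i) (pts (.inl i)) ++ forwardSide (.inr i) (pts (.inr i))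

/-- A link diagram `D` on the closed oriented surface `Σ` of genus `g`, together with a symplectic
basis `Ω`, given by simple closed curves `xᵢ, yᵢ` that meet only in the base point `∞`,
with `xᵢ · yⱼ = δᵢⱼ` and `xᵢ · xⱼ = yᵢ · yⱼ = 0`, transverse to `D`, and such that cutting `Σ` along
`Ω` gives the `4g`-gon with boundary `∏ xᵢ⁻¹ yᵢ⁻¹ xᵢ yᵢ`. The list `pts z` contains, in the
direction of `z`, the points of `D ∩ z`, an entry being `true` if `D · z = +1` there (so `D` leaves
the polygon through the side `z` and enters it through the side `z⁻¹`) and `false` if `D · z = -1`.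
The polygon is drawn as an upper half plane, and `word` is the part of `D` in it. -/
structure SurfaceDiagram (g : ℕ) where
  pts : Palette g → List Bool
  word : Word g
  plain : ∀ ℓ ∈ word, ℓ.2.isPlain
  comps : List (Color g × List (Letter g))
  closes : State.run ⟨boundary pts, []⟩ 0 word = some ⟨[], comps⟩

namespace SurfaceDiagram

variable {g : ℕ}

/-- The Gauss code of `D`, decorated with the intersections of `D` with `Ω`. -/
def code (D : SurfaceDiagram g) : Code g := linkCode D.comps

/-- `D` is a diagram of the virtual link `L`. -/
def Represents (D : SurfaceDiagram g) (L : VirtualLink) : Prop :=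
  Code.Equivalent (Code.erase D.code) (L.code g)

/-- `W` is a diagram of the prismatic link `Zh_Ω(D)`: a link whose `α`-components have the same
decorated Gauss diagram as `D`, with exactly one component of each colour `z ∈ Ω`. The arcs
of colour `z` are joined up to a component in an arbitrary way, with virtual crossings. -/
def IsZh (D : SurfaceDiagram g) (W : Word g) : Prop :=
  ∃ cs, W.IsLink cs ∧ Code.Equivalent (linkCode cs) D.code ∧
    ∀ z : Palette g, cs.countP (fun c => c.1 = some z) = 1

end SurfaceDiagram

/-! ### The prismatic `U_q(gl(1|1))` polynomial -/

section Quantum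

variable {K : Type*} [CommRing K] {g : ℕ}

/-- The prismatic `U_q(gl(1|1))` functor on elementary tangles, acting on the leftmost
tensor factors. The colour `α` is the vector representation with even basis vector `false` and odd
basis vector `true`; the colours in `Ω` are the trivial representation, with basis vector `false`.
A tensor of basis vectors is a list. -/
noncomputable def Piece.eval (q : Kˣ) (z : Palette g → Kˣ) :
    Piece g → List Bool → (List Bool →₀ K)
  | .pos, false :: false :: r => .single (false :: false :: r) ↑q⁻¹
  | .pos, false :: true :: r => .single (true :: false :: r) 1
  | .pos, true :: false :: r => .single (false :: true :: r) 1
      + .single (true :: false :: r) (↑q⁻¹ - ↑q)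
  | .pos, true :: true :: r => .single (true :: true :: r) (-↑q)
  | .neg, false :: false :: r => .single (false :: false :: r) ↑q
  | .neg, false :: true :: r => .single (true :: false :: r) 1
      + .single (false :: true :: r) (↑q - ↑q⁻¹)
  | .neg, true :: false :: r => .single (false :: true :: r) 1
  | .neg, true :: true :: r => .single (true :: true :: r) (-↑q⁻¹)
  | .virt none none, false :: false :: r => .single (false :: false :: r) 1
  | .virt none none, false :: true :: r => .single (true :: false :: r) ↑q⁻¹
  | .virt none none, true :: false :: r => .single (false :: true :: r) ↑q
  | .virt none none, true :: true :: r => .single (true :: true :: r) (-1)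
  | .virt _ _, a :: b :: r => .single (b :: a :: r) 1
  | .overPos c, a :: b :: r => .single (b :: a :: r) (if b then ↑(z c)⁻¹ else 1)
  | .overNeg c, a :: b :: r => .single (b :: a :: r) (if a then ↑(z c) else 1)
  | .cupR none, r => .single (false :: false :: r) 1 + .single (true :: true :: r) 1
  | .cupR (some _), r => .single (false :: false :: r) 1
  | .cupL none, r => .single (false :: false :: r) ↑q⁻¹ + .single (true :: true :: r) (-↑q⁻¹)
  | .cupL (some _), r => .single (false :: false :: r) 1
  | .capR _, false :: false :: r => .single r 1
  | .capR none, true :: true :: r => .single r 1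
  | .capL none, false :: false :: r => .single r ↑q
  | .capL none, true :: true :: r => .single r (-↑q)
  | .capL (some _), false :: false :: r => .single r 1
  | _, _ => 0

/-- The linear map of a layer. -/
noncomputable def Layer.eval (q : Kˣ) (z : Palette g → Kˣ) (ℓ : Layer g) :
    (List Bool →₀ K) →ₗ[K] (List Bool →₀ K) :=
  Finsupp.linearCombination K fun v =>
    Finsupp.mapDomain (fun r => v.take ℓ.1 ++ r) (ℓ.2.eval q z (v.drop ℓ.1))

/-- The scalar by which a word without free ends acts. -/
noncomputable def Word.eval (q : Kˣ) (z : Palette g → Kˣ) (W : Word g) : K :=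
  (W.foldl (fun v ℓ => Layer.eval q z ℓ v) (.single [] 1)) []

end Quantum

/-- The prismatic `U_q(gl(1|1))` polynomial `Q̃^{1|1}_Ω(W)(q, x₁, y₁, …, x_g, y_g)`. -/
noncomputable def quantumPoly {g : ℕ} (W : Word g) : LaurentPalette g :=
  Word.eval (uVar g) zVar W

/-- The substitution `q ↦ q⁻¹`, `xᵢ, yᵢ ↦ w⁻¹`. -/
noncomputable def quantumSubst (g : ℕ) : LaurentPalette g →+* LaurentTwo :=
  AddMonoidAlgebra.mapDomainRingHom ℤ
    ({ toFun := fun a => (-a.1, -∑ z, a.2 z)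
       map_zero' := by simp
       map_add' := fun a b => by
        ext <;> simp [Finset.sum_add_distrib] <;> ring } : ℤ × (Palette g → ℤ) →+ ℤ × ℤ)

/-! ### The CSW polynomial -/

section CSW

variable {g : ℕ}

/-- The arcs of a decorated code: the `i`-th arc of a component enters its `i`-th letter, and a
component without letters has one arc. -/
abbrev Arc (C : Code g) : Type := (j : Fin C.length) × Fin (max 1 (C.get j).length)

/-- The letter at the end of an arc. -/
def Arc.letter {C : Code g} (a : Arc C) : Option (Letter g) := (C.get a.1)[a.2.val]?

/-- The arc that leaves the letter at the end of an arc. -/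
def Arc.succ {C : Code g} (a : Arc C) : Arc C :=
  ⟨a.1, ⟨(a.2.val + 1) % max 1 (C.get a.1).length, Nat.mod_lt _ (by omega)⟩⟩

/-- Generators of the group of a link in `Σ × [0,1]`: meridians of the arcs, and the curves in `Ω`
(on `Σ × {1}`). -/
abbrev Gen (C : Code g) : Type := Arc C ⊕ Palette g

/-- The meridian of an arc. -/
def meridian {C : Code g} (a : Arc C) : FreeGroup (Gen C) := FreeGroup.of (Sum.inl a)

/-- The curve `xᵢ`. -/
def curveX (C : Code g) (i : Fin g) : FreeGroup (Gen C) := FreeGroup.of (Sum.inr (Sum.inl i))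

/-- The curve `yᵢ`. -/
def curveY (C : Code g) (i : Fin g) : FreeGroup (Gen C) := FreeGroup.of (Sum.inr (Sum.inr i))

/-- `[xᵢ, yᵢ] = xᵢ⁻¹ yᵢ⁻¹ xᵢ yᵢ`. -/
def handle (C : Code g) (i : Fin g) : FreeGroup (Gen C) :=
  (curveX C i)⁻¹ * (curveY C i)⁻¹ * curveX C i * curveY C i

/-- The product of the `[xⱼ, yⱼ]` with `j < i`: the path along the boundary of the polygon from the
base point to the side `xᵢ⁻¹`. -/
def handlesBefore (C : Code g) (i : Fin g) : FreeGroup (Gen C) :=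
  (((List.finRange g).filter fun j => j < i).map (handle C)).prod

/-- The surface relator `∏ [xᵢ, yᵢ]`. -/
def surfaceRelator (C : Code g) : FreeGroup (Gen C) := ((List.finRange g).map (handle C)).prod

/-- The covering transformation of the universal cover of `Σ` that takes the side of the
polygon through which the diagram leaves at a letter `omega z ε` to the side through which it
enters again. (A letter of colour `yᵢ` sits on the curve `xᵢ` and one of colour `xᵢ` on `yᵢ`.) The
transformation that takes the side `xᵢ⁻¹` to the side `xᵢ` has class `yᵢ⁻¹` in homology, the one that
takes the side `yᵢ⁻¹` to the side `yᵢ` has class `xᵢ`. -/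
def deck (C : Code g) (z : Palette g) (ε : Bool) : FreeGroup (Gen C) :=
  match z with
  | .inr i =>
    let δ := handlesBefore C i * (curveX C i)⁻¹ * (curveY C i)⁻¹ * curveX C i *
      (handlesBefore C i)⁻¹
    if ε then δ⁻¹ else δ
  | .inl i =>
    let δ := handlesBefore C i * (curveX C i)⁻¹ * (curveY C i)⁻¹ * curveX C i * curveY C i *
      curveX C i * (handlesBefore C i)⁻¹
    if ε then δ else δ⁻¹

/-- The relators of the group of a link in `Σ × [0,1]`: the surface relator, no change at an
over-passage, the Wirtinger relators at the under-passages, and conjugation by a covering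
transformation where the diagram crosses `Ω`. -/
inductive IsRelator (C : Code g) : FreeGroup (Gen C) → Prop
  | surface : IsRelator C (surfaceRelator C)
  | over (a : Arc C) (c : ℕ) (ε : Bool) (h : a.letter = some (.over c ε)) :
      IsRelator C (meridian a * (meridian a.succ)⁻¹)
  | underPos (a o : Arc C) (c : ℕ) (h : a.letter = some (.under c true))
      (ho : o.letter = some (.over c true)) :
      IsRelator C ((meridian o)⁻¹ * meridian a * meridian o * (meridian a.succ)⁻¹)
  | underNeg (a o : Arc C) (c : ℕ) (h : a.letter = some (.under c false))
      (ho : o.letter = some (.over c false)) :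
      IsRelator C (meridian o * meridian a * (meridian o)⁻¹ * (meridian a.succ)⁻¹)
  | omega (a : Arc C) (z : Palette g) (ε : Bool) (h : a.letter = some (.omega z ε)) :
      IsRelator C (deck C z ε * meridian a * (deck C z ε)⁻¹ * (meridian a.succ)⁻¹)

/-- The group `π₁(Σ × [0,1] ∖ L)`. -/
abbrev LinkGroup (C : Code g) : Type := PresentedGroup {r | IsRelator C r}

/-- Meridians go to `t`, and `xᵢ`, `yᵢ` to their homology classes. -/
def abGen (C : Code g) : Gen C → Multiplicative (ℤ × (Palette g → ℤ))
  | .inl _ => .ofAdd (1, 0)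
  | .inr z => .ofAdd (0, Pi.single z 1)

theorem lift_handle (C : Code g) (i : Fin g) : FreeGroup.lift (abGen C) (handle C i) = 1 := by
  simp [handle]

theorem lift_isRelator (C : Code g) (r : FreeGroup (Gen C)) (h : r ∈ {r | IsRelator C r}) :
    FreeGroup.lift (abGen C) r = 1 := by
  rcases h with h | h | h | h | h
  · rw [surfaceRelator, map_list_prod]
    refine List.prod_eq_one ?_
    intro x hx
    simp only [List.mem_map] at hx
    obtain ⟨y, ⟨i, -, rfl⟩, rfl⟩ := hx
    exact lift_handle C i
  all_goals simp [meridian, abGen, mul_comm]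

/-- The homomorphism `π₁(Σ × [0,1] ∖ L) → ⟨t⟩ × H₁(Σ)`. -/
noncomputable def ab (C : Code g) : LinkGroup C →* Multiplicative (ℤ × (Palette g → ℤ)) :=
  PresentedGroup.toGroup (lift_isRelator C)

/-- The relations of the Alexander module: lifts of loops satisfy `[hk] = [h] + φ(h)[k]`, and the
lifts of the curves in `Ω`, which lie over `Σ × {1}`, vanish. -/
noncomputable def alexanderRelations (C : Code g) :
    Submodule (LaurentPalette g) (LinkGroup C →₀ LaurentPalette g) :=
  Submodule.span (LaurentPalette g)
    ({v | ∃ h k : LinkGroup C, v = Finsupp.single (h * k) 1 - Finsupp.single h 1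
        - Finsupp.single k (AddMonoidAlgebra.of ℤ _ (ab C h))} ∪
      {v | ∃ z : Palette g, v = Finsupp.single (PresentedGroup.of (Sum.inr z)) 1})

/-- The Alexander module: the first homology of the cover of `Σ × [0,1] ∖ L` with group
`⟨t⟩ × H₁(Σ)` relative to the preimage of `Σ × {1}`. -/
abbrev AlexanderModule (C : Code g) : Type :=
  (LinkGroup C →₀ LaurentPalette g) ⧸ alexanderRelations C

end CSW

/-- The zeroth elementary (Fitting) ideal of a module: generated by the determinants of all square
matrices of relations between the members of finite generating families. -/
def zerothIdeal (R M : Type*) [CommRing R] [AddCommGroup M] [Module R M] : Ideal R :=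
  Ideal.span {d | ∃ (n : ℕ) (m : Fin n → M) (A : Matrix (Fin n) (Fin n) R),
    Submodule.span R (Set.range m) = ⊤ ∧ (∀ i, ∑ j, A i j • m j = 0) ∧ A.det = d}

/-- `Δ` is a CSW polynomial of `D`: a generator of the zeroth ideal of its Alexander module. -/
def SurfaceDiagram.IsCSW {g : ℕ} (D : SurfaceDiagram g) (Δ : LaurentPalette g) : Prop :=
  zerothIdeal (LaurentPalette g) (AlexanderModule D.code) = Ideal.span {Δ}

/-- The substitution `t ↦ q²`, `xᵢ, yᵢ ↦ w`. -/
noncomputable def cswSubst (g : ℕ) : LaurentPalette g →+* LaurentTwo :=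
  AddMonoidAlgebra.mapDomainRingHom ℤ
    ({ toFun := fun a => (2 * a.1, ∑ z, a.2 z)
       map_zero' := by simp
       map_add' := fun a b => by
        ext <;> simp [Finset.sum_add_distrib, mul_add] } : ℤ × (Palette g → ℤ) →+ ℤ × ℤ)

end PrismaticLink

open PrismaticLink

/-! All three polynomials come from one determinant, `codeDet τ ζ`, attached to a Gauss code
decorated with crossings with `Ω`. Each component gives a generator for its first arc, and each
classical crossing gives one for its over-arc. Along a component, an arc is unchanged at an
over-passage, becomes `τ^ε • in + (1 - τ^ε) • over` at an under-passage of sign `ε`, and is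
multiplied by `ζ z ^ ε` at a crossing with a strand of colour `z`. The relations define the
over-arcs and close each component up. The system is square, and up to sign its determinant depends
only on the decorated Gauss diagram up to names of crossings (`signEq_codeDet_of_equivalent`).

CSW polynomial: classes of lifted loops obey the crossed rule `[hk] = [h] + φ(h)[k]`. It turns the
Wirtinger relators and the conjugations by covering transformations into the relations above, with
`τ = t⁻¹` and `ζ z = z`. So the Alexander module has a square presentation with determinant
`codeDet`, and a Fitting ideal with such a presentation is generated by the determinant
(`zerothIdeal_alexanderModule`).

Quantum polynomial: tensor powers of the vector representation behave like an exterior algebra, on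
which a crossing acts, up to a scalar, as the exterior power of a Burau matrix with parameter `q²`.
The vector below a horizontal line is described by `amp`: its coefficient at a basis tensor is an
alternating form, evaluated on the arcs selected by the odd vectors on upward strands and the even
vectors on downward ones. The form is `systemForm`, the determinant of the relations found so far
with open slots for the missing rows. A crossing performs a substitution, a cup adds a generator, a
cap fills a slot with the relation that identifies two ends. When no ends are left, `± q^m` times
the full determinant remains, with `τ = q²` and `ζ z = z⁻¹` (`word_eval_eq_codeDet`).

Generalized Alexander polynomial: if all `ζ z` equal `t` and `τ = s t`, crossings with `Ω` only
rescale arcs, so only their net exponents matter. The biquandle relations differ from those above by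
a factor `t^ε` after an over-passage and `t^(-ε)` before an under-passage. If the net exponents
before the passages are those of `L.exponent`, the two systems agree after rescaling generators by
units (`signEq_codeDet_decorate`).

It remains to realise these exponents on a surface. A handle lets two neighbouring blocks of strands
exchange places, one gaining exponent `+1` and the other `-1` (`reaches_handle`); with enough
handles every order and all exponents occur (`exists_handleMoves`, `exists_surfaceDiagram`). The
substitutions `q ↦ q⁻¹`, `z ↦ w⁻¹` on the quantum side and `t ↦ q²`, `z ↦ w` on the CSW side both
lead to `τ = q⁻²`, `ζ = w`, that is `s = q⁻²w⁻¹`, `t = w`. -/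

namespace PrismaticLink

/-! ### Determinants of lists of vectors -/

section ListDet

variable {ι K : Type*} [CommRing K]

/-- The determinant of the coordinates of the vectors `L` at the indices `G`, and `0` if their
numbers differ. -/
noncomputable def ldet (G : List ι) (L : List (ι →₀ K)) : K :=
  if h : L.length = G.length then
    (Matrix.of fun i j : Fin G.length => L[i.val] G[j.val]).det else 0

theorem ldet_of_length {G : List ι} {L : List (ι →₀ K)} (n : ℕ) (hG : G.length = n)
    (hL : L.length = n) :
    ldet G L = (Matrix.of fun i j : Fin n => L[i.val] G[j.val]).det := by
  subst hG
  rw [ldet, dif_pos hL]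

theorem ldet_eq_zero_of_length {G : List ι} {L : List (ι →₀ K)} (h : L.length ≠ G.length) :
    ldet G L = 0 := dif_neg h

@[simp] theorem ldet_nil : ldet ([] : List ι) ([] : List (ι →₀ K)) = 1 := by simp [ldet]

/-- Exhibiting one entry as an updated row of a matrix that does not depend on it reduces linearity
in that entry to linearity of the determinant in a row. -/
theorem ldet_slot (G : List ι) (A B : List (ι →₀ K))
    (h : A.length + 1 + B.length = G.length) (x : ι →₀ K) :
    ldet G (A ++ x :: B) = (Matrix.updateRow
      (Matrix.of fun i j : Fin G.length => (A ++ 0 :: B).getD i.val 0 G[j.val])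
      ⟨A.length, by omega⟩ fun j => x G[j.val]).det := by
  rw [ldet_of_length G.length rfl (by simp; omega)]
  congr 1
  ext i j
  by_cases hi : i = ⟨A.length, by omega⟩
  · subst hi
    simp
  · have hi' : i.val ≠ A.length := fun h' => hi (Fin.ext h')
    rw [Matrix.updateRow_ne hi]
    simp only [Matrix.of_apply]
    congr 1
    rcases lt_or_gt_of_ne hi' with h1 | h1
    · simp [List.getElem_append_left, h1, List.getD_eq_getElem?_getD, List.getElem?_append_left]
    · rw [List.getElem_append_right h1.le, List.getD_eq_getElem?_getD,
        List.getElem?_append_right h1.le]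
      obtain ⟨m, hm⟩ : ∃ m, i.val - A.length = m + 1 := ⟨i.val - A.length - 1, by omega⟩
      have hm' : m < B.length := by have := i.2; omega
      simp [hm, hm']

/-- Multilinear and alternating functions of a list of vectors. -/
structure IsAlternating {E : Type*} [AddCommGroup E] [Module K E] (F : List E → K) : Prop where
  add : ∀ A B x y, F (A ++ (x + y) :: B) = F (A ++ x :: B) + F (A ++ y :: B)
  smul : ∀ A B (c : K) x, F (A ++ (c • x) :: B) = c * F (A ++ x :: B)
  self : ∀ A B x, F (A ++ x :: x :: B) = 0

theorem isAlternating_ldet (G : List ι) : IsAlternating (ldet (K := K) G) where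
  add A B x y := by
    by_cases h : A.length + 1 + B.length = G.length
    · simp only [ldet_slot G A B h]
      rw [← Matrix.det_updateRow_add]
      rfl
    · have h' : ∀ z, (A ++ z :: B).length ≠ G.length := fun z => by simpa [← add_assoc, add_right_comm] using h
      simp [ldet_eq_zero_of_length (h' _)]
  smul A B c x := by
    by_cases h : A.length + 1 + B.length = G.length
    · simp only [ldet_slot G A B h]
      rw [← Matrix.det_updateRow_smul]
      rfl
    · have h' : ∀ z, (A ++ z :: B).length ≠ G.length := fun z => by simpa [← add_assoc, add_right_comm] using h
      simp [ldet_eq_zero_of_length (h' _)]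
  self A B x := by
    by_cases h : (A ++ x :: x :: B).length = G.length
    · rw [ldet_of_length _ rfl h]
      have h' : A.length + (B.length + 1 + 1) = G.length := by simpa using h
      refine Matrix.det_zero_of_row_eq (i := ⟨A.length, by omega⟩)
        (j := ⟨A.length + 1, by omega⟩) (by simp) ?_
      ext j
      simp [List.getElem_append_right]
    · exact ldet_eq_zero_of_length h

namespace IsAlternating

variable {E : Type*} [AddCommGroup E] [Module K E] {F : List E → K}

theorem zero (hF : IsAlternating F) (A B : List E) : F (A ++ 0 :: B) = 0 := by
  have := hF.smul A B 0 0
  simpa using this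

theorem neg (hF : IsAlternating F) (A B : List E) (x : E) :
    F (A ++ (-x) :: B) = - F (A ++ x :: B) := by
  have := hF.smul A B (-1) x
  simpa using this

theorem sub (hF : IsAlternating F) (A B : List E) (x y : E) :
    F (A ++ (x - y) :: B) = F (A ++ x :: B) - F (A ++ y :: B) := by
  rw [sub_eq_add_neg, hF.add, hF.neg, sub_eq_add_neg]

theorem swap (hF : IsAlternating F) (A B : List E) (x y : E) :
    F (A ++ x :: y :: B) = - F (A ++ y :: x :: B) := by
  have h := hF.self A B (x + y)
  have h1 := hF.add A ((x + y) :: B) x y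
  have h2 := hF.add (A ++ [x]) B x y
  have h3 := hF.add (A ++ [y]) B x y
  simp only [List.append_assoc, List.singleton_append] at h2 h3
  rw [h1, h2, h3, hF.self, hF.self] at h
  linear_combination h

theorem append_left (hF : IsAlternating F) (P : List E) : IsAlternating fun L => F (P ++ L) where
  add A B x y := by simpa using hF.add (P ++ A) B x y
  smul A B c x := by simpa using hF.smul (P ++ A) B c x
  self A B x := by simpa using hF.self (P ++ A) B x

/-- The sign counts the adjacent transpositions that carry `x` across `A`. Elimination, caps and
cups all act on the front entry, and this brings a vector there. -/
theorem move (hF : IsAlternating F) (P A B : List E) (x : E) :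
    F (P ++ A ++ x :: B) = (-1) ^ A.length * F (P ++ x :: (A ++ B)) := by
  induction A generalizing P with
  | nil => simp
  | cons a A ih =>
    have := ih (P ++ [a])
    simp only [List.append_assoc, List.cons_append, List.nil_append] at this ⊢
    rw [this, hF.swap, List.length_cons, pow_succ]
    ring

/-- The sign is chosen before `A` and `B`: later the permuted block is a fixed stock of relations,
while the other entries vary with the basis tensor. -/
theorem perm (hF : IsAlternating F) {Y Y' : List E} (h : Y.Perm Y') :
    ∃ ε : ℤˣ, ∀ A B, F (A ++ Y ++ B) = ((ε : ℤ) : K) * F (A ++ Y' ++ B) := by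
  induction h with
  | nil => exact ⟨1, by simp⟩
  | cons x _ ih =>
    obtain ⟨ε, h⟩ := ih
    exact ⟨ε, fun A B => by simpa using h (A ++ [x]) B⟩
  | swap x y l =>
    exact ⟨-1, fun A B => by simpa using hF.swap A (l ++ B) y x⟩
  | trans _ _ ih1 ih2 =>
    obtain ⟨ε, h⟩ := ih1
    obtain ⟨δ, h'⟩ := ih2
    exact ⟨ε * δ, fun A B => by rw [h, h']; push_cast; ring⟩

/-- Adding to one entry a multiple of another one. -/
theorem add_mul_of_mem (hF : IsAlternating F) (A B : List E) (x y : E) (c : K)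
    (hy : y ∈ A ++ B) : F (A ++ (x + c • y) :: B) = F (A ++ x :: B) := by
  rw [hF.add, hF.smul]
  suffices F (A ++ y :: B) = 0 by simp [this]
  rw [List.mem_append] at hy
  rcases hy with hy | hy
  · obtain ⟨S, T, rfl⟩ := List.append_of_mem hy
    have := hF.move (S ++ [y]) T B y
    simp only [List.append_assoc, List.cons_append, List.nil_append] at this ⊢
    rw [this, hF.self, mul_zero]
  · obtain ⟨S, T, rfl⟩ := List.append_of_mem hy
    have h1 := hF.move A (y :: S) T y
    have h2 := hF.move (A ++ [y]) S T y
    simp only [List.append_assoc, List.cons_append, List.nil_append] at h1 h2 ⊢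
    rw [h2, hF.self, mul_zero]

end IsAlternating

theorem ldet_swap_index (A B : List ι) (x y : ι) (L : List (ι →₀ K)) :
    ldet (A ++ x :: y :: B) L = - ldet (A ++ y :: x :: B) L := by
  by_cases h : L.length = A.length + 2 + B.length
  · have e1 : (A ++ x :: y :: B).length = A.length + 2 + B.length := by simp; omega
    have e2 : (A ++ y :: x :: B).length = A.length + 2 + B.length := by simp; omega
    rw [ldet_of_length _ e1 h, ldet_of_length _ e2 h]
    let i : Fin (A.length + 2 + B.length) := ⟨A.length, by omega⟩
    let j : Fin (A.length + 2 + B.length) := ⟨A.length + 1, by omega⟩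
    have hij : i ≠ j := by simp [i, j]
    have := Matrix.det_permute' (Equiv.swap i j) (Matrix.of fun a b :
      Fin (A.length + 2 + B.length) => L[a.val] ((A ++ y :: x :: B)[b.val]))
    rw [Equiv.Perm.sign_swap hij] at this
    push_cast at this
    rw [neg_one_mul] at this
    rw [← this]
    congr 1
    ext a b
    simp only [Matrix.of_apply, Matrix.submatrix_apply, id]
    congr 1
    by_cases h1 : b = i
    · subst h1
      simp [i, j, List.getElem_append_right]
    by_cases h2 : b = j
    · subst h2
      simp [i, j, List.getElem_append_right]
    rw [Equiv.swap_apply_of_ne_of_ne h1 h2]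
    have h1' : b.val ≠ A.length := fun h => h1 (Fin.ext h)
    have h2' : b.val ≠ A.length + 1 := fun h => h2 (Fin.ext h)
    rcases lt_or_gt_of_ne h1' with h3 | h3
    · simp [List.getElem_append_left, h3]
    · rw [List.getElem_append_right h3.le, List.getElem_append_right h3.le]
      obtain ⟨m, hm⟩ : ∃ m, b.val - A.length = m + 2 := ⟨b.val - A.length - 2, by omega⟩
      simp [hm]
  · rw [ldet_eq_zero_of_length, ldet_eq_zero_of_length, neg_zero] <;> simp <;> omega

/-- The prefix `A` in the induction allows transpositions at any place. The sign is uniform in `L`,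
so that it can be absorbed into the scalar in front of an alternating form. -/
theorem ldet_perm_index {G G' : List ι} (h : G.Perm G') :
    ∃ ε : ℤˣ, ∀ L : List (ι →₀ K), ldet G L = ((ε : ℤ) : K) * ldet G' L := by
  suffices ∃ ε : ℤˣ, ∀ A, ∀ L : List (ι →₀ K),
      ldet (A ++ G) L = ((ε : ℤ) : K) * ldet (A ++ G') L by
    obtain ⟨ε, h⟩ := this
    exact ⟨ε, h []⟩
  induction h with
  | nil => exact ⟨1, by simp⟩
  | cons x _ ih =>
    obtain ⟨ε, h⟩ := ih
    exact ⟨ε, fun A L => by simpa using h (A ++ [x]) L⟩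
  | swap x y l => exact ⟨-1, fun A L => by simpa using ldet_swap_index A l y x L⟩
  | trans _ _ ih1 ih2 =>
    obtain ⟨ε, h⟩ := ih1
    obtain ⟨δ, h'⟩ := ih2
    exact ⟨ε * δ, fun A L => by rw [h, h']; push_cast; ring⟩

theorem ldet_perm {G : List ι} {L L' : List (ι →₀ K)} (h : L.Perm L') :
    ∃ ε : ℤˣ, ldet G L = ((ε : ℤ) : K) * ldet G L' := by
  obtain ⟨ε, h⟩ := (isAlternating_ldet (K := K) G).perm h
  exact ⟨ε, by simpa using h [] []⟩

/-- The substitution of `f` for the basis vector `b`. -/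
noncomputable def subst (b : ι) (f : ι →₀ K) : (ι →₀ K) →ₗ[K] (ι →₀ K) :=
  LinearMap.id + (Finsupp.lapply b).smulRight (f - Finsupp.single b 1)

theorem subst_apply (b : ι) (f v : ι →₀ K) :
    subst b f v = v + v b • (f - Finsupp.single b 1) := rfl

theorem subst_of_eq_zero {b : ι} {f v : ι →₀ K} (h : v b = 0) : subst b f v = v := by
  simp [subst_apply, h]

@[simp] theorem subst_single_self (b : ι) (f : ι →₀ K) :
    subst b f (Finsupp.single b 1) = f := by
  simp [subst_apply]

theorem subst_single_ne {b c : ι} (h : c ≠ b) (f : ι →₀ K) (a : K) :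
    subst b f (Finsupp.single c a) = Finsupp.single c a :=
  subst_of_eq_zero (by simp [h])

/-- Elimination of a generator by means of a relation that expresses it by the other ones. -/
theorem ldet_elim {G : List ι} {b : ι} {f : ι →₀ K} (hf : f b = 0)
    (L : List (ι →₀ K)) :
    ldet (b :: G) ((Finsupp.single b 1 - f) :: L) = ldet G (L.map (subst b f)) := by
  by_cases h : L.length = G.length
  · obtain ⟨r, hr⟩ : ∃ r : ι →₀ K, r = Finsupp.single b 1 - f := ⟨_, rfl⟩
    have hrb : r b = 1 := by simp [hr, hf]
    have hL : (r :: L).length = G.length + 1 := by simp [h]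
    rw [← hr, ldet_of_length (G.length + 1) (by simp) hL,
      ldet_of_length G.length rfl (by simp [h])]
    -- `N` arises by clearing the column of `b` with the first row. What is left of the other rows
    -- is their image under `subst b f`, because `v - v b • r = v + v b • (f - single b 1)`.
    let N : Matrix (Fin (G.length + 1)) (Fin (G.length + 1)) K := fun i j =>
      if i = 0 then r ((b :: G)[j.val]'(by simp; omega))
      else subst b f ((r :: L)[i.val]'(by omega)) ((b :: G)[j.val]'(by simp; omega))
    rw [Matrix.det_eq_of_forall_row_eq_smul_add_const (B := N)
      (fun i : Fin (G.length + 1) => if i = 0 then 0 else ((r :: L)[i.val]'(by omega)) b) 0 (by simp)]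
    · rw [Matrix.det_succ_column_zero, Finset.sum_eq_single 0]
      · have h0 : N 0 0 = 1 := by simp [N, hrb]
        rw [h0, Fin.val_zero, pow_zero, one_mul, one_mul]
        congr 1
        ext i j
        simp [N, Matrix.submatrix]
      · intro i _ hi
        suffices N i 0 = 0 by simp [this]
        simp only [N, if_neg hi]
        simp [subst_apply, hf]
      · simp
    · intro i j
      by_cases hi : i = 0
      · subst hi
        simp [N]
      · simp [N, hi, subst_apply, hr]
        ring
  · rw [ldet_eq_zero_of_length (by simpa using h), ldet_eq_zero_of_length (by simpa using h)]

/-- Change of a generator. -/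
theorem ldet_map_subst {G : List ι} {b : ι} (hb : b ∉ G) (f : ι →₀ K) (L : List (ι →₀ K)) :
    ldet (b :: G) (L.map (subst b f)) = f b * ldet (b :: G) L := by
  by_cases h : L.length = G.length + 1
  · rw [ldet_of_length (G.length + 1) (by simp) (by simp [h]),
      ldet_of_length (G.length + 1) (by simp) h]
    let M : Matrix (Fin (G.length + 1)) (Fin (G.length + 1)) K := fun i j =>
      (L[i.val]'(by omega)) ((b :: G)[j.val]'(by simp; omega))
    -- `N` adds to each column of `G` the multiple of the column of `b` prescribed by `f`, which
    -- does not change the determinant. Multiplying its first column by `f b` then gives the matrix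
    -- of the substituted rows.
    let N : Matrix (Fin (G.length + 1)) (Fin (G.length + 1)) K := fun i j =>
      M i j + M i 0 * if j = 0 then 0 else f ((b :: G)[j.val]'(by simp; omega))
    have h1 : N.det = M.det := by
      rw [← Matrix.det_transpose N, ← Matrix.det_transpose M]
      refine Matrix.det_eq_of_forall_row_eq_smul_add_const
        (fun j : Fin (G.length + 1) => if j = 0 then 0 else
          f ((b :: G)[j.val]'(by simp; omega))) 0 (by simp) fun i j => ?_
      change M j i + M j 0 * _ = M j i + _ * M j 0
      rw [mul_comm (M j 0)]
    have h2 := Matrix.det_updateCol_smul N 0 (f b) fun i => N i 0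
    rw [Matrix.updateCol_eq_self] at h2
    change _ = f b * M.det
    rw [← h1, ← h2]
    congr 1
    ext i j
    by_cases hj : j = 0
    · subst hj
      rw [Matrix.updateCol_self]
      simp [N, M, subst_apply]
      ring
    · obtain ⟨k, rfl⟩ := Fin.exists_succ_eq.2 hj
      have hk : G[k.val] ≠ b := fun e => hb (e ▸ List.getElem_mem _)
      rw [Matrix.updateCol_ne hj]
      simp [N, M, subst_apply, hk.symm]
  · rw [ldet_eq_zero_of_length (by simpa using h), ldet_eq_zero_of_length (by simpa using h),
      mul_zero]

theorem ldet_map_ringHom {K' : Type*} [CommRing K'] (φ : K →+* K') (G : List ι)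
    (L : List (ι →₀ K)) :
    φ (ldet G L) = ldet G (L.map (Finsupp.mapRange φ φ.map_zero)) := by
  by_cases h : L.length = G.length
  · rw [ldet_of_length _ rfl h, ldet_of_length _ rfl (by simpa using h), RingHom.map_det]
    congr 1
    ext i j
    simp
  · rw [ldet_eq_zero_of_length h, ldet_eq_zero_of_length (by simpa using h), map_zero]

/-- Renaming the generators. -/
theorem ldet_rename {κ : Type*} (f : ι → κ) {G : List ι} {L : List (ι →₀ K)}
    {L' : List (κ →₀ K)}
    (h : List.Forall₂ (fun l l' => ∀ i ∈ G, l' (f i) = l i) L L') :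
    ldet (G.map f) L' = ldet G L := by
  by_cases hl : L.length = G.length
  · have hl' := h.length_eq
    rw [ldet_of_length G.length (by simp) (hl' ▸ hl), ldet_of_length _ rfl hl]
    congr 1
    ext i j
    have := (List.forall₂_iff_get.1 h).2 i (by omega) (by omega) G[j.val] (by simp)
    simpa using this
  · rw [ldet_eq_zero_of_length hl, ldet_eq_zero_of_length]
    rw [← h.length_eq]
    simpa using hl

end ListDet

end PrismaticLink

namespace PrismaticLink

/-! ### Equality up to sign -/

/-- Equality up to sign. -/
def SignEq {K : Type*} [CommRing K] (a b : K) : Prop := ∃ ε : ℤˣ, a = ((ε : ℤ) : K) * b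

namespace SignEq

variable {K : Type*} [CommRing K] {a b c : K}

theorem refl (a : K) : SignEq a a := ⟨1, by simp⟩

theorem of_eq (h : a = b) : SignEq a b := h ▸ refl a

theorem trans (h : SignEq a b) (h' : SignEq b c) : SignEq a c := by
  obtain ⟨ε, h⟩ := h
  obtain ⟨δ, h'⟩ := h'
  exact ⟨ε * δ, by rw [h, h']; push_cast; ring⟩

theorem sign_mul_self (ε : ℤˣ) (a : K) : ((ε : ℤ) : K) * (((ε : ℤ) : K) * a) = a := by
  rw [← mul_assoc, ← Int.cast_mul, ← Units.val_mul, Int.units_mul_self]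
  simp

theorem symm (h : SignEq a b) : SignEq b a := by
  obtain ⟨ε, h⟩ := h
  exact ⟨ε, by rw [h, sign_mul_self]⟩

theorem associated (h : SignEq a b) : Associated a b := by
  obtain ⟨ε, h⟩ := h
  refine Associated.symm ⟨Units.map (Int.castRingHom K).toMonoidHom ε, ?_⟩
  rw [h, mul_comm]
  rfl

end SignEq

theorem signEq_ldet {ι K : Type*} [CommRing K] {G G' : List ι} {L L' : List (ι →₀ K)}
    (hG : G.Perm G') (hL : L.Perm L') : SignEq (ldet G L) (ldet G' L') := by
  obtain ⟨ε, h⟩ := ldet_perm_index (K := K) hG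
  exact SignEq.trans ⟨ε, h L⟩ (ldet_perm hL)

/-! ### The determinant of a decorated code -/

section Transport

variable {K : Type*} [CommRing K] {g : ℕ} {N : Type*} (τ : Kˣ) (ζ : Palette g → Kˣ)

/-- The generator of an arc or a component named `b`. -/
noncomputable abbrev base (K : Type*) [CommRing K] {N : Type*} (b : N) : (N ⊕ ℕ) →₀ K :=
  Finsupp.single (Sum.inl b) 1

/-- The generator of the over-arc at the crossing `c`. -/
noncomputable abbrev overGen (K : Type*) [CommRing K] (N : Type*) (c : ℕ) : (N ⊕ ℕ) →₀ K :=
  Finsupp.single (Sum.inr c) 1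

/-- The coefficient with which a letter acts on the incoming arc. -/
noncomputable def Letter.coeff : Letter g → Kˣ
  | .over _ _ => 1
  | .under _ ε => τ ^ sgn ε
  | .omega z ε => ζ z ^ sgn ε

/-- The outgoing arc at a letter in terms of the incoming one. -/
noncomputable def Letter.act : Letter g → ((N ⊕ ℕ) →₀ K) → ((N ⊕ ℕ) →₀ K)
  | .over _ _, v => v
  | .under c ε, v => ((τ ^ sgn ε : Kˣ) : K) • v + (1 - ((τ ^ sgn ε : Kˣ) : K)) • overGen K N c
  | .omega z ε, v => ((ζ z ^ sgn ε : Kˣ) : K) • v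

/-- The last arc of a strand in terms of the first one. -/
noncomputable def transport (w : List (Letter g)) (v : (N ⊕ ℕ) →₀ K) : (N ⊕ ℕ) →₀ K :=
  w.foldl (fun v ℓ => ℓ.act τ ζ v) v

@[simp] theorem transport_nil (v : (N ⊕ ℕ) →₀ K) : transport τ ζ [] v = v := rfl

@[simp] theorem transport_cons (ℓ : Letter g) (w : List (Letter g)) (v : (N ⊕ ℕ) →₀ K) :
    transport τ ζ (ℓ :: w) v = transport τ ζ w (ℓ.act τ ζ v) := rfl

@[simp] theorem transport_append (w w' : List (Letter g)) (v : (N ⊕ ℕ) →₀ K) :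
    transport τ ζ (w ++ w') v = transport τ ζ w' (transport τ ζ w v) := by
  simp [transport]

/-- The definitions of the over-arcs on a strand with first arc `v`. -/
noncomputable def overRels : List (Letter g) → ((N ⊕ ℕ) →₀ K) → List ((N ⊕ ℕ) →₀ K)
  | [], _ => []
  | .over c _ :: w, v => (overGen K N c - v) :: overRels w v
  | .under c ε :: w, v => overRels w ((Letter.under c ε).act τ ζ v)
  | .omega z ε :: w, v => overRels w ((Letter.omega z ε).act τ ζ v)

/-- The crossings at which a strand passes over. -/
def overLabels : List (Letter g) → List ℕ
  | [] => []
  | .over c _ :: w => c :: overLabels w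
  | .under _ _ :: w => overLabels w
  | .omega _ _ :: w => overLabels w

theorem overLabels_append (w w' : List (Letter g)) :
    overLabels (w ++ w') = overLabels w ++ overLabels w' := by
  induction w with
  | nil => rfl
  | cons ℓ w ih => cases ℓ <;> simp [overLabels, ih]

theorem overRels_append (w w' : List (Letter g)) (v : (N ⊕ ℕ) →₀ K) :
    overRels τ ζ (w ++ w') v = overRels τ ζ w v ++ overRels τ ζ w' (transport τ ζ w v) := by
  induction w generalizing v with
  | nil => rfl
  | cons ℓ w ih => cases ℓ <;> simp [overRels, ih, Letter.act]

theorem length_overRels (w : List (Letter g)) (v : (N ⊕ ℕ) →₀ K) :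
    (overRels τ ζ w v).length = (overLabels w).length := by
  induction w generalizing v with
  | nil => rfl
  | cons ℓ w ih => cases ℓ <;> simp [overRels, overLabels, ih]

/-- The classical crossings that a letter belongs to. -/
def Letter.labels : Letter g → List ℕ
  | .over c _ => [c]
  | .under c _ => [c]
  | .omega _ _ => []

/-- The classical crossings that a strand passes through. -/
def crossLabels (w : List (Letter g)) : List ℕ := w.flatMap Letter.labels

section Map

variable {K' : Type*} [CommRing K'] {N' : Type*} {ρ : K →+* K'}
  (φ : ((N ⊕ ℕ) →₀ K) →ₛₗ[ρ] ((N' ⊕ ℕ) →₀ K')) (σ : ℕ → ℕ)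

theorem map_coe_zpow (u : Kˣ) (n : ℤ) :
    ρ ((u ^ n : Kˣ) : K) = ((Units.map ρ.toMonoidHom u ^ n : K'ˣ) : K') := by
  rw [← map_zpow]
  rfl

/-- A letter uses only scalars and over-arc generators, so a semilinear map that matches these
commutes with it. Having both `ρ` and `σ` makes change of coefficients, renaming of crossings and
substitution for a generator instances of the same fact. -/
theorem map_act (ℓ : Letter g) (h : ∀ c ∈ ℓ.labels, φ (overGen K N c) = overGen K' N' (σ c))
    (v : (N ⊕ ℕ) →₀ K) :
    φ (ℓ.act τ ζ v) = (ℓ.relabel σ).act (Units.map ρ.toMonoidHom τ)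
      (fun z => Units.map ρ.toMonoidHom (ζ z)) (φ v) := by
  rcases ℓ with ⟨c, ε⟩ | ⟨c, ε⟩ | ⟨z, ε⟩
  · rfl
  ·
    have := h c (by simp [Letter.labels])
    simp only [Letter.act, Letter.relabel, map_add, LinearMap.map_smulₛₗ, this, map_sub, map_one,
      map_coe_zpow]
  ·
    simp only [Letter.act, Letter.relabel, LinearMap.map_smulₛₗ, map_coe_zpow]

theorem map_transport (w : List (Letter g))
    (h : ∀ c ∈ crossLabels w, φ (overGen K N c) = overGen K' N' (σ c)) (v : (N ⊕ ℕ) →₀ K) :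
    φ (transport τ ζ w v) = transport (Units.map ρ.toMonoidHom τ)
      (fun z => Units.map ρ.toMonoidHom (ζ z)) (w.map (Letter.relabel σ)) (φ v) := by
  induction w generalizing v with
  | nil => rfl
  | cons ℓ w ih =>
    rw [List.map_cons, transport_cons, transport_cons, ih, map_act (σ := σ)]
    · exact fun c hc => h c (by simp [crossLabels, hc])
    · exact fun c hc => h c (by simp only [crossLabels, List.flatMap_cons, List.mem_append] at hc ⊢; exact Or.inr hc)

theorem map_overRels (w : List (Letter g))
    (h : ∀ c ∈ crossLabels w, φ (overGen K N c) = overGen K' N' (σ c)) (v : (N ⊕ ℕ) →₀ K) :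
    (overRels τ ζ w v).map φ = overRels (Units.map ρ.toMonoidHom τ)
      (fun z => Units.map ρ.toMonoidHom (ζ z)) (w.map (Letter.relabel σ)) (φ v) := by
  induction w generalizing v with
  | nil => rfl
  | cons ℓ w ih =>
    have h1 : ∀ c ∈ crossLabels w, φ (overGen K N c) = overGen K' N' (σ c) := fun c hc =>
      h c (by simp only [crossLabels, List.flatMap_cons, List.mem_append] at hc ⊢; exact Or.inr hc)
    have h2 : ∀ c ∈ ℓ.labels, φ (overGen K N c) = overGen K' N' (σ c) :=
      fun c hc => h c (by simp [crossLabels, hc])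
    rcases ℓ with ⟨c, ε⟩ | ⟨c, ε⟩ | ⟨z, ε⟩
    ·
      have h3 := h2 c (by simp [Letter.labels])
      simp only [overRels, List.map_cons, map_sub, ih h1, h3, Letter.relabel]
    ·
      rw [List.map_cons]
      simp only [overRels]
      rw [ih h1, map_act τ ζ φ σ _ h2]
      rfl
    ·
      rw [List.map_cons]
      simp only [overRels]
      rw [ih h1, map_act τ ζ φ σ _ h2]
      rfl

end Map

@[simp] theorem relabel_id (ℓ : Letter g) : ℓ.relabel id = ℓ := by cases ℓ <;> rfl

theorem linearMap_transport {N' : Type*} (φ : ((N ⊕ ℕ) →₀ K) →ₗ[K] ((N' ⊕ ℕ) →₀ K))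
    (w : List (Letter g)) (h : ∀ c ∈ crossLabels w, φ (overGen K N c) = overGen K N' c)
    (v : (N ⊕ ℕ) →₀ K) : φ (transport τ ζ w v) = transport τ ζ w (φ v) := by
  have := map_transport τ ζ φ id w h v
  simpa [show (Letter.relabel id : Letter g → Letter g) = id from funext relabel_id] using this

theorem linearMap_overRels {N' : Type*} (φ : ((N ⊕ ℕ) →₀ K) →ₗ[K] ((N' ⊕ ℕ) →₀ K))
    (w : List (Letter g)) (h : ∀ c ∈ crossLabels w, φ (overGen K N c) = overGen K N' c)
    (v : (N ⊕ ℕ) →₀ K) : (overRels τ ζ w v).map φ = overRels τ ζ w (φ v) := by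
  have := map_overRels τ ζ φ id w h v
  simpa [show (Letter.relabel id : Letter g → Letter g) = id from funext relabel_id] using this

/-- A letter acts by an affine map whose linear part is a unit. This unit is what has to cancel when
the first arc of a component is moved past the letter. -/
theorem act_eq_add (ℓ : Letter g) (v : (N ⊕ ℕ) →₀ K) :
    ℓ.act τ ζ v = ((ℓ.coeff τ ζ : Kˣ) : K) • v + ℓ.act τ ζ 0 := by
  cases ℓ <;> simp [Letter.act, Letter.coeff]

theorem act_sub_act (ℓ : Letter g) (v v' : (N ⊕ ℕ) →₀ K) :
    ℓ.act τ ζ v - ℓ.act τ ζ v' = ((ℓ.coeff τ ζ : Kˣ) : K) • (v - v') := by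
  rw [act_eq_add, act_eq_add τ ζ ℓ v', smul_sub]
  abel

theorem act_zero_inl (ℓ : Letter g) (b : N) : (ℓ.act τ ζ (0 : (N ⊕ ℕ) →₀ K)) (Sum.inl b) = 0 := by
  cases ℓ <;> simp [Letter.act]

/-- Arcs of a strand lie in every submodule that contains the first one and the over-arcs. -/
theorem transport_mem {S : Submodule K ((N ⊕ ℕ) →₀ K)} (w : List (Letter g))
    (hS : ∀ c ∈ crossLabels w, overGen K N c ∈ S) {v : (N ⊕ ℕ) →₀ K} (hv : v ∈ S) :
    transport τ ζ w v ∈ S := by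
  induction w generalizing v with
  | nil => exact hv
  | cons ℓ w ih =>
    refine ih (fun c hc => hS c ?_) ?_
    · simp only [crossLabels, List.flatMap_cons, List.mem_append] at hc ⊢
      exact Or.inr hc
    · rcases ℓ with ⟨c, ε⟩ | ⟨c, ε⟩ | ⟨z, ε⟩
      · exact hv
      ·
        exact S.add_mem (S.smul_mem _ hv) (S.smul_mem _ (hS c (by simp [crossLabels, Letter.labels])))
      · exact S.smul_mem _ hv

theorem overRels_mem {S : Submodule K ((N ⊕ ℕ) →₀ K)} (w : List (Letter g))
    (hS : ∀ c ∈ crossLabels w, overGen K N c ∈ S) {v : (N ⊕ ℕ) →₀ K} (hv : v ∈ S)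
    {r : (N ⊕ ℕ) →₀ K} (hr : r ∈ overRels τ ζ w v) : r ∈ S := by
  induction w generalizing v with
  | nil => simp [overRels] at hr
  | cons ℓ w ih =>
    have h1 : ∀ c ∈ crossLabels w, overGen K N c ∈ S := fun c hc => hS c (by
      simp only [crossLabels, List.flatMap_cons, List.mem_append] at hc ⊢; exact Or.inr hc)
    have h2 := transport_mem τ ζ [ℓ] (S := S)
      (fun c hc => hS c (by simp_all [crossLabels])) hv
    rcases ℓ with ⟨c, ε⟩ | ⟨c, ε⟩ | ⟨z, ε⟩
    ·
      simp only [overRels, List.mem_cons] at hr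
      rcases hr with rfl | hr
      · exact S.sub_mem (hS c (by simp [crossLabels, Letter.labels])) hv
      · exact ih h1 hv hr
    · exact ih h1 h2 hr
    · exact ih h1 h2 hr

end Transport

end PrismaticLink

namespace PrismaticLink

/-! ### The determinant of a system of closed components and its invariance. -/

section SystemDet

variable {K : Type*} [CommRing K] {g : ℕ} {N : Type*} (τ : Kˣ) (ζ : Palette g → Kˣ)

/-- The relations of a closed component with first arc `b`. -/
noncomputable def componentRels (c : N × List (Letter g)) : List ((N ⊕ ℕ) →₀ K) :=
  (base K c.1 - transport τ ζ c.2 (base K c.1)) :: overRels τ ζ c.2 (base K c.1)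

/-- The generators of a system of closed components. -/
def systemGens (cs : List (N × List (Letter g))) : List (N ⊕ ℕ) :=
  cs.map (fun c => Sum.inl c.1) ++ (cs.flatMap fun c => overLabels c.2).map Sum.inr

/-- The determinant of a system of closed components with named first arcs. -/
noncomputable def systemDet (cs : List (N × List (Letter g))) : K :=
  ldet (systemGens cs) (cs.flatMap (componentRels τ ζ))

/-- The determinant of a decorated code. -/
noncomputable def codeDet (C : Code g) : K :=
  systemDet τ ζ (C.zipIdx.map Prod.swap)

variable {τ ζ}

theorem perm_systemGens {cs cs' : List (N × List (Letter g))} (h : cs.Perm cs') :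
    (systemGens cs).Perm (systemGens cs') :=
  (h.map _).append ((h.flatMap_right _).map _)

theorem signEq_systemDet_of_perm {cs cs' : List (N × List (Letter g))} (h : cs.Perm cs') :
    SignEq (systemDet τ ζ cs) (systemDet τ ζ cs') :=
  signEq_ldet (perm_systemGens h) (h.flatMap_right _)

theorem systemGens_cons (c : N × List (Letter g)) (cs : List (N × List (Letter g))) :
    (systemGens (c :: cs)).Perm
      (Sum.inl c.1 :: ((overLabels c.2).map Sum.inr ++ systemGens cs)) := by
  simp only [systemGens, List.map_cons, List.flatMap_cons, List.map_append, List.cons_append]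
  refine List.Perm.cons _ ?_
  rw [← List.append_assoc, ← List.append_assoc]
  exact List.perm_append_comm.append_right _

theorem inl_mem_systemGens {b : N} {cs : List (N × List (Letter g))} :
    Sum.inl b ∈ systemGens cs ↔ b ∈ cs.map Prod.fst := by
  simp [systemGens]

theorem map_componentRels_subst {b : N} {f : (N ⊕ ℕ) →₀ K} {c : N × List (Letter g)}
    (hc : c.1 ≠ b) : (componentRels τ ζ c).map (subst (Sum.inl b) f) = componentRels τ ζ c := by
  have h1 : subst (Sum.inl b) f (base K c.1) = base K c.1 :=
    subst_single_ne (by simpa using hc) f 1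
  have h2 : ∀ x ∈ crossLabels c.2, subst (Sum.inl b) f (overGen K N x) = overGen K N x :=
    fun x _ => subst_single_ne (by simp) f 1
  rw [componentRels, List.map_cons, map_sub, linearMap_transport _ _ _ _ h2,
    linearMap_overRels _ _ _ _ h2, h1]

theorem map_componentRels_subst_of_notMem {b : N} {f : (N ⊕ ℕ) →₀ K}
    {cs : List (N × List (Letter g))} (hb : b ∉ cs.map Prod.fst) :
    (cs.flatMap (componentRels τ ζ)).map (subst (Sum.inl b) f)
      = cs.flatMap (componentRels τ ζ) := by
  induction cs with
  | nil => rfl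
  | cons c cs ih =>
    simp only [List.map_cons, List.mem_cons, not_or] at hb
    rw [List.flatMap_cons, List.map_append, ih hb.2, map_componentRels_subst (Ne.symm hb.1)]

theorem act_base_apply (ℓ : Letter g) (b : N) :
    (ℓ.act τ ζ (base K b)) (Sum.inl b) = ((ℓ.coeff τ ζ : Kˣ) : K) := by
  rw [act_eq_add, Finsupp.add_apply, act_zero_inl]
  simp

/-- Moving the starting point of a component past one letter is a change of the generator `b`,
harmless because the letter acts with a unit coefficient. This makes the determinant a function of
cyclic words. -/
theorem signEq_systemDet_rotate {b : N} {cs : List (N × List (Letter g))}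
    (hb : b ∉ cs.map Prod.fst) (ℓ : Letter g) (w : List (Letter g)) :
    SignEq (systemDet τ ζ ((b, ℓ :: w) :: cs)) (systemDet τ ζ ((b, w ++ [ℓ]) :: cs)) := by
  have hG : (systemGens ((b, ℓ :: w) :: cs)).Perm (systemGens ((b, w ++ [ℓ]) :: cs)) := by
    refine (systemGens_cons _ _).trans (List.Perm.trans ?_ (systemGens_cons _ _).symm)
    refine ((List.Perm.map _ ?_).append_right _).cons _
    dsimp only
    rw [← List.singleton_append, overLabels_append, overLabels_append]
    exact List.perm_append_comm
  refine SignEq.trans (signEq_ldet hG (List.Perm.refl _)) ?_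
  rw [systemDet, List.flatMap_cons, List.flatMap_cons]
  have hu : IsUnit ((ℓ.coeff τ ζ : Kˣ) : K) := Units.isUnit _
  obtain ⟨G, hGp, hbG⟩ : ∃ G, (systemGens ((b, w ++ [ℓ]) :: cs)).Perm (Sum.inl b :: G)
      ∧ Sum.inl b ∉ G := by
    refine ⟨_, systemGens_cons _ _, ?_⟩
    simp only [List.mem_append, not_or, inl_mem_systemGens]
    exact ⟨by simp, hb⟩
  refine (signEq_ldet hGp (List.Perm.refl _)).trans (SignEq.trans ?_
    (signEq_ldet hGp (List.Perm.refl _)).symm)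
  rcases ℓ with ⟨c, ε⟩ | ⟨c, ε⟩ | ⟨z, ε⟩
  -- The arc does not change at an over-passage. Only the definition of the over-arc moves from the
  -- start to the end of the word, and adding the closing relation to one form of it gives the
  -- other.
  · have hF := isAlternating_ldet (K := K) (Sum.inl b :: G)
    have h1 := hF.add_mul_of_mem [base K b - transport τ ζ w (base K b)]
      (overRels τ ζ w (base K b) ++ cs.flatMap (componentRels τ ζ)) (overGen K N c - base K b)
      (base K b - transport τ ζ w (base K b)) 1 (by simp)
    refine SignEq.trans (SignEq.of_eq ?_) (SignEq.trans (SignEq.of_eq h1.symm)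
      (signEq_ldet (List.Perm.refl _) ?_))
    · simp [componentRels, overRels, Letter.act]
    · simp only [componentRels, overRels_append, overRels, transport_append, transport_cons,
        transport_nil, Letter.act, one_smul, sub_add_sub_cancel, List.cons_append, List.nil_append,
        List.append_assoc]
      exact (List.perm_middle.symm).cons _
  -- Substituting the outgoing arc for `b` produces the coefficient of the letter twice: as the
  -- factor in the change of generator, and as a factor of the closing relation, by `act_sub_act`.
  -- It is a unit and cancels.
  · have h1 := ldet_map_subst hbG ((Letter.under c ε).act τ ζ (base K b))
      (componentRels τ ζ (b, w ++ [Letter.under c ε]) ++ cs.flatMap (componentRels τ ζ))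
    rw [List.map_append, map_componentRels_subst_of_notMem hb, componentRels, List.map_cons,
      map_sub, linearMap_transport, linearMap_overRels, subst_single_self, transport_append,
      overRels_append, transport_cons, transport_nil, act_sub_act] at h1
    rotate_left
    · exact fun x _ => subst_single_ne (by simp) _ 1
    · exact fun x _ => subst_single_ne (by simp) _ 1
    have h2 := (isAlternating_ldet (K := K) (Sum.inl b :: G)).smul []
    simp only [List.nil_append] at h2
    rw [List.cons_append, h2, act_base_apply] at h1
    have h3 := hu.mul_left_cancel h1
    refine SignEq.of_eq (Eq.trans ?_ h3)
    simp [componentRels, overRels]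
  · have h1 := ldet_map_subst hbG ((Letter.omega z ε).act τ ζ (base K b))
      (componentRels τ ζ (b, w ++ [Letter.omega z ε]) ++ cs.flatMap (componentRels τ ζ))
    rw [List.map_append, map_componentRels_subst_of_notMem hb, componentRels, List.map_cons,
      map_sub, linearMap_transport, linearMap_overRels, subst_single_self, transport_append,
      overRels_append, transport_cons, transport_nil, act_sub_act] at h1
    rotate_left
    · exact fun x _ => subst_single_ne (by simp) _ 1
    · exact fun x _ => subst_single_ne (by simp) _ 1
    have h2 := (isAlternating_ldet (K := K) (Sum.inl b :: G)).smul []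
    simp only [List.nil_append] at h2
    rw [List.cons_append, h2, act_base_apply] at h1
    have h3 := hu.mul_left_cancel h1
    refine SignEq.of_eq (Eq.trans ?_ h3)
    simp [componentRels, overRels]

theorem signEq_systemDet_isRotated {b : N} {cs : List (N × List (Letter g))}
    (hb : b ∉ cs.map Prod.fst) {w w' : List (Letter g)} (h : w.IsRotated w') :
    SignEq (systemDet τ ζ ((b, w) :: cs)) (systemDet τ ζ ((b, w') :: cs)) := by
  obtain ⟨n, rfl⟩ := h
  induction n generalizing w with
  | zero => simpa using SignEq.refl _
  | succ n ih =>
    cases w with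
    | nil => simpa using SignEq.refl _
    | cons ℓ w =>
      rw [List.rotate_cons_succ]
      exact (signEq_systemDet_rotate hb ℓ w).trans ih

theorem signEq_systemDet_forall₂ {cs cs' : List (N × List (Letter g))}
    (h : List.Forall₂ (fun c c' => c.1 = c'.1 ∧ c.2.IsRotated c'.2) cs cs')
    (hn : (cs.map Prod.fst).Nodup) : SignEq (systemDet τ ζ cs) (systemDet τ ζ cs') := by
  -- `P` collects the components that have already been rotated.
  suffices ∀ P : List (N × List (Letter g)), ((P ++ cs).map Prod.fst).Nodup →
      SignEq (systemDet τ ζ (P ++ cs)) (systemDet τ ζ (P ++ cs')) from this [] hn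
  clear hn
  induction h with
  | nil => exact fun P _ => SignEq.refl _
  | @cons c c' cs cs' hc hcs ih =>
    intro P hP
    obtain ⟨b, w⟩ := c
    obtain ⟨b', w'⟩ := c'
    obtain ⟨rfl, hr⟩ := hc
    have h1 : SignEq (systemDet τ ζ (P ++ (b, w) :: cs)) (systemDet τ ζ (P ++ (b, w') :: cs)) := by
      refine (signEq_systemDet_of_perm List.perm_middle).trans (SignEq.trans ?_
        (signEq_systemDet_of_perm List.perm_middle.symm))
      refine signEq_systemDet_isRotated ?_ hr
      have := (List.perm_middle.map Prod.fst).nodup_iff.1 hP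
      exact (List.nodup_cons.1 (by simpa using this)).1
    refine h1.trans ?_
    have := ih (P ++ [(b, w')]) (by simpa using hP)
    simpa using this

/-- Renaming the first arcs and the crossings. -/
theorem systemDet_rename {N' : Type*} (f : N → N') {σ : ℕ → ℕ} (hσ : σ.Injective)
    {cs : List (N × List (Letter g))} (hf : Set.InjOn f {b | b ∈ cs.map Prod.fst}) :
    systemDet τ ζ (cs.map fun c => (f c.1, c.2.map (Letter.relabel σ))) = systemDet τ ζ cs := by
  have hov : ∀ w : List (Letter g),
      overLabels (w.map (Letter.relabel σ)) = (overLabels w).map σ := by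
    intro w
    induction w with
    | nil => rfl
    | cons ℓ w ih => cases ℓ <;> simp [overLabels, Letter.relabel, ih]
  let φ := Finsupp.lmapDomain K K (Sum.map f σ : N ⊕ ℕ → N' ⊕ ℕ)
  have hφ : ∀ c, φ (overGen K N c) = overGen K N' (σ c) := fun c => by simp [φ]
  have hφ' : ∀ b, φ (base K b) = base K (f b) := fun c => by simp [φ]
  have hrel : (cs.map fun c => (f c.1, c.2.map (Letter.relabel σ))).flatMap (componentRels τ ζ)
      = (cs.flatMap (componentRels τ ζ)).map φ := by
    rw [List.map_flatMap, List.flatMap_map]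
    congr 1
    funext c
    have h1 := map_transport τ ζ φ σ c.2 (fun x _ => hφ x) (base K c.1)
    have h2 := map_overRels τ ζ φ σ c.2 (fun x _ => hφ x) (base K c.1)
    rw [hφ'] at h1 h2
    simp only [componentRels, List.map_cons, map_sub, h1, h2, hφ']
    rfl
  have hgen : systemGens (cs.map fun c => (f c.1, c.2.map (Letter.relabel σ)))
      = (systemGens cs).map (Sum.map f σ) := by
    simp only [systemGens, List.map_append, List.map_map, List.flatMap_map, List.map_flatMap, hov]
    rfl
  rw [systemDet, hgen, hrel]
  refine ldet_rename _ ?_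
  rw [List.forall₂_map_right_iff, List.forall₂_same]
  intro r hr i hi
  -- `f` is injective only on the names that occur, so coordinates are compared on a set that
  -- contains the support of every relation.
  let S : Set (N ⊕ ℕ) := {x | ∀ b, x = Sum.inl b → b ∈ cs.map Prod.fst}
  have hS : Set.InjOn (Sum.map f σ) S := by
    rintro (x | x) hx (y | y) hy hxy <;> simp at hxy
    · rw [hf (hx x rfl) (hy y rfl) hxy]
    · rw [hσ hxy]
  refine Finsupp.mapDomain_apply' S r ?_ hS ?_
  · rw [← Finsupp.mem_supported K]
    obtain ⟨c, hc, hr⟩ := List.mem_flatMap.1 hr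
    have hb : base K c.1 ∈ Finsupp.supported K K S := by
      refine Finsupp.single_mem_supported _ _ ?_
      intro b hb
      rw [← Sum.inl.inj hb]
      exact List.mem_map_of_mem hc
    have ho : ∀ x ∈ crossLabels c.2, overGen K N x ∈ Finsupp.supported K K S :=
      fun x _ => Finsupp.single_mem_supported _ _ (fun b hb => by simp at hb)
    rw [componentRels, List.mem_cons] at hr
    rcases hr with rfl | hr
    · exact Submodule.sub_mem _ hb (transport_mem _ _ _ ho hb)
    · exact overRels_mem _ _ _ ho hb hr
  · intro b hb
    subst hb
    exact inl_mem_systemGens.1 hi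

theorem map_fst_swap_zipIdx {α : Type*} (l : List α) (k : ℕ) :
    ((l.zipIdx k).map Prod.swap).map Prod.fst = List.range' k l.length := by
  induction l generalizing k with
  | nil => rfl
  | cons a l ih => simp [List.range'_succ, ← ih (k + 1)]

theorem map_snd_swap_zipIdx {α : Type*} (l : List α) (k : ℕ) :
    ((l.zipIdx k).map Prod.swap).map Prod.snd = l := by
  induction l generalizing k with
  | nil => rfl
  | cons a l ih => simpa using ih (k + 1)

/-- The determinant of a code does not depend on the names of the first arcs. -/
theorem signEq_codeDet_systemDet {cs : List (N × List (Letter g))}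
    (hn : (cs.map Prod.fst).Nodup) {C : Code g} (hC : (cs.map Prod.snd).Perm C) :
    SignEq (codeDet τ ζ C) (systemDet τ ζ cs) := by
  classical
  obtain ⟨cs', hp, hcs'⟩ : ∃ cs' : List (N × List (Letter g)), cs.Perm cs' ∧
      cs'.map Prod.snd = C := by
    clear hn
    -- A permutation of the words lifts to a permutation of the named components.
    have : ∀ (C' C : Code g), C'.Perm C → ∀ cs : List (N × List (Letter g)),
        cs.map Prod.snd = C' → ∃ cs', cs.Perm cs' ∧ cs'.map Prod.snd = C := by
      intro C' C h
      induction h with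
      | nil => exact fun cs h => ⟨cs, List.Perm.refl _, h⟩
      | cons x _ ih =>
        rintro (_ | ⟨c, cs⟩) h
        · simp at h
        · simp only [List.map_cons, List.cons.injEq] at h
          obtain ⟨cs', hp, h'⟩ := ih cs h.2
          exact ⟨c :: cs', hp.cons _, by simp [h.1, h']⟩
      | swap x y l =>
        rintro (_ | ⟨c, _ | ⟨c', cs⟩⟩) h
        · simp at h
        · simp at h
        · simp only [List.map_cons, List.cons.injEq] at h
          exact ⟨c' :: c :: cs, List.Perm.swap _ _ _, by simp [h]⟩
      | trans _ _ ih1 ih2 =>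
        intro cs h
        obtain ⟨cs', hp, h⟩ := ih1 cs h
        obtain ⟨cs'', hp', h⟩ := ih2 cs' h
        exact ⟨cs'', hp.trans hp', h⟩
    exact this _ _ hC cs rfl
  refine SignEq.trans ?_ (signEq_systemDet_of_perm hp).symm
  have hn' : (cs'.map Prod.fst).Nodup := (hp.map _).nodup_iff.1 hn
  refine SignEq.of_eq ?_
  -- Names are replaced by positions in the list, which are the names used in `codeDet`.
  rw [← systemDet_rename (fun b => (cs'.map Prod.fst).idxOf b) (σ := id) Function.injective_id]
  · rw [codeDet]
    congr 1
    subst hcs'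
    refine List.ext_getElem (by simp) fun i h1 h2 => ?_
    have h3 : i < (cs'.map Prod.fst).length := by simpa using h2
    have h4 := hn'.idxOf_getElem i h3
    rw [List.getElem_map] at h4
    simp [h4, show (Letter.relabel id : Letter g → Letter g) = id from funext relabel_id]
  · intro x hx y hy hxy
    exact (List.idxOf_inj hx).1 hxy

/-- Cyclic words are cancelled from the two multisets one at a time. This matches the components,
and equality of cycles is rotation of words. -/
theorem exists_forall₂_of_diagram_eq {C C' : Code g} (h : C.diagram = C'.diagram) :
    ∃ C'' : Code g, C'.Perm C'' ∧ List.Forall₂ List.IsRotated C C'' := by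
  rw [Code.diagram, Code.diagram, Multiset.coe_eq_coe] at h
  induction C generalizing C' with
  | nil =>
    rw [List.map_nil, List.nil_perm, List.map_eq_nil_iff] at h
    subst h
    exact ⟨[], List.Perm.refl _, .nil⟩
  | cons w C ih =>
    have hm : (Cycle.ofList w : Cycle (Letter g)) ∈ C'.map fun w => Cycle.ofList w :=
      h.subset (by simp)
    obtain ⟨w', hw', hww'⟩ := List.mem_map.1 hm
    obtain ⟨S, T, rfl⟩ := List.append_of_mem hw'
    have h2 : (C.map fun w => Cycle.ofList w).Perm ((S ++ T).map fun w => Cycle.ofList w) := by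
      have h3 := h.trans ((List.perm_middle (a := w')).map fun w => Cycle.ofList w)
      rw [List.map_cons, List.map_cons, hww'] at h3
      exact h3.cons_inv
    obtain ⟨C'', hp, hf⟩ := ih h2
    exact ⟨w' :: C'', List.perm_middle.trans (hp.cons _), .cons (Cycle.coe_eq_coe.1 hww'.symm) hf⟩

theorem signEq_codeDet_of_diagram_eq {C C' : Code g} (h : C.diagram = C'.diagram) :
    SignEq (codeDet τ ζ C) (codeDet τ ζ C') := by
  obtain ⟨C'', hp, hf⟩ := exists_forall₂_of_diagram_eq h
  have h1 : SignEq (codeDet τ ζ C) (codeDet τ ζ C'') := by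
    refine signEq_systemDet_forall₂ ?_ ?_
    · rw [List.forall₂_map_left_iff, List.forall₂_map_right_iff, List.forall₂_iff_get]
      refine ⟨by simpa using hf.length_eq, fun i h1 h2 => ?_⟩
      have := (List.forall₂_iff_get.1 hf).2 i (by simpa using h1) (by simpa using h2)
      simpa using this
    · rw [map_fst_swap_zipIdx]
      exact List.nodup_range'
  refine h1.trans (SignEq.symm (signEq_codeDet_systemDet ?_ ?_))
  · rw [map_fst_swap_zipIdx]
    exact List.nodup_range'
  · rw [map_snd_swap_zipIdx]
    exact hp.symm

theorem codeDet_relabel {σ : ℕ → ℕ} (hσ : σ.Injective) (C : Code g) :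
    codeDet τ ζ (C.map (List.map (Letter.relabel σ))) = codeDet τ ζ C := by
  rw [codeDet, codeDet,
    ← systemDet_rename (cs := C.zipIdx.map Prod.swap) id hσ (Set.injOn_id _), List.zipIdx_map]
  simp only [List.map_map]
  rfl

/-- The determinant is an invariant of decorated Gauss diagrams. -/
theorem signEq_codeDet_of_equivalent {C C' : Code g} (h : Code.Equivalent C C') :
    SignEq (codeDet τ ζ C) (codeDet τ ζ C') := by
  obtain ⟨σ, h⟩ := h
  rw [← codeDet_relabel σ.injective C]
  exact signEq_codeDet_of_diagram_eq h

theorem map_systemDet {K' : Type*} [CommRing K'] (ρ : K →+* K')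
    (cs : List (N × List (Letter g))) :
    ρ (systemDet τ ζ cs) = systemDet (Units.map ρ.toMonoidHom τ)
      (fun z => Units.map ρ.toMonoidHom (ζ z)) cs := by
  let φ : ((N ⊕ ℕ) →₀ K) →ₛₗ[ρ] ((N ⊕ ℕ) →₀ K') :=
    { toFun := Finsupp.mapRange ρ ρ.map_zero
      map_add' := fun v w => Finsupp.mapRange_add (map_add ρ) v w
      map_smul' := fun c v => by ext; simp }
  have hφ : ∀ x, φ (Finsupp.single x 1) = Finsupp.single x 1 := fun x => by
    change Finsupp.mapRange ρ ρ.map_zero (Finsupp.single x 1) = _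
    simp
  rw [systemDet, ldet_map_ringHom, systemDet]
  congr 1
  change (cs.flatMap (componentRels τ ζ)).map φ = _
  rw [List.map_flatMap]
  congr 1
  funext c
  have h1 := map_transport τ ζ φ id c.2 (fun x _ => hφ _) (base K c.1)
  have h2 := map_overRels τ ζ φ id c.2 (fun x _ => hφ _) (base K c.1)
  rw [show (Letter.relabel id : Letter g → Letter g) = id from funext relabel_id, List.map_id,
    hφ] at h1 h2
  simp only [componentRels, List.map_cons, map_sub, h1, h2, hφ]

theorem map_codeDet {K' : Type*} [CommRing K'] (ρ : K →+* K') (C : Code g) :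
    ρ (codeDet τ ζ C) = codeDet (Units.map ρ.toMonoidHom τ)
      (fun z => Units.map ρ.toMonoidHom (ζ z)) C :=
  map_systemDet ρ _

end SystemDet

end PrismaticLink

namespace PrismaticLink

/-! ### The zeroth ideal of a module with a square presentation -/

/-- Fitting's argument that the ideal does not depend on the presentation. Express the two
generating families by each other through `P` and `Q`. The rows of `B P` and of `1 - Q P` are
relations between the `e j`, hence combinations `X A` and `Y A` of the rows of `A`. A block
factorisation then shows that `det A` divides `det B`. -/
theorem det_mem_span_of_relations {R M : Type*} [CommRing R] [AddCommGroup M] [Module R M]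
    {n k : ℕ} {e : Fin n → M} {A : Matrix (Fin n) (Fin n) R}
    (he : Submodule.span R (Set.range e) = ⊤)
    (hA' : ∀ v : Fin n → R, ∑ j, v j • e j = 0 → ∃ c : Fin n → R, v = Matrix.vecMul c A)
    {m : Fin k → M} {B : Matrix (Fin k) (Fin k) R}
    (hm : Submodule.span R (Set.range m) = ⊤) (hB : ∀ i, ∑ j, B i j • m j = 0) :
    B.det ∈ Ideal.span {A.det} := by
  have h1 : ∀ i, ∃ p : Fin n → R, ∑ j, p j • e j = m i := fun i =>
    (Submodule.mem_span_range_iff_exists_fun R).1 (he ▸ Submodule.mem_top)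
  have h2 : ∀ i, ∃ p : Fin k → R, ∑ j, p j • m j = e i := fun i =>
    (Submodule.mem_span_range_iff_exists_fun R).1 (hm ▸ Submodule.mem_top)
  choose P hP using h1
  choose Q hQ using h2
  have hmul : ∀ {a b : ℕ} (S : Matrix (Fin a) (Fin b) R) (T : Matrix (Fin b) (Fin n) R)
      (i : Fin a), ∑ j, (S * T) i j • e j = ∑ l, S i l • ∑ j, T l j • e j := by
    intro a b S T i
    simp only [Matrix.mul_apply, Finset.sum_smul, Finset.smul_sum, smul_smul]
    exact Finset.sum_comm
  have hX : ∀ i, ∃ c : Fin n → R, (B * Matrix.of P) i = Matrix.vecMul c A := fun i => by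
    refine hA' _ ?_
    rw [hmul]
    simpa [hP] using hB i
  have hY : ∀ i, ∃ c : Fin n → R,
      ((1 : Matrix (Fin n) (Fin n) R) - Matrix.of Q * Matrix.of P) i = Matrix.vecMul c A :=
    fun i => by
      refine hA' _ ?_
      simp only [Matrix.sub_apply, sub_smul, Finset.sum_sub_distrib, hmul, Matrix.of_apply, hP, hQ]
      simp [Matrix.one_apply]
  choose X hX using hX
  choose Y hY using hY
  have hX' : B * Matrix.of P = Matrix.of X * A := funext hX
  have hY' : (1 : Matrix (Fin n) (Fin n) R) - Matrix.of Q * Matrix.of P = Matrix.of Y * A :=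
    funext hY
  clear hX hY hP hQ
  generalize Matrix.of P = P at hX' hY'
  generalize Matrix.of Q = Q at hY'
  -- The upper right block of the product is `-B P + X A = 0` and the lower right one is `Q P + Y A
  -- = 1`. The left side has determinant `det B`, the last factor `det A`.
  have key : Matrix.fromBlocks B 0 (-Q) 1 = Matrix.fromBlocks B (Matrix.of X)
      (-Q) (Matrix.of Y) * Matrix.fromBlocks 1 (-P) 0 A := by
    rw [Matrix.fromBlocks_multiply, ← hX', ← hY']
    congr 1 <;> simp
  have := congrArg Matrix.det key
  rw [Matrix.det_fromBlocks_zero₁₂, Matrix.det_mul, Matrix.det_fromBlocks_zero₂₁, Matrix.det_one,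
    Matrix.det_one, mul_one, one_mul] at this
  rw [this]
  exact Ideal.mul_mem_left _ _ (Ideal.mem_span_singleton_self _)

/-- The zeroth ideal of a module with a square presentation matrix is generated by its
determinant. -/
theorem zerothIdeal_eq_span_det {R M : Type*} [CommRing R] [AddCommGroup M] [Module R M]
    {n : ℕ} {e : Fin n → M} {A : Matrix (Fin n) (Fin n) R}
    (he : Submodule.span R (Set.range e) = ⊤) (hA : ∀ i, ∑ j, A i j • e j = 0)
    (hA' : ∀ v : Fin n → R, ∑ j, v j • e j = 0 → ∃ c : Fin n → R, v = Matrix.vecMul c A) :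
    zerothIdeal R M = Ideal.span {A.det} := by
  apply le_antisymm
  · refine Ideal.span_le.2 ?_
    rintro d ⟨k, m, B, hm, hB, rfl⟩
    exact det_mem_span_of_relations he hA' hm hB
  · exact Ideal.span_mono (Set.singleton_subset_iff.2 ⟨n, e, A, he, hA, rfl⟩)

/-- The system is square: a component has one closing relation for its first arc and one relation
for each of its over-arcs. This is what makes the zeroth ideal principal. -/
theorem length_systemRels {K : Type*} [CommRing K] {g : ℕ} {N : Type*} (τ : Kˣ)
    (ζ : Palette g → Kˣ) (cs : List (N × List (Letter g))) :
    (cs.flatMap (componentRels τ ζ)).length = (systemGens cs).length := by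
  induction cs with
  | nil => rfl
  | cons c cs ih =>
    have := (systemGens_cons c cs).length_eq
    simp only [List.length_cons, List.length_append, List.length_map] at this
    rw [List.flatMap_cons, List.length_append, ih, this, componentRels, List.length_cons,
      length_overRels]
    omega

/-- The zeroth ideal of a module with generators `G` and relations `L`. -/
theorem zerothIdeal_eq_span_ldet {ι R M : Type*} [CommRing R] [AddCommGroup M] [Module R M]
    {G : List ι} (hG : G.Nodup) {L : List (ι →₀ R)} (hL : L.length = G.length)
    (ev : (ι →₀ R) →ₗ[R] M) (hLG : ∀ r ∈ L, ∀ x ∈ r.support, x ∈ G)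
    (hspan : Submodule.span R {m | ∃ x ∈ G, m = ev (Finsupp.single x 1)} = ⊤)
    (hrel : ∀ r ∈ L, ev r = 0)
    (hker : ∀ v : ι →₀ R, (∀ x ∈ v.support, x ∈ G) → ev v = 0 →
      v ∈ Submodule.span R {r | r ∈ L}) :
    zerothIdeal R M = Ideal.span {ldet G L} := by
  classical
  have hexp : ∀ v : ι →₀ R, (∀ x ∈ v.support, x ∈ G) →
      v = ∑ j : Fin G.length, v G[j.val] • Finsupp.single G[j.val] 1 := by
    intro v hv
    ext x
    simp only [Finsupp.finsetSum_apply, Finsupp.smul_apply, smul_eq_mul]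
    by_cases hx : x ∈ G
    · obtain ⟨i, hi, rfl⟩ := List.getElem_of_mem hx
      rw [Finset.sum_eq_single ⟨i, hi⟩]
      · simp
      · intro j _ hj
        have : G[j.val] ≠ G[i] := fun h =>
          hj (Fin.ext ((List.Nodup.getElem_inj_iff hG).1 h))
        simp [this]
      · simp
    · have h0 : v x = 0 := by
        by_contra h
        exact hx (hv x (by simpa using h))
      rw [h0, Finset.sum_eq_zero]
      intro j _
      have : G[j.val] ≠ x := fun h => hx (h ▸ List.getElem_mem _)
      simp [this]
  rw [ldet_of_length _ rfl hL]
  refine zerothIdeal_eq_span_det (e := fun j => ev (Finsupp.single G[j.val] 1)) ?_ ?_ ?_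
  · rw [← hspan]
    congr 1
    ext m
    simp only [Set.mem_range, Set.mem_ofPred_eq]
    constructor
    · rintro ⟨j, rfl⟩
      exact ⟨_, List.getElem_mem _, rfl⟩
    · rintro ⟨x, hx, rfl⟩
      obtain ⟨i, hi, rfl⟩ := List.getElem_of_mem hx
      exact ⟨⟨i, hi⟩, rfl⟩
  · intro i
    have hi : L[i.val] ∈ L := List.getElem_mem _
    have := hrel _ hi
    rw [hexp _ (hLG _ hi), map_sum] at this
    simpa only [map_smul, Matrix.of_apply] using this
  · intro v hv
    have h1 := hker (∑ j : Fin G.length, v j • Finsupp.single G[j.val] 1) ?_ ?_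
    · rw [show {r | r ∈ L} = Set.range fun i : Fin G.length => L[i.val] by
        ext r
        simp only [Set.mem_ofPred_eq, Set.mem_range]
        constructor
        · intro h
          obtain ⟨i, hi, rfl⟩ := List.getElem_of_mem h
          exact ⟨⟨i, hL ▸ hi⟩, rfl⟩
        · rintro ⟨i, rfl⟩
          exact List.getElem_mem _] at h1
      obtain ⟨c, hc⟩ := (Submodule.mem_span_range_iff_exists_fun R).1 h1
      refine ⟨c, funext fun j => ?_⟩
      have := congrArg (fun f => f G[j.val]) hc
      simp only [Finsupp.finsetSum_apply, Finsupp.smul_apply, smul_eq_mul] at this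
      rw [Finset.sum_eq_single (s := Finset.univ) (a := j) (f := fun x : Fin G.length =>
        v x * (Finsupp.single G[x.val] 1 : ι →₀ R) G[j.val])] at this
      · simpa [Matrix.vecMul, dotProduct] using this.symm
      · intro i _ hij
        have : G[i.val] ≠ G[j.val] := fun h =>
          hij (Fin.ext ((List.Nodup.getElem_inj_iff hG).1 h))
        simp [this]
      · simp
    · intro x hx
      by_contra hxG
      refine (Finsupp.mem_support_iff.1 hx) ?_
      rw [Finsupp.finsetSum_apply, Finset.sum_eq_zero]
      intro j _
      have : G[j.val] ≠ x := fun h => hxG (h ▸ List.getElem_mem _)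
      simp [this]
    · simpa only [map_sum, map_smul] using hv

/-! ### The Alexander module -/

section Alexander

variable {g : ℕ} {C : Code g}

/-- The class of the lift of a loop. -/
noncomputable def loopClass (h : LinkGroup C) : AlexanderModule C :=
  (alexanderRelations C).mkQ (Finsupp.single h 1)

/-- The homomorphism to homology, with values in the units of the group ring. -/
noncomputable def abUnit (C : Code g) : LinkGroup C →* (LaurentPalette g)ˣ :=
  (AddMonoidAlgebra.of ℤ (ℤ × (Palette g → ℤ))).toHomUnits.comp (ab C)

/-- Classes of lifted loops form a crossed homomorphism. The Fox calculus needed below is this rule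
together with its consequence for inverses. -/
theorem loopClass_mul (h k : LinkGroup C) :
    loopClass (h * k) = loopClass h + (abUnit C h : LaurentPalette g) • loopClass k := by
  have h1 : (alexanderRelations C).mkQ (Finsupp.single (h * k) 1 - Finsupp.single h 1
      - Finsupp.single k (AddMonoidAlgebra.of ℤ _ (ab C h))) = 0 := by
    rw [Submodule.mkQ_apply, Submodule.Quotient.mk_eq_zero]
    exact Submodule.subset_span (Or.inl ⟨h, k, rfl⟩)
  rw [map_sub, map_sub, sub_sub, sub_eq_zero] at h1
  rw [loopClass, h1]
  congr 1
  rw [loopClass, ← map_smul, Finsupp.smul_single, smul_eq_mul, mul_one]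
  rfl

theorem loopClass_one : loopClass (1 : LinkGroup C) = 0 := by
  have := loopClass_mul (1 : LinkGroup C) 1
  simpa using this

theorem loopClass_inv (h : LinkGroup C) :
    loopClass h⁻¹ = -(((abUnit C h)⁻¹ : (LaurentPalette g)ˣ) : LaurentPalette g) • loopClass h := by
  have := loopClass_mul h⁻¹ h
  rw [inv_mul_cancel, loopClass_one, map_inv] at this
  rw [neg_smul]
  exact eq_neg_of_add_eq_zero_left this.symm

theorem loopClass_curve (z : Palette g) :
    loopClass (PresentedGroup.of (Sum.inr z) : LinkGroup C) = 0 := by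
  rw [loopClass, Submodule.mkQ_apply, Submodule.Quotient.mk_eq_zero]
  exact Submodule.subset_span (Or.inr ⟨z, rfl⟩)

theorem abUnit_of_curve (z : Palette g) :
    abUnit C (PresentedGroup.of (Sum.inr z)) = zVar z := by
  simp [abUnit, ab, abGen, zVar, mono]

theorem abUnit_of_arc (a : Arc C) :
    abUnit C (PresentedGroup.of (Sum.inl a)) = uVar g := by
  simp [abUnit, ab, abGen, uVar, mono]

/-- The subgroup generated by the curves in the surface. -/
def curveSubgroup (C : Code g) : Subgroup (FreeGroup (Gen C)) :=
  Subgroup.closure (Set.range fun z => FreeGroup.of (Sum.inr z))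

theorem curve_mem (z : Palette g) : FreeGroup.of (Sum.inr z) ∈ curveSubgroup C :=
  Subgroup.subset_closure ⟨z, rfl⟩

theorem handle_mem (i : Fin g) : handle C i ∈ curveSubgroup C :=
  mul_mem (mul_mem (mul_mem (inv_mem (curve_mem _)) (inv_mem (curve_mem _))) (curve_mem _))
    (curve_mem _)

theorem handlesBefore_mem (i : Fin g) : handlesBefore C i ∈ curveSubgroup C := by
  refine Subgroup.list_prod_mem _ ?_
  intro x hx
  obtain ⟨j, -, rfl⟩ := List.mem_map.1 hx
  exact handle_mem j

theorem surfaceRelator_mem : surfaceRelator C ∈ curveSubgroup C := by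
  refine Subgroup.list_prod_mem _ ?_
  intro x hx
  obtain ⟨j, -, rfl⟩ := List.mem_map.1 hx
  exact handle_mem j

theorem deck_mem (z : Palette g) (ε : Bool) : deck C z ε ∈ curveSubgroup C := by
  have hx : ∀ i, curveX C i ∈ curveSubgroup C := fun i => curve_mem _
  have hy : ∀ i, curveY C i ∈ curveSubgroup C := fun i => curve_mem _
  have hb := fun i => handlesBefore_mem (C := C) i
  cases z with
  | inl i =>
    have h1 : handlesBefore C i * (curveX C i)⁻¹ * (curveY C i)⁻¹ * curveX C i * curveY C i *
        curveX C i * (handlesBefore C i)⁻¹ ∈ curveSubgroup C :=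
      mul_mem (mul_mem (mul_mem (mul_mem (mul_mem (mul_mem (hb i) (inv_mem (hx i)))
        (inv_mem (hy i))) (hx i)) (hy i)) (hx i)) (inv_mem (hb i))
    cases ε
    · exact inv_mem h1
    · exact h1
  | inr i =>
    have h1 : handlesBefore C i * (curveX C i)⁻¹ * (curveY C i)⁻¹ * curveX C i *
        (handlesBefore C i)⁻¹ ∈ curveSubgroup C :=
      mul_mem (mul_mem (mul_mem (mul_mem (hb i) (inv_mem (hx i))) (inv_mem (hy i))) (hx i))
        (inv_mem (hb i))
    cases ε
    · exact h1
    · exact inv_mem h1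

/-- In an abelian group the conjugating paths along the boundary cancel. What remains is `yᵢ⁻¹` for
the passage from the side `xᵢ⁻¹` to `xᵢ` and `xᵢ` for the one from `yᵢ⁻¹` to `yᵢ`; the case
distinctions on `ε` in `deck` turn this into `z ^ ε`. -/
theorem lift_abGen_deck (z : Palette g) (ε : Bool) :
    (AddMonoidAlgebra.of ℤ (ℤ × (Palette g → ℤ))).toHomUnits
      (FreeGroup.lift (abGen C) (deck C z ε)) = zVar z ^ sgn ε := by
  have h1 : ∀ a b c : (LaurentPalette g)ˣ, c * a⁻¹ * b⁻¹ * a * c⁻¹ = b⁻¹ := fun a b c => by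
    rw [mul_right_comm (c * a⁻¹) b⁻¹ a, inv_mul_cancel_right, mul_right_comm, mul_inv_cancel,
      one_mul]
  have h2 : ∀ a b c : (LaurentPalette g)ˣ, c * a⁻¹ * b⁻¹ * a * b * a * c⁻¹ = a := fun a b c => by
    rw [mul_right_comm (c * a⁻¹) b⁻¹ a, inv_mul_cancel_right, inv_mul_cancel_right,
      mul_right_comm, mul_inv_cancel, one_mul]
  cases z <;> cases ε <;>
    simp only [deck, map_mul, map_inv, if_true, if_false, Bool.false_eq_true, h1, h2, curveX,
      curveY, FreeGroup.lift_apply_of] <;>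
    simp [abGen, zVar, mono, sgn]

/-- The generating curves have class zero by definition, and the crossed rule passes this on to
products and inverses. Hence covering transformations contribute to the relations only through their
homology classes. -/
theorem loopClass_mk_curve {x : FreeGroup (Gen C)} (hx : x ∈ curveSubgroup C) :
    loopClass (PresentedGroup.mk {r | IsRelator C r} x) = 0 := by
  induction hx using Subgroup.closure_induction with
  | mem x hx =>
    obtain ⟨z, rfl⟩ := hx
    exact loopClass_curve z
  | one => simpa using loopClass_one
  | mul x y _ _ hx hy => rw [map_mul, loopClass_mul, hx, hy, smul_zero, add_zero]
  | inv x _ hx => rw [map_inv, loopClass_inv, hx, smul_zero]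

theorem abUnit_mk (x : FreeGroup (Gen C)) : abUnit C (PresentedGroup.mk {r | IsRelator C r} x)
    = (AddMonoidAlgebra.of ℤ (ℤ × (Palette g → ℤ))).toHomUnits
      (FreeGroup.lift (abGen C) x) := rfl

theorem mk_eq_of_isRelator {x y : FreeGroup (Gen C)} (h : IsRelator C (x * y⁻¹)) :
    PresentedGroup.mk {r | IsRelator C r} x = PresentedGroup.mk {r | IsRelator C r} y :=
  (PresentedGroup.mk_eq_mk_of_mul_inv_mem (rels := {r | IsRelator C r}) h)

/-- The class of the meridian of an arc. -/
noncomputable def arcClass (a : Arc C) : AlexanderModule C :=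
  loopClass (PresentedGroup.of (Sum.inl a))

theorem arcClass_eq (a : Arc C) :
    arcClass a = loopClass (PresentedGroup.mk {r | IsRelator C r} (meridian a)) := rfl

theorem abUnit_meridian (a : Arc C) :
    abUnit C (PresentedGroup.mk {r | IsRelator C r} (meridian a)) = uVar g := abUnit_of_arc a

theorem arcClass_succ_over {a : Arc C} {c : ℕ} {ε : Bool} (h : a.letter = some (.over c ε)) :
    arcClass a.succ = arcClass a := by
  rw [arcClass_eq, arcClass_eq, mk_eq_of_isRelator (IsRelator.over a c ε h)]

/-- For a positive crossing the crossed rule gives `[o⁻¹ a o] = -t⁻¹[o] + t⁻¹[a] + [o]`, and for a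
negative one the same with `t` in place of `t⁻¹`. So under-passages act with the parameter `τ =
t⁻¹`. -/
theorem arcClass_succ_under {a o : Arc C} {c : ℕ} {ε : Bool} (h : a.letter = some (.under c ε))
    (ho : o.letter = some (.over c ε)) :
    arcClass a.succ = (((uVar g)⁻¹ ^ sgn ε : (LaurentPalette g)ˣ) : LaurentPalette g) • arcClass a
      + (1 - (((uVar g)⁻¹ ^ sgn ε : (LaurentPalette g)ˣ) : LaurentPalette g)) • arcClass o := by
  cases ε with
  | true =>
    rw [arcClass_eq, ← mk_eq_of_isRelator (IsRelator.underPos a o c h ho)]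
    simp only [map_mul, map_inv, loopClass_mul, loopClass_inv, abUnit_meridian, ← arcClass_eq,
      Units.val_mul]
    simp only [sgn, if_true, zpow_one, neg_smul, sub_smul, one_smul, Units.inv_mul]
    abel
  | false =>
    rw [arcClass_eq, ← mk_eq_of_isRelator (IsRelator.underNeg a o c h ho)]
    simp only [map_mul, map_inv, loopClass_mul, loopClass_inv, abUnit_meridian, ← arcClass_eq,
      Units.val_mul]
    simp only [sgn, Bool.false_eq_true, if_false, zpow_neg, zpow_one, inv_inv, smul_smul, neg_smul,
      sub_smul, one_smul, Units.mul_inv, mul_assoc, smul_neg, mul_one]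
    abel

/-- The conjugating element `δ` has class zero, so `[δ a δ⁻¹] = φ(δ)[a]`: the non-commutative
relator leaves just the scalar `z ^ ε`. -/
theorem arcClass_succ_omega {a : Arc C} {z : Palette g} {ε : Bool}
    (h : a.letter = some (.omega z ε)) :
    arcClass a.succ = ((zVar z ^ sgn ε : (LaurentPalette g)ˣ) : LaurentPalette g) • arcClass a := by
  rw [arcClass_eq, ← mk_eq_of_isRelator (IsRelator.omega a z ε h)]
  rw [map_mul, map_mul, map_inv, loopClass_mul, loopClass_mul, loopClass_inv,
    loopClass_mk_curve (deck_mem z ε), abUnit_mk, lift_abGen_deck, smul_zero, smul_zero, add_zero,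
    zero_add]
  rfl

end Alexander

end PrismaticLink

namespace PrismaticLink

/-! ### Arcs of a well-formed code as vectors. -/

section Letters

variable {K : Type*} [CommRing K] {g : ℕ} {N : Type*} (τ : Kˣ) (ζ : Palette g → Kˣ)

theorem transport_take_succ {w : List (Letter g)} {i : ℕ} {ℓ : Letter g} (h : w[i]? = some ℓ)
    (v : (N ⊕ ℕ) →₀ K) :
    transport τ ζ (w.take (i + 1)) v = ℓ.act τ ζ (transport τ ζ (w.take i) v) := by
  rw [List.take_add_one, h, transport_append]
  rfl

theorem mem_overRels_iff {w : List (Letter g)} {v r : (N ⊕ ℕ) →₀ K} :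
    r ∈ overRels τ ζ w v ↔ ∃ i c ε, w[i]? = some (.over c ε) ∧
      r = overGen K N c - transport τ ζ (w.take i) v := by
  induction w generalizing v with
  | nil => simp [overRels]
  | cons ℓ w ih =>
    have hs : (∃ i c ε, (ℓ :: w)[i]? = some (Letter.over c ε) ∧
        r = overGen K N c - transport τ ζ ((ℓ :: w).take i) v) ↔
        (∃ c ε, ℓ = Letter.over c ε ∧ r = overGen K N c - v) ∨
        ∃ i c ε, w[i]? = some (Letter.over c ε) ∧
          r = overGen K N c - transport τ ζ (w.take i) (ℓ.act τ ζ v) := by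
      constructor
      · rintro ⟨_ | i, c, ε, h, rfl⟩
        · exact Or.inl ⟨c, ε, by simpa using h, by simp⟩
        · exact Or.inr ⟨i, c, ε, by simpa using h, by simp⟩
      · rintro (⟨c, ε, rfl, rfl⟩ | ⟨i, c, ε, h, rfl⟩)
        · exact ⟨0, c, ε, by simp, by simp⟩
        · exact ⟨i + 1, c, ε, by simpa using h, by simp⟩
    rw [hs, ← ih]
    rcases ℓ with ⟨c, ε⟩ | ⟨c, ε⟩ | ⟨z, ε⟩ <;> simp [overRels, Letter.act]

theorem mem_overLabels_iff {w : List (Letter g)} {c : ℕ} :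
    c ∈ overLabels w ↔ ∃ ε, Letter.over c ε ∈ w := by
  induction w with
  | nil => simp [overLabels]
  | cons ℓ w ih =>
    rcases ℓ with ⟨c, ε⟩ | ⟨c, ε⟩ | ⟨z, ε⟩ <;> simp [overLabels, ih, exists_or, eq_comm]

theorem mem_crossLabels_iff {w : List (Letter g)} {c : ℕ} :
    c ∈ crossLabels w ↔ (∃ ε, Letter.over c ε ∈ w) ∨ ∃ ε, Letter.under c ε ∈ w := by
  simp only [crossLabels, List.mem_flatMap]
  constructor
  · rintro ⟨ℓ, h, hc⟩
    rcases ℓ with ⟨d, ε⟩ | ⟨d, ε⟩ | ⟨z, ε⟩ <;> simp [Letter.labels] at hc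
    · exact Or.inl ⟨ε, hc ▸ h⟩
    · exact Or.inr ⟨ε, hc ▸ h⟩
  · rintro (⟨ε, h⟩ | ⟨ε, h⟩)
    · exact ⟨_, h, by simp [Letter.labels]⟩
    · exact ⟨_, h, by simp [Letter.labels]⟩

/-- Every crossing occurs at most once as an over-passage, and it does if it occurs as an
under-passage. -/
structure Code.WellFormed (C : Code g) : Prop where
  nodup : (C.flatMap overLabels).Nodup
  exists_over : ∀ w ∈ C, ∀ c ε, Letter.under c ε ∈ w → ∃ w' ∈ C, Letter.over c ε ∈ w'

theorem overLabels_eq_filterMap (w : List (Letter g)) : overLabels w = w.filterMap fun ℓ =>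
    match ℓ with
    | .over c _ => some c
    | _ => none := by
  induction w with
  | nil => rfl
  | cons ℓ w ih => cases ℓ <;> simp [overLabels, ih]

/-- The over-arc at a crossing is thereby a function of the label, as is needed to send the
generator of that label to a class in the Alexander module. -/
theorem Code.WellFormed.over_unique {C : Code g} (hC : C.WellFormed) {a o : Arc C} {c : ℕ}
    {ε ε' : Bool} (ha : a.letter = some (.over c ε)) (ho : o.letter = some (.over c ε')) :
    a = o := by
  obtain ⟨j, i⟩ := a
  obtain ⟨j', i'⟩ := o
  simp only [Arc.letter] at ha ho
  have hmem : c ∈ overLabels (C.get j) := mem_overLabels_iff.2 ⟨ε, List.mem_of_getElem? ha⟩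
  have hmem' : c ∈ overLabels (C.get j') := mem_overLabels_iff.2 ⟨ε', List.mem_of_getElem? ho⟩
  have hn := List.nodup_flatMap.1 hC.nodup
  have hj : j = j' := by
    by_contra hne
    have hp := List.pairwise_iff_getElem.1 hn.2
    rcases lt_or_gt_of_ne (fun h => hne (Fin.ext h)) with h | h
    · exact hp _ _ j.2 j'.2 h hmem hmem'
    · exact hp _ _ j'.2 j.2 h hmem' hmem
  subst hj
  have hw := hn.1 _ (List.get_mem C j)
  rw [overLabels_eq_filterMap, List.Nodup, List.pairwise_filterMap] at hw
  have hp := List.pairwise_iff_getElem.1 hw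
  obtain ⟨h1, h1'⟩ := List.getElem?_eq_some_iff.1 ha
  obtain ⟨h2, h2'⟩ := List.getElem?_eq_some_iff.1 ho
  have hi : i.val = i'.val := by
    by_contra hne
    rcases lt_or_gt_of_ne hne with h | h
    · exact hp _ _ h1 h2 h c (by rw [h1']) c (by rw [h2']) rfl
    · exact hp _ _ h2 h1 h c (by rw [h2']) c (by rw [h1']) rfl
  exact congrArg _ (Fin.ext hi)

/-- The components of a code, named by their position. -/
def Code.named (C : Code g) : List (ℕ × List (Letter g)) := C.zipIdx.map Prod.swap

theorem Code.mem_named {C : Code g} {c : ℕ × List (Letter g)} :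
    c ∈ C.named ↔ C[c.1]? = some c.2 := by
  obtain ⟨b, w⟩ := c
  simp only [Code.named, List.mem_map, Prod.exists, Prod.swap_prod_mk, Prod.mk.injEq]
  constructor
  · rintro ⟨w', b', h, rfl, rfl⟩
    exact List.mem_zipIdx_iff_getElem?.1 h
  · intro h
    exact ⟨w, b, List.mem_zipIdx_iff_getElem?.2 h, rfl, rfl⟩

theorem Code.flatMap_named {β : Type*} (C : Code g) (f : List (Letter g) → List β) :
    (C.named.flatMap fun c => f c.2) = C.flatMap f := by
  conv_rhs => rw [← map_snd_swap_zipIdx C 0]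
  rw [List.flatMap_map, Code.named]

theorem Code.nodup_systemGens {C : Code g} (hC : C.WellFormed) :
    (systemGens C.named).Nodup := by
  rw [systemGens, List.nodup_append, C.flatMap_named overLabels]
  refine ⟨?_, hC.nodup.map Sum.inr_injective, ?_⟩
  · have : (C.named.map Prod.fst).Nodup := by
      rw [Code.named, map_fst_swap_zipIdx]
      exact List.nodup_range'
    have h := this.map (f := (Sum.inl : ℕ → ℕ ⊕ ℕ)) Sum.inl_injective
    rwa [List.map_map] at h
  · simp

theorem Code.inl_mem_systemGens {C : Code g} {b : ℕ} (h : b < C.length) :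
    Sum.inl b ∈ systemGens C.named := by
  rw [PrismaticLink.inl_mem_systemGens, Code.named, map_fst_swap_zipIdx]
  simpa using h

theorem Code.inr_mem_systemGens {C : Code g} {c : ℕ} :
    Sum.inr c ∈ systemGens C.named ↔ ∃ w ∈ C, c ∈ overLabels w := by
  rw [systemGens, C.flatMap_named overLabels]
  simp

theorem Code.WellFormed.crossLabels_mem {C : Code g} (hC : C.WellFormed) {w : List (Letter g)}
    (hw : w ∈ C) {c : ℕ} (h : c ∈ crossLabels w) : Sum.inr c ∈ systemGens C.named := by
  rw [Code.inr_mem_systemGens]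
  rcases mem_crossLabels_iff.1 h with ⟨ε, h⟩ | ⟨ε, h⟩
  · exact ⟨w, hw, mem_overLabels_iff.2 ⟨ε, h⟩⟩
  · obtain ⟨w', hw', h'⟩ := hC.exists_over w hw c ε h
    exact ⟨w', hw', mem_overLabels_iff.2 ⟨ε, h'⟩⟩

/-- An arc in terms of the first arc of its component and of the over-arcs. -/
noncomputable def arcVec {C : Code g} (a : Arc C) : (ℕ ⊕ ℕ) →₀ K :=
  transport τ ζ ((C.get a.1).take a.2.val) (base K a.1.val)

theorem Arc.lt_length {C : Code g} {a : Arc C} {ℓ : Letter g} (h : a.letter = some ℓ) :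
    a.2.val < (C.get a.1).length := (List.getElem?_eq_some_iff.1 h).1

theorem Code.get_mem_named {C : Code g} (j : Fin C.length) : (j.val, C.get j) ∈ C.named :=
  Code.mem_named.2 (by simp)

theorem arcVec_mem {C : Code g} (hC : C.WellFormed) (a : Arc C) :
    arcVec τ ζ a ∈ Finsupp.supported K K {x | x ∈ systemGens C.named} := by
  refine transport_mem τ ζ _ (fun c hc => Finsupp.single_mem_supported _ _ ?_)
    (Finsupp.single_mem_supported _ _ (Code.inl_mem_systemGens a.1.2))
  refine hC.crossLabels_mem (List.get_mem C a.1) (mem_crossLabels_iff.2 ?_)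
  rcases mem_crossLabels_iff.1 hc with ⟨ε, h⟩ | ⟨ε, h⟩
  · exact Or.inl ⟨ε, List.mem_of_mem_take h⟩
  · exact Or.inr ⟨ε, List.mem_of_mem_take h⟩

/-- Inside the word this is one more step of `transport`. After the last letter the successor is the
first arc again, and the equation is the closing relation, which `f` kills. -/
theorem apply_arcVec_succ {P : Type*} [AddCommGroup P] [Module K P] {C : Code g}
    (f : ((ℕ ⊕ ℕ) →₀ K) →ₗ[K] P) (hf : ∀ c ∈ C.named, ∀ r ∈ componentRels τ ζ c, f r = 0)
    {a : Arc C} {ℓ : Letter g} (h : a.letter = some ℓ) :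
    f (arcVec τ ζ a.succ) = f (ℓ.act τ ζ (arcVec τ ζ a)) := by
  have hlt := Arc.lt_length h
  have hs := transport_take_succ τ ζ h (base K a.1.val)
  by_cases h1 : a.2.val + 1 < (C.get a.1).length
  · have h2 : (Arc.succ a).2.val = a.2.val + 1 := by
      simp only [Arc.succ]
      exact Nat.mod_eq_of_lt (lt_max_of_lt_right h1)
    rw [arcVec, h2]
    exact congrArg f hs
  · have h3 : a.2.val + 1 = (C.get a.1).length := by omega
    have h2 : (Arc.succ a).2.val = 0 := by
      simp only [Arc.succ]
      rw [h3, max_eq_right (by omega), Nat.mod_self]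
    rw [h3, List.take_length] at hs
    have h4 := hf _ (Code.get_mem_named a.1) (base K a.1.val - transport τ ζ (C.get a.1)
      (base K a.1.val)) (by simp [componentRels])
    rw [arcVec, h2]
    rw [map_sub, sub_eq_zero, hs] at h4
    exact h4

theorem apply_overGen {P : Type*} [AddCommGroup P] [Module K P] {C : Code g}
    (f : ((ℕ ⊕ ℕ) →₀ K) →ₗ[K] P) (hf : ∀ c ∈ C.named, ∀ r ∈ componentRels τ ζ c, f r = 0)
    {o : Arc C} {c : ℕ} {ε : Bool} (h : o.letter = some (.over c ε)) :
    f (overGen K ℕ c) = f (arcVec τ ζ o) := by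
  rw [← sub_eq_zero, ← map_sub]
  refine hf _ (Code.get_mem_named o.1) _ ?_
  rw [componentRels, List.mem_cons]
  exact Or.inr ((mem_overRels_iff τ ζ).2 ⟨_, c, ε, h, rfl⟩)

end Letters

/-! ### The presentation of the Alexander module -/

section Presentation

/-- The action of units by scalar multiplication. -/
def scaleAut (R Q : Type*) [CommRing R] [AddCommGroup Q] [Module R Q] :
    Rˣ →* MulAut (Multiplicative Q) where
  toFun u :=
    { toFun := fun q => .ofAdd ((u : R) • q.toAdd)
      invFun := fun q => .ofAdd (((u⁻¹ : Rˣ) : R) • q.toAdd)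
      left_inv := fun q => by simp [smul_smul]
      right_inv := fun q => by simp [smul_smul]
      map_mul' := fun a b => by simp }
  map_one' := by ext; simp
  map_mul' u v := by ext; simp [smul_smul]

@[simp] theorem toAdd_scaleAut {R Q : Type*} [CommRing R] [AddCommGroup Q] [Module R Q] (u : Rˣ)
    (q : Multiplicative Q) : (scaleAut R Q u q).toAdd = (u : R) • q.toAdd := rfl

variable {g : ℕ}

section Crossed

variable {C : Code g} {Q : Type*} [AddCommGroup Q] [Module (LaurentPalette g) Q]
  (v : Arc C → Q)

/-- The values on the generators of the homomorphism that classifies a crossed homomorphism. -/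
noncomputable def crossedGen :
    Gen C → Multiplicative Q ⋊[scaleAut (LaurentPalette g) Q] (LaurentPalette g)ˣ
  | .inl a => ⟨.ofAdd (v a), uVar g⟩
  | .inr z => SemidirectProduct.inr (zVar z)

theorem right_lift_crossedGen (x : FreeGroup (Gen C)) :
    (FreeGroup.lift (crossedGen v) x).right =
      (AddMonoidAlgebra.of ℤ (ℤ × (Palette g → ℤ))).toHomUnits (FreeGroup.lift (abGen C) x) := by
  have : (SemidirectProduct.rightHom.comp (FreeGroup.lift (crossedGen v))) =
      (AddMonoidAlgebra.of ℤ (ℤ × (Palette g → ℤ))).toHomUnits.comp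
        (FreeGroup.lift (abGen C)) := by
    ext z
    cases z <;> simp [crossedGen, abGen, uVar, zVar, mono]
  exact DFunLike.congr_fun this x

theorem left_lift_curve {x : FreeGroup (Gen C)} (hx : x ∈ curveSubgroup C) :
    (FreeGroup.lift (crossedGen v) x).left = 1 := by
  induction hx using Subgroup.closure_induction with
  | mem x hx =>
    obtain ⟨z, rfl⟩ := hx
    simp [crossedGen]
  | one => simp
  | mul x y _ _ hx hy => simp [hx, hy]
  | inv x _ hx => simp [hx]

/-- Homomorphisms to `Q ⋊ Rˣ` over the homology character are crossed homomorphisms to `Q`. The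
conditions on `v` are the crossed rule written out for each relator, so every relator becomes
trivial. -/
theorem lift_crossedGen_eq_one
  (hover : ∀ (a : Arc C) c ε, a.letter = some (.over c ε) → v a.succ = v a)
  (hunder : ∀ (a o : Arc C) c ε, a.letter = some (.under c ε) → o.letter = some (.over c ε) →
    v a.succ = (((uVar g)⁻¹ ^ sgn ε : (LaurentPalette g)ˣ) : LaurentPalette g) • v a
      + (1 - (((uVar g)⁻¹ ^ sgn ε : (LaurentPalette g)ˣ) : LaurentPalette g)) • v o)
  (homega : ∀ (a : Arc C) z ε, a.letter = some (.omega z ε) →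
    v a.succ = ((zVar z ^ sgn ε : (LaurentPalette g)ˣ) : LaurentPalette g) • v a)
    (r : FreeGroup (Gen C)) (h : r ∈ {r | IsRelator C r}) :
    FreeGroup.lift (crossedGen v) r = 1 := by
  have hright : (FreeGroup.lift (crossedGen v) r).right = 1 := by
    rw [right_lift_crossedGen, lift_isRelator C r h, map_one]
  refine SemidirectProduct.ext ?_ hright
  have hm : ∀ a : Arc C, FreeGroup.lift (crossedGen v) (meridian a) = ⟨.ofAdd (v a), uVar g⟩ :=
    fun a => by simp [meridian, crossedGen]
  -- Apart from the surface relator, relators have the form `x * y⁻¹`. The unit component of the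
  -- image is already known to be trivial, so it is enough to compare the module components of `x`
  -- and `y`.
  have hconj : ∀ x y : FreeGroup (Gen C), r = x * y⁻¹ →
      (FreeGroup.lift (crossedGen v) x).left = (FreeGroup.lift (crossedGen v) y).left →
      (FreeGroup.lift (crossedGen v) r).left = 1 := by
    rintro x y rfl hxy
    rw [map_mul, map_inv, SemidirectProduct.mul_right, SemidirectProduct.inv_right,
      mul_inv_eq_one] at hright
    rw [map_mul, map_inv, SemidirectProduct.mul_left, SemidirectProduct.inv_left, hxy, hright,
      ← MulAut.mul_apply, ← map_mul, mul_inv_cancel, map_one, MulAut.one_apply, mul_inv_cancel]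
  rcases h with h | ⟨a, c, ε, h⟩ | ⟨a, o, c, h, ho⟩ | ⟨a, o, c, h, ho⟩ | ⟨a, z, ε, h⟩
  · exact left_lift_curve v surfaceRelator_mem
  · refine hconj _ _ rfl ?_
    simp [hm, hover a c ε h]
  · refine hconj _ _ rfl ?_
    have := hunder a o c true h ho
    simp only [sgn, if_true, zpow_one] at this
    simp only [map_mul, map_inv, hm, SemidirectProduct.mul_left, SemidirectProduct.inv_left,
      SemidirectProduct.mul_right, SemidirectProduct.inv_right]
    apply Multiplicative.toAdd.injective
    simp only [← map_inv, ← map_mul]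
    simp only [toAdd_mul, toAdd_scaleAut, toAdd_inv, toAdd_ofAdd, this, Units.val_mul, sub_smul,
      one_smul, smul_add, smul_neg, Units.inv_mul]
    abel
  · refine hconj _ _ rfl ?_
    have := hunder a o c false h ho
    simp only [sgn, Bool.false_eq_true, if_false, zpow_neg, zpow_one, inv_inv] at this
    simp only [map_mul, map_inv, hm, SemidirectProduct.mul_left, SemidirectProduct.inv_left,
      SemidirectProduct.mul_right]
    apply Multiplicative.toAdd.injective
    simp only [← map_inv, ← map_mul]
    simp only [toAdd_mul, toAdd_scaleAut, toAdd_inv, toAdd_ofAdd, this, Units.val_mul, sub_smul,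
      one_smul, smul_neg, smul_smul, mul_assoc, Units.mul_inv, mul_one]
    abel
  · refine hconj _ _ rfl ?_
    have h1 := left_lift_curve v (deck_mem (C := C) z ε)
    have h2 := right_lift_crossedGen v (deck C z ε)
    rw [lift_abGen_deck] at h2
    simp only [map_mul, map_inv, hm, SemidirectProduct.mul_left, SemidirectProduct.inv_left, h1, h2]
    apply Multiplicative.toAdd.injective
    simp [homega a z ε h, -map_zpow]

/-- A compatible assignment of vectors to the arcs extends to the Alexander module. -/
theorem exists_linearMap_alexanderModule
  (hover : ∀ (a : Arc C) c ε, a.letter = some (.over c ε) → v a.succ = v a)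
  (hunder : ∀ (a o : Arc C) c ε, a.letter = some (.under c ε) → o.letter = some (.over c ε) →
    v a.succ = (((uVar g)⁻¹ ^ sgn ε : (LaurentPalette g)ˣ) : LaurentPalette g) • v a
      + (1 - (((uVar g)⁻¹ ^ sgn ε : (LaurentPalette g)ˣ) : LaurentPalette g)) • v o)
  (homega : ∀ (a : Arc C) z ε, a.letter = some (.omega z ε) →
    v a.succ = ((zVar z ^ sgn ε : (LaurentPalette g)ˣ) : LaurentPalette g) • v a) :
    ∃ ψ : AlexanderModule C →ₗ[LaurentPalette g] Q, ∀ a, ψ (arcClass a) = v a := by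
  let F : LinkGroup C →* Multiplicative Q ⋊[scaleAut (LaurentPalette g) Q] (LaurentPalette g)ˣ :=
    PresentedGroup.toGroup (lift_crossedGen_eq_one v hover hunder homega)
  have hFr : ∀ h, (F h).right = abUnit C h := by
    have : SemidirectProduct.rightHom.comp F = abUnit C := by
      refine PresentedGroup.ext fun x => ?_
      cases x with
      | inl a => simp [F, crossedGen, abUnit_of_arc]
      | inr z => simp [F, crossedGen, abUnit_of_curve]
    exact fun h => DFunLike.congr_fun this h
  let ψ₀ : (LinkGroup C →₀ LaurentPalette g) →ₗ[LaurentPalette g] Q :=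
    Finsupp.linearCombination _ fun h => (F h).left.toAdd
  -- The product of the semidirect product, read in the first component, is the defining relation of
  -- the module. The curves are mapped into the complement and so have first component zero.
  have hker : alexanderRelations C ≤ LinearMap.ker ψ₀ := by
    refine Submodule.span_le.2 ?_
    rintro _ (⟨h, k, rfl⟩ | ⟨z, rfl⟩)
    · rw [SetLike.mem_coe, LinearMap.mem_ker, map_sub, map_sub]
      simp only [ψ₀, Finsupp.linearCombination_single, one_smul, map_mul,
        SemidirectProduct.mul_left, hFr, toAdd_mul, toAdd_scaleAut]
      rw [add_sub_cancel_left]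
      exact sub_self _
    · rw [SetLike.mem_coe, LinearMap.mem_ker]
      simp [ψ₀, F, crossedGen]
  refine ⟨(alexanderRelations C).liftQ ψ₀ hker, fun a => ?_⟩
  rw [arcClass, loopClass, Submodule.mkQ_apply, Submodule.liftQ_apply]
  simp [ψ₀, F, crossedGen]

end Crossed

/-- By the crossed rule, the loops with class in the span form a subgroup. It contains the
meridians, and also the curves, whose classes vanish. -/
theorem span_arcClass (C : Code g) :
    Submodule.span (LaurentPalette g) (Set.range (arcClass (C := C))) = ⊤ := by
  set S := Submodule.span (LaurentPalette g) (Set.range (arcClass (C := C))) with hS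
  have h1 : ∀ h : LinkGroup C, loopClass h ∈ S := by
    let H : Subgroup (LinkGroup C) :=
      { carrier := {h | loopClass h ∈ S}
        one_mem' := by
          change loopClass _ ∈ S
          rw [loopClass_one]
          exact S.zero_mem
        mul_mem' := fun {a b} ha hb => by
          change loopClass _ ∈ S
          rw [loopClass_mul]
          exact S.add_mem ha (S.smul_mem _ hb)
        inv_mem' := fun {a} ha => by
          change loopClass _ ∈ S
          rw [loopClass_inv]
          exact S.smul_mem _ ha }
    intro h
    refine PresentedGroup.generated_by _ H (fun x => ?_) h
    cases x with
    | inl a => exact Submodule.subset_span ⟨a, rfl⟩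
    | inr z =>
      change loopClass _ ∈ S
      rw [loopClass_curve]
      exact S.zero_mem
  rw [eq_top_iff]
  rintro m -
  obtain ⟨f, rfl⟩ := Submodule.mkQ_surjective _ m
  induction f using Finsupp.induction_linear with
  | zero => rw [map_zero]; exact S.zero_mem
  | add f f' hf hf' => rw [map_add]; exact S.add_mem hf hf'
  | single h r =>
    rw [show (Finsupp.single h r : LinkGroup C →₀ LaurentPalette g) = r • Finsupp.single h 1 by
      simp, map_smul]
    exact S.smul_mem _ (h1 h)

/-- The zeroth ideal of the Alexander module is principal. -/
theorem zerothIdeal_alexanderModule {C : Code g} (hC : C.WellFormed) :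
    zerothIdeal (LaurentPalette g) (AlexanderModule C) =
      Ideal.span {codeDet (uVar g)⁻¹ zVar C} := by
  classical
  let τ : (LaurentPalette g)ˣ := (uVar g)⁻¹
  -- A component is sent to its initial arc and a label to the arc that enters the over-passage with
  -- this label; the values `0` concern only names that do not occur.
  let ev : ((ℕ ⊕ ℕ) →₀ LaurentPalette g) →ₗ[LaurentPalette g] AlexanderModule C :=
    Finsupp.linearCombination _ fun x =>
      match x with
      | .inl j => if h : j < C.length then arcClass ⟨⟨j, h⟩, ⟨0, by simp⟩⟩ else 0
      | .inr c => if h : ∃ (o : Arc C) (ε : Bool), o.letter = some (.over c ε) then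
          arcClass h.choose else 0
  have hev_over : ∀ (o : Arc C) c ε, o.letter = some (.over c ε) →
      ev (overGen _ ℕ c) = arcClass o := by
    intro o c ε h
    have hex : ∃ (o : Arc C) (ε : Bool), o.letter = some (.over c ε) := ⟨o, ε, h⟩
    simp only [ev, Finsupp.linearCombination_single, one_smul, dif_pos hex]
    obtain ⟨ε', h'⟩ := hex.choose_spec
    rw [hC.over_unique h' h]
  -- The action of letters on vectors corresponds to the succession of meridian classes. An
  -- under-passage needs its over-passage to exist in the code, which is the second condition in
  -- `WellFormed`.
  have hstep : ∀ (a : Arc C) ℓ, a.letter = some ℓ → ∀ u, ev u = arcClass a →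
      ev (ℓ.act τ zVar u) = arcClass a.succ := by
    intro a ℓ h u hu
    rcases ℓ with ⟨c, ε⟩ | ⟨c, ε⟩ | ⟨z, ε⟩
    · rw [arcClass_succ_over h, ← hu]
      rfl
    · obtain ⟨w', hw', h'⟩ := hC.exists_over _ (List.get_mem C a.1) c ε (List.mem_of_getElem? h)
      obtain ⟨j, hj, rfl⟩ := List.getElem_of_mem hw'
      obtain ⟨i, hi, h'⟩ := List.getElem_of_mem h'
      have ho : Arc.letter (⟨⟨j, hj⟩, ⟨i, lt_max_of_lt_right hi⟩⟩ : Arc C) =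
          some (.over c ε) := by
        simp only [Arc.letter]
        rw [List.getElem?_eq_some_iff]
        exact ⟨hi, h'⟩
      rw [arcClass_succ_under h ho, ← hev_over _ c ε ho, ← hu]
      simp only [Letter.act, map_add, map_smul]
      rfl
    · rw [arcClass_succ_omega h, ← hu]
      simp [Letter.act]
  have hev_arc : ∀ a : Arc C, ev (arcVec τ zVar a) = arcClass a := by
    rintro ⟨j, i, hi⟩
    induction i with
    | zero =>
      simp [arcVec, ev]
    | succ i ih =>
      have hlt : i + 1 < (C.get j).length := by
        rcases lt_max_iff.1 hi with h | h
        · omega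
        · exact h
      have hl : Arc.letter (⟨j, ⟨i, by omega⟩⟩ : Arc C) = some ((C.get j)[i]) := by
        simp only [Arc.letter]
        rw [List.getElem?_eq_getElem]
      have hs : Arc.succ (⟨j, ⟨i, by omega⟩⟩ : Arc C) = ⟨j, ⟨i + 1, hi⟩⟩ := by
        simp only [Arc.succ]
        congr 2
        exact Nat.mod_eq_of_lt hi
      rw [← hs, ← hstep _ _ hl _ (ih (by omega)), hs]
      exact congrArg ev (transport_take_succ τ zVar (List.getElem?_eq_getElem _) _)
  have hrel : ∀ c ∈ C.named, ∀ r ∈ componentRels τ zVar c, ev r = 0 := by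
    rintro ⟨b, w⟩ hc r hr
    have hc : C[b]? = some w := Code.mem_named.1 hc
    obtain ⟨hb, rfl⟩ := List.getElem?_eq_some_iff.1 hc
    rw [componentRels, List.mem_cons] at hr
    rcases hr with rfl | hr
    · rcases Nat.eq_zero_or_pos (C[b]).length with h0 | h0
      · rw [List.length_eq_zero_iff] at h0
        simp only [h0, transport_nil, sub_self, map_zero]
      · obtain ⟨n, hn⟩ : ∃ n, (C[b]).length = n + 1 := ⟨(C[b]).length - 1, by omega⟩
        have hl : Arc.letter (⟨⟨b, hb⟩, ⟨n, lt_max_of_lt_right (by simp; omega)⟩⟩ : Arc C) =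
            some ((C[b])[n]) := by
          simp only [Arc.letter]
          exact List.getElem?_eq_getElem _
        have hs : Arc.succ (⟨⟨b, hb⟩, ⟨n, lt_max_of_lt_right (by simp; omega)⟩⟩ : Arc C) =
            ⟨⟨b, hb⟩, ⟨0, by simp⟩⟩ := by
          simp only [Arc.succ]
          congr 2
          simp [hn]
        have h1 := hstep _ _ hl _ (hev_arc _)
        rw [hs] at h1
        have h2 := transport_take_succ τ zVar (w := C[b]) (i := n)
          (List.getElem?_eq_getElem (by omega)) (base (LaurentPalette g) b)
        rw [← hn, List.take_length] at h2
        rw [map_sub, h2, sub_eq_zero]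
        refine Eq.trans ?_ h1.symm
        simpa [arcVec] using hev_arc ⟨⟨b, hb⟩, ⟨0, by simp⟩⟩
    · obtain ⟨i, c, ε, h, rfl⟩ := (mem_overRels_iff τ zVar).1 hr
      have hi := (List.getElem?_eq_some_iff.1 h).1
      have hl : Arc.letter (⟨⟨b, hb⟩, ⟨i, lt_max_of_lt_right hi⟩⟩ : Arc C) =
          some (.over c ε) := h
      rw [map_sub, hev_over _ c ε hl, sub_eq_zero]
      exact (hev_arc _).symm
  have hsupp : ∀ r ∈ C.named.flatMap (componentRels τ zVar),
      r ∈ Finsupp.supported (LaurentPalette g) (LaurentPalette g)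
        {x | x ∈ systemGens C.named} := by
    intro r hr
    obtain ⟨⟨b, w⟩, hc, hr⟩ := List.mem_flatMap.1 hr
    have hc : C[b]? = some w := Code.mem_named.1 hc
    obtain ⟨hb, rfl⟩ := List.getElem?_eq_some_iff.1 hc
    have h1 : base (LaurentPalette g) b ∈ Finsupp.supported (LaurentPalette g)
        (LaurentPalette g) {x | x ∈ systemGens C.named} :=
      Finsupp.single_mem_supported _ _ (Code.inl_mem_systemGens hb)
    have h2 : ∀ c ∈ crossLabels C[b], overGen (LaurentPalette g) ℕ c ∈
        Finsupp.supported (LaurentPalette g) (LaurentPalette g) {x | x ∈ systemGens C.named} :=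
      fun c hc => Finsupp.single_mem_supported _ _ (hC.crossLabels_mem (List.getElem_mem hb) hc)
    rw [componentRels, List.mem_cons] at hr
    rcases hr with rfl | hr
    · exact Submodule.sub_mem _ h1 (transport_mem τ zVar _ h2 h1)
    · exact overRels_mem τ zVar _ h2 h1 hr
  refine zerothIdeal_eq_span_ldet (Code.nodup_systemGens hC)
    (length_systemRels τ zVar _) ev ?_ ?_ ?_ ?_
  · intro r hr x hx
    exact (Finsupp.mem_supported _ _).1 (hsupp r hr) hx
  · rw [eq_top_iff, ← span_arcClass C]
    refine Submodule.span_le.2 ?_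
    rintro _ ⟨a, rfl⟩
    rw [← hev_arc a]
    have h1 := arcVec_mem τ zVar hC a
    rw [Finsupp.supported_eq_span_single] at h1
    have h2 := Submodule.mem_map_of_mem (f := ev) h1
    rw [Submodule.map_span] at h2
    refine Submodule.span_mono ?_ h2
    rintro _ ⟨_, ⟨x, hx, rfl⟩, rfl⟩
    exact ⟨x, hx, rfl⟩
  · intro r hr
    obtain ⟨c, hc, hr⟩ := List.mem_flatMap.1 hr
    exact hrel c hc r hr
  · intro u hu hev
    let S := Submodule.span (LaurentPalette g)
      {r | r ∈ C.named.flatMap (componentRels τ zVar)}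
    have hf : ∀ c ∈ C.named, ∀ r ∈ componentRels τ zVar c, S.mkQ r = 0 := by
      intro c hc r hr
      rw [Submodule.mkQ_apply, Submodule.Quotient.mk_eq_zero]
      exact Submodule.subset_span (List.mem_flatMap.2 ⟨c, hc, hr⟩)
    -- Modulo the relations, the arc vectors satisfy the conditions for a map out of the Alexander
    -- module. This map undoes `ev` on generators, so the kernel of `ev` on vectors in these
    -- generators consists of combinations of relations only.
    obtain ⟨ψ, hψ⟩ := exists_linearMap_alexanderModule (fun a : Arc C => S.mkQ (arcVec τ zVar a))
      (fun a c ε h => apply_arcVec_succ τ zVar S.mkQ hf h)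
      (fun a o c ε h ho => by
        rw [apply_arcVec_succ τ zVar S.mkQ hf h, ← apply_overGen τ zVar S.mkQ hf ho]
        simp only [Letter.act, map_add, map_smul]
        rfl)
      (fun a z ε h => by
        rw [apply_arcVec_succ τ zVar S.mkQ hf h]
        simp only [Letter.act, map_smul])
    have hid : ∀ x ∈ systemGens C.named, ψ (ev (Finsupp.single x 1)) =
        S.mkQ (Finsupp.single x 1) := by
      rintro (j | c) hx
      · have hj : j < C.length := by
          rw [inl_mem_systemGens, Code.named, map_fst_swap_zipIdx] at hx
          simpa using hx
        have h1 : arcVec τ zVar (⟨⟨j, hj⟩, ⟨0, by simp⟩⟩ : Arc C) = base _ j := by simp [arcVec]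
        change ψ (ev (base _ j)) = S.mkQ (base _ j)
        rw [← h1, hev_arc, hψ]
      · obtain ⟨w, hw, hc⟩ := Code.inr_mem_systemGens.1 hx
        obtain ⟨ε, hc⟩ := mem_overLabels_iff.1 hc
        obtain ⟨j, hj, rfl⟩ := List.getElem_of_mem hw
        obtain ⟨i, hi, h'⟩ := List.getElem_of_mem hc
        have ho : Arc.letter (⟨⟨j, hj⟩, ⟨i, lt_max_of_lt_right hi⟩⟩ : Arc C) =
            some (.over c ε) := by
          simp only [Arc.letter]
          rw [List.getElem?_eq_some_iff]
          exact ⟨hi, h'⟩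
        rw [hev_over _ c ε ho, hψ, apply_overGen τ zVar S.mkQ hf ho]
    have hall : ψ (ev u) = S.mkQ u := by
      have h1 : u ∈ Finsupp.supported (LaurentPalette g) (LaurentPalette g)
          {x | x ∈ systemGens C.named} := (Finsupp.mem_supported _ _).2 fun x hx => hu x hx
      rw [Finsupp.supported_eq_span_single] at h1
      clear hu hev
      induction h1 using Submodule.span_induction with
      | mem x hx =>
        obtain ⟨y, hy, rfl⟩ := hx
        exact hid y hy
      | zero => simp
      | add x y _ _ hx hy => rw [map_add, map_add, map_add, hx, hy]
      | smul a x _ hx => rw [map_smul, map_smul, map_smul, hx]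
    rw [hev, map_zero] at hall
    exact (Submodule.Quotient.mk_eq_zero S).1 hall.symm

end Presentation

end PrismaticLink

namespace PrismaticLink

/-! ### Amplitudes -/

section Amplitude

variable {K : Type*} [CommRing K] {E : Type*} [AddCommGroup E] [Module K E]

/-- What a point on a horizontal line contributes: nothing, the last arc of an upward strand, or
the first arc of a downward one. -/
inductive Col (E : Type*)
  | omega
  | up (x : E)
  | down (y : E)

/-- Apply a map to the vector of a column. -/
def Col.map {E' : Type*} (φ : E → E') : Col E → Col E'
  | .omega => .omega
  | .up x => .up (φ x)
  | .down y => .down (φ y)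

/-- The vector of a column, if there is one, lies in `S`. -/
def Col.In (S : Set E) : Col E → Prop
  | .omega => True
  | .up x => x ∈ S
  | .down y => y ∈ S

/-- The number of upward strands minus the number of downward ones. -/
def charge : List (Col E) → ℤ
  | [] => 0
  | .omega :: L => charge L
  | .up _ :: L => 1 + charge L
  | .down _ :: L => -1 + charge L

/-- The number of downward strands. -/
def downs : List (Col E) → ℕ
  | [] => 0
  | .omega :: L => downs L
  | .up _ :: L => downs L
  | .down _ :: L => downs L + 1

/-- The number of odd basis vectors. -/
def odds (s : List Bool) : ℕ := s.count true

/-- The coefficient at a tensor of basis vectors of the vector that is associated with an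
alternating function. An upward strand is selected if it carries the odd basis vector, a downward
one if it carries the even basis vector. -/
noncomputable def amp (q : Kˣ) (F : List E → K) (h : ℤ) (a : ℕ) : List (Col E) → List Bool → K
  | [], [] => F []
  | [], _ :: _ => 0
  | _ :: _, [] => 0
  | .omega :: L, b :: s => if b then 0 else amp q F h a L s
  | .up x :: L, b :: s =>
    if b then amp q (fun X => F (-((q ^ h : Kˣ) : K) • x :: X)) (h + 1) (a + 1) L s
    else amp q F (h + 1) a L s
  | .down y :: L, b :: s =>
    if b then (-1) ^ a * amp q F (h - 1) (a + 1) L s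
    else (-1) ^ a * amp q (fun X => F (((q ^ (h - 1) : Kˣ) : K) • y :: X)) (h - 1) a L s

variable {q : Kˣ}

theorem amp_mul (c : K) (F : List E → K) (h : ℤ) (a : ℕ) (L : List (Col E)) (s : List Bool) :
    amp q (fun X => c * F X) h a L s = c * amp q F h a L s := by
  induction L generalizing s F h a with
  | nil => cases s <;> simp [amp]
  | cons p L ih =>
    cases s with
    | nil => simp [amp]
    | cons b s => cases p <;> cases b <;> simp [amp, ih, mul_left_comm]

theorem amp_add (F F' : List E → K) (h : ℤ) (a : ℕ) (L : List (Col E)) (s : List Bool) :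
    amp q (fun X => F X + F' X) h a L s = amp q F h a L s + amp q F' h a L s := by
  induction L generalizing s F F' h a with
  | nil => cases s <;> simp [amp]
  | cons p L ih =>
    cases s with
    | nil => simp [amp]
    | cons b s => cases p <;> cases b <;> simp [amp, ih, mul_add]

theorem amp_zero (h : ℤ) (a : ℕ) (L : List (Col E)) (s : List Bool) :
    amp q (fun _ => 0) h a L s = 0 := by
  simpa using amp_mul (q := q) (0 : K) (fun _ : List E => 0) h a L s

/-- The counter `a` enters only through signs. Hence two odd vectors on strands that meet at a piece
are invisible to what lies further to the right. -/
theorem amp_add_two (F : List E → K) (h : ℤ) (a : ℕ) (L : List (Col E)) (s : List Bool) :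
    amp q F h (a + 2) L s = amp q F h a L s := by
  induction L generalizing s F h a with
  | nil => cases s <;> simp [amp]
  | cons p L ih =>
    cases s with
    | nil => simp [amp]
    | cons b s =>
      cases p <;> cases b <;> simp [amp, ih, add_right_comm a 2 1, pow_add]

theorem amp_map {E' : Type*} [AddCommGroup E'] [Module K E'] (φ : E →ₗ[K] E')
    (F : List E' → K) (h : ℤ) (a : ℕ) (L : List (Col E)) (s : List Bool) :
    amp q (fun X => F (X.map φ)) h a L s = amp q F h a (L.map (Col.map φ)) s := by
  induction L generalizing s F h a with
  | nil => cases s <;> simp [amp]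
  | cons p L ih =>
    cases s with
    | nil => cases p <;> simp [amp, Col.map]
    | cons b s =>
      have h1 := fun x => ih (fun X => F (x :: X))
      cases p <;> cases b <;> simp [amp, Col.map, ih, h1]

theorem amp_eq_zero_of_length (F : List E → K) (h : ℤ) (a : ℕ) {L : List (Col E)} {s : List Bool}
    (hl : s.length ≠ L.length) : amp q F h a L s = 0 := by
  induction L generalizing s F h a with
  | nil => cases s <;> simp_all [amp]
  | cons p L ih =>
    cases s with
    | nil => simp [amp]
    | cons b s =>
      have h1 := fun F h a => ih F h a (s := s) (by simpa using hl)
      cases p <;> cases b <;> simp [amp, h1]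

/-- This is for cups, where the enlarged form is compared with the old one only on vectors that do
not involve the new generator. -/
theorem amp_congr {S : Submodule K E} {F F' : List E → K}
    (hF : ∀ X : List E, (∀ x ∈ X, x ∈ S) → F X = F' X) (h : ℤ) (a : ℕ) {L : List (Col E)}
    (hL : ∀ p ∈ L, p.In S) (s : List Bool) : amp q F h a L s = amp q F' h a L s := by
  induction L generalizing s F F' h a with
  | nil => cases s <;> simp [amp, hF]
  | cons p L ih =>
    cases s with
    | nil => simp [amp]
    | cons b s =>
      obtain ⟨hp, hL'⟩ := List.forall_mem_cons.1 hL
      have h1 : ∀ x ∈ S, ∀ X : List E, (∀ x ∈ X, x ∈ S) → F (x :: X) = F' (x :: X) :=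
        fun x hx X hX => hF _ (List.forall_mem_cons.2 ⟨hx, hX⟩)
      rcases p with _ | x | y
      · simp only [amp, ih hF h a hL' s]
      · simp only [amp, ih hF _ _ hL' s, ih (h1 _ (S.smul_mem _ hp)) _ _ hL' s]
      · simp only [amp, ih hF _ _ hL' s, ih (h1 _ (S.smul_mem _ hp)) _ _ hL' s]

/-- Splitting off the strands on the left. -/
theorem exists_amp_append (h : ℤ) (a : ℕ) (L : List (Col E)) (s : List Bool)
    (hs : s.length = L.length) : ∃ (c : K) (X₀ : List E),
      (c = 0 ∨ (-1 : K) ^ X₀.length = (-1) ^ (odds s) * (-1) ^ (downs L)) ∧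
      (∀ S : Submodule K E, (∀ p ∈ L, p.In S) → ∀ x ∈ X₀, x ∈ S) ∧
      ∀ (F : List E → K) M t, amp q F h a (L ++ M) (s ++ t) =
        c * amp q (fun X => F (X₀ ++ X)) (h + charge L) (a + odds s) M t := by
  induction L generalizing s h a with
  | nil =>
    rw [List.length_nil, List.length_eq_zero_iff] at hs
    subst hs
    exact ⟨1, [], Or.inr (by simp [odds, downs]), by simp, fun F M t => by simp [charge, odds]⟩
  | cons p L ih =>
    cases s with
    | nil => simp at hs
    | cons b s =>
      replace hs : s.length = L.length := by simpa using hs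
      rcases p with _ | x | y
      · obtain ⟨c, X₀, hX, hS, hF⟩ := ih h a s hs
        cases b
        · exact ⟨c, X₀, by simpa [odds, downs] using hX, fun S hL => hS S (List.forall_mem_cons.1 hL).2,
            fun F M t => by
            simp [amp, hF, charge, odds]⟩
        -- An odd vector on an `Ω`-strand makes the amplitude vanish. The parity of `X₀` then
        -- carries no information, hence the alternative `c = 0` in the statement.
        · exact ⟨0, [], Or.inl rfl, by simp, fun F M t => by simp [amp]⟩
      · cases b
        · obtain ⟨c, X₀, hX, hS, hF⟩ := ih (h + 1) a s hs
          exact ⟨c, X₀, by simpa [odds, downs] using hX, fun S hL => hS S (List.forall_mem_cons.1 hL).2,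
            fun F M t => by
            simp [amp, hF, charge, odds, add_assoc]⟩
        · obtain ⟨c, X₀, hX, hS, hF⟩ := ih (h + 1) (a + 1) s hs
          refine ⟨c, (-((q ^ h : Kˣ) : K) • x) :: X₀, ?_, fun S hL =>
            List.forall_mem_cons.2 ⟨S.smul_mem _ (List.forall_mem_cons.1 hL).1,
              hS S (List.forall_mem_cons.1 hL).2⟩, fun F M t => ?_⟩
          · refine hX.imp id fun hX => ?_
            simp only [odds, downs, List.length_cons, List.count_cons_self, pow_succ] at hX ⊢
            rw [hX]
            ring
          · simp only [List.cons_append, amp, if_true, hF, charge, odds, List.count_cons_self]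
            congr 2
            · ring
            · ring
      · cases b
        · obtain ⟨c, X₀, hX, hS, hF⟩ := ih (h - 1) a s hs
          refine ⟨(-1) ^ a * c, (((q ^ (h - 1) : Kˣ) : K) • y) :: X₀, ?_, fun S hL =>
            List.forall_mem_cons.2 ⟨S.smul_mem _ (List.forall_mem_cons.1 hL).1,
              hS S (List.forall_mem_cons.1 hL).2⟩, fun F M t => ?_⟩
          · refine hX.imp (fun h => by simp [h]) fun hX => ?_
            simp only [odds, downs, List.length_cons, pow_succ] at hX ⊢
            rw [hX]
            simp
          · simp only [List.cons_append, amp, Bool.false_eq_true, if_false, hF, charge, odds,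
              mul_assoc, List.count_cons_of_ne (show false ≠ true by simp)]
            congr 3
            ring
        · obtain ⟨c, X₀, hX, hS, hF⟩ := ih (h - 1) (a + 1) s hs
          refine ⟨(-1) ^ a * c, X₀, ?_, fun S hL => hS S (List.forall_mem_cons.1 hL).2,
            fun F M t => ?_⟩
          · refine hX.imp (fun h => by simp [h]) fun hX => ?_
            simp only [odds, downs, List.count_cons_self, pow_succ] at hX ⊢
            rw [hX]
            ring
          · simp only [List.cons_append, amp, if_true, hF, charge, odds, List.count_cons_self,
              mul_assoc]
            congr 3
            · ring
            · ring

end Amplitude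

/-! ### Coefficients of the linear map of a layer -/

section Layer

variable {K : Type*} [CommRing K] {g : ℕ} {q : Kˣ} {z : Palette g → Kˣ}

theorem sum_list_sum {ι α : Type*} (S : Finset ι) (l : List α) (f : ι → α → K) :
    ∑ s ∈ S, (l.map (f s)).sum = (l.map fun x => ∑ s ∈ S, f s x).sum := by
  induction l with
  | nil => simp
  | cons x l ih => simp [Finset.sum_add_distrib, ih]

/-- `pre` is a row of the matrix of `P`: the inputs from which `t` arises, with coefficients. The
condition `hv` excludes tensors with fewer than `n` factors, for which `take` and `drop` would not
cut at the position of the piece. -/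
theorem layer_eval_apply {n : ℕ} {P : Piece g} {v : List Bool →₀ K}
    (hv : ∀ s, s.length < n → v s = 0) {sl t : List Bool} (hn : sl.length = n)
    (pre : List (List Bool × K))
    (hpre : ∀ r, P.eval q z r t = (pre.map fun x => if r = x.1 then x.2 else 0).sum) :
    Layer.eval q z (n, P) v (sl ++ t) = (pre.map fun x => x.2 * v (sl ++ x.1)).sum := by
  subst hn
  rw [Layer.eval, Finsupp.linearCombination_apply, Finsupp.sum, Finsupp.finsetSum_apply]
  have key : ∀ s ∈ v.support, (v s • Finsupp.mapDomain (fun r => s.take sl.length ++ r)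
      (P.eval q z (s.drop sl.length))) (sl ++ t) =
      (pre.map fun x => if s = sl ++ x.1 then v s * x.2 else 0).sum := by
    intro s hs
    have hlen : sl.length ≤ s.length := by
      by_contra h
      exact Finsupp.mem_support_iff.1 hs (hv s (by omega))
    have htake : (s.take sl.length).length = sl.length := by simpa using hlen
    have hiff : ∀ x : List Bool, s = sl ++ x ↔ s.take sl.length = sl ∧ s.drop sl.length = x := by
      intro x
      constructor
      · rintro rfl
        simp
      · rintro ⟨h, rfl⟩
        conv_lhs => rw [← List.take_append_drop sl.length s, h]
    rw [Finsupp.smul_apply, smul_eq_mul]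
    by_cases h : s.take sl.length = sl
    · simp only [h, hiff, true_and]
      rw [Finsupp.mapDomain_apply (fun a b hab => List.append_cancel_left hab), hpre,
        ← List.sum_map_mul_left]
      simp [mul_ite]
    · simp only [hiff, h, false_and, if_false, List.map_const', List.sum_replicate, smul_zero]
      rw [Finsupp.mapDomain_of_notMem_range, mul_zero]
      rintro ⟨r, hr⟩
      exact h (List.append_inj_left hr htake)
  rw [Finset.sum_congr rfl key, sum_list_sum]
  congr 1
  refine List.map_congr_left fun x _ => ?_
  rw [Finset.sum_ite_eq']
  split_ifs with h
  · ring
  · rw [Finsupp.notMem_support_iff.1 h, mul_zero]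

theorem layer_eval_apply_of_length_lt {n : ℕ} {P : Piece g} {v : List Bool →₀ K}
    (hv : ∀ s, s.length < n → v s = 0) {s : List Bool} (hs : s.length < n) :
    Layer.eval q z (n, P) v s = 0 := by
  rw [Layer.eval, Finsupp.linearCombination_apply, Finsupp.sum, Finsupp.finsetSum_apply]
  refine Finset.sum_eq_zero fun r hr => ?_
  rw [Finsupp.smul_apply, Finsupp.mapDomain_of_notMem_range, smul_zero]
  rintro ⟨t, rfl⟩
  refine Finsupp.mem_support_iff.1 hr (hv r ?_)
  simp only [List.length_append, List.length_take] at hs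
  omega

variable {E : Type*} [AddCommGroup E] [Module K E]

/-- A layer acts on amplitudes as it does on those of the strands to the right of its left end. -/
theorem layer_eval_amp {P : Piece g} {v : List Bool →₀ K} {F F' : List E → K}
    {L M M' : List (Col E)} {κ : K} (hv : ∀ s, v s = amp q F 0 0 (L ++ M) s)
    (hloc : ∀ t, ∃ pre : List (List Bool × K),
      (∀ r, P.eval q z r t = (pre.map fun x => if r = x.1 then x.2 else 0).sum) ∧
      ∀ (X₀ : List E) (a : ℕ), (-1 : K) ^ X₀.length = (-1) ^ a * (-1) ^ (downs L) →
        (∀ S : Submodule K E, (∀ p ∈ L, p.In S) → ∀ x ∈ X₀, x ∈ S) →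
        (pre.map fun x => x.2 * amp q (fun X => F (X₀ ++ X)) (charge L) a M x.1).sum =
          κ * amp q (fun X => F' (X₀ ++ X)) (charge L) a M' t)
    (s : List Bool) :
    Layer.eval q z (L.length, P) v s = κ * amp q F' 0 0 (L ++ M') s := by
  have hv0 : ∀ s : List Bool, s.length < L.length → v s = 0 := fun s hs => by
    rw [hv, amp_eq_zero_of_length]
    simp only [List.length_append]
    omega
  rcases lt_or_ge s.length L.length with hs | hs
  · rw [layer_eval_apply_of_length_lt hv0 hs, amp_eq_zero_of_length, mul_zero]
    simp only [List.length_append]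
    omega
  · obtain ⟨sl, t, rfl, hsl⟩ : ∃ sl t, s = sl ++ t ∧ sl.length = L.length :=
      ⟨s.take L.length, s.drop L.length, by simp, by simpa using hs⟩
    -- The strands on the left enter only through the vectors `X₀` they select, the charge and the
    -- parity of their odd vectors. The parity of `X₀` is tied to the other data, which makes the
    -- scalar of a cap or cup independent of the basis tensor.
    obtain ⟨c, X₀, hX, hS, hF⟩ := exists_amp_append (q := q) 0 0 L sl hsl
    simp only [zero_add] at hF
    obtain ⟨pre, hpre, hsum⟩ := hloc t
    rcases hX with rfl | hX
    · rw [layer_eval_apply hv0 hsl pre hpre, hF]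
      simp [hv, hF]
    · rw [layer_eval_apply hv0 hsl pre hpre, hF]
      simp only [hv, hF, mul_left_comm _ c]
      rw [List.sum_map_mul_left, hsum X₀ (odds sl) hX hS, mul_left_comm]

end Layer

end PrismaticLink

namespace PrismaticLink

set_option linter.unusedSimpArgs false

/-! ### The effect of each elementary tangle on amplitudes. -/

section LocalMoves

variable {K : Type*} [CommRing K] {g : ℕ} {q : Kˣ} {z : Palette g → Kˣ}
  {E : Type*} [AddCommGroup E] [Module K E] {v : List Bool →₀ K} {F : List E → K}
  {L R : List (Col E)}

theorem amp_neg (F : List E → K) (h : ℤ) (a : ℕ) (L : List (Col E)) (s : List Bool) :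
    amp q (fun X => -F X) h a L s = -amp q F h a L s := by
  simpa using amp_mul (q := q) (-1 : K) F h a L s

/-- The coefficients of a crossing that are needed at a given tensor of basis vectors. -/
theorem crossing_pre {P : Piece g} {w : Bool → Bool → List (Bool × Bool × K)}
    (hnil : ∀ r, P.eval q z r [] = 0) (hone : ∀ r b, P.eval q z r [b] = 0)
    (hw : ∀ r b b' t, P.eval q z r (b :: b' :: t) =
      ((w b b').map fun x => if r = x.1 :: x.2.1 :: t then x.2.2 else 0).sum)
    {F F' : List E → K} {L R : List (Col E)} {p₁ p₂ p₃ p₄ : Col E} {κ : K}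
    (hv : ∀ s, v s = amp q F 0 0 (L ++ p₁ :: p₂ :: R) s)
    (hloc : ∀ (X₀ : List E) (a : ℕ) b b' t,
      ((w b b').map fun x => x.2.2 *
        amp q (fun X => F (X₀ ++ X)) (charge L) a (p₁ :: p₂ :: R) (x.1 :: x.2.1 :: t)).sum =
      κ * amp q (fun X => F' (X₀ ++ X)) (charge L) a (p₃ :: p₄ :: R) (b :: b' :: t))
    (s : List Bool) :
    Layer.eval q z (L.length, P) v s = κ * amp q F' 0 0 (L ++ p₃ :: p₄ :: R) s := by
  refine layer_eval_amp hv (fun t => ?_) s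
  rcases t with _ | ⟨b, _ | ⟨b', t⟩⟩
  · exact ⟨[], by simp [hnil], fun X₀ a _ _ => by cases p₃ <;> simp [amp]⟩
  · exact ⟨[], by simp [hone], fun X₀ a _ _ => by
      rw [amp_eq_zero_of_length _ _ _ (by simp)]; simp⟩
  · exact ⟨(w b b').map fun x => (x.1 :: x.2.1 :: t, x.2.2), fun r => by
      rw [hw, List.map_map]; rfl, fun X₀ a _ _ => by
      rw [← hloc, List.map_map]; rfl⟩

/-- A crossing of two upward `α`-strands which preserves the number of odd basis vectors. -/
theorem layer_eval_crossing {P : Piece g} {A B C D G κ α β γ δ : K}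
    (hnil : ∀ r, P.eval q z r [] = 0) (hone : ∀ r b, P.eval q z r [b] = 0)
    (hw : ∀ r b b' t, P.eval q z r (b :: b' :: t) = (((match b, b' with
      | false, false => [(false, false, κ)]
      | true, false => [(false, true, A), (true, false, B)]
      | false, true => [(false, true, C), (true, false, D)]
      | true, true => [(true, true, G)]) : List (Bool × Bool × K)).map
        fun x => if r = x.1 :: x.2.1 :: t then x.2.2 else 0).sum)
    (hA : A * q = κ * α) (hB : B = κ * β) (hC : C = κ * δ) (hD : D = κ * q * γ)
    (hG : G = κ * (β * δ - α * γ)) (hF : IsAlternating F) {x x' : E}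
    (hv : ∀ s, v s = amp q F 0 0 (L ++ .up x :: .up x' :: R) s) (s : List Bool) :
    Layer.eval q z (L.length, P) v s =
      κ * amp q F 0 0 (L ++ .up (α • x' + β • x) :: .up (γ • x + δ • x') :: R) s := by
  -- On no odd vector the crossing is `κ`, on one it is a two by two matrix, and on two it is `κ`
  -- times a determinant up to sign, by `hG`. As `F` is alternating, this is the exterior power of a
  -- substitution for the two strands. The extra `q` in `hA` and `hD` compensates the weight `q ^ h`
  -- of `amp`, which grows by one factor across an upward strand.
  refine crossing_pre (w := fun b b' => match b, b' with
      | false, false => [(false, false, κ)]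
      | true, false => [(false, true, A), (true, false, B)]
      | false, true => [(false, true, C), (true, false, D)]
      | true, true => [(true, true, G)]) hnil hone hw hv ?_ s
  intro X₀ a b b' t
  have h0 := fun A x x' => hF.add X₀ A x x'
  have h1 := fun A x => hF.self X₀ A x
  have h2 := fun A x (c : K) y => hF.smul (X₀ ++ [y]) A c x
  have h3 := fun A x x' y => hF.add (X₀ ++ [y]) A x x'
  have h4 := fun A => hF.swap X₀ A x' x
  have h5 := fun c X => hF.smul X₀ X c
  simp only [List.append_assoc, List.cons_append, List.nil_append] at h2 h3
  cases b <;> cases b' <;>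
    simp only [amp, zpow_add_one, smul_add, smul_smul, if_true, if_false, h5, h0, h1, h2, h3, h4,
      amp_mul, amp_add, amp_add_two, amp_zero, amp_neg, List.map, List.sum_cons, List.sum_nil,
      Units.val_mul, Bool.false_eq_true, mul_zero, add_zero, zero_add, add_assoc,
      one_add_one_eq_two]
  · subst hC hD
    ring
  · subst hB
    linear_combination (-((q ^ charge L : Kˣ) : K) *
      amp q (fun X => F (X₀ ++ x' :: X)) (charge L + 2) (a + 1) R t) * hA
  · subst hG
    ring

/-- The R-matrix is `q⁻¹` times the exterior power of a Burau matrix with parameter `q²`: the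
over-strand `x` continues to the right, and the under-strand becomes `q² x' + (1 - q²) x`. This is
the origin of `τ = q²`. -/
theorem layer_eval_pos (hF : IsAlternating F) {x x' : E}
    (hv : ∀ s, v s = amp q F 0 0 (L ++ .up x :: .up x' :: R) s) (s : List Bool) :
    Layer.eval q z (L.length, .pos) v s = ((q⁻¹ : Kˣ) : K) * amp q F 0 0
      (L ++ .up (((q ^ 2 : Kˣ) : K) • x' + (1 - ((q ^ 2 : Kˣ) : K)) • x) :: .up x :: R) s := by
  have hq : (q : K) * ((q⁻¹ : Kˣ) : K) = 1 := q.mul_inv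
  have := layer_eval_crossing (P := .pos) (z := z) (q := q) (A := 1) (B := ((q⁻¹ : Kˣ) : K) - q)
    (C := 0) (D := 1) (G := -q) (κ := ((q⁻¹ : Kˣ) : K)) (α := ((q ^ 2 : Kˣ) : K))
    (β := 1 - ((q ^ 2 : Kˣ) : K)) (γ := 1) (δ := 0) ?_ ?_ ?_ ?_ ?_ ?_ ?_ ?_ hF hv s
  · simpa using this
  · rintro (_ | ⟨_ | _, _ | ⟨_ | _, r⟩⟩) <;> simp [Piece.eval]
  · rintro (_ | ⟨_ | _, _ | ⟨_ | _, r⟩⟩) b <;> simp [Piece.eval]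
  · rintro r b b' t
    rcases r with (_ | ⟨_ | _, _ | ⟨_ | _, r⟩⟩) <;> rcases b with _ | _ <;> rcases b' with _ | _ <;>
      simp [Piece.eval, Finsupp.single_apply] <;> split_ifs <;> simp
  all_goals push_cast
  · linear_combination (-(q : K)) * hq
  · linear_combination (q : K) * hq
  · ring
  · linear_combination -hq
  · linear_combination (q : K) * hq

theorem layer_eval_neg (hF : IsAlternating F) {x x' : E}
    (hv : ∀ s, v s = amp q F 0 0 (L ++ .up x :: .up x' :: R) s) (s : List Bool) :
    Layer.eval q z (L.length, .neg) v s = (q : K) * amp q F 0 0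
      (L ++ .up x' :: .up ((((q ^ 2)⁻¹ : Kˣ) : K) • x + (1 - (((q ^ 2)⁻¹ : Kˣ) : K)) • x') :: R)
        s := by
  have hq : (q : K) * ((q⁻¹ : Kˣ) : K) = 1 := q.mul_inv
  have h2 : (((q ^ 2)⁻¹ : Kˣ) : K) = ((q⁻¹ : Kˣ) : K) ^ 2 := by
    rw [← inv_pow, Units.val_pow_eq_pow_val]
  rw [h2]
  have := layer_eval_crossing (P := .neg) (z := z) (q := q) (A := 1) (B := 0)
    (C := q - ((q⁻¹ : Kˣ) : K)) (D := 1) (G := -((q⁻¹ : Kˣ) : K)) (κ := (q : K)) (α := 1)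
    (β := 0) (γ := ((q⁻¹ : Kˣ) : K) ^ 2) (δ := 1 - ((q⁻¹ : Kˣ) : K) ^ 2)
    ?_ ?_ ?_ ?_ ?_ ?_ ?_ ?_ hF hv s
  · simpa using this
  · rintro (_ | ⟨_ | _, _ | ⟨_ | _, r⟩⟩) <;> simp [Piece.eval]
  · rintro (_ | ⟨_ | _, _ | ⟨_ | _, r⟩⟩) b <;> simp [Piece.eval]
  · rintro r b b' t
    rcases r with (_ | ⟨_ | _, _ | ⟨_ | _, r⟩⟩) <;> rcases b with _ | _ <;> rcases b' with _ | _ <;>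
      simp [Piece.eval, Finsupp.single_apply] <;> split_ifs <;> simp
  · ring
  · ring
  · linear_combination ((q⁻¹ : Kˣ) : K) * hq
  · linear_combination (-(q : K) * ((q⁻¹ : Kˣ) : K) - 1) * hq
  · linear_combination ((q⁻¹ : Kˣ) : K) * hq

/-- The powers of `q` in the virtual crossing are those by which the weight of a selected strand
changes when it is shifted past an upward strand. So the two columns merely change places. -/
theorem layer_eval_virt_none (hF : IsAlternating F) {x x' : E}
    (hv : ∀ s, v s = amp q F 0 0 (L ++ .up x :: .up x' :: R) s) (s : List Bool) :
    Layer.eval q z (L.length, .virt none none) v s =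
      amp q F 0 0 (L ++ .up x' :: .up x :: R) s := by
  have hq : (q : K) * ((q⁻¹ : Kˣ) : K) = 1 := q.mul_inv
  have := layer_eval_crossing (P := .virt none none) (z := z) (q := q) (A := ((q⁻¹ : Kˣ) : K))
    (B := 0) (C := 0) (D := q) (G := -1) (κ := 1) (α := 1) (β := 0) (γ := 1) (δ := 0)
    ?_ ?_ ?_ ?_ ?_ ?_ ?_ ?_ hF hv s
  · simpa using this
  · rintro (_ | ⟨_ | _, _ | ⟨_ | _, r⟩⟩) <;> simp [Piece.eval]
  · rintro (_ | ⟨_ | _, _ | ⟨_ | _, r⟩⟩) b <;> simp [Piece.eval]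
  · rintro r b b' t
    rcases r with (_ | ⟨_ | _, _ | ⟨_ | _, r⟩⟩) <;> rcases b with _ | _ <;> rcases b' with _ | _ <;>
      simp [Piece.eval, Finsupp.single_apply] <;> split_ifs <;> simp
  · linear_combination hq
  all_goals ring

/-- The column of an upward strand that is coloured `c`. -/
def Col.colored (c : Color g) (x : E) : Col E := if c = none then .up x else .omega

theorem layer_eval_virt {c d : Color g} (hF : IsAlternating F) {x x' : E}
    (hv : ∀ s, v s = amp q F 0 0 (L ++ .colored c x :: .colored d x' :: R) s) (s : List Bool) :
    Layer.eval q z (L.length, .virt c d) v s =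
      amp q F 0 0 (L ++ .colored d x' :: .colored c x :: R) s := by
  by_cases hcd : c = none ∧ d = none
  · obtain ⟨rfl, rfl⟩ := hcd
    simpa [Col.colored] using layer_eval_virt_none hF (by simpa [Col.colored] using hv) s
  · rw [← one_mul (amp _ _ _ _ _ _)]
    refine crossing_pre (w := fun b b' => [(b', b, 1)]) ?_ ?_ ?_ hv ?_ s
    · rintro (_ | ⟨_ | _, _ | ⟨_ | _, r⟩⟩) <;> rcases c with _ | c <;> rcases d with _ | d <;>
        simp_all [Piece.eval]
    · rintro (_ | ⟨_ | _, _ | ⟨_ | _, r⟩⟩) b <;> rcases c with _ | c <;> rcases d with _ | d <;>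
        simp_all [Piece.eval]
    · rintro r b b' t
      rcases r with (_ | ⟨_ | _, _ | ⟨_ | _, r⟩⟩) <;> rcases b with _ | _ <;>
        rcases b' with _ | _ <;> rcases c with _ | c <;> rcases d with _ | d <;>
        simp_all [Piece.eval, Finsupp.single_apply]
    · intro X₀ a b b' t
      rcases c with _ | c <;> rcases d with _ | d <;> cases b <;> cases b' <;>
        simp_all [Col.colored, amp]

/-- An upward strand contributes its vector precisely when it carries the odd basis vector, so a
factor on `e₂` is a factor on the arc. Here `ζ c = (z c)⁻¹` comes from. -/
theorem layer_eval_overPos (hF : IsAlternating F) {c : Palette g} {x : E}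
    (hv : ∀ s, v s = amp q F 0 0 (L ++ .omega :: .up x :: R) s) (s : List Bool) :
    Layer.eval q z (L.length, .overPos c) v s =
      amp q F 0 0 (L ++ .up ((((z c)⁻¹ : Kˣ) : K) • x) :: .omega :: R) s := by
  rw [← one_mul (amp _ _ _ _ _ _)]
  refine crossing_pre (w := fun b b' => [(b', b, if b then (((z c)⁻¹ : Kˣ) : K) else 1)])
    ?_ ?_ ?_ hv ?_ s
  · rintro (_ | ⟨_ | _, _ | ⟨_ | _, r⟩⟩) <;> simp [Piece.eval]
  · rintro (_ | ⟨_ | _, _ | ⟨_ | _, r⟩⟩) b <;> simp [Piece.eval]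
  · rintro r b b' t
    rcases r with (_ | ⟨_ | _, _ | ⟨_ | _, r⟩⟩) <;> rcases b with _ | _ <;> rcases b' with _ | _ <;>
      simp [Piece.eval, Finsupp.single_apply]
  · intro X₀ a b b' t
    cases b <;> cases b' <;> simp [amp, -neg_smul, hF.smul, amp_mul, amp_neg, mul_left_comm]

theorem layer_eval_overNeg (hF : IsAlternating F) {c : Palette g} {x : E}
    (hv : ∀ s, v s = amp q F 0 0 (L ++ .up x :: .omega :: R) s) (s : List Bool) :
    Layer.eval q z (L.length, .overNeg c) v s =
      amp q F 0 0 (L ++ .omega :: .up ((z c : K) • x) :: R) s := by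
  rw [← one_mul (amp _ _ _ _ _ _)]
  refine crossing_pre (w := fun b b' => [(b', b, if b' then (z c : K) else 1)])
    ?_ ?_ ?_ hv ?_ s
  · rintro (_ | ⟨_ | _, _ | ⟨_ | _, r⟩⟩) <;> simp [Piece.eval]
  · rintro (_ | ⟨_ | _, _ | ⟨_ | _, r⟩⟩) b <;> simp [Piece.eval]
  · rintro r b b' t
    rcases r with (_ | ⟨_ | _, _ | ⟨_ | _, r⟩⟩) <;> rcases b with _ | _ <;> rcases b' with _ | _ <;>
      simp [Piece.eval, Finsupp.single_apply]
  · intro X₀ a b b' t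
    cases b <;> cases b' <;> simp [amp, -neg_smul, hF.smul, amp_mul, amp_neg, mul_left_comm]

/-! #### Caps and cups -/

/-- Of the two surviving tensors one selects `y` and the other `x`, with opposite signs; by
linearity the cap inserts `y - x`, the relation that glues the ends. The scalar comes from moving it
past the vectors selected on the left and from its weight. -/
theorem layer_eval_capR (hF : IsAlternating F) {x y : E}
    (hv : ∀ s, v s = amp q F 0 0 (L ++ .down y :: .up x :: R) s) (s : List Bool) :
    Layer.eval q z (L.length, .capR none) v s =
      ((-1) ^ downs L * ((q ^ (charge L - 1) : Kˣ) : K)) *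
        amp q (fun X => F ((y - x) :: X)) 0 0 (L ++ R) s := by
  refine layer_eval_amp hv (fun t => ⟨[(false :: false :: t, 1), (true :: true :: t, 1)],
    fun r => ?_, fun X₀ a hX _ => ?_⟩) s
  · rcases r with (_ | ⟨_ | _, _ | ⟨_ | _, r⟩⟩) <;> simp [Piece.eval, Finsupp.single_apply]
  · have h1 := fun X => hF.move [] X₀ X (y - x)
    simp only [List.nil_append] at h1
    have h2 : ∀ X, F ((y - x) :: (X₀ ++ X)) =
        (-1) ^ X₀.length * (F (X₀ ++ y :: X) + (-1) * F (X₀ ++ x :: X)) := by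
      intro X
      rw [neg_one_mul, ← sub_eq_add_neg, ← hF.sub, h1, ← mul_assoc, ← mul_pow]
      simp
    have h3 : (-1 : K) ^ (downs L) * (-1) ^ X₀.length = (-1) ^ a := by
      rw [hX, mul_comm, mul_assoc, ← mul_pow]
      simp
    simp only [h2, amp_mul, amp_add]
    simp only [List.map, List.sum_cons, List.sum_nil, amp, if_true, if_false, Bool.false_eq_true,
      hF.smul, amp_mul, add_assoc, one_add_one_eq_two, amp_add_two, sub_add_cancel]
    linear_combination (-((q ^ (charge L - 1) : Kˣ) : K) * (amp q (fun X => F (X₀ ++ y :: X))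
      (charge L) a R t - amp q (fun X => F (X₀ ++ x :: X)) (charge L) a R t)) * h3

theorem layer_eval_capL (hF : IsAlternating F) {x y : E}
    (hv : ∀ s, v s = amp q F 0 0 (L ++ .up x :: .down y :: R) s) (s : List Bool) :
    Layer.eval q z (L.length, .capL none) v s =
      ((-1) ^ downs L * ((q ^ (charge L + 1) : Kˣ) : K)) *
        amp q (fun X => F ((y - x) :: X)) 0 0 (L ++ R) s := by
  refine layer_eval_amp hv (fun t => ⟨[(false :: false :: t, (q : K)), (true :: true :: t, -q)],
    fun r => ?_, fun X₀ a hX _ => ?_⟩) s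
  · rcases r with (_ | ⟨_ | _, _ | ⟨_ | _, r⟩⟩) <;> simp [Piece.eval, Finsupp.single_apply]
    split_ifs <;> simp
  · have h1 := fun X => hF.move [] X₀ X (y - x)
    simp only [List.nil_append] at h1
    have h2 : ∀ X, F ((y - x) :: (X₀ ++ X)) =
        (-1) ^ X₀.length * (F (X₀ ++ y :: X) + (-1) * F (X₀ ++ x :: X)) := by
      intro X
      rw [neg_one_mul, ← sub_eq_add_neg, ← hF.sub, h1, ← mul_assoc, ← mul_pow]
      simp
    have h3 : (-1 : K) ^ (downs L) * (-1) ^ X₀.length = (-1) ^ a := by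
      rw [hX, mul_comm, mul_assoc, ← mul_pow]
      simp
    simp only [h2, amp_mul, amp_add, zpow_add_one, Units.val_mul]
    simp only [List.map, List.sum_cons, List.sum_nil, amp, if_true, if_false, Bool.false_eq_true,
      hF.smul, amp_mul, add_assoc, one_add_one_eq_two, amp_add_two, add_sub_cancel_right, pow_succ]
    linear_combination (-((q ^ (charge L) : Kˣ) : K) * q * (amp q (fun X => F (X₀ ++ y :: X))
      (charge L) a R t - amp q (fun X => F (X₀ ++ x :: X)) (charge L) a R t)) * h3

theorem layer_eval_cap_some {P : Piece g} {c : Palette g} (hP : P = .capR (some c) ∨ P = .capL (some c))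
    (hv : ∀ s, v s = amp q F 0 0 (L ++ .omega :: .omega :: R) s) (s : List Bool) :
    Layer.eval q z (L.length, P) v s = amp q F 0 0 (L ++ R) s := by
  rw [← one_mul (amp _ _ _ _ _ _)]
  refine layer_eval_amp hv (fun t => ⟨[(false :: false :: t, 1)],
    fun r => ?_, fun X₀ a hX _ => by simp [amp]⟩) s
  rcases hP with rfl | rfl <;>
    rcases r with (_ | ⟨_ | _, _ | ⟨_ | _, r⟩⟩) <;> simp [Piece.eval, Finsupp.single_apply]

theorem layer_eval_cup_some {P : Piece g} {c : Palette g} (hP : P = .cupR (some c) ∨ P = .cupL (some c))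
    (hv : ∀ s, v s = amp q F 0 0 (L ++ R) s) (s : List Bool) :
    Layer.eval q z (L.length, P) v s = amp q F 0 0 (L ++ .omega :: .omega :: R) s := by
  rw [← one_mul (amp _ _ _ _ _ _)]
  refine layer_eval_amp hv (fun t => ?_) s
  rcases t with _ | ⟨_ | _, _ | ⟨_ | _, t⟩⟩
  case cons.false.cons.false =>
    refine ⟨[(t, 1)], fun r => ?_, fun X₀ a _ _ => by simp [amp]⟩
    rcases hP with rfl | rfl <;> simp [Piece.eval, Finsupp.single_apply]
  all_goals
    refine ⟨[], fun r => ?_, fun X₀ a _ _ => by simp [amp]⟩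
    rcases hP with rfl | rfl <;> simp [Piece.eval, Finsupp.single_apply]

/-- The coefficient can be nonzero only if exactly one of the two new ends selects `e`, that is, if
the two ends carry equal basis vectors. The hypotheses describe the form after a free generator `e`
has been added: it vanishes when no entry involves `e`, and an entry `e` strips off to give the old
form. -/
theorem layer_eval_cup {F' : List E → K} (hF' : IsAlternating F') {S : Submodule K E} {e : E}
    {κ : K} (hκ : κ * κ = 1) (hcons : ∀ X : List E, (∀ x ∈ X, x ∈ S) → F' (e :: X) = κ * F X)
    (hzero : ∀ X : List E, (∀ x ∈ X, x ∈ S) → F' X = 0)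
    (hL : ∀ p ∈ L, p.In S) (hR : ∀ p ∈ R, p.In S)
    {P : Piece g} {p p' : Col E} (hP : P = .cupR none ∧ p = .up e ∧ p' = .down e ∨
      P = .cupL none ∧ p = .down e ∧ p' = .up e)
    (hv : ∀ s, v s = amp q F 0 0 (L ++ R) s) (s : List Bool) :
    Layer.eval q z (L.length, P) v s =
      (κ * (-1) ^ downs L * ((q ^ (-charge L) : Kˣ) : K)) *
        amp q F' 0 0 (L ++ p :: p' :: R) s := by
  have hq : ((q ^ (charge L) : Kˣ) : K) * ((q ^ (-charge L) : Kˣ) : K) = 1 := by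
    rw [← Units.val_mul, ← zpow_add]
    simp
  have hq1 : (q : K) * ((q⁻¹ : Kˣ) : K) = 1 := q.mul_inv
  refine layer_eval_amp hv (fun t => ?_) s
  -- The next three facts treat the cases in which neither of the new ends selects `e`, exactly one
  -- does, or both do.
  have hX0 : ∀ (X₀ : List E) (a h : _) (t : List Bool), (∀ x ∈ X₀, x ∈ S) →
      amp q (fun X => F' (X₀ ++ X)) h a R t = 0 := fun X₀ a h t hX₀ => by
    rw [amp_congr (F' := fun _ => 0) (S := S) _ _ _ hR, amp_zero]
    intro X hX
    exact hzero _ fun x hx => (List.mem_append.1 hx).elim (hX₀ x) (hX x)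
  have hX1 : ∀ (X₀ : List E) (a : ℕ) (h : ℤ) (t : List Bool), (∀ x ∈ X₀, x ∈ S) →
      (-1 : K) ^ X₀.length = (-1) ^ a * (-1) ^ (downs L) →
      amp q (fun X => F' (X₀ ++ e :: X)) h a R t =
        κ * (-1) ^ a * (-1) ^ (downs L) * amp q (fun X => F (X₀ ++ X)) h a R t := by
    intro X₀ a h t hX₀ hsign
    rw [← amp_mul]
    refine amp_congr (S := S) ?_ _ _ hR _
    intro X hX
    have := hF'.move [] X₀ X e
    simp only [List.nil_append] at this
    rw [this, hcons _ fun x hx => (List.mem_append.1 hx).elim (hX₀ x) (hX x), hsign]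
    ring
  have hX2 : ∀ (X₀ : List E) (a : ℕ) (h : ℤ) (t : List Bool),
      amp q (fun X => F' (X₀ ++ e :: e :: X)) h a R t = 0 := fun X₀ a h t => by
    simp only [hF'.self, amp_zero]
  have h2 := fun X₀ A x (c : K) y => hF'.smul (X₀ ++ [y]) A c x
  simp only [List.append_assoc, List.cons_append, List.nil_append] at h2
  have hsq : ∀ n : ℕ, (-1 : K) ^ n * (-1 : K) ^ n = 1 := fun n => by rw [← mul_pow]; simp
  have hall : ∀ n : ℕ, ((-1 : K) ^ n * (-1) ^ n) * ((-1) ^ downs L * (-1) ^ downs L) * (κ * κ) *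
      (((q ^ (charge L) : Kˣ) : K) * ((q ^ (-charge L) : Kˣ) : K)) = 1 := fun n => by
    rw [hsq, hsq, hκ, hq]
    simp
  rcases hP with ⟨rfl, rfl, rfl⟩ | ⟨rfl, rfl, rfl⟩
  · rcases t with _ | ⟨_ | _, _ | ⟨_ | _, t⟩⟩
    · exact ⟨[], fun r => by simp [Piece.eval, Finsupp.single_apply], fun X₀ a _ _ => by simp [amp]⟩
    · exact ⟨[], fun r => by simp [Piece.eval, Finsupp.single_apply], fun X₀ a _ _ => by simp [amp]⟩
    · refine ⟨[(t, 1)], fun r => by simp [Piece.eval, Finsupp.single_apply], fun X₀ a hs hS => ?_⟩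
      simp only [amp, List.map, List.sum_cons, List.sum_nil, Bool.false_eq_true, if_false,
        hF'.smul, amp_mul, hX1 X₀ _ _ _ (hS S hL) hs, add_sub_cancel_right]
      linear_combination (norm := ring_nf) (-amp q (fun X => F (X₀ ++ X)) (charge L) a R t) *
        hall a
    · refine ⟨[], fun r => by simp [Piece.eval, Finsupp.single_apply], fun X₀ a hs hS => ?_⟩
      simp [amp, hX0 X₀ _ _ _ (hS S hL)]
    · exact ⟨[], fun r => by simp [Piece.eval, Finsupp.single_apply], fun X₀ a _ _ => by simp [amp]⟩
    · refine ⟨[], fun r => by simp [Piece.eval, Finsupp.single_apply], fun X₀ a hs hS => ?_⟩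
      simp only [amp, if_true, Bool.false_eq_true, if_false, hF'.smul, h2, amp_mul, hX2]
      simp
    · refine ⟨[(t, 1)], fun r => by simp [Piece.eval, Finsupp.single_apply], fun X₀ a hs hS => ?_⟩
      simp only [amp, List.map, List.sum_cons, List.sum_nil, Bool.false_eq_true, if_true, add_assoc,
        one_add_one_eq_two, amp_add_two,
        hF'.smul, amp_mul, hX1 X₀ _ _ _ (hS S hL) hs, add_sub_cancel_right]
      linear_combination (norm := ring_nf) (-amp q (fun X => F (X₀ ++ X)) (charge L) a R t) *
        hall a
  · have hq2 : ((q ^ (charge L - 1) : Kˣ) : K) * ((q ^ (-charge L) : Kˣ) : K) =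
        ((q⁻¹ : Kˣ) : K) := by
      rw [← Units.val_mul, ← zpow_add, show charge L - 1 + -charge L = -1 by ring, zpow_neg_one]
    have hall2 : ∀ n : ℕ, ((-1 : K) ^ n * (-1) ^ n) * ((-1) ^ downs L * (-1) ^ downs L) *
        (κ * κ) * (((q ^ (charge L - 1) : Kˣ) : K) * ((q ^ (-charge L) : Kˣ) : K)) =
        ((q⁻¹ : Kˣ) : K) := fun n => by
      rw [hsq, hsq, hκ, hq2]
      simp
    rcases t with _ | ⟨_ | _, _ | ⟨_ | _, t⟩⟩
    · exact ⟨[], fun r => by simp [Piece.eval, Finsupp.single_apply], fun X₀ a _ _ => by simp [amp]⟩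
    · exact ⟨[], fun r => by simp [Piece.eval, Finsupp.single_apply], fun X₀ a _ _ => by simp [amp]⟩
    · refine ⟨[(t, ((q⁻¹ : Kˣ) : K))], fun r => by simp [Piece.eval, Finsupp.single_apply],
        fun X₀ a hs hS => ?_⟩
      simp only [amp, List.map, List.sum_cons, List.sum_nil, Bool.false_eq_true, if_false,
        hF'.smul, amp_mul, hX1 X₀ _ _ _ (hS S hL) hs, sub_add_cancel]
      linear_combination (norm := ring_nf) (-amp q (fun X => F (X₀ ++ X)) (charge L) a R t) *
        hall2 a
    · refine ⟨[], fun r => by simp [Piece.eval, Finsupp.single_apply], fun X₀ a hs hS => ?_⟩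
      simp only [amp, if_true, Bool.false_eq_true, if_false, hF'.smul, h2, amp_mul, hX2]
      simp
    · exact ⟨[], fun r => by simp [Piece.eval, Finsupp.single_apply], fun X₀ a _ _ => by simp [amp]⟩
    · refine ⟨[], fun r => by simp [Piece.eval, Finsupp.single_apply], fun X₀ a hs hS => ?_⟩
      simp [amp, hX0 X₀ _ _ _ (hS S hL)]
    · refine ⟨[(t, -((q⁻¹ : Kˣ) : K))], fun r => by
        simp [Piece.eval, Finsupp.single_apply]; split_ifs <;> simp, fun X₀ a hs hS => ?_⟩
      simp only [amp, List.map, List.sum_cons, List.sum_nil, Bool.false_eq_true, if_true, add_assoc,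
        one_add_one_eq_two, amp_add_two,
        hF'.smul, amp_mul, hX1 X₀ _ _ _ (hS S hL) hs, sub_add_cancel]
      linear_combination (norm := ring_nf) (amp q (fun X => F (X₀ ++ X)) (charge L) a R t) *
        hall2 a

end LocalMoves

end PrismaticLink

namespace PrismaticLink

/-! ### Alternating forms of partly closed systems. -/

section SystemForm

variable {K : Type*} [CommRing K] {g : ℕ} {N : Type*} (τ : Kˣ) (ζ : Palette g → Kˣ)

/-- The alternating function of a system `cl` of closed components and a system `st` of strands. -/
noncomputable def systemForm (cl st : List (N × List (Letter g))) (X : List ((N ⊕ ℕ) →₀ K)) : K :=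
  ldet (systemGens (cl ++ st)) (cl.flatMap (componentRels τ ζ) ++
    st.flatMap (fun c => overRels τ ζ c.2 (base K c.1)) ++ X)

variable {τ ζ} {cl st : List (N × List (Letter g))}

theorem isAlternating_systemForm : IsAlternating (systemForm (K := K) τ ζ cl st) :=
  (isAlternating_ldet _).append_left _

theorem systemForm_nil (cl : List (N × List (Letter g))) :
    systemForm τ ζ cl [] [] = systemDet τ ζ cl := by
  simp [systemForm, systemDet]

/-- Bookkeeping of orders: rearranging generators and known relations costs one sign, the same for
all fillings `X` of the open slots. -/
theorem exists_sign_ldet {ι : Type*} {G G' : List ι} {Y Y' : List (ι →₀ K)} (hG : G.Perm G')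
    (hY : Y.Perm Y') : ∃ ε : ℤˣ, ∀ X, ldet G (Y ++ X) = ((ε : ℤ) : K) * ldet G' (Y' ++ X) := by
  obtain ⟨ε, h⟩ := ldet_perm_index (K := K) hG
  obtain ⟨δ, h'⟩ := (isAlternating_ldet (K := K) G').perm hY
  exact ⟨ε * δ, fun X => by
    have := h' [] X
    simp only [List.nil_append] at this
    rw [h, this]
    push_cast
    ring⟩

theorem exists_sign_systemForm_perm {cl cl' st st' : List (N × List (Letter g))}
    (hcl : cl.Perm cl') (hst : st.Perm st') : ∃ ε : ℤˣ, ∀ X,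
      systemForm τ ζ cl st X = ((ε : ℤ) : K) * systemForm τ ζ cl' st' X :=
  exists_sign_ldet (perm_systemGens (hcl.append hst))
    ((hcl.flatMap_right _).append (hst.flatMap_right _))

theorem systemForm_append_of_ne_over (a : N) (w : List (Letter g)) {ℓ : Letter g}
    (hℓ : overLabels [ℓ] = []) (X : List ((N ⊕ ℕ) →₀ K)) :
    systemForm τ ζ cl ((a, w ++ [ℓ]) :: st) X = systemForm τ ζ cl ((a, w) :: st) X := by
  have h1 : ∀ v : (N ⊕ ℕ) →₀ K, overRels τ ζ [ℓ] v = [] := fun v => by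
    rw [← List.length_eq_zero_iff, length_overRels, hℓ, List.length_nil]
  simp [systemForm, systemGens, overLabels_append, overRels_append, hℓ, h1]

theorem map_flatMap_eq_self {α E : Type*} {l : List α} {f : α → List E} {φ : E → E}
    (h : ∀ a ∈ l, ∀ x ∈ f a, φ x = x) : (l.flatMap f).map φ = l.flatMap f := by
  conv_rhs => rw [← List.map_id (l.flatMap f)]
  refine List.map_congr_left fun x hx => ?_
  obtain ⟨a, ha, hx⟩ := List.mem_flatMap.1 hx
  exact h a ha x hx

/-- The vectors fixed by a substitution. -/
theorem subst_overRels {b : N ⊕ ℕ} {f : (N ⊕ ℕ) →₀ K} {w : List (Letter g)} {v : (N ⊕ ℕ) →₀ K}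
    (hw : ∀ c ∈ crossLabels w, Sum.inr c ≠ b) (hv : v b = 0) :
    ∀ x ∈ overRels τ ζ w v, subst b f x = x := by
  intro x hx
  have : x ∈ LinearMap.ker (Finsupp.lapply (R := K) (M := K) b) :=
    overRels_mem τ ζ w (fun c hc => by simp [hw c hc]) (by simpa using hv) hx
  exact subst_of_eq_zero (by simpa using this)

theorem transport_apply_eq_zero {b : N ⊕ ℕ} {w : List (Letter g)} {v : (N ⊕ ℕ) →₀ K}
    (hw : ∀ c ∈ crossLabels w, Sum.inr c ≠ b) (hv : v b = 0) : transport τ ζ w v b = 0 := by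
  have : transport τ ζ w v ∈ LinearMap.ker (Finsupp.lapply (R := K) (M := K) b) :=
    transport_mem τ ζ w (fun c hc => by simp [hw c hc]) (by simpa using hv)
  simpa using this

theorem subst_componentRels {b : N ⊕ ℕ} {f : (N ⊕ ℕ) →₀ K} {c : N × List (Letter g)}
    (hw : ∀ i ∈ crossLabels c.2, Sum.inr i ≠ b) (hb : Sum.inl c.1 ≠ b) :
    ∀ x ∈ componentRels τ ζ c, subst b f x = x := by
  have h1 : base K c.1 b = 0 := by simp [hb]
  refine List.forall_mem_cons.2 ⟨subst_of_eq_zero ?_, subst_overRels hw h1⟩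
  rw [Finsupp.sub_apply, h1, transport_apply_eq_zero hw h1, sub_zero]

/-- A substitution for a generator that does not occur. -/
theorem map_subst_system {b : N ⊕ ℕ} {f : (N ⊕ ℕ) →₀ K}
    (h : ∀ c ∈ cl ++ st, Sum.inl c.1 ≠ b ∧ ∀ i ∈ crossLabels c.2, Sum.inr i ≠ b) :
    (cl.flatMap (componentRels τ ζ) ++
      st.flatMap (fun c => overRels τ ζ c.2 (base K c.1))).map (subst b f) =
    cl.flatMap (componentRels τ ζ) ++ st.flatMap (fun c => overRels τ ζ c.2 (base K c.1)) := by
  rw [List.map_append, map_flatMap_eq_self, map_flatMap_eq_self]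
  · intro c hc
    have := h c (List.mem_append_right _ hc)
    exact subst_overRels this.2 (by simp [this.1])
  · intro c hc
    have := h c (List.mem_append_left _ hc)
    exact subst_componentRels this.2 this.1

/-- The over-arc at a new crossing can be eliminated. -/
theorem exists_sign_systemForm_over {a : N} {w : List (Letter g)} {k : ℕ} (ε : Bool)
    (h : ∀ c ∈ cl ++ (a, w) :: st, k ∉ crossLabels c.2) : ∃ δ : ℤˣ, ∀ X,
      systemForm τ ζ cl ((a, w ++ [.over k ε]) :: st) X = ((δ : ℤ) : K) *
        systemForm τ ζ cl ((a, w) :: st)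
          (X.map (subst (Sum.inr k) (transport τ ζ w (base K a)))) := by
  have hw : k ∉ crossLabels w := h (a, w) (by simp)
  obtain ⟨δ, hδ⟩ := exists_sign_ldet (K := K)
    (G := systemGens (cl ++ (a, w ++ [Letter.over k ε]) :: st))
    (G' := Sum.inr k :: systemGens (cl ++ (a, w) :: st))
    (Y := cl.flatMap (componentRels τ ζ) ++ ((a, w ++ [Letter.over k ε]) :: st).flatMap
      (fun c => overRels τ ζ c.2 (base K c.1)))
    (Y' := (overGen K N k - transport τ ζ w (base K a)) :: (cl.flatMap (componentRels τ ζ) ++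
      ((a, w) :: st).flatMap (fun c => overRels τ ζ c.2 (base K c.1))))
    (by
      rw [← Multiset.coe_eq_coe]
      simp only [systemGens, overLabels_append, overLabels, List.map_append, List.flatMap_append,
        List.map_cons, List.flatMap_cons, ← Multiset.coe_add, ← Multiset.cons_coe,
        ← Multiset.singleton_add, List.map_nil, Multiset.coe_nil]
      abel)
    (by
      rw [← Multiset.coe_eq_coe]
      simp only [List.flatMap_cons, overRels_append, overRels, ← Multiset.coe_add,
        ← Multiset.cons_coe, ← Multiset.singleton_add, Multiset.coe_nil]
      abel)
  refine ⟨δ, fun X => (hδ X).trans ?_⟩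
  rw [List.cons_append, ldet_elim (transport_apply_eq_zero
    (fun c hc => by rintro ⟨⟩; exact hw hc) (by simp)), List.map_append,
    map_subst_system (fun c hc => ⟨by simp, fun i hi => by rintro ⟨⟩; exact h c hc hi⟩)]
  rfl

/-- A fresh strand adds a generator and no relation. The row `base e` says that the generator is
zero and removes it again; without an entry that involves `e` its column vanishes. -/
theorem systemForm_cup {e : N} (h : ∀ c ∈ cl ++ st, c.1 ≠ e) : ∃ δ : ℤˣ,
    (∀ X : List ((N ⊕ ℕ) →₀ K), (∀ x ∈ X, x (Sum.inl e) = 0) →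
      systemForm τ ζ cl ((e, []) :: st) (base K e :: X) =
        ((δ : ℤ) : K) * systemForm τ ζ cl st X) ∧
    ∀ X : List ((N ⊕ ℕ) →₀ K), (∀ x ∈ X, x (Sum.inl e) = 0) →
      systemForm τ ζ cl ((e, []) :: st) X = 0 := by
  obtain ⟨δ, hδ⟩ := ldet_perm_index (K := K) (G := systemGens (cl ++ (e, []) :: st))
    (G' := Sum.inl e :: systemGens (cl ++ st)) (by
      rw [← Multiset.coe_eq_coe]
      simp only [systemGens, overLabels, List.map_append, List.flatMap_append,
        List.map_cons, List.flatMap_cons, ← Multiset.coe_add, ← Multiset.cons_coe,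
        ← Multiset.singleton_add, List.map_nil, Multiset.coe_nil]
      abel)
  have hX : ∀ X : List ((N ⊕ ℕ) →₀ K), (∀ x ∈ X, x (Sum.inl e) = 0) →
      X.map (subst (Sum.inl e) 0) = X := fun X hX => by
    conv_rhs => rw [← List.map_id X]
    exact List.map_congr_left fun x hx => subst_of_eq_zero (hX x hx)
  have hY := map_subst_system (K := K) (τ := τ) (ζ := ζ) (b := Sum.inl e) (f := 0)
    (cl := cl) (st := st) fun c hc => ⟨by simpa using h c hc, by simp⟩
  have hnot : (Sum.inl e : N ⊕ ℕ) ∉ systemGens (cl ++ st) := by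
    rw [inl_mem_systemGens, List.mem_map]
    rintro ⟨c, hc, rfl⟩
    exact h c hc rfl
  obtain ⟨δ', hδ'⟩ := (isAlternating_ldet (K := K) (Sum.inl e :: systemGens (cl ++ st))).perm
    (Y := cl.flatMap (componentRels τ ζ) ++ st.flatMap (fun c => overRels τ ζ c.2 (base K c.1))
      ++ [base K e]) (Y' := base K e :: (cl.flatMap (componentRels τ ζ) ++
        st.flatMap (fun c => overRels τ ζ c.2 (base K c.1)))) (by
      rw [← Multiset.coe_eq_coe]
      simp only [← Multiset.coe_add, ← Multiset.cons_coe, ← Multiset.singleton_add,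
        Multiset.coe_nil]
      abel)
  refine ⟨δ * δ', fun X h0 => ?_, fun X h0 => ?_⟩
  · have := hδ' [] X
    simp only [List.nil_append, List.append_assoc, List.cons_append] at this
    simp only [systemForm, hδ, List.flatMap_cons, overRels, List.nil_append, List.append_assoc]
    rw [this, ← sub_zero (base K e), ldet_elim (by simp), ← List.append_assoc, List.map_append, hY,
      hX X h0]
    push_cast
    ring
  · simp only [systemForm, hδ, List.flatMap_cons, overRels, List.nil_append]
    -- Substituting `0` for `e` changes none of the rows, yet it multiplies the determinant by the
    -- coefficient of `e` in `0`.
    rw [← hX X h0, ← hY, ← List.map_append, ldet_map_subst hnot]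
    simp

/-- The relation eliminates the first arc of `d` in favour of the last arc of `u`. The over-arcs of
`w'` are then read as on a continuation of `w`, which is what concatenating the words expresses. -/
theorem systemForm_join {u d : N} {w w' : List (Letter g)} (hud : u ≠ d)
    (h : ∀ c ∈ cl ++ st, c.1 ≠ d) : ∃ δ : ℤˣ, ∀ X : List ((N ⊕ ℕ) →₀ K),
      systemForm τ ζ cl ((u, w) :: (d, w') :: st)
          ((base K d - transport τ ζ w (base K u)) :: X) = ((δ : ℤ) : K) *
        systemForm τ ζ cl ((u, w ++ w') :: st)
          (X.map (subst (Sum.inl d) (transport τ ζ w (base K u)))) := by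
  obtain ⟨δ, hδ⟩ := exists_sign_ldet (K := K)
    (G := systemGens (cl ++ (u, w) :: (d, w') :: st))
    (G' := Sum.inl d :: systemGens (cl ++ (u, w ++ w') :: st))
    (Y := cl.flatMap (componentRels τ ζ) ++ ((u, w) :: (d, w') :: st).flatMap
      (fun c => overRels τ ζ c.2 (base K c.1)) ++ [base K d - transport τ ζ w (base K u)])
    (Y' := (base K d - transport τ ζ w (base K u)) :: (cl.flatMap (componentRels τ ζ) ++
      ((u, w) :: (d, w') :: st).flatMap (fun c => overRels τ ζ c.2 (base K c.1))))
    (by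
      rw [← Multiset.coe_eq_coe]
      simp only [systemGens, overLabels_append, List.map_append, List.flatMap_append,
        List.map_cons, List.flatMap_cons, ← Multiset.coe_add, ← Multiset.cons_coe,
        ← Multiset.singleton_add]
      abel)
    (by
      rw [← Multiset.coe_eq_coe]
      simp only [← Multiset.coe_add, ← Multiset.cons_coe, ← Multiset.singleton_add,
        Multiset.coe_nil]
      abel)
  have hu : transport τ ζ w (base K u) (Sum.inl d) = 0 :=
    transport_apply_eq_zero (by simp) (by simp [hud])
  refine ⟨δ, fun X => ?_⟩
  have := hδ X
  simp only [List.append_assoc, List.cons_append, List.nil_append] at this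
  simp only [systemForm, List.append_assoc]
  rw [this, ldet_elim hu]
  have h1 := map_flatMap_eq_self (l := cl) (f := componentRels τ ζ)
    (φ := subst (Sum.inl d) (transport τ ζ w (base K u))) fun c hc =>
      subst_componentRels (by simp) (by simpa using h c (by simp [hc]))
  have h2 := map_flatMap_eq_self (l := st) (f := fun c => overRels τ ζ c.2 (base K c.1))
    (φ := subst (Sum.inl d) (transport τ ζ w (base K u))) fun c hc =>
      subst_overRels (by simp) (by simp [h c (by simp [hc])])
  have h3 : (overRels τ ζ w (base K u)).map (subst (Sum.inl d) (transport τ ζ w (base K u))) =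
      overRels τ ζ w (base K u) := by
    conv_rhs => rw [← List.map_id (overRels τ ζ w (base K u))]
    exact List.map_congr_left fun x hx => subst_overRels (by simp) (by simp [hud]) x hx
  have h4 : (overRels τ ζ w' (base K d)).map (subst (Sum.inl d) (transport τ ζ w (base K u))) =
      overRels τ ζ w' (transport τ ζ w (base K u)) := by
    rw [linearMap_overRels _ _ _ _ (fun c _ => subst_single_ne (by simp) _ _), subst_single_self]
  simp only [List.map_append, List.flatMap_cons, h1, h2, h3, h4, overRels_append,
    List.append_assoc]

/-- The inserted row is literally the closing relation of the component, so the strand moves from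
the open part to the closed part and only the order of rows changes. -/
theorem systemForm_close {a : N} {w : List (Letter g)} : ∃ δ : ℤˣ, ∀ X : List ((N ⊕ ℕ) →₀ K),
    systemForm τ ζ cl ((a, w) :: st) ((base K a - transport τ ζ w (base K a)) :: X) =
      ((δ : ℤ) : K) * systemForm τ ζ (cl ++ [(a, w)]) st X := by
  obtain ⟨δ, hδ⟩ := exists_sign_ldet (K := K)
    (G := systemGens (cl ++ (a, w) :: st)) (G' := systemGens ((cl ++ [(a, w)]) ++ st))
    (Y := cl.flatMap (componentRels τ ζ) ++ ((a, w) :: st).flatMap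
      (fun c => overRels τ ζ c.2 (base K c.1)) ++ [base K a - transport τ ζ w (base K a)])
    (Y' := (cl ++ [(a, w)]).flatMap (componentRels τ ζ) ++
      st.flatMap (fun c => overRels τ ζ c.2 (base K c.1)))
    (by simp)
    (by
      rw [← Multiset.coe_eq_coe]
      simp only [componentRels, List.flatMap_append, List.flatMap_cons, ← Multiset.coe_add,
        ← Multiset.cons_coe, ← Multiset.singleton_add, List.flatMap_nil, Multiset.coe_nil]
      abel)
  refine ⟨δ, fun X => ?_⟩
  rw [systemForm, systemForm, ← hδ]
  simp

end SystemForm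

end PrismaticLink

namespace PrismaticLink

/-! ### Steps between states -/

/-- The effect of one layer. -/
inductive Step {g : ℕ} (k : ℕ) : State g → Layer g → State g → Prop
  | pos (l r : List (Pt g)) (p p' : Pt g) (cl) (hp : p.IsUp none) (hp' : p'.IsUp none) :
    Step k ⟨l ++ p :: p' :: r, cl⟩ (l.length, .pos)
      ⟨l ++ p'.meet (.under k true) :: p.meet (.over k true) :: r, cl⟩
  | neg (l r : List (Pt g)) (p p' : Pt g) (cl) (hp : p.IsUp none) (hp' : p'.IsUp none) :
    Step k ⟨l ++ p :: p' :: r, cl⟩ (l.length, .neg)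
      ⟨l ++ p'.meet (.over k false) :: p.meet (.under k false) :: r, cl⟩
  | virt (c d : Color g) (l r : List (Pt g)) (p p' : Pt g) (cl) (hp : p.IsUp c) (hp' : p'.IsUp d) :
    Step k ⟨l ++ p :: p' :: r, cl⟩ (l.length, .virt c d) ⟨l ++ p' :: p :: r, cl⟩
  | overPos (z : Palette g) (l r : List (Pt g)) (p p' : Pt g) (cl) (hp : p.IsUp (some z))
    (hp' : p'.IsUp none) :
    Step k ⟨l ++ p :: p' :: r, cl⟩ (l.length, .overPos z)
      ⟨l ++ p'.meet (.omega z true) :: p :: r, cl⟩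
  | overNeg (z : Palette g) (l r : List (Pt g)) (p p' : Pt g) (cl) (hp : p.IsUp none)
    (hp' : p'.IsUp (some z)) :
    Step k ⟨l ++ p :: p' :: r, cl⟩ (l.length, .overNeg z)
      ⟨l ++ p' :: p.meet (.omega z false) :: r, cl⟩
  | cupR (c : Color g) (l r : List (Pt g)) (cl) :
    Step k ⟨l ++ r, cl⟩ (l.length, .cupR c)
      ⟨l ++ ⟨c, true, .inl k, []⟩ :: ⟨c, false, .inl k, []⟩ :: r, cl⟩
  | cupL (c : Color g) (l r : List (Pt g)) (cl) :
    Step k ⟨l ++ r, cl⟩ (l.length, .cupL c)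
      ⟨l ++ ⟨c, false, .inl k, []⟩ :: ⟨c, true, .inl k, []⟩ :: r, cl⟩
  | capR (c : Color g) (l r : List (Pt g)) (d u : Pt g) (cl) (hd : d.IsDown c) (hu : u.IsUp c) :
    Step k ⟨l ++ d :: u :: r, cl⟩ (l.length, .capR c) (State.join u d (l ++ r) cl)
  | capL (c : Color g) (l r : List (Pt g)) (u d : Pt g) (cl) (hu : u.IsUp c) (hd : d.IsDown c) :
    Step k ⟨l ++ u :: d :: r, cl⟩ (l.length, .capL c) (State.join u d (l ++ r) cl)

theorem Step.step_eq {g k : ℕ} {S S' : State g} {ℓ : Layer g} (h : Step k S ℓ S') :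
    S.step k ℓ = some S' := by
  cases h <;> simp_all [State.step]

/-- The invariants below are proved by cases on `Step`, where the points next to the piece are
already displayed. -/
theorem step_of_step_eq {g k : ℕ} {S S' : State g} {ℓ : Layer g} (h : S.step k ℓ = some S') :
    Step k S ℓ S' := by
  obtain ⟨n, P⟩ := ℓ
  obtain ⟨pts, cl⟩ := S
  rw [State.step] at h
  split_ifs at h with hn
  obtain ⟨l, r, rfl, rfl⟩ : ∃ l r, pts = l ++ r ∧ n = l.length :=
    ⟨pts.take n, pts.drop n, by simp, by simpa using hn⟩
  simp only [List.take_left, List.drop_left] at h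
  split at h
  all_goals first
    | cases h; done
    | (split_ifs at h with hc
       obtain ⟨h1, h2⟩ := hc
       cases h
       first
        | exact Step.pos _ _ _ _ _ h1 h2
        | exact Step.neg _ _ _ _ _ h1 h2
        | exact Step.virt _ _ _ _ _ _ _ h1 h2
        | exact Step.overPos _ _ _ _ _ _ h1 h2
        | exact Step.overNeg _ _ _ _ _ _ h1 h2
        | exact Step.capR _ _ _ _ _ _ h1 h2
        | exact Step.capL _ _ _ _ _ _ h1 h2)
    | (cases h
       first
        | exact Step.cupR _ _ _ _
        | exact Step.cupL _ _ _ _)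

/-! ### Well-formed lists of points -/

section Valid

variable {g : ℕ}

/-- The name of a strand. -/
abbrev ArcName (g : ℕ) : Type := ℕ ⊕ (Palette g × ℕ)

/-- Direction, name and colour of a point. -/
def Pt.skel (p : Pt g) : Bool × ArcName g × Color g := (p.up, p.arc, p.color)

/-- The names are used consistently, and those that are natural numbers are less than `k`. -/
structure Skel (k : ℕ) (l : List (Bool × ArcName g × Color g)) : Prop where
  ups : ((l.filter fun x => x.1).map fun x => x.2.1).Nodup
  downs : ((l.filter fun x => !x.1).map fun x => x.2.1).Nodup
  matched : ∀ x ∈ l, x.1 = false → (true, x.2) ∈ l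
  fresh : ∀ x ∈ l, ∀ j, x.2.1 = .inl j → j < k

namespace Skel

variable {k : ℕ} {l l' : List (Bool × ArcName g × Color g)} {u d : ArcName g} {c c' : Color g}

theorem perm (h : Skel k l) (hl : l.Perm l') : Skel k l' where
  ups := (((hl.filter _).map _).nodup_iff).1 h.ups
  downs := (((hl.filter _).map _).nodup_iff).1 h.downs
  matched x hx hx' := hl.mem_iff.1 (h.matched x (hl.mem_iff.2 hx) hx')
  fresh x hx := h.fresh x (hl.mem_iff.2 hx)

theorem mono {k' : ℕ} (h : Skel k l) (hk : k ≤ k') : Skel k' l :=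
  { h with fresh := fun x hx j hj => (h.fresh x hx j hj).trans_le hk }

theorem cup (h : Skel k l) (c : Color g) :
    Skel (k + 1) ((true, .inl k, c) :: (false, .inl k, c) :: l) where
  ups := by
    simp only [List.filter_cons, if_true, Bool.false_eq_true, if_false, List.map_cons,
      List.nodup_cons]
    refine ⟨fun hm => ?_, h.ups⟩
    obtain ⟨x, hx, hx'⟩ := List.mem_map.1 hm
    exact lt_irrefl k (h.fresh x (List.mem_filter.1 hx).1 k hx')
  downs := by
    simp only [List.filter_cons, Bool.not_true, Bool.not_false, if_true, Bool.false_eq_true,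
      if_false, List.map_cons, List.nodup_cons]
    refine ⟨fun hm => ?_, h.downs⟩
    obtain ⟨x, hx, hx'⟩ := List.mem_map.1 hm
    exact lt_irrefl k (h.fresh x (List.mem_filter.1 hx).1 k hx')
  matched x hx hx' := by
    simp only [List.mem_cons] at hx ⊢
    rcases hx with rfl | rfl | hx
    · simp at hx'
    · simp
    · exact Or.inr (Or.inr (h.matched x hx hx'))
  fresh x hx j hj := by
    simp only [List.mem_cons] at hx
    rcases hx with rfl | rfl | hx
    · cases hj; omega
    · cases hj; omega
    · have := h.fresh x hx j hj
      omega

theorem ne_of_down (h : Skel k ((true, u, c) :: (false, d, c') :: l)) {x} (hx : x ∈ l)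
    (hx' : x.1 = false) : x.2.1 ≠ d := by
  have := h.downs
  simp only [List.filter_cons, Bool.not_true, Bool.not_false, if_true, Bool.false_eq_true,
      if_false, List.map_cons, List.nodup_cons] at this
  rintro rfl
  exact this.1 (List.mem_map.2 ⟨x, List.mem_filter.2 ⟨hx, by simp [hx']⟩, rfl⟩)

theorem ne_of_up (h : Skel k ((true, u, c) :: l)) {x} (hx : x ∈ l)
    (hx' : x.1 = true) : x.2.1 ≠ u := by
  have := h.ups
  simp only [List.filter_cons, if_true, List.map_cons, List.nodup_cons] at this
  rintro rfl
  exact this.1 (List.mem_map.2 ⟨x, List.mem_filter.2 ⟨hx, by simp [hx']⟩, rfl⟩)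

theorem close (h : Skel k ((true, u, c) :: (false, u, c) :: l)) : Skel k l where
  ups := by
    have := h.ups
    simp only [List.filter_cons, if_true, Bool.false_eq_true, if_false, List.map_cons,
      List.nodup_cons] at this
    exact this.2
  downs := by
    have := h.downs
    simp only [List.filter_cons, Bool.not_true, Bool.not_false, if_true, Bool.false_eq_true,
      if_false, List.map_cons, List.nodup_cons] at this
    exact this.2
  matched x hx hx' := by
    have := h.matched x (by simp [hx]) hx'
    simp only [List.mem_cons, Prod.mk.injEq, Bool.true_eq_false, false_and, false_or,
      true_and] at this
    rcases this with h' | h'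
    · exact absurd (by rw [h']) (h.ne_of_down hx hx')
    · exact h'
  fresh x hx := h.fresh x (by simp [hx])

/-- The name `d` disappears: its downward end has been used up, and its upward end takes over the
name `u`. -/
theorem join (h : Skel k ((true, u, c) :: (false, d, c) :: (true, d, c) :: l)) :
    Skel k ((true, u, c) :: l) where
  ups := by
    have := h.ups
    simp only [List.filter_cons, if_true, Bool.false_eq_true, if_false, List.map_cons,
      List.nodup_cons, List.mem_cons, not_or] at this ⊢
    exact ⟨this.1.2, this.2.2⟩
  downs := by
    have := h.downs
    simp only [List.filter_cons, Bool.not_true, Bool.not_false, if_true, Bool.false_eq_true,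
      if_false, List.map_cons, List.nodup_cons] at this ⊢
    exact this.2
  matched x hx hx' := by
    rw [List.mem_cons] at hx
    rcases hx with rfl | hx
    · simp at hx'
    have := h.matched x (by simp [hx]) hx'
    simp only [List.mem_cons, Prod.mk.injEq, Bool.true_eq_false, false_and, false_or,
      true_and] at this ⊢
    rcases this with h' | h' | h'
    · exact Or.inl h'
    · exact absurd (by rw [h']) (h.ne_of_down (List.mem_cons_of_mem _ hx) hx')
    · exact Or.inr h'
  fresh x hx := h.fresh x (by simp only [List.mem_cons] at hx ⊢; tauto)

end Skel

/-- A list of points with an upward point `u` and a downward one `d` which are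
to be joined, with different names: the other upward point with the name of `d`. -/
theorem exists_join {k : ℕ} {u d : Pt g} {rest : List (Pt g)} {c : Color g}
    (h : Skel k ((u :: d :: rest).map Pt.skel)) (hu : u.IsUp c) (hd : d.IsDown c)
    (hne : u.arc ≠ d.arc) (cl : List (Color g × List (Letter g))) :
    ∃ A B x, rest = A ++ x :: B ∧ x.IsUp c ∧ x.arc = d.arc ∧
      (∀ p ∈ A ++ B, p.arc ≠ d.arc) ∧
      State.join u d rest cl = ⟨A ++ ⟨c, true, u.arc, u.word ++ x.word⟩ :: B, cl⟩ := by
  obtain ⟨hu1, hu2⟩ := hu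
  obtain ⟨hd1, hd2⟩ := hd
  -- The strand that ends downwards at `d` has an upward end of the same name. It is not `u`, whose
  -- name is different, so it is one of the other points.
  have h1 := h.matched d.skel (by simp) (by simp [Pt.skel, hd1])
  simp only [List.map_cons, List.mem_cons, Pt.skel, Prod.mk.injEq, hu1, hd1, Bool.true_eq_false,
    false_and, false_or, true_and, hne.symm, List.mem_map] at h1
  obtain ⟨x, hx, hx1, hx2, hx3⟩ := h1
  obtain ⟨A, B, rfl⟩ := List.append_of_mem hx
  have hall : ∀ p ∈ A ++ B, p.arc ≠ d.arc := by
    intro p hp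
    cases hpu : p.up
    · have h' : Skel k ((true, u.arc, c) :: (false, d.arc, c) :: (A ++ x :: B).map Pt.skel) := by
        simpa [Pt.skel, hu1, hu2, hd1, hd2] using h
      refine h'.ne_of_down (x := p.skel) ?_ hpu
      simp only [List.mem_map, List.mem_append, List.mem_cons] at hp ⊢
      exact ⟨p, by tauto, rfl⟩
    · have h' : Skel k ((true, d.arc, c) :: ((u :: d :: (A ++ B)).map Pt.skel)) := by
        refine h.perm ?_
        have : (true, d.arc, c) = x.skel := by simp [Pt.skel, hx1, hx2, hx3, hd2]
        rw [this, ← List.map_cons]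
        refine List.Perm.map _ ?_
        rw [← Multiset.coe_eq_coe]
        simp only [← Multiset.coe_add, ← Multiset.cons_coe, ← Multiset.singleton_add]
        abel
      exact h'.ne_of_up (x := p.skel) (List.mem_map_of_mem (by simp only [List.mem_cons]; tauto)) hpu
  refine ⟨A, B, x, rfl, ⟨hx1, hx3.trans hd2⟩, hx2, hall, ?_⟩
  have hfix : ∀ l : List (Pt g), (∀ p ∈ l, p.arc ≠ d.arc) → (l.map fun p =>
      if p.up = true ∧ p.arc = d.arc then { p with arc := u.arc, word := u.word ++ p.word } else p)
      = l := fun l hl => by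
    conv_rhs => rw [← List.map_id l]
    exact List.map_congr_left fun p hp => by simp [hl p hp]
  rw [State.join, if_neg hne, List.map_append, List.map_cons, hfix A fun p hp => hall p (by simp [hp]),
    hfix B fun p hp => hall p (by simp [hp]), if_pos ⟨hx1, hx2⟩, hx1, hx3, hd2]

end Valid

end PrismaticLink

namespace PrismaticLink

/-! ### The invariant carried upwards through a tangle. -/

section Invariant

variable {K : Type*} [CommRing K] {g : ℕ}

/-- The contribution of a point to the amplitudes. -/
noncomputable def Pt.col (τ : Kˣ) (ζ : Palette g → Kˣ) (p : Pt g) : Col ((ArcName g ⊕ ℕ) →₀ K) :=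
  if p.color = none then
    if p.up then .up (transport τ ζ p.word (base K p.arc)) else .down (base K p.arc)
  else .omega

/-- The `α`-coloured strands. -/
def alphaStrands (pts : List (Pt g)) : List (ArcName g × List (Letter g)) :=
  (pts.filter fun p => p.up && p.color.isNone).map fun p => (p.arc, p.word)

/-- The states that occur below a link, with names for the closed components. -/
structure WF (k : ℕ) (pts : List (Pt g)) (cl : List (ArcName g × List (Letter g))) : Prop where
  skel : Skel k (pts.map Pt.skel)
  labels : ∀ p ∈ pts, ∀ c ∈ crossLabels p.word, c < k
  nodup : (cl.map Prod.fst).Nodup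
  fresh : ∀ c ∈ cl, ∀ j, c.1 = .inl j → j < k
  closed_labels : ∀ c ∈ cl, ∀ i ∈ crossLabels c.2, i < k
  disjoint : ∀ c ∈ cl, ∀ p ∈ pts, p.up = true → p.arc ≠ c.1

variable {τ : Kˣ} {ζ : Palette g → Kˣ} {k : ℕ} {pts pts' : List (Pt g)}
  {cl : List (ArcName g × List (Letter g))}

theorem alphaStrands_perm (h : pts.Perm pts') : (alphaStrands pts).Perm (alphaStrands pts') :=
  (h.filter _).map _

theorem alphaStrands_cons_of_up {p : Pt g} (hp : p.IsUp none) :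
    alphaStrands (p :: pts) = (p.arc, p.word) :: alphaStrands pts := by
  simp [alphaStrands, hp.1, hp.2]

theorem alphaStrands_cons_of_down {p : Pt g} (hp : p.up = false) :
    alphaStrands (p :: pts) = alphaStrands pts := by
  simp [alphaStrands, hp]

theorem alphaStrands_cons_of_color {p : Pt g} (hp : p.color ≠ none) :
    alphaStrands (p :: pts) = alphaStrands pts := by
  simp [alphaStrands, hp]

theorem exists_of_mem_alphaStrands {c : ArcName g × List (Letter g)} (h : c ∈ alphaStrands pts) :
    ∃ p ∈ pts, p.up = true ∧ c = (p.arc, p.word) := by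
  simp only [alphaStrands, List.mem_map, List.mem_filter, Bool.and_eq_true] at h
  obtain ⟨p, ⟨hp, h1, -⟩, rfl⟩ := h
  exact ⟨p, hp, h1, rfl⟩

namespace WF

theorem of_perm (h : WF k pts cl) (hp : (pts.map Pt.skel).Perm (pts'.map Pt.skel))
    (hl : ∀ p ∈ pts', ∀ c ∈ crossLabels p.word, c < k + 1) : WF (k + 1) pts' cl where
  skel := (h.skel.perm hp).mono (by omega)
  labels := hl
  nodup := h.nodup
  fresh c hc j hj := (h.fresh c hc j hj).trans (by omega)
  closed_labels c hc i hi := (h.closed_labels c hc i hi).trans (by omega)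
  disjoint c hc p hpp hup := by
    have : p.skel ∈ pts.map Pt.skel := hp.mem_iff.2 (List.mem_map_of_mem hpp)
    obtain ⟨p', hp', he⟩ := List.mem_map.1 this
    simp only [Pt.skel, Prod.mk.injEq] at he
    rw [← he.2.1]
    exact h.disjoint c hc p' hp' (he.1.trans hup)

theorem system (h : WF k pts cl) {c : ArcName g × List (Letter g)}
    (hc : c ∈ cl ++ alphaStrands pts) :
    (∀ j, c.1 = .inl j → j < k) ∧ ∀ i ∈ crossLabels c.2, i < k := by
  rcases List.mem_append.1 hc with hc | hc
  · exact ⟨h.fresh c hc, h.closed_labels c hc⟩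
  · obtain ⟨p, hp, -, rfl⟩ := exists_of_mem_alphaStrands hc
    exact ⟨h.skel.fresh p.skel (List.mem_map_of_mem hp), h.labels p hp⟩

end WF

theorem col_meet_cons {p : Pt g} (hp : p.IsUp none) (x : Letter g) :
    (p.meet x).col τ ζ = .up (x.act τ ζ (transport τ ζ p.word (base K p.arc))) := by
  simp [Pt.col, Pt.meet, hp.1, hp.2]

theorem col_of_up {p : Pt g} (hp : p.IsUp none) :
    p.col τ ζ = .up (transport τ ζ p.word (base K p.arc)) := by
  simp [Pt.col, hp.1, hp.2]

theorem col_of_down {p : Pt g} (hp : p.IsDown none) : p.col τ ζ = .down (base K p.arc) := by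
  simp [Pt.col, hp.1, hp.2]

theorem col_of_color {p : Pt g} (hp : p.color ≠ none) : p.col τ ζ = .omega := by
  simp [Pt.col, hp]

/-- Substitutions for generators that a point does not involve. -/
theorem map_col_subst {p : Pt g} {b : ArcName g ⊕ ℕ} {f : (ArcName g ⊕ ℕ) →₀ K}
    (h1 : Sum.inl p.arc ≠ b) (h2 : ∀ c ∈ crossLabels p.word, Sum.inr c ≠ b) :
    (p.col τ ζ).map (subst b f) = p.col τ ζ := by
  have h3 : base K p.arc b = 0 := by simp [h1]
  unfold Pt.col
  split_ifs
  · simp only [Col.map]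
    rw [subst_of_eq_zero (transport_apply_eq_zero h2 h3)]
  · simp only [Col.map]
    rw [subst_of_eq_zero h3]
  · rfl

theorem map_cols_subst {b : ArcName g ⊕ ℕ} {f : (ArcName g ⊕ ℕ) →₀ K}
    (h : ∀ p ∈ pts, Sum.inl p.arc ≠ b ∧ ∀ c ∈ crossLabels p.word, Sum.inr c ≠ b) :
    (pts.map (Pt.col τ ζ)).map (Col.map (subst b f)) = pts.map (Pt.col τ ζ) := by
  rw [List.map_map]
  exact List.map_congr_left fun p hp => map_col_subst (h p hp).1 (h p hp).2

theorem crossLabels_append (w w' : List (Letter g)) :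
    crossLabels (w ++ w') = crossLabels w ++ crossLabels w' := by
  simp [crossLabels]

/-- A unit `± q ^ m`. -/
def IsMono (q : Kˣ) (κ : K) : Prop := ∃ (ε : ℤˣ) (m : ℤ), κ = ((ε : ℤ) : K) * ((q ^ m : Kˣ) : K)

namespace IsMono

variable {q : Kˣ} {κ κ' : K}

theorem mul (h : IsMono q κ) (h' : IsMono q κ') : IsMono q (κ * κ') := by
  obtain ⟨ε, m, rfl⟩ := h
  obtain ⟨ε', m', rfl⟩ := h'
  refine ⟨ε * ε', m + m', ?_⟩
  rw [zpow_add]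
  push_cast
  ring

theorem sign (ε : ℤˣ) : IsMono q (((ε : ℤ) : K)) := ⟨ε, 0, by simp⟩

theorem zpow (m : ℤ) : IsMono q (((q ^ m : Kˣ) : K)) := ⟨1, m, by simp⟩

theorem neg_one_pow (n : ℕ) : IsMono q ((-1 : K) ^ n) := by
  have := sign (q := q) (K := K) ((-1) ^ n)
  simpa using this

theorem one : IsMono q (1 : K) := ⟨1, 0, by simp⟩

theorem self : IsMono q (q : K) := by simpa using zpow (q := q) 1

theorem inv : IsMono q ((q⁻¹ : Kˣ) : K) := by simpa using zpow (q := q) (-1)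

end IsMono

variable (q : Kˣ) (z : Palette g → Kˣ)

/-- The vector below a horizontal line has the amplitudes of the Alexander system of the state. -/
def Tracks (S : State g) (cl : List (ArcName g × List (Letter g))) (v : List Bool →₀ K) : Prop :=
  ∃ κ, IsMono q κ ∧ ∀ s, v s = amp q (fun X => κ * systemForm (q ^ 2) (fun c => (z c)⁻¹) cl
    (alphaStrands S.pts) X) 0 0 (S.pts.map (Pt.col (q ^ 2) fun c => (z c)⁻¹)) s

variable {q z} {v : List Bool →₀ K}

theorem isAlternating_mul {E : Type*} [AddCommGroup E] [Module K E] {F : List E → K}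
    (hF : IsAlternating F) (c : K) : IsAlternating fun X => c * F X where
  add A B x y := by rw [hF.add, mul_add]
  smul A B a x := by rw [hF.smul, mul_left_comm]
  self A B x := by rw [hF.self, mul_zero]

/-- The change of the system at a crossing of the upward strands `o` (over) and `u`. -/
theorem exists_sign_systemForm_crossing {o u : Pt g} {rest : List (Pt g)} (ε : Bool)
    (h : WF k pts cl) (hpts : pts.Perm (o :: u :: rest)) (ho : o.IsUp none) (hu : u.IsUp none)
    (hpts' : pts'.Perm (o.meet (.over k ε) :: u.meet (.under k ε) :: rest)) :
    ∃ δ : ℤˣ, ∀ X, systemForm (K := K) τ ζ cl (alphaStrands pts) (X.map (subst (Sum.inr k)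
      (transport τ ζ o.word (base K o.arc)))) =
        ((δ : ℤ) : K) * systemForm τ ζ cl (alphaStrands pts') X := by
  have h1 := alphaStrands_perm hpts
  have h2 := alphaStrands_perm hpts'
  have hom : (o.meet (.over k ε)).IsUp none := ho
  have hum : (u.meet (.under k ε)).IsUp none := hu
  rw [alphaStrands_cons_of_up ho, alphaStrands_cons_of_up hu] at h1
  rw [alphaStrands_cons_of_up hom, alphaStrands_cons_of_up hum] at h2
  obtain ⟨δ₁, e1⟩ := exists_sign_systemForm_perm (K := K) (τ := τ) (ζ := ζ) (List.Perm.refl cl) h1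
  obtain ⟨δ₂, e2⟩ := exists_sign_systemForm_perm (K := K) (τ := τ) (ζ := ζ) (List.Perm.refl cl)
    (h2.trans (List.Perm.swap _ _ _)).symm
  -- The label `k` is larger than all labels used so far, so the over-arc of the new crossing can be
  -- eliminated. The under-passage adds neither a generator nor a relation.
  obtain ⟨δ₃, e3⟩ := exists_sign_systemForm_over (K := K) (τ := τ) (ζ := ζ) (cl := cl)
    (a := o.arc) (w := o.word) (k := k) (st := (u.arc, u.word) :: alphaStrands rest) ε (by
      intro c hc hk
      have hc' : c ∈ cl ++ alphaStrands pts := by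
        rw [List.mem_append] at hc ⊢
        exact hc.imp id fun hc => h1.mem_iff.2 hc
      exact lt_irrefl _ ((h.system hc').2 k hk))
  obtain ⟨δ₄, e4⟩ := exists_sign_systemForm_perm (K := K) (τ := τ) (ζ := ζ) (List.Perm.refl cl)
    (List.Perm.swap (u.arc, u.word) (o.arc, o.word ++ [.over k ε]) (alphaStrands rest))
  refine ⟨δ₁ * δ₃ * δ₄ * δ₂, fun X => ?_⟩
  rw [e1]
  have e5 := e3 X
  have e6 := e4 X
  have e7 := e2 X
  simp only [Pt.meet] at e7
  rw [systemForm_append_of_ne_over u.arc u.word (by rfl)] at e7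
  rw [e6, e7] at e5
  have e8 : ((δ₃ : ℤ) : K) * (((δ₃ : ℤ) : K) * systemForm τ ζ cl ((o.arc, o.word) ::
      (u.arc, u.word) :: alphaStrands rest) (X.map (subst (Sum.inr k)
        (transport τ ζ o.word (base K o.arc))))) = _ := SignEq.sign_mul_self _ _
  rw [← e8, ← e5]
  push_cast
  ring

end Invariant

end PrismaticLink

namespace PrismaticLink

/-! ### Crossings and cups preserve the invariant. -/

section Tracks

variable {K : Type*} [CommRing K] {g : ℕ} {q : Kˣ} {z : Palette g → Kˣ}
  {k : ℕ} {cl : List (ArcName g × List (Letter g))} {v : List Bool →₀ K}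
  {l r : List (Pt g)} {closed closed' : List (Color g × List (Letter g))}

/-- The local computation yields columns in which the over-strand itself appears, while the new
state uses the generator of the over-arc `k`. They differ by a substitution, which `amp_map` shifts
from the columns to the form; there it is the elimination of the over-arc. -/
theorem Tracks.of_crossing {P : Piece g} {o u p₁ p₂ p₁' p₂' : Pt g} {ε : Bool} {κ₀ : K}
    (hκ₀ : IsMono q κ₀) (h : WF k (l ++ p₁ :: p₂ :: r) cl) (ho : o.IsUp none) (hu : u.IsUp none)
    (hp : [p₁, p₂].Perm [o, u])
    (hp' : [p₁', p₂'].Perm [o.meet (.over k ε), u.meet (.under k ε)])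
    (hP : ∀ F : List ((ArcName g ⊕ ℕ) →₀ K) → K, IsAlternating F →
      (∀ s, v s = amp q F 0 0 ((l ++ p₁ :: p₂ :: r).map (Pt.col (q ^ 2) fun c => (z c)⁻¹)) s) →
      ∀ s, Layer.eval q z (l.length, P) v s = κ₀ * amp q F 0 0
        (((l ++ p₁' :: p₂' :: r).map (Pt.col (q ^ 2) fun c => (z c)⁻¹)).map
          (Col.map (subst (Sum.inr k)
            (transport (q ^ 2) (fun c => (z c)⁻¹) o.word (base K o.arc))))) s)
    (ht : Tracks q z ⟨l ++ p₁ :: p₂ :: r, closed⟩ cl v) :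
    Tracks q z ⟨l ++ p₁' :: p₂' :: r, closed'⟩ cl (Layer.eval q z (l.length, P) v) := by
  obtain ⟨κ, hκ, hv⟩ := ht
  obtain ⟨δ, hδ⟩ := exists_sign_systemForm_crossing (K := K) (τ := q ^ 2) (ζ := fun c => (z c)⁻¹)
    (pts := l ++ p₁ :: p₂ :: r) (pts' := l ++ p₁' :: p₂' :: r) (rest := l ++ r)
    ε h (by
      have := (hp.append_right (l ++ r))
      refine List.Perm.trans ?_ this
      rw [← Multiset.coe_eq_coe]
      simp only [← Multiset.coe_add, ← Multiset.cons_coe, ← Multiset.singleton_add,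
        Multiset.coe_nil]
      abel) ho hu (by
      have := (hp'.append_right (l ++ r))
      refine List.Perm.trans ?_ this
      rw [← Multiset.coe_eq_coe]
      simp only [← Multiset.coe_add, ← Multiset.cons_coe, ← Multiset.singleton_add,
        Multiset.coe_nil]
      abel)
  refine ⟨κ₀ * κ * ((δ : ℤ) : K), (hκ₀.mul hκ).mul (.sign δ), fun s => ?_⟩
  rw [hP _ (isAlternating_mul isAlternating_systemForm κ) hv, ← amp_map, ← amp_mul]
  congr 1
  funext X
  rw [hδ]
  ring

theorem forall_label_lt (h : WF k l cl) {p : Pt g} (hp : p ∈ l) :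
    Sum.inl p.arc ≠ (Sum.inr k : ArcName g ⊕ ℕ) ∧
      ∀ i ∈ crossLabels p.word, (Sum.inr i : ArcName g ⊕ ℕ) ≠ Sum.inr k :=
  ⟨by simp, fun i hi => by
    have := h.labels p hp i hi
    simp
    omega⟩

theorem Tracks.pos {p p' : Pt g} (h : WF k (l ++ p :: p' :: r) cl) (hp : p.IsUp none)
    (hp' : p'.IsUp none) (ht : Tracks q z ⟨l ++ p :: p' :: r, closed⟩ cl v) :
    Tracks q z ⟨l ++ p'.meet (.under k true) :: p.meet (.over k true) :: r, closed⟩ cl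
      (Layer.eval q z (l.length, .pos) v) := by
  refine Tracks.of_crossing (o := p) (u := p') (ε := true) .inv h hp hp' (.refl _) (.swap _ _ _)
    (fun F hF hv s => ?_) ht
  simp only [List.map_append, List.map_cons, col_of_up hp, col_of_up hp'] at hv
  have := layer_eval_pos (z := z) hF hv s
  rw [List.length_map] at this
  have hl := map_cols_subst (K := K) (τ := q ^ 2) (ζ := fun c => (z c)⁻¹) (pts := l)
    (f := transport (q ^ 2) (fun c => (z c)⁻¹) p.word (base K p.arc))
    fun x hx => forall_label_lt h (p := x) (by simp [hx])
  have hr := map_cols_subst (K := K) (τ := q ^ 2) (ζ := fun c => (z c)⁻¹) (pts := r)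
    (f := transport (q ^ 2) (fun c => (z c)⁻¹) p.word (base K p.arc))
    fun x hx => forall_label_lt h (p := x) (by simp [hx])
  have h1 := map_col_subst (K := K) (τ := q ^ 2) (ζ := fun c => (z c)⁻¹) (p := p)
    (f := transport (q ^ 2) (fun c => (z c)⁻¹) p.word (base K p.arc))
    (forall_label_lt h (p := p) (by simp)).1 (forall_label_lt h (p := p) (by simp)).2
  have h2 := map_col_subst (K := K) (τ := q ^ 2) (ζ := fun c => (z c)⁻¹) (p := p')
    (f := transport (q ^ 2) (fun c => (z c)⁻¹) p.word (base K p.arc))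
    (forall_label_lt h (p := p') (by simp)).1 (forall_label_lt h (p := p') (by simp)).2
  rw [col_of_up hp] at h1
  rw [col_of_up hp'] at h2
  simp only [Col.map, Col.up.injEq] at h1 h2
  rw [this, List.map_append, List.map_append, hl, List.map_cons, List.map_cons, List.map_cons,
    List.map_cons, hr, col_meet_cons hp, col_meet_cons hp']
  simp only [Col.map, Letter.act, map_add, map_smul, h1, h2, subst_single_self, sgn, if_true,
    zpow_one]

theorem Tracks.neg {p p' : Pt g} (h : WF k (l ++ p :: p' :: r) cl) (hp : p.IsUp none)
    (hp' : p'.IsUp none) (ht : Tracks q z ⟨l ++ p :: p' :: r, closed⟩ cl v) :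
    Tracks q z ⟨l ++ p'.meet (.over k false) :: p.meet (.under k false) :: r, closed⟩ cl
      (Layer.eval q z (l.length, .neg) v) := by
  refine Tracks.of_crossing (o := p') (u := p) (ε := false) .self h hp' hp (.swap _ _ _) (.refl _)
    (fun F hF hv s => ?_) ht
  simp only [List.map_append, List.map_cons, col_of_up hp, col_of_up hp'] at hv
  have := layer_eval_neg (z := z) hF hv s
  rw [List.length_map] at this
  have hl := map_cols_subst (K := K) (τ := q ^ 2) (ζ := fun c => (z c)⁻¹) (pts := l)
    (f := transport (q ^ 2) (fun c => (z c)⁻¹) p'.word (base K p'.arc))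
    fun x hx => forall_label_lt h (p := x) (by simp [hx])
  have hr := map_cols_subst (K := K) (τ := q ^ 2) (ζ := fun c => (z c)⁻¹) (pts := r)
    (f := transport (q ^ 2) (fun c => (z c)⁻¹) p'.word (base K p'.arc))
    fun x hx => forall_label_lt h (p := x) (by simp [hx])
  have h1 := map_col_subst (K := K) (τ := q ^ 2) (ζ := fun c => (z c)⁻¹) (p := p)
    (f := transport (q ^ 2) (fun c => (z c)⁻¹) p'.word (base K p'.arc))
    (forall_label_lt h (p := p) (by simp)).1 (forall_label_lt h (p := p) (by simp)).2
  have h2 := map_col_subst (K := K) (τ := q ^ 2) (ζ := fun c => (z c)⁻¹) (p := p')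
    (f := transport (q ^ 2) (fun c => (z c)⁻¹) p'.word (base K p'.arc))
    (forall_label_lt h (p := p') (by simp)).1 (forall_label_lt h (p := p') (by simp)).2
  rw [col_of_up hp] at h1
  rw [col_of_up hp'] at h2
  simp only [Col.map, Col.up.injEq] at h1 h2
  rw [this, List.map_append, List.map_append, hl, List.map_cons, List.map_cons, List.map_cons,
    List.map_cons, hr, col_meet_cons hp, col_meet_cons hp']
  simp only [Col.map, Letter.act, map_add, map_smul, h1, h2, subst_single_self, sgn,
    Bool.false_eq_true, if_false, zpow_neg, zpow_one]

/-- A layer that does not change the system of relations. -/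
theorem Tracks.of_amp {S S' : State g} {ℓ : Layer g} {κ₀ : K} (hκ₀ : IsMono q κ₀)
    (hst : ∃ δ : ℤˣ, ∀ X, systemForm (K := K) (q ^ 2) (fun c => (z c)⁻¹) cl
      (alphaStrands S.pts) X = ((δ : ℤ) : K) *
        systemForm (q ^ 2) (fun c => (z c)⁻¹) cl (alphaStrands S'.pts) X)
    (hP : ∀ F : List ((ArcName g ⊕ ℕ) →₀ K) → K, IsAlternating F →
      (∀ s, v s = amp q F 0 0 (S.pts.map (Pt.col (q ^ 2) fun c => (z c)⁻¹)) s) →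
      ∀ s, Layer.eval q z ℓ v s = κ₀ * amp q F 0 0
        (S'.pts.map (Pt.col (q ^ 2) fun c => (z c)⁻¹)) s)
    (ht : Tracks q z S cl v) : Tracks q z S' cl (Layer.eval q z ℓ v) := by
  obtain ⟨κ, hκ, hv⟩ := ht
  obtain ⟨δ, hδ⟩ := hst
  refine ⟨κ₀ * κ * ((δ : ℤ) : K), (hκ₀.mul hκ).mul (.sign δ), fun s => ?_⟩
  rw [hP _ (isAlternating_mul isAlternating_systemForm κ) hv, ← amp_mul]
  congr 1
  funext X
  rw [hδ]
  ring

theorem Tracks.virt {p p' : Pt g} {c d : Color g} (hp : p.IsUp c) (hp' : p'.IsUp d)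
    (ht : Tracks q z ⟨l ++ p :: p' :: r, closed⟩ cl v) :
    Tracks q z ⟨l ++ p' :: p :: r, closed⟩ cl (Layer.eval q z (l.length, .virt c d) v) := by
  refine Tracks.of_amp .one (exists_sign_systemForm_perm (.refl _)
    (alphaStrands_perm (List.Perm.append_left _ (List.Perm.swap _ _ _)))) (fun F hF hv s => ?_) ht
  have h1 : ∀ {p : Pt g} {c}, p.IsUp c → p.col (q ^ 2) (fun c => (z c)⁻¹) =
      Col.colored c (transport (q ^ 2) (fun c => (z c)⁻¹) p.word (base K p.arc)) := by
    rintro p c ⟨h, rfl⟩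
    simp [Pt.col, Col.colored, h]
  simp only [List.map_append, List.map_cons, h1 hp, h1 hp'] at hv ⊢
  have := layer_eval_virt (z := z) hF hv s
  rw [List.length_map] at this
  rw [this, one_mul]

theorem Tracks.overPos {p p' : Pt g} {c : Palette g} (hp : p.IsUp (some c)) (hp' : p'.IsUp none)
    (ht : Tracks q z ⟨l ++ p :: p' :: r, closed⟩ cl v) :
    Tracks q z ⟨l ++ p'.meet (.omega c true) :: p :: r, closed⟩ cl
      (Layer.eval q z (l.length, .overPos c) v) := by
  have hc : p.color ≠ none := by simp [hp.2]
  have hm : (p'.meet (.omega c true)).IsUp none := hp'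
  refine Tracks.of_amp .one ?_ (fun F hF hv s => ?_) ht
  · obtain ⟨δ, hδ⟩ := exists_sign_systemForm_perm (K := K) (τ := q ^ 2) (ζ := fun c => (z c)⁻¹)
      (List.Perm.refl cl) (alphaStrands_perm (pts := l ++ p :: p' :: r) (pts' := p' :: p :: (l ++ r))
        ((List.Perm.append_left _ (.swap _ _ _)).trans (List.perm_middle.trans
          (List.perm_middle.cons _))))
    obtain ⟨δ', hδ'⟩ := exists_sign_systemForm_perm (K := K) (τ := q ^ 2) (ζ := fun c => (z c)⁻¹)
      (List.Perm.refl cl) (alphaStrands_perm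
        (pts' := l ++ p'.meet (.omega c true) :: p :: r)
        (pts := p'.meet (.omega c true) :: p :: (l ++ r))
        (List.perm_middle.trans (List.perm_middle.cons _)).symm)
    refine ⟨δ * δ', fun X => ?_⟩
    have e := hδ' X
    rw [alphaStrands_cons_of_up hm] at e
    simp only [Pt.meet] at e
    rw [systemForm_append_of_ne_over _ _ (by rfl)] at e
    rw [hδ, alphaStrands_cons_of_up hp', e]
    simp only [Pt.meet]
    push_cast
    ring
  · simp only [List.map_append, List.map_cons, col_of_up hp', col_of_color hc,
      col_meet_cons hp'] at hv ⊢
    have := layer_eval_overPos (z := z) (c := c) hF hv s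
    rw [List.length_map] at this
    simpa [Letter.act, sgn] using this

theorem Tracks.overNeg {p p' : Pt g} {c : Palette g} (hp : p.IsUp none) (hp' : p'.IsUp (some c))
    (ht : Tracks q z ⟨l ++ p :: p' :: r, closed⟩ cl v) :
    Tracks q z ⟨l ++ p' :: p.meet (.omega c false) :: r, closed⟩ cl
      (Layer.eval q z (l.length, .overNeg c) v) := by
  have hc : p'.color ≠ none := by simp [hp'.2]
  have hm : (p.meet (.omega c false)).IsUp none := hp
  refine Tracks.of_amp .one ?_ (fun F hF hv s => ?_) ht
  · obtain ⟨δ, hδ⟩ := exists_sign_systemForm_perm (K := K) (τ := q ^ 2) (ζ := fun c => (z c)⁻¹)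
      (List.Perm.refl cl) (alphaStrands_perm (pts := l ++ p :: p' :: r) (pts' := p :: p' :: (l ++ r))
        (List.perm_middle.trans (List.perm_middle.cons _)))
    obtain ⟨δ', hδ'⟩ := exists_sign_systemForm_perm (K := K) (τ := q ^ 2) (ζ := fun c => (z c)⁻¹)
      (List.Perm.refl cl) (alphaStrands_perm
        (pts' := l ++ p' :: p.meet (.omega c false) :: r)
        (pts := p.meet (.omega c false) :: p' :: (l ++ r))
        ((List.Perm.append_left _ (.swap _ _ _)).trans (List.perm_middle.trans
          (List.perm_middle.cons _))).symm)
    refine ⟨δ * δ', fun X => ?_⟩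
    have e := hδ' X
    rw [alphaStrands_cons_of_up hm] at e
    simp only [Pt.meet] at e
    rw [systemForm_append_of_ne_over _ _ (by rfl)] at e
    rw [hδ, alphaStrands_cons_of_up hp, e]
    simp only [Pt.meet]
    push_cast
    ring
  · simp only [List.map_append, List.map_cons, col_of_up hp, col_of_color hc,
      col_meet_cons hp] at hv ⊢
    have := layer_eval_overNeg (z := z) (c := c) hF hv s
    rw [List.length_map] at this
    simpa [Letter.act, sgn] using this

/-- The two ends of a new strand. -/
def cupPts (c : Color g) (k : ℕ) (b : Bool) : List (Pt g) :=
  [⟨c, b, .inl k, []⟩, ⟨c, !b, .inl k, []⟩]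

theorem Tracks.cup {P : Piece g} {c : Color g} {b : Bool} (h : WF k (l ++ r) cl)
    (hP : P = .cupR c ∧ b = true ∨ P = .cupL c ∧ b = false)
    (ht : Tracks q z ⟨l ++ r, closed⟩ cl v) :
    Tracks q z ⟨l ++ (cupPts c k b ++ r), closed⟩ cl (Layer.eval q z (l.length, P) v) := by
  have hperm : (l ++ (cupPts c k b ++ r)).Perm
      (⟨c, true, .inl k, []⟩ :: ⟨c, false, .inl k, []⟩ :: (l ++ r)) := by
    cases b
    · exact (List.perm_middle.trans (List.perm_middle.cons _)).trans (.swap _ _ _)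
    · exact List.perm_middle.trans (List.perm_middle.cons _)
  have hst := alphaStrands_perm hperm
  rcases c with _ | c
  · rw [alphaStrands_cons_of_up ⟨rfl, rfl⟩, alphaStrands_cons_of_down rfl] at hst
    obtain ⟨δ', hδ'⟩ := exists_sign_systemForm_perm (K := K) (τ := q ^ 2) (ζ := fun c => (z c)⁻¹)
      (List.Perm.refl cl) hst
    obtain ⟨δ, h1, h2⟩ := systemForm_cup (K := K) (τ := q ^ 2) (ζ := fun c => (z c)⁻¹)
      (cl := cl) (st := alphaStrands (l ++ r)) (e := .inl k) fun c hc he =>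
        lt_irrefl k ((h.system hc).1 k he)
    obtain ⟨κ, hκ, hv⟩ := ht
    -- The number `k` of the layer has not been used as a name, so the old columns lie in the
    -- subspace without the new generator, where the enlarged form is known.
    have hmem : ∀ p ∈ l ++ r, (p.col (q ^ 2) fun c => (z c)⁻¹).In
        (LinearMap.ker (Finsupp.lapply (R := K) (M := K) (Sum.inl (Sum.inl k) : ArcName g ⊕ ℕ))) := by
      intro p hp
      have h3 : base K p.arc (Sum.inl (Sum.inl k)) = 0 := by
        have : p.arc ≠ .inl k := fun he =>
          lt_irrefl k (h.skel.fresh p.skel (List.mem_map_of_mem hp) k he)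
        simp [this]
      unfold Pt.col
      split_ifs
      · exact transport_apply_eq_zero (by simp) h3
      · exact h3
      · trivial
    have hv' : ∀ s, v s = amp q (fun X => κ * systemForm (q ^ 2) (fun c => (z c)⁻¹) cl
        (alphaStrands (l ++ r)) X) 0 0 (l.map (Pt.col (q ^ 2) fun c => (z c)⁻¹) ++
          r.map (Pt.col (q ^ 2) fun c => (z c)⁻¹)) s := by simpa using hv
    have key := layer_eval_cup (z := z) (e := base K (Sum.inl k : ArcName g))
      (F := fun X => κ * systemForm (q ^ 2) (fun c => (z c)⁻¹) cl (alphaStrands (l ++ r)) X)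
      (F' := fun X => κ * systemForm (q ^ 2) (fun c => (z c)⁻¹) cl
        ((.inl k, []) :: alphaStrands (l ++ r)) X)
      (isAlternating_mul isAlternating_systemForm κ)
      (S := LinearMap.ker (Finsupp.lapply (R := K) (M := K)
        (Sum.inl (Sum.inl k) : ArcName g ⊕ ℕ))) (κ := ((δ : ℤ) : K))
      (by have := SignEq.sign_mul_self δ (1 : K); simpa using this)
      (fun X hX => by rw [h1 X fun x hx => by simpa using hX x hx]; ring)
      (fun X hX => by rw [h2 X fun x hx => by simpa using hX x hx, mul_zero])
      (L := l.map (Pt.col (q ^ 2) fun c => (z c)⁻¹)) (R := r.map (Pt.col (q ^ 2) fun c => (z c)⁻¹))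
      (List.forall_mem_map.2 fun p hp => hmem p (List.mem_append_left _ hp))
      (List.forall_mem_map.2 fun p hp => hmem p (List.mem_append_right _ hp))
      (P := P) (p := if b then .up (base K (Sum.inl k)) else .down (base K (Sum.inl k)))
      (p' := if b then .down (base K (Sum.inl k)) else .up (base K (Sum.inl k)))
      (by rcases hP with ⟨rfl, rfl⟩ | ⟨rfl, rfl⟩ <;> simp) hv'
    rw [List.length_map] at key
    refine ⟨_ * κ * ((δ' : ℤ) : K), ((((IsMono.sign δ).mul (IsMono.neg_one_pow
      (downs (l.map (Pt.col (q ^ 2) fun c => (z c)⁻¹))))).mul (IsMono.zpow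
        (-charge (l.map (Pt.col (q ^ 2) fun c => (z c)⁻¹))))).mul hκ).mul (IsMono.sign δ'),
      fun s => ?_⟩
    have hcols : (l ++ (cupPts none k b ++ r)).map (Pt.col (q ^ 2) fun c => (z c)⁻¹) =
        l.map (Pt.col (q ^ 2) fun c => (z c)⁻¹) ++
          (if b then .up (base K (Sum.inl k)) else .down (base K (Sum.inl k))) ::
          (if b then .down (base K (Sum.inl k)) else .up (base K (Sum.inl k))) ::
          r.map (Pt.col (q ^ 2) fun c => (z c)⁻¹) := by
      cases b <;> simp [cupPts, Pt.col]
    rw [key s, hcols, ← amp_mul]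
    congr 1
    funext X
    rw [hδ']
    have := SignEq.sign_mul_self δ' (systemForm (q ^ 2) (fun c => (z c)⁻¹) cl
        ((.inl k, []) :: alphaStrands (l ++ r)) X)
    linear_combination (-((δ : ℤ) : K) * (-1) ^ (downs (l.map (Pt.col (q ^ 2) fun c => (z c)⁻¹))) *
      ((q ^ (-charge (l.map (Pt.col (q ^ 2) fun c => (z c)⁻¹))) : Kˣ) : K) * κ) * this
  -- A strand with a colour in `Ω` carries the trivial representation and takes no part in the
  -- system of relations.
  · rw [alphaStrands_cons_of_color (by simp), alphaStrands_cons_of_color (by simp)] at hst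
    refine Tracks.of_amp .one (exists_sign_systemForm_perm (.refl _) hst.symm)
      (fun F hF hv s => ?_) ht
    simp only [List.map_append] at hv
    have := layer_eval_cup_some (z := z) (P := P) (c := c)
      (by rcases hP with ⟨rfl, -⟩ | ⟨rfl, -⟩ <;> simp) hv s
    rw [List.length_map] at this
    rw [this, one_mul]
    simp [cupPts, Pt.col]

end Tracks

end PrismaticLink

namespace PrismaticLink

/-! ### Caps, and the value of the functor on a link. -/

section Caps

variable {K : Type*} [CommRing K] {g : ℕ} {q : Kˣ} {z : Palette g → Kˣ}
  {k : ℕ} {cl : List (ArcName g × List (Letter g))} {v : List Bool →₀ K}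
  {l r rest : List (Pt g)} {closed : List (Color g × List (Letter g))} {u d : Pt g} {c : Color g}

theorem perm_two_front {α : Type*} (l r : List α) (a b : α) :
    (l ++ a :: b :: r).Perm (a :: b :: (l ++ r)) :=
  List.perm_middle.trans (List.perm_middle.cons _)

/-- Both versions are used: a closed `α`-component joins the list of components, one with a colour
in `Ω` is dropped. -/
theorem WF.close (h : WF k (u :: d :: rest) cl) (hu : u.IsUp c) (hd : d.IsDown c)
    (he : u.arc = d.arc) : WF (k + 1) rest cl ∧ WF (k + 1) rest (cl ++ [(u.arc, u.word)]) := by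
  have hs : Skel k ((true, u.arc, c) :: (false, u.arc, c) :: rest.map Pt.skel) := by
    have := h.skel
    simpa [Pt.skel, hu.1, hu.2, hd.1, hd.2, he] using this
  have h1 : WF (k + 1) rest cl :=
    { skel := hs.close.mono (by omega)
      labels := fun p hp i hi => (h.labels p (by simp [hp]) i hi).trans (by omega)
      nodup := h.nodup
      fresh := fun c hc j hj => (h.fresh c hc j hj).trans (by omega)
      closed_labels := fun c hc i hi => (h.closed_labels c hc i hi).trans (by omega)
      disjoint := fun c hc p hp hup => h.disjoint c hc p (by simp [hp]) hup }
  refine ⟨h1, h1.skel, h1.labels, ?_, ?_, ?_, ?_⟩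
  · rw [List.map_append, List.nodup_append]
    refine ⟨h.nodup, by simp, ?_⟩
    intro a ha b hb
    obtain ⟨x, hx, rfl⟩ := List.mem_map.1 ha
    simp only [List.map_cons, List.map_nil, List.mem_singleton] at hb
    subst hb
    exact fun e => h.disjoint x hx u (by simp) hu.1 e.symm
  · intro x hx j hj
    rcases List.mem_append.1 hx with hx | hx
    · exact h1.fresh x hx j hj
    · rw [List.mem_singleton.1 hx] at hj
      exact (h.skel.fresh u.skel (by simp) j hj).trans (by omega)
  · intro x hx i hi
    rcases List.mem_append.1 hx with hx | hx
    · exact h1.closed_labels x hx i hi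
    · rw [List.mem_singleton.1 hx] at hi
      exact (h.labels u (by simp) i hi).trans (by omega)
  · intro x hx p hp hup
    rcases List.mem_append.1 hx with hx | hx
    · exact h1.disjoint x hx p hp hup
    · rw [List.mem_singleton.1 hx]
      have h2 : Skel k ((true, u.arc, c) :: ((d :: rest).map Pt.skel)) := by
        have := h.skel
        simpa [Pt.skel, hu.1, hu.2, hd.1, hd.2, he] using this
      exact h2.ne_of_up (x := p.skel) (List.mem_map_of_mem (by simp [hp])) hup

theorem WF.join {A B : List (Pt g)} {x : Pt g} (h : WF k (u :: d :: (A ++ x :: B)) cl)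
    (hu : u.IsUp c) (hd : d.IsDown c) (hx : x.IsUp c) (he : x.arc = d.arc) :
    WF (k + 1) (A ++ ⟨c, true, u.arc, u.word ++ x.word⟩ :: B) cl where
  skel := by
    have hs : Skel k ((true, u.arc, c) :: (false, d.arc, c) :: (true, d.arc, c) ::
        (A ++ B).map Pt.skel) := by
      refine h.skel.perm ?_
      have e1 : (true, u.arc, c) = u.skel := by simp [Pt.skel, hu.1, hu.2]
      have e2 : (false, d.arc, c) = d.skel := by simp [Pt.skel, hd.1, hd.2]
      have e3 : (true, d.arc, c) = x.skel := by simp [Pt.skel, hx.1, hx.2, he]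
      rw [e1, e2, e3, ← List.map_cons, ← List.map_cons, ← List.map_cons]
      exact ((List.perm_middle.cons _).cons _).map _
    refine (hs.join.mono (by omega)).perm ?_
    rw [List.map_append, List.map_append, List.map_cons]
    exact List.perm_middle.symm
  labels p hp i hi := by
    simp only [List.mem_append, List.mem_cons] at hp
    rcases hp with hp | rfl | hp
    · exact (h.labels p (by simp [hp]) i hi).trans (by omega)
    · rw [crossLabels_append, List.mem_append] at hi
      rcases hi with hi | hi
      · exact (h.labels u (by simp) i hi).trans (by omega)
      · exact (h.labels x (by simp) i hi).trans (by omega)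
    · exact (h.labels p (by simp [hp]) i hi).trans (by omega)
  nodup := h.nodup
  fresh c hc j hj := (h.fresh c hc j hj).trans (by omega)
  closed_labels c hc i hi := (h.closed_labels c hc i hi).trans (by omega)
  disjoint y hy p hp hup := by
    simp only [List.mem_append, List.mem_cons] at hp
    rcases hp with hp | rfl | hp
    · exact h.disjoint y hy p (by simp [hp]) hup
    · exact h.disjoint y hy u (by simp) hu.1
    · exact h.disjoint y hy p (by simp [hp]) hup

theorem WF.perm (h : WF k l cl) (hl : l.Perm r) : WF k r cl where
  skel := h.skel.perm (hl.map _)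
  labels p hp := h.labels p (hl.mem_iff.2 hp)
  nodup := h.nodup
  fresh := h.fresh
  closed_labels := h.closed_labels
  disjoint c hc p hp := h.disjoint c hc p (hl.mem_iff.2 hp)

/-- A cap on two ends that are neighbours. -/
theorem Tracks.cap {P : Piece g} {p₁ p₂ : Pt g} (h : WF k (l ++ p₁ :: p₂ :: r) cl)
    (hcl : cl.map Prod.snd = linkCode closed) (hu : u.IsUp c) (hd : d.IsDown c)
    (hP : P = .capR c ∧ p₁ = d ∧ p₂ = u ∨ P = .capL c ∧ p₁ = u ∧ p₂ = d)
    (ht : Tracks q z ⟨l ++ p₁ :: p₂ :: r, closed⟩ cl v) :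
    ∃ cl', WF (k + 1) (State.join u d (l ++ r) closed).pts cl' ∧
      cl'.map Prod.snd = linkCode (State.join u d (l ++ r) closed).closed ∧
      Tracks q z (State.join u d (l ++ r) closed) cl' (Layer.eval q z (l.length, P) v) := by
  have hperm : (l ++ p₁ :: p₂ :: r).Perm (u :: d :: (l ++ r)) := by
    rcases hP with ⟨-, rfl, rfl⟩ | ⟨-, rfl, rfl⟩
    · exact (perm_two_front _ _ _ _).trans (.swap _ _ _)
    · exact perm_two_front _ _ _ _
  have h' := h.perm hperm
  have hst := alphaStrands_perm hperm
  rcases c with _ | c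
  · obtain ⟨κ, hκ, hv⟩ := ht
    obtain ⟨κ₀, hκ₀, key⟩ : ∃ κ₀ : K, IsMono q κ₀ ∧ ∀ s, Layer.eval q z (l.length, P) v s = κ₀ *
        amp q (fun X => κ * systemForm (q ^ 2) (fun c => (z c)⁻¹) cl (alphaStrands
          (l ++ p₁ :: p₂ :: r)) ((base K d.arc - transport (q ^ 2) (fun c => (z c)⁻¹) u.word
            (base K u.arc)) :: X)) 0 0 ((l ++ r).map (Pt.col (q ^ 2) fun c => (z c)⁻¹)) s := by
      rcases hP with ⟨rfl, rfl, rfl⟩ | ⟨rfl, rfl, rfl⟩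
      · simp only [List.map_append, List.map_cons, col_of_up hu, col_of_down hd] at hv
        refine ⟨_, (IsMono.neg_one_pow (downs (l.map (Pt.col (q ^ 2) fun c => (z c)⁻¹)))).mul
          (IsMono.zpow (charge (l.map (Pt.col (q ^ 2) fun c => (z c)⁻¹)) - 1)), fun s => ?_⟩
        have := layer_eval_capR (z := z) (isAlternating_mul isAlternating_systemForm κ) hv s
        rw [List.length_map] at this
        rw [this, List.map_append]
      · simp only [List.map_append, List.map_cons, col_of_up hu, col_of_down hd] at hv
        refine ⟨_, (IsMono.neg_one_pow (downs (l.map (Pt.col (q ^ 2) fun c => (z c)⁻¹)))).mul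
          (IsMono.zpow (charge (l.map (Pt.col (q ^ 2) fun c => (z c)⁻¹)) + 1)), fun s => ?_⟩
        have := layer_eval_capL (z := z) (isAlternating_mul isAlternating_systemForm κ) hv s
        rw [List.length_map] at this
        rw [this, List.map_append]
    rw [alphaStrands_cons_of_up hu, alphaStrands_cons_of_down hd.1] at hst
    -- If the two ends belong to one strand, the cap closes a component and the inserted row is its
    -- closing relation. Otherwise it joins two strands and the row eliminates the first arc of the
    -- second one.
    by_cases he : u.arc = d.arc
    · refine ⟨cl ++ [(u.arc, u.word)], ?_⟩
      rw [State.join, if_pos he]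
      refine ⟨(h'.close hu hd he).2, by
        rw [List.map_append, hcl]; simp [linkCode, hu.2], ?_⟩
      obtain ⟨δ, hδ⟩ := exists_sign_systemForm_perm (K := K) (τ := q ^ 2) (ζ := fun c => (z c)⁻¹)
        (List.Perm.refl cl) hst
      obtain ⟨δ', hδ'⟩ := systemForm_close (K := K) (τ := q ^ 2) (ζ := fun c => (z c)⁻¹)
        (cl := cl) (st := alphaStrands (l ++ r)) (a := u.arc) (w := u.word)
      refine ⟨κ₀ * κ * ((δ : ℤ) : K) * ((δ' : ℤ) : K),
        ((hκ₀.mul hκ).mul (.sign δ)).mul (.sign δ'), fun s => ?_⟩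
      rw [key s, ← amp_mul]
      congr 1
      funext X
      rw [hδ, ← he, hδ']
      ring
    · obtain ⟨A, B, x, hrest, hx, hxd, hall, hjoin⟩ := exists_join h'.skel hu hd he closed
      rw [hrest] at hst h' key
      rw [hrest] at hjoin ⊢
      rw [hjoin]
      refine ⟨cl, h'.join hu hd hx hxd, hcl, ?_⟩
      have hne : ∀ y ∈ cl ++ alphaStrands (A ++ B), y.1 ≠ d.arc := by
        intro y hy
        rcases List.mem_append.1 hy with hy | hy
        · rw [← hxd]
          exact fun e => h'.disjoint y hy x (by simp) hx.1 e.symm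
        · obtain ⟨p, hp, -, rfl⟩ := exists_of_mem_alphaStrands hy
          exact hall p hp
      have h1 : (alphaStrands (A ++ x :: B)).Perm ((d.arc, x.word) :: alphaStrands (A ++ B)) := by
        have := alphaStrands_perm (List.perm_middle (l₁ := A) (l₂ := B) (a := x))
        rwa [alphaStrands_cons_of_up hx, hxd] at this
      have h2 : (alphaStrands (A ++ ⟨none, true, u.arc, u.word ++ x.word⟩ :: B)).Perm
          ((u.arc, u.word ++ x.word) :: alphaStrands (A ++ B)) := by
        have := alphaStrands_perm (List.perm_middle (l₁ := A) (l₂ := B)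
          (a := ⟨none, true, u.arc, u.word ++ x.word⟩))
        rwa [alphaStrands_cons_of_up ⟨rfl, rfl⟩] at this
      obtain ⟨δ, hδ⟩ := exists_sign_systemForm_perm (K := K) (τ := q ^ 2) (ζ := fun c => (z c)⁻¹)
        (List.Perm.refl cl) (hst.trans (h1.cons _))
      obtain ⟨δ', hδ'⟩ := systemForm_join (K := K) (τ := q ^ 2) (ζ := fun c => (z c)⁻¹)
        (cl := cl) (st := alphaStrands (A ++ B)) (w := u.word) (w' := x.word) he hne
      obtain ⟨δ'', hδ''⟩ := exists_sign_systemForm_perm (K := K) (τ := q ^ 2)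
        (ζ := fun c => (z c)⁻¹) (List.Perm.refl cl) h2.symm
      refine ⟨κ₀ * κ * ((δ : ℤ) : K) * ((δ' : ℤ) : K) * ((δ'' : ℤ) : K),
        (((hκ₀.mul hκ).mul (.sign δ)).mul (.sign δ')).mul (.sign δ''), fun s => ?_⟩
      have hfix := fun (C : List (Pt g)) (hC : ∀ p ∈ C, p ∈ A ++ B) =>
        map_cols_subst (K := K) (τ := q ^ 2) (ζ := fun c => (z c)⁻¹) (pts := C)
        (b := Sum.inl d.arc)
        (f := transport (q ^ 2) (fun c => (z c)⁻¹) u.word (base K u.arc)) fun p hp =>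
          ⟨by simpa using hall p (hC p hp), by simp⟩
      -- The elimination affects only the column of `x`, the upper end of the strand of `d`; it
      -- becomes the end of the concatenated strand.
      have hcols : (A ++ ⟨none, true, u.arc, u.word ++ x.word⟩ :: B).map
          (Pt.col (q ^ 2) fun c => (z c)⁻¹) = ((A ++ x :: B).map
            (Pt.col (q ^ 2) fun c => (z c)⁻¹)).map (Col.map (subst (Sum.inl d.arc)
              (transport (q ^ 2) (fun c => (z c)⁻¹) u.word (base K u.arc)))) := by
        rw [List.map_append, List.map_append, List.map_append, List.map_cons, List.map_cons,
          List.map_cons, hfix A fun p hp => by simp [hp], hfix B fun p hp => by simp [hp],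
          col_of_up hx, col_of_up ⟨rfl, rfl⟩, Col.map, linearMap_transport _ _ _ _
            (fun c _ => subst_single_ne (by simp) _ _), hxd, subst_single_self, transport_append]
      rw [key s, hcols, ← amp_map, ← amp_mul]
      congr 1
      funext X
      rw [hδ, hδ', hδ'']
      ring
  · have hcu : u.color ≠ none := by simp [hu.2]
    have hcd : d.color ≠ none := by simp [hd.2]
    rw [alphaStrands_cons_of_color hcu, alphaStrands_cons_of_color hcd] at hst
    have key : ∀ F : List ((ArcName g ⊕ ℕ) →₀ K) → K, IsAlternating F →
        (∀ s, v s = amp q F 0 0 ((l ++ p₁ :: p₂ :: r).map (Pt.col (q ^ 2) fun c => (z c)⁻¹)) s) →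
        ∀ s, Layer.eval q z (l.length, P) v s = 1 * amp q F 0 0
          ((l ++ r).map (Pt.col (q ^ 2) fun c => (z c)⁻¹)) s := by
      intro F hF hv s
      have h1 : p₁.color ≠ none ∧ p₂.color ≠ none := by
        rcases hP with ⟨-, rfl, rfl⟩ | ⟨-, rfl, rfl⟩ <;> simp [hcu, hcd]
      simp only [List.map_append, List.map_cons, col_of_color h1.1, col_of_color h1.2] at hv
      have := layer_eval_cap_some (z := z) (P := P) (c := c) (by
        rcases hP with ⟨rfl, -⟩ | ⟨rfl, -⟩ <;> simp) hv s
      rw [List.length_map] at this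
      rw [this, one_mul, List.map_append]
    by_cases he : u.arc = d.arc
    · refine ⟨cl, ?_⟩
      rw [State.join, if_pos he]
      refine ⟨(h'.close hu hd he).1, by rw [hcl]; simp [linkCode, hu.2], ?_⟩
      exact Tracks.of_amp .one (exists_sign_systemForm_perm (.refl _) hst) key ht
    · obtain ⟨A, B, x, hrest, hx, hxd, hall, hjoin⟩ := exists_join h'.skel hu hd he closed
      rw [hrest] at hst h' key
      rw [hrest] at hjoin ⊢
      rw [hjoin]
      refine ⟨cl, h'.join hu hd hx hxd, hcl, ?_⟩
      have hcx : x.color ≠ none := by simp [hx.2]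
      refine Tracks.of_amp .one (exists_sign_systemForm_perm (.refl _) (hst.trans ?_))
        (fun F hF hv s => ?_) ht
      · refine (alphaStrands_perm List.perm_middle).trans (List.Perm.trans ?_
          (alphaStrands_perm List.perm_middle.symm))
        rw [alphaStrands_cons_of_color hcx, alphaStrands_cons_of_color (by simp)]
      · rw [key F hF hv s]
        simp [Pt.col, hx.2]

theorem WF.swap {p p' p₁ p₂ : Pt g} (h : WF k (l ++ p :: p' :: r) cl) (e₁ : p₁.skel = p'.skel)
    (e₂ : p₂.skel = p.skel) (h₁ : ∀ i ∈ crossLabels p₁.word, i < k + 1)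
    (h₂ : ∀ i ∈ crossLabels p₂.word, i < k + 1) : WF (k + 1) (l ++ p₁ :: p₂ :: r) cl := by
  refine h.of_perm ?_ fun x hx => ?_
  · simp only [List.map_append, List.map_cons, e₁, e₂]
    exact List.Perm.append_left _ (.swap _ _ _)
  · simp only [List.mem_append, List.mem_cons] at hx
    rcases hx with hx | rfl | rfl | hx
    · exact fun i hi => (h.labels x (by simp [hx]) i hi).trans (by omega)
    · exact h₁
    · exact h₂
    · exact fun i hi => (h.labels x (by simp [hx]) i hi).trans (by omega)

theorem WF.labels_meet {p : Pt g} (h : WF k l cl) (hp : p ∈ l) {x : Letter g}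
    (hx : ∀ i ∈ x.labels, i < k + 1) : ∀ i ∈ crossLabels (p.meet x).word, i < k + 1 := by
  intro i hi
  simp only [Pt.meet, crossLabels_append, List.mem_append] at hi
  rcases hi with hi | hi
  · exact (h.labels p hp i hi).trans (by omega)
  · exact hx i (by simpa [crossLabels] using hi)

theorem WF.labels_succ {p : Pt g} (h : WF k l cl) (hp : p ∈ l) :
    ∀ i ∈ crossLabels p.word, i < k + 1 :=
  fun i hi => (h.labels p hp i hi).trans (by omega)

theorem WF.cup (h : WF k (l ++ r) cl) (c : Color g) (b : Bool) :
    WF (k + 1) (l ++ (cupPts c k b ++ r)) cl where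
  skel := by
    refine (h.skel.cup c).perm ?_
    have : ((true, .inl k, c) :: (false, .inl k, c) :: (l ++ r).map Pt.skel) =
        ((⟨c, true, .inl k, []⟩ :: ⟨c, false, .inl k, []⟩ :: (l ++ r) : List (Pt g)).map
          Pt.skel) := rfl
    rw [this]
    refine List.Perm.map _ ?_
    cases b
    · exact ((perm_two_front _ _ _ _).trans (.swap _ _ _)).symm
    · exact (perm_two_front _ _ _ _).symm
  labels p hp i hi := by
    simp only [cupPts, List.mem_append, List.mem_cons, List.not_mem_nil, or_false] at hp
    rcases hp with hp | (rfl | rfl) | hp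
    · exact (h.labels p (by simp [hp]) i hi).trans (by omega)
    · simp [crossLabels] at hi
    · simp [crossLabels] at hi
    · exact (h.labels p (by simp [hp]) i hi).trans (by omega)
  nodup := h.nodup
  fresh c hc j hj := (h.fresh c hc j hj).trans (by omega)
  closed_labels c hc i hi := (h.closed_labels c hc i hi).trans (by omega)
  disjoint y hy p hp hup := by
    have hk : (.inl k : ArcName g) ≠ y.1 := fun e => lt_irrefl k (h.fresh y hy k e.symm)
    simp only [cupPts, List.mem_append, List.mem_cons, List.not_mem_nil, or_false] at hp
    rcases hp with hp | (rfl | rfl) | hp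
    · exact h.disjoint y hy p (by simp [hp]) hup
    · exact hk
    · exact hk
    · exact h.disjoint y hy p (by simp [hp]) hup

/-- Well-formed states with tracked amplitudes are preserved by a layer. -/
theorem Tracks.step {S S' : State g} {ℓ : Layer g} (hs : Step k S ℓ S') (h : WF k S.pts cl)
    (hcl : cl.map Prod.snd = linkCode S.closed) (ht : Tracks q z S cl v) :
    ∃ cl', WF (k + 1) S'.pts cl' ∧ cl'.map Prod.snd = linkCode S'.closed ∧
      Tracks q z S' cl' (Layer.eval q z ℓ v) := by
  have hk : ∀ ε, (∀ i ∈ (Letter.over k ε : Letter g).labels, i < k + 1) ∧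
      ∀ i ∈ (Letter.under k ε : Letter g).labels, i < k + 1 := by simp [Letter.labels]
  have hω : ∀ z' ε, ∀ i ∈ (Letter.omega z' ε : Letter g).labels, i < k + 1 := by
    simp [Letter.labels]
  cases hs with
  | pos l r p p' closed hp hp' =>
    exact ⟨cl, h.swap rfl rfl (h.labels_meet (by simp) (hk _).2) (h.labels_meet (by simp) (hk _).1),
      hcl, ht.pos h hp hp'⟩
  | neg l r p p' closed hp hp' =>
    exact ⟨cl, h.swap rfl rfl (h.labels_meet (by simp) (hk _).1) (h.labels_meet (by simp) (hk _).2),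
      hcl, ht.neg h hp hp'⟩
  | virt c d l r p p' closed hp hp' =>
    exact ⟨cl, h.swap rfl rfl (h.labels_succ (by simp)) (h.labels_succ (by simp)),
      hcl, ht.virt hp hp'⟩
  | overPos z' l r p p' closed hp hp' =>
    exact ⟨cl, h.swap rfl rfl (h.labels_meet (by simp) (hω _ _)) (h.labels_succ (by simp)),
      hcl, ht.overPos hp hp'⟩
  | overNeg z' l r p p' closed hp hp' =>
    exact ⟨cl, h.swap rfl rfl (h.labels_succ (by simp)) (h.labels_meet (by simp) (hω _ _)),
      hcl, ht.overNeg hp hp'⟩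
  | cupR c l r closed => exact ⟨cl, h.cup c true, hcl, ht.cup h (.inl ⟨rfl, rfl⟩)⟩
  | cupL c l r closed => exact ⟨cl, h.cup c false, hcl, ht.cup h (.inr ⟨rfl, rfl⟩)⟩
  | capR c l r d u closed hd hu => exact ht.cap h hcl hu hd (.inl ⟨rfl, rfl, rfl⟩)
  | capL c l r u d closed hu hd => exact ht.cap h hcl hu hd (.inr ⟨rfl, rfl, rfl⟩)

theorem Tracks.run {W : Word g} {S S' : State g} (hs : State.run S k W = some S')
    (h : WF k S.pts cl) (hcl : cl.map Prod.snd = linkCode S.closed) (ht : Tracks q z S cl v) :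
    ∃ k' cl', WF k' S'.pts cl' ∧ cl'.map Prod.snd = linkCode S'.closed ∧
      Tracks q z S' cl' (W.foldl (fun v ℓ => Layer.eval q z ℓ v) v) := by
  induction W generalizing S k cl v with
  | nil =>
    obtain rfl : S = S' := by simpa [State.run] using hs
    exact ⟨k, cl, h, hcl, ht⟩
  | cons ℓ W ih =>
    simp only [State.run, Option.bind_eq_some_iff] at hs
    obtain ⟨S₁, h1, h2⟩ := hs
    obtain ⟨cl₁, h3, h4, h5⟩ := Tracks.step (step_of_step_eq h1) h hcl ht
    exact ih h2 h3 h4 h5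

/-- The value of the `U_q(gl(1|1))` functor on a link is the determinant of its code. -/
theorem word_eval_eq_codeDet (q : Kˣ) (z : Palette g → Kˣ) {W : Word g}
    {cs : List (Color g × List (Letter g))} (hW : W.IsLink cs) :
    ∃ (ε : ℤˣ) (m : ℤ), Word.eval q z W = ((ε : ℤ) : K) * ((q ^ m : Kˣ) : K) *
      codeDet (q ^ 2) (fun c => (z c)⁻¹) (linkCode cs) := by
  obtain ⟨k', cl', h1, h2, κ, hκ, hv⟩ := Tracks.run (q := q) (z := z) (cl := [])
    (v := Finsupp.single [] 1) hW
    ⟨⟨by simp, by simp, by simp, by simp⟩, by simp, by simp, by simp, by simp, by simp⟩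
    (by simp [linkCode])
    -- At the bottom there are no points and no relations, and the empty determinant is `1`.
    ⟨1, .one, fun s => by
      cases s <;> simp [amp, alphaStrands, systemForm, systemGens, ldet_nil]⟩
  -- At the top the form has no open slots and is the determinant of the closed components. Their
  -- names are distinct, so they may be replaced by positions.
  obtain ⟨δ, hδ⟩ := (signEq_codeDet_systemDet (τ := q ^ 2) (ζ := fun c => (z c)⁻¹) h1.nodup
    (h2 ▸ List.Perm.refl _ : (cl'.map Prod.snd).Perm (linkCode cs))).symm
  obtain ⟨ε, m, h⟩ := hκ.mul (IsMono.sign δ)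
  refine ⟨ε, m, ?_⟩
  have := hv []
  rw [Word.eval, this, ← h]
  simp only [alphaStrands, List.filter_nil, List.map_nil, amp, systemForm_nil, hδ]
  ring

end Caps

end PrismaticLink

namespace PrismaticLink

/-! ### Cutting a code into strands -/

section FormPerm

variable {α : Type*} [DecidableEq α]

theorem prod_formPerm_of_notMem {cs : List (List α)} {p : α} (hp : p ∉ cs.flatten) :
    (cs.map List.formPerm).prod p = p := by
  induction cs with
  | nil => rfl
  | cons c cs ih =>
    simp only [List.flatten_cons, List.mem_append, not_or] at hp
    rw [List.map_cons, List.prod_cons, Equiv.Perm.mul_apply, ih hp.2,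
      List.formPerm_apply_of_notMem hp.1]

theorem prod_formPerm_of_mem {cs : List (List α)} (h : cs.flatten.Nodup) {c : List α}
    (hc : c ∈ cs) {p : α} (hp : p ∈ c) : (cs.map List.formPerm).prod p = c.formPerm p := by
  induction cs with
  | nil => simp at hc
  | cons c' cs ih =>
    rw [List.flatten_cons, List.nodup_append] at h
    rw [List.map_cons, List.prod_cons, Equiv.Perm.mul_apply]
    rcases List.mem_cons.1 hc with rfl | hc
    · rw [prod_formPerm_of_notMem fun hp' => h.2.2 _ hp _ hp' rfl]
    · rw [ih h.2.1 hc, List.formPerm_apply_of_notMem]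
      exact fun hp' => h.2.2 _ hp' _ (List.mem_flatten.2
        ⟨c, hc, List.formPerm_apply_mem_of_mem hp⟩) rfl

theorem map_formPerm {l : List α} (h : l.Nodup) : l.map l.formPerm = l.rotate 1 := by
  refine List.ext_getElem (by simp) fun i h1 h2 => ?_
  rw [List.getElem_map, List.formPerm_apply_getElem l h i (by simpa using h1),
    List.getElem_rotate]

end FormPerm

section Chain

variable {K : Type*} [CommRing K] {g : ℕ} {N : Type*} {τ : Kˣ} {ζ : Palette g → Kˣ}

variable (τ ζ) in
/-- The relations that join the strands `W y`, for `y` in a list, to a strand that ends with `v`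
and close them up to a component with first arc `a`. -/
noncomputable def chainRels (W : N → List (Letter g)) (a : N) :
    ((N ⊕ ℕ) →₀ K) → List N → List ((N ⊕ ℕ) →₀ K)
  | v, [] => [base K a - v]
  | v, y :: ys => (base K y - v) :: chainRels W a (transport τ ζ (W y) (base K y)) ys

theorem chainRels_eq (W : N → List (Letter g)) (a p : N) (ys : List N) :
    chainRels τ ζ W a (transport τ ζ (W p) (base K p)) ys =
      List.zipWith (fun x y => base K y - transport τ ζ (W x) (base K x)) (p :: ys) (ys ++ [a]) := by
  induction ys generalizing p with
  | nil => rfl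
  | cons y ys ih => simp [chainRels, ih]

theorem map_subst_chainRels {W : N → List (Letter g)} {a b : N} {f v : (N ⊕ ℕ) →₀ K} {ys : List N}
    (hab : a ≠ b) (hys : b ∉ ys) :
    (chainRels τ ζ W a v ys).map (subst (Sum.inl b) f) =
      chainRels τ ζ W a (subst (Sum.inl b) f v) ys := by
  induction ys generalizing v with
  | nil => simp [chainRels, subst_single_ne (show (Sum.inl a : N ⊕ ℕ) ≠ Sum.inl b by simpa using hab)]
  | cons y ys ih =>
    simp only [List.mem_cons, not_or] at hys
    have hy : (Sum.inl y : N ⊕ ℕ) ≠ Sum.inl b := by simpa using fun h => hys.1 h.symm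
    rw [chainRels, List.map_cons, ih hys.2, map_sub, subst_single_ne hy, chainRels,
      subst_of_eq_zero (v := transport τ ζ (W y) (base K y))
        (transport_apply_eq_zero (by simp) (by simp [hy]))]

/-- Each relation of the chain eliminates the first arc of the next strand and thereby concatenates
its word; the last relation closes the component. The rows `X` must not involve the eliminated arcs
in order to come through unchanged. -/
theorem systemForm_chain {W : N → List (Letter g)} {a : N} {w : List (Letter g)} {ys : List N}
    {cl st : List (N × List (Letter g))} (hn : (a :: ys).Nodup)
    (hst : ∀ c ∈ cl ++ st, c.1 ∉ ys) : ∃ δ : ℤˣ, ∀ X : List ((N ⊕ ℕ) →₀ K),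
      (∀ x ∈ X, ∀ y ∈ ys, x (Sum.inl y) = 0) →
      systemForm τ ζ cl ((a, w) :: (ys.map (fun y => (y, W y)) ++ st))
        (chainRels τ ζ W a (transport τ ζ w (base K a)) ys ++ X) =
      ((δ : ℤ) : K) * systemForm τ ζ (cl ++ [(a, w ++ ys.flatMap W)]) st X := by
  induction ys generalizing w with
  | nil =>
    obtain ⟨δ, hδ⟩ := systemForm_close (K := K) (τ := τ) (ζ := ζ) (cl := cl) (st := st) (a := a)
      (w := w)
    exact ⟨δ, fun X _ => by simpa [chainRels] using hδ X⟩
  | cons y ys ih =>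
    simp only [List.nodup_cons, List.mem_cons, not_or] at hn
    obtain ⟨⟨hay, ha⟩, hy, hys⟩ := hn
    obtain ⟨δ, hδ⟩ := systemForm_join (K := K) (τ := τ) (ζ := ζ) (cl := cl)
      (st := ys.map (fun y => (y, W y)) ++ st) (w := w) (w' := W y) hay (by
        intro c hc
        simp only [List.mem_append, List.mem_map] at hc
        rcases hc with hc | ⟨x, hx, rfl⟩ | hc
        · exact fun e => hst c (by simp [hc]) (by simp [e])
        · exact fun e => hy (e ▸ hx)
        · exact fun e => hst c (by simp [hc]) (by simp [e]))
    obtain ⟨δ', hδ'⟩ := ih (w := w ++ W y) (by simp [ha, hys])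
      (fun c hc h => hst c hc (by simp [h]))
    refine ⟨δ * δ', fun X hX => ?_⟩
    have hX' : X.map (subst (Sum.inl y) (transport τ ζ w (base K a))) = X := by
      conv_rhs => rw [← List.map_id X]
      exact List.map_congr_left fun x hx => subst_of_eq_zero (hX x hx y (by simp))
    rw [List.map_cons, chainRels, List.cons_append, List.cons_append, hδ, List.map_append,
      map_subst_chainRels hay hy, hX', linearMap_transport _ _ _ _
        (fun c _ => subst_single_ne (by simp) _ _), subst_single_self, ← transport_append,
      hδ' X fun x hx z hz => hX x hx z (by simp [hz])]
    simp only [List.flatMap_cons, List.append_assoc]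
    push_cast
    ring

theorem chainRels_apply_of_notMem {W : N → List (Letter g)} {a b : N} {v : (N ⊕ ℕ) →₀ K}
    {ys : List N} (hab : a ≠ b) (hys : b ∉ ys) (hv : v (Sum.inl b) = 0) :
    ∀ x ∈ chainRels τ ζ W a v ys, x (Sum.inl b) = 0 := by
  induction ys generalizing v with
  | nil => simp [chainRels, hab, hv]
  | cons y ys ih =>
    simp only [List.mem_cons, not_or] at hys
    have hy : y ≠ b := Ne.symm hys.1
    refine List.forall_mem_cons.2 ⟨by simp [hy, hv], ih hys.2 ?_⟩
    exact transport_apply_eq_zero (by simp) (by simp [hy])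

/-- The chains can be processed independently, because strands of different components have
different names. -/
theorem systemForm_strands {W : N → List (Letter g)} {cs : List (N × List N)}
    {cl : List (N × List (Letter g))} (hn : (cs.flatMap fun c => c.1 :: c.2).Nodup)
    (hcl : ∀ c ∈ cl, c.1 ∉ cs.flatMap fun c => c.1 :: c.2) : SignEq
      (systemForm τ ζ cl (cs.flatMap fun c => (c.1 :: c.2).map fun y => (y, W y))
        (cs.flatMap fun c => chainRels τ ζ W c.1 (transport τ ζ (W c.1) (base K c.1)) c.2))
      (systemDet τ ζ (cl ++ cs.map fun c => (c.1, (c.1 :: c.2).flatMap W))) := by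
  induction cs generalizing cl with
  | nil => simpa [systemForm_nil] using SignEq.refl _
  | cons c cs ih =>
    rw [List.flatMap_cons, List.nodup_append] at hn
    obtain ⟨hc, hcs, hd⟩ := hn
    obtain ⟨δ, hδ⟩ := systemForm_chain (K := K) (τ := τ) (ζ := ζ) (W := W) (w := W c.1) (cl := cl)
      (st := cs.flatMap fun c => (c.1 :: c.2).map fun y => (y, W y)) hc (by
        intro x hx hx'
        rcases List.mem_append.1 hx with hx | hx
        · exact hcl x hx (by simp [hx'])
        · simp only [List.mem_flatMap, List.mem_map] at hx
          obtain ⟨c', hc', y, hy, rfl⟩ := hx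
          exact hd y (by simp [hx']) y (List.mem_flatMap.2 ⟨c', hc', hy⟩) rfl)
    have ih' := ih (cl := cl ++ [(c.1, W c.1 ++ c.2.flatMap W)]) hcs (by
      intro x hx
      rcases List.mem_append.1 hx with hx | hx
      · exact fun h => hcl x hx (by simp only [List.flatMap_cons, List.mem_append]; exact Or.inr h)
      · rw [List.mem_singleton.1 hx]
        exact fun h => hd c.1 (by simp) c.1 h rfl)
    refine SignEq.trans ⟨δ, ?_⟩ (SignEq.trans ih' (SignEq.of_eq (by simp)))
    rw [List.flatMap_cons, List.flatMap_cons, ← hδ]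
    · rfl
    · intro x hx y hy
      obtain ⟨c', hc', hx⟩ := List.mem_flatMap.1 hx
      have hy' : y ∉ c'.1 :: c'.2 := fun h =>
        hd y (by simp [hy]) y (List.mem_flatMap.2 ⟨c', hc', h⟩) rfl
      simp only [List.mem_cons, not_or] at hy'
      exact chainRels_apply_of_notMem (Ne.symm hy'.1) hy'.2
        (transport_apply_eq_zero (by simp) (by simp [Ne.symm hy'.1])) x hx

variable [DecidableEq N]

/-- The relations of a cyclic sequence of strands. -/
theorem chainRels_eq_map {W : N → List (Letter g)} {a : N} {ys : List N} (hn : (a :: ys).Nodup) :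
    chainRels τ ζ W a (transport τ ζ (W a) (base K a)) ys = (a :: ys).map fun x =>
      base K ((a :: ys).formPerm x) - transport τ ζ (W x) (base K x) := by
  have h : ys ++ [a] = (a :: ys).map (a :: ys).formPerm := by
    rw [map_formPerm hn]
    simp
  rw [chainRels_eq, h, List.zipWith_map_right, List.zipWith_self]

/-- The determinant of a code whose components are cut into strands. -/
theorem signEq_codeDet_strands {W : N → List (Letter g)} {cs : List (List N)}
    (hn : cs.flatten.Nodup) (hne : [] ∉ cs) :
    SignEq (codeDet τ ζ (cs.map fun c => c.flatMap W))
      (systemForm τ ζ [] (cs.flatten.map fun x => (x, W x)) (cs.flatten.map fun x =>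
        base K ((cs.map List.formPerm).prod x) - transport τ ζ (W x) (base K x))) := by
  obtain ⟨cs', rfl⟩ : ∃ cs' : List (N × List N), cs'.map (fun c => c.1 :: c.2) = cs := by
    clear hn
    induction cs with
    | nil => exact ⟨[], rfl⟩
    | cons c cs ih =>
      simp only [List.mem_cons, not_or] at hne
      obtain ⟨cs', rfl⟩ := ih hne.2
      obtain ⟨a, ys, rfl⟩ := List.exists_cons_of_ne_nil (Ne.symm hne.1)
      exact ⟨(a, ys) :: cs', rfl⟩
  have hflat : (cs'.map fun c => c.1 :: c.2).flatten = cs'.flatMap fun c => c.1 :: c.2 := rfl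
  have h1 := systemForm_strands (K := K) (τ := τ) (ζ := ζ) (W := W) (cl := []) (cs := cs')
    (hflat ▸ hn) (by simp)
  have h2 : (cs'.map fun c => c.1 :: c.2).flatten.map (fun x =>
      base K (((cs'.map fun c => c.1 :: c.2).map List.formPerm).prod x) -
        transport τ ζ (W x) (base K x)) =
      cs'.flatMap fun c => chainRels τ ζ W c.1 (transport τ ζ (W c.1) (base K c.1)) c.2 := by
    rw [hflat, List.map_flatMap]
    refine List.flatMap_congr fun c hc => ?_
    have hcn : (c.1 :: c.2).Nodup := (List.nodup_flatten.1 hn).1 _ (List.mem_map_of_mem hc)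
    rw [chainRels_eq_map hcn]
    refine List.map_congr_left fun x hx => ?_
    rw [prod_formPerm_of_mem hn (List.mem_map_of_mem hc) hx]
  have h3 : (cs'.map fun c => c.1 :: c.2).flatten.map (fun x => (x, W x)) =
      cs'.flatMap fun c => (c.1 :: c.2).map fun y => (y, W y) := by
    rw [hflat, List.map_flatMap]
  rw [h2, h3]
  refine SignEq.trans (signEq_codeDet_systemDet ?_ ?_) h1.symm
  · rw [List.nil_append, List.map_map]
    have : ((cs'.map fun c => c.1 :: c.2).flatten).Nodup := hn
    clear h1 h2 h3 hne hflat hn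
    induction cs' with
    | nil => simp
    | cons c cs' ih =>
      rw [List.map_cons, List.flatten_cons, List.nodup_append] at this
      rw [List.map_cons, List.nodup_cons]
      refine ⟨fun h => ?_, ih this.2.1⟩
      obtain ⟨c', hc', he⟩ := List.mem_map.1 h
      exact this.2.2 c.1 (by simp) c.1 (List.mem_flatten.2 ⟨_, List.mem_map_of_mem hc', by
        simp only [Function.comp] at he
        simp [← he]⟩) rfl
  · rw [List.nil_append, List.map_map, List.map_map]
    exact List.Perm.refl _

end Chain

/-- The closing relation of a component without letters is `base - base = 0`. -/
theorem codeDet_eq_zero_of_nil_mem {K : Type*} [CommRing K] {g : ℕ} {τ : Kˣ} {ζ : Palette g → Kˣ}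
    {C : Code g} (hC : [] ∈ C) : codeDet τ ζ C = 0 := by
  obtain ⟨c, hc, hc'⟩ : ∃ c ∈ C.zipIdx.map Prod.swap, c.2 = [] := by
    have := map_snd_swap_zipIdx C 0
    rw [← this] at hC
    obtain ⟨c, hc, h⟩ := List.mem_map.1 hC
    exact ⟨c, hc, h⟩
  obtain ⟨A, B, hAB⟩ := List.append_of_mem hc
  rw [codeDet, systemDet, hAB, List.flatMap_append, List.flatMap_cons, componentRels, hc',
    transport_nil, sub_self, List.cons_append]
  exact (isAlternating_ldet _).zero _ _

theorem ldet_map_eq_det {K ι I : Type*} [CommRing K] [Fintype I] [DecidableEq I] {l : List I}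
    (hn : l.Nodup) (hl : ∀ i, i ∈ l) (f : I → ι) (R : I → ι →₀ K) :
    ldet (l.map f) (l.map R) = (Matrix.of fun i j => R i (f j)).det := by
  rw [ldet_of_length l.length (by simp) (by simp),
    ← Matrix.det_submatrix_equiv_self (hn.getEquivOfForallMemList l hl)]
  congr 1
  ext i j
  simp

end PrismaticLink

namespace PrismaticLink

/-! ### The generalized Alexander polynomial as a determinant of a decorated code -/

section Gap

variable {g : ℕ} (L : VirtualLink)

/-- The letter of a passage, where `κ` names the crossings. -/
def VirtualLink.letter (g : ℕ) (κ : Fin L.n → ℕ) (p : Fin L.n × Bool) : Letter g :=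
  if p.2 then .over (κ p.1) (L.sign p.1) else .under (κ p.1) (L.sign p.1)

/-- The exponent of the crossings with `Ω` on the arc before a passage. -/
def VirtualLink.exponent (p : Fin L.n × Bool) : ℤ :=
  (if p.2 then 0 else -sgn (L.sign p.1)) +
    if (L.next⁻¹ p).2 then sgn (L.sign (L.next⁻¹ p).1) else 0

/-- The sum of the signs of the crossings with `Ω`. -/
def netExp : List (Letter g) → ℤ
  | [] => 0
  | .omega _ ε :: w => sgn ε + netExp w
  | _ :: w => netExp w

/-- The code of `L` with crossings with `Ω` before each passage. -/
def VirtualLink.decorate (κ : Fin L.n → ℕ) (om : Fin L.n × Bool → List (Letter g)) : Code g :=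
  L.comps.map fun c => c.flatMap fun p => om p ++ [L.letter g κ p]

variable {L}

/-- Once all colours have the same value, crossings with `Ω` are seen only through their net
exponent. It therefore suffices to realise exponents on the surface, not particular words. -/
theorem transport_omega {K N : Type*} [CommRing K] {τ ω : Kˣ} {w : List (Letter g)}
    (hw : ∀ ℓ ∈ w, ℓ.isClassical = false) (v : (N ⊕ ℕ) →₀ K) :
    transport τ (fun _ => ω) w v = ((ω ^ netExp w : Kˣ) : K) • v := by
  induction w generalizing v with
  | nil => simp [netExp]
  | cons ℓ w ih =>
    obtain ⟨h1, h2⟩ := List.forall_mem_cons.1 hw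
    rcases ℓ with ⟨c, ε⟩ | ⟨c, ε⟩ | ⟨z, ε⟩
    · simp [Letter.isClassical] at h1
    · simp [Letter.isClassical] at h1
    · rw [transport_cons, ih h2]
      simp only [Letter.act, netExp, smul_smul, zpow_add, Units.val_mul]
      rw [mul_comm]

theorem overLabels_omega {w : List (Letter g)} (hw : ∀ ℓ ∈ w, ℓ.isClassical = false) :
    overLabels w = [] := by
  induction w with
  | nil => rfl
  | cons ℓ w ih =>
    obtain ⟨h1, h2⟩ := List.forall_mem_cons.1 hw
    rcases ℓ with ⟨c, ε⟩ | ⟨c, ε⟩ | ⟨z, ε⟩ <;> simp_all [Letter.isClassical, overLabels]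

theorem overRels_omega {K N : Type*} [CommRing K] {τ : Kˣ} {ζ : Palette g → Kˣ}
    {w : List (Letter g)} (hw : ∀ ℓ ∈ w, ℓ.isClassical = false) (v : (N ⊕ ℕ) →₀ K) :
    overRels τ ζ w v = [] := by
  rw [← List.length_eq_zero_iff, length_overRels, overLabels_omega hw, List.length_nil]

theorem next_apply_eq (L : VirtualLink) (p : Fin L.n × Bool) :
    L.next p = (L.comps.map List.formPerm).prod p := rfl

theorem gap_eq_zero_of_nil_mem (h : [] ∈ L.comps) : L.gap = 0 := by
  have : Nonempty (Fin (L.comps.count [])) := ⟨⟨0, List.count_pos_iff.2 h⟩⟩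
  rw [VirtualLink.gap, Matrix.det_fromBlocks_zero₂₁, Matrix.det_zero, mul_zero]

theorem gap_eq_of_nil_notMem (h : [] ∉ L.comps) : L.gap = (1 - L.transfer).det := by
  have : IsEmpty (Fin (L.comps.count [])) := by
    rw [List.count_eq_zero.2 h]
    infer_instance
  rw [VirtualLink.gap, Matrix.det_fromBlocks_zero₂₁, Matrix.det_isEmpty (A := (0 : Matrix
    (Fin (L.comps.count [])) (Fin (L.comps.count [])) LaurentTwo)), mul_one]

variable {K : Type*} [CommRing K] (φ : LaurentTwo →+* K)

/-- The generalized Alexander polynomial, with substitutions for `s` and `t`, is a determinant of a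
decorated code. -/
theorem signEq_codeDet_decorate {κ : Fin L.n → ℕ} (hκ : κ.Injective)
    {om : Fin L.n × Bool → List (Letter g)} (hom : ∀ p, ∀ ℓ ∈ om p, ℓ.isClassical = false)
    (hexp : ∀ p, netExp (om p) = L.exponent p) {s t : Kˣ}
    (hs : Units.map φ.toMonoidHom (mono ((1, 0) : ℤ × ℤ)) = s)
    (ht : Units.map φ.toMonoidHom (mono ((0, 1) : ℤ × ℤ)) = t) :
    SignEq (codeDet (s * t) (fun _ => t) (L.decorate κ om)) (φ L.gap) := by
  -- A component without crossings makes both sides zero: a zero row on the right, a zero closing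
  -- relation on the left.
  by_cases hnil : [] ∈ L.comps
  · rw [gap_eq_zero_of_nil_mem hnil, map_zero]
    exact SignEq.of_eq (codeDet_eq_zero_of_nil_mem (List.mem_map.2 ⟨[], hnil, rfl⟩))
  rw [gap_eq_of_nil_notMem hnil]
  refine SignEq.trans (signEq_codeDet_strands (W := fun p => om p ++ [L.letter g κ p]) L.nodup
    hnil) ?_
  -- the strands in a standard order
  let P : List (Fin L.n × Bool) := (List.finRange L.n).map (fun c => (c, true)) ++
    (List.finRange L.n).map fun c => (c, false)
  have hPn : P.Nodup := by
    refine List.nodup_append.2 ⟨(List.nodup_finRange _).map fun a b h => by simpa using h,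
      (List.nodup_finRange _).map fun a b h => by simpa using h, ?_⟩
    rintro x hx y hy rfl
    obtain ⟨c, -, rfl⟩ := List.mem_map.1 hx
    obtain ⟨c', -, h⟩ := List.mem_map.1 hy
    simp at h
  have hPm : ∀ p, p ∈ P := by
    rintro ⟨c, _ | _⟩ <;> simp [P]
  have hperm : L.comps.flatten.Perm P :=
    (List.perm_ext_iff_of_nodup L.nodup hPn).2 fun p => ⟨fun _ => hPm p, fun _ => L.complete p⟩
  -- The rows are the relation at the end of each strand and the definition of each over-arc. The
  -- columns, given by `f`, are the first arcs of the strands and the over-arcs.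
  let R : (Fin L.n × Bool) ⊕ Fin L.n → ((Fin L.n × Bool) ⊕ ℕ) →₀ K := fun i => match i with
    | .inl p => base K (L.next p) -
        transport (s * t) (fun _ => t) (om p ++ [L.letter g κ p]) (base K p)
    | .inr c => overGen K _ (κ c) - ((t ^ L.exponent (c, true) : Kˣ) : K) • base K (c, true)
  let f : (Fin L.n × Bool) ⊕ Fin L.n → (Fin L.n × Bool) ⊕ ℕ := Sum.map id κ
  let I : List ((Fin L.n × Bool) ⊕ Fin L.n) := P.map .inl ++ (List.finRange L.n).map .inr
  have hI : I.Nodup := by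
    refine List.nodup_append.2 ⟨hPn.map Sum.inl_injective,
      (List.nodup_finRange _).map Sum.inr_injective, ?_⟩
    rintro x hx y hy rfl
    obtain ⟨c, -, rfl⟩ := List.mem_map.1 hx
    obtain ⟨c', -, h⟩ := List.mem_map.1 hy
    simp at h
  have hIm : ∀ i, i ∈ I := by
    rintro (p | c)
    · exact List.mem_append_left _ (List.mem_map_of_mem (hPm p))
    · exact List.mem_append_right _ (List.mem_map_of_mem (by simp))
  have hover : ∀ p, overLabels (om p ++ [L.letter g κ p]) = if p.2 then [κ p.1] else [] := by
    intro p
    rw [overLabels_append, overLabels_omega (hom p), VirtualLink.letter]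
    split_ifs <;> rfl
  have hrels : ∀ p, overRels (s * t) (fun _ => t) (om p ++ [L.letter g κ p]) (base K p) =
      if p.2 then [overGen K _ (κ p.1) - ((t ^ L.exponent p : Kˣ) : K) • base K p] else [] := by
    intro p
    rw [overRels_append, overRels_omega (hom p), VirtualLink.letter, transport_omega (hom p), hexp]
    split_ifs <;> rfl
  have hsys : SignEq (systemForm (s * t) (fun _ => t) []
      (L.comps.flatten.map fun x => (x, om x ++ [L.letter g κ x])) (L.comps.flatten.map fun x =>
        base K ((L.comps.map List.formPerm).prod x) -
          transport (s * t) (fun _ => t) (om x ++ [L.letter g κ x]) (base K x)))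
      (ldet (I.map f) (I.map R)) := by
    have e : ∀ l : List (Fin L.n × Bool), (l.flatMap fun p => if p.2 then [p] else []) =
        l.filter fun p => p.2 := by
      intro l
      induction l with
      | nil => rfl
      | cons a l ih =>
        rw [List.flatMap_cons, ih, List.filter_cons]
        split_ifs <;> rfl
    have e' : (P.filter fun p => p.2) = (List.finRange L.n).map fun c => (c, true) := by
      simp [P, List.filter_append, List.filter_map, Function.comp_def]
    refine signEq_ldet ?_ ?_
    · have : (L.comps.flatten.flatMap fun x => overLabels (om x ++ [L.letter g κ x])).Perm
          ((List.finRange L.n).map κ) := by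
        simp only [hover]
        refine (hperm.flatMap_right _).trans (List.Perm.of_eq ?_)
        have := congrArg (List.map fun p => κ p.1) ((e P).trans e')
        rw [List.map_flatMap, List.map_map] at this
        refine Eq.trans (List.flatMap_congr fun p _ => ?_) this
        split_ifs <;> rfl
      simp only [systemGens, List.nil_append, List.map_map, List.flatMap_map, I, List.map_append]
      exact (hperm.map _).append (this.map Sum.inr |>.trans (by simp [f, Function.comp_def]))
    · have : (L.comps.flatten.flatMap fun x => overRels (s * t) (fun _ => t)
          (om x ++ [L.letter g κ x]) (base K x)).Perm ((List.finRange L.n).map fun c => R (.inr c)) := by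
        simp only [hrels]
        refine (hperm.flatMap_right _).trans (List.Perm.of_eq ?_)
        have := congrArg (List.map fun p => overGen K _ (κ p.1) -
          ((t ^ L.exponent p : Kˣ) : K) • base K p) ((e P).trans e')
        rw [List.map_flatMap, List.map_map] at this
        refine Eq.trans (List.flatMap_congr fun p _ => ?_) this
        split_ifs <;> rfl
      simp only [List.flatMap_nil, List.nil_append, List.flatMap_map, I, List.map_append,
        List.map_map]
      exact (this.append (hperm.map _)).trans List.perm_append_comm
  refine SignEq.trans hsys ?_
  rw [ldet_map_eq_det hI hIm]
  -- The block of over-arc definitions against over-arcs is the identity, so eliminating the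
  -- over-arcs leaves the Schur complement `A - B * C`.
  let A : Matrix (Fin L.n × Bool) (Fin L.n × Bool) K := fun p p' => R (.inl p) (.inl p')
  let B : Matrix (Fin L.n × Bool) (Fin L.n) K := fun p c => R (.inl p) (.inr (κ c))
  let C : Matrix (Fin L.n) (Fin L.n × Bool) K := fun c p' => R (.inr c) (.inl p')
  have hblocks : (Matrix.of fun i j => R i (f j)) = Matrix.fromBlocks A B C 1 := by
    ext (i | i) (j | j)
    · rfl
    · rfl
    · rfl
    · simp [R, f, Matrix.one_apply, Finsupp.single_apply, hκ.eq_iff]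
  rw [hblocks, Matrix.det_fromBlocks_one₂₂]
  -- In the biquandle the semi-arc leaving an over-passage already contains the factor `t ^ ε`,
  -- whereas the strand `p` starts before the `Ω`-crossings that supply it. So the first arc of the
  -- strand `p` is `lam p` times the semi-arc `L.next⁻¹ p`.
  let lam : Fin L.n × Bool → Kˣ := fun p =>
    if (L.next⁻¹ p).2 then t ^ (-sgn (L.sign (L.next⁻¹ p).1)) else 1
  have hlam : ∀ p, t ^ L.exponent p * lam p = t ^ (if p.2 then 0 else -sgn (L.sign p.1)) := by
    intro p
    simp only [VirtualLink.exponent, lam]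
    split_ifs <;> simp [zpow_add]
  have hmat : (A - B * C) * Matrix.diagonal (fun p => (lam p : K)) =
      Matrix.diagonal (fun p => (lam (L.next p) : K)) *
        (φ.mapMatrix (1 - L.transfer)).submatrix id (L.next⁻¹ : Equiv.Perm _) := by
    ext p p'
    rw [Matrix.mul_diagonal, Matrix.diagonal_mul, Matrix.submatrix_apply]
    have hnext : (L.next⁻¹ p' = p) = (L.next p = p') :=
      propext ⟨fun h => by simp [← h], fun h => by simp [← h]⟩
    have hone : φ ((1 : Matrix _ _ LaurentTwo) p (L.next⁻¹ p')) * (lam (L.next p) : K) =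
        (if L.next p = p' then 1 else 0) * (lam p' : K) := by
      rw [Matrix.one_apply]
      simp only [eq_comm (a := p), hnext]
      split_ifs with h
      · rw [h, map_one]
      · simp
    have hlamnext : lam (L.next p) = if p.2 then t ^ (-sgn (L.sign p.1)) else 1 := by
      simp [lam]
    have hC : ∀ c, C c p' = -(((t ^ L.exponent (c, true) : Kˣ) : K) *
        if (c, true) = p' then 1 else 0) := by
      intro c
      simp [C, R, Finsupp.single_apply]
    have hs' : ∀ n : ℤ, φ ((mono ((1, 0) : ℤ × ℤ) ^ n : LaurentTwoˣ) : LaurentTwo) =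
        ((s ^ n : Kˣ) : K) := fun n => by rw [map_coe_zpow, hs]
    have ht' : ∀ n : ℤ, φ ((mono ((0, 1) : ℤ × ℤ) ^ n : LaurentTwoˣ) : LaurentTwo) =
        ((t ^ n : Kˣ) : K) := fun n => by rw [map_coe_zpow, ht]
    have hst' : ∀ n : ℤ, φ (((mono ((1, 0) : ℤ × ℤ) * mono ((0, 1) : ℤ × ℤ)) ^ n : LaurentTwoˣ) :
        LaurentTwo) = (((s * t) ^ n : Kˣ) : K) := fun n => by
      rw [map_coe_zpow, map_mul, hs, ht]
    have hsub : φ.mapMatrix (1 - L.transfer) (id p) (L.next⁻¹ p') =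
        φ ((1 : Matrix _ _ LaurentTwo) p (L.next⁻¹ p')) - φ (L.transfer p (L.next⁻¹ p')) := by
      rw [← map_sub]
      rfl
    have hBC : (A - B * C) p p' = A p p' - ∑ c, B p c * C c p' := rfl
    rw [hsub, hBC, mul_sub, mul_comm _ (φ ((1 : Matrix _ _ LaurentTwo) p (L.next⁻¹ p'))), hone]
    have hl := congrArg (fun u : Kˣ => (u : K)) (hlam p)
    simp only [Units.val_mul] at hl
    rcases p with ⟨c, _ | _⟩
    · have hA : A (c, false) p' = (if L.next (c, false) = p' then 1 else 0) -
          (((s * t) ^ sgn (L.sign c) : Kˣ) : K) * (((t ^ L.exponent (c, false) : Kˣ) : K) *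
            if (c, false) = p' then 1 else 0) := by
        simp [A, R, transport_omega (hom _), hexp, VirtualLink.letter, Letter.act,
          Finsupp.single_apply]
        exact fun h h' => absurd h' h
      have hB : ∀ c', B (c, false) c' = if c' = c then
          -(1 - (((s * t) ^ sgn (L.sign c) : Kˣ) : K)) else 0 := by
        intro c'
        simp only [B, R, transport_append, transport_omega (hom _), hexp, VirtualLink.letter,
          Bool.false_eq_true, if_false, transport_cons, transport_nil, Letter.act,
          Finsupp.sub_apply, Finsupp.add_apply, Finsupp.smul_apply, Finsupp.single_apply,
          Sum.inr.injEq, hκ.eq_iff, reduceCtorEq, smul_eq_mul]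
        by_cases h : c' = c
        · simp [h]
        · simp [h, Ne.symm h]
      have hT : φ (L.transfer (c, false) (L.next⁻¹ p')) =
          (((s ^ sgn (L.sign c) : Kˣ) : K) * if (c, false) = p' then 1 else 0) +
          (1 - (((s * t) ^ sgn (L.sign c) : Kˣ) : K)) * if (c, true) = p' then 1 else 0 := by
        simp only [VirtualLink.transfer, Bool.false_eq_true, if_false, Pi.add_apply,
          Pi.single_apply, EmbeddingLike.apply_eq_iff_eq, map_add, eq_comm (a := p')]
        split_ifs <;> simp [hs', hst']
      have hl' := congrArg (fun u : Kˣ => (u : K)) (hlam (c, true))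
      simp only [Units.val_mul, if_true, zpow_zero, Units.val_one] at hl'
      simp only [Bool.false_eq_true, if_false] at hl
      rw [hlamnext, hT, hA]
      generalize (if L.next (c, false) = p' then (1 : K) else 0) = δ
      simp only [hB, hC, ite_mul, zero_mul, Finset.sum_ite_eq', Finset.mem_univ, if_true,
        Bool.false_eq_true, if_false, Units.val_one, one_mul]
      have hsp : (((s * t) ^ sgn (L.sign c) : Kˣ) : K) * ((t ^ (-sgn (L.sign c)) : Kˣ) : K) =
          ((s ^ sgn (L.sign c) : Kˣ) : K) := by
        rw [← Units.val_mul, mul_zpow, mul_assoc, ← zpow_add, add_neg_cancel, zpow_zero, mul_one]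
      by_cases h1 : (c, false) = p'
      · subst h1
        simp only [if_true, Prod.mk.injEq, and_false, Bool.true_eq_false, if_false]
        linear_combination (-(((s * t) ^ sgn (L.sign c) : Kˣ) : K)) * hl - hsp
      · by_cases h2 : (c, true) = p'
        · subst h2
          simp only [if_true, Prod.mk.injEq, and_false, Bool.false_eq_true, if_false]
          linear_combination (-(1 - (((s * t) ^ sgn (L.sign c) : Kˣ) : K))) * hl'
        · simp [h1, h2]
    · have hA : A (c, true) p' = (if L.next (c, true) = p' then 1 else 0) -
          ((t ^ L.exponent (c, true) : Kˣ) : K) * if (c, true) = p' then 1 else 0 := by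
        simp [A, R, transport_omega (hom _), hexp, VirtualLink.letter, Letter.act,
          Finsupp.single_apply]
      have hB : ∀ c', B (c, true) c' = 0 := by
        intro c'
        simp [B, R, transport_omega (hom _), hexp, VirtualLink.letter, Letter.act]
      have hT : φ (L.transfer (c, true) (L.next⁻¹ p')) =
          ((t ^ sgn (L.sign c) : Kˣ) : K) * if (c, true) = p' then 1 else 0 := by
        simp only [VirtualLink.transfer, if_true,
          Pi.single_apply, EmbeddingLike.apply_eq_iff_eq, eq_comm (a := p')]
        split_ifs <;> simp [ht']
      simp only [if_true, zpow_zero, Units.val_one] at hl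
      rw [hlamnext, hT, hA]
      simp only [hB, zero_mul, Finset.sum_const_zero, if_true, sub_zero]
      have htt : ((t ^ (-sgn (L.sign c)) : Kˣ) : K) * ((t ^ sgn (L.sign c) : Kˣ) : K) = 1 := by
        rw [← Units.val_mul, ← zpow_add]
        simp
      by_cases h1 : (c, true) = p'
      · subst h1
        rw [if_pos rfl]
        linear_combination htt - hl
      · simp [h1]
  -- The two diagonal matrices have the same determinant because `L.next` permutes the passages. It
  -- is a unit and cancels; the reordering of columns leaves a sign.
  have hdet := congrArg Matrix.det hmat
  rw [Matrix.det_mul, Matrix.det_mul, Matrix.det_diagonal, Matrix.det_diagonal,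
    Matrix.det_permute', Equiv.prod_comp L.next (fun p => (lam p : K)), mul_comm,
    ← RingHom.map_det] at hdet
  have hunit : IsUnit (∏ p, (lam p : K)) := by
    rw [← Units.coe_prod]
    exact Units.isUnit _
  refine ⟨_, hunit.mul_left_cancel hdet⟩

end Gap

end PrismaticLink

namespace PrismaticLink

/-! ### Running words -/

section Run

variable {g : ℕ} {S S' S₁ : State g} {k : ℕ} {W W' : Word g}

theorem run_cons {ℓ : Layer g} (h : Step k S ℓ S₁) (h' : S₁.run (k + 1) W = some S') :
    S.run k (ℓ :: W) = some S' := by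
  rw [State.run, h.step_eq]
  exact h'

theorem run_append (h : S.run k W = some S₁) (h' : S₁.run (k + W.length) W' = some S') :
    S.run k (W ++ W') = some S' := by
  induction W generalizing S k with
  | nil =>
    obtain rfl : S = S₁ := by simpa [State.run] using h
    exact h'
  | cons ℓ W ih =>
    simp only [State.run, Option.bind_eq_some_iff] at h
    obtain ⟨S₂, h1, h2⟩ := h
    rw [List.cons_append, State.run, h1]
    refine ih h2 ?_
    rw [List.length_cons, ← add_assoc, add_right_comm] at h'
    exact h'

end Run

/-! ### Closing up -/

/-- A strand of a tangle with its ends, its colour and its letters. -/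
structure Strand (X : Type*) (g : ℕ) where
  start : X
  fin : X
  color : Color g
  word : List (Letter g)

section Close

variable {g : ℕ} {X : Type*} {arc : X → ArcName g} {next : X → X}

/-- The upper end of a strand. -/
def Strand.up (arc : X → ArcName g) (t : Strand X g) : Pt g := ⟨t.color, true, arc t.start, t.word⟩

/-- The lower end of the strand that follows a given one. -/
def Strand.down (arc : X → ArcName g) (next : X → X) (t : Strand X g) : Pt g :=
  ⟨t.color, false, arc (next t.fin), []⟩

@[simp]
theorem Strand.down_up (t : Strand X g) : (t.down arc next).up = false := rfl

/-- Does each strand of the cyclic list follow the previous one? -/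
def IsCyc (next : X → X) (c : List (Strand X g)) : Prop :=
  (c.rotate 1).map Strand.start = c.map fun t => next t.fin

/-- Nested caps. -/
def closeWord {g : ℕ} : List (Color g) → Word g
  | [] => []
  | c :: cs => (cs.length, .capL c) :: closeWord cs

theorem IsCyc.rotate {c : List (Strand X g)} (h : IsCyc next c) (n : ℕ) :
    IsCyc next (c.rotate n) := by
  rw [IsCyc, List.rotate_rotate, add_comm, ← List.rotate_rotate, List.map_rotate, h, List.map_rotate]

/-- Closing up a tangle whose strands, in the order of the upper ends from right to left, are
followed by those whose lower ends are read from left to right. -/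
theorem run_closeWord (harc : arc.Injective) (T : List (Strand X g))
    (comps : List (Color g × List (Strand X g))) (hT : (comps.flatMap Prod.snd).Perm T)
    (hcomps : ∀ c ∈ comps, c.2 ≠ [] ∧ IsCyc next c.2 ∧ ∀ t ∈ c.2, t.color = c.1)
    (hn : (T.map Strand.start).Nodup) (k : ℕ) (closed : List (Color g × List (Letter g))) :
    ∃ cs, State.run ⟨T.map (Strand.up arc) ++ T.reverse.map (Strand.down arc next), closed⟩ k
        (closeWord (T.map Strand.color).reverse) = some ⟨[], closed ++ cs⟩ ∧
      Multiset.ofList (cs.map fun c => (c.1, Cycle.ofList c.2)) =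
        Multiset.ofList (comps.map fun c => (c.1, Cycle.ofList (c.2.flatMap Strand.word))) := by
  -- The innermost cap joins the upper end of the last strand to the lower end next to it, which
  -- belongs to the strand that follows. Each cap thus lowers the number of strands by one.
  induction hlen : T.length generalizing T comps k closed with
  | zero =>
    obtain rfl := List.length_eq_zero_iff.1 hlen
    have : comps = [] := by
      rcases comps with _ | ⟨c, comps⟩
      · rfl
      · have := hT.length_eq
        have h1 := List.length_pos_iff.2 (hcomps c (by simp)).1
        rw [List.flatMap_cons, List.length_append, List.length_nil] at this
        omega
    subst this
    exact ⟨[], by simp [closeWord, State.run], by simp⟩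
  | succ n ih =>
    obtain ⟨T', t, rfl⟩ : ∃ T' t, T = T' ++ [t] := by
      rcases List.eq_nil_or_concat T with rfl | ⟨T', t, h⟩
      · simp at hlen
      · exact ⟨T', t, by rw [h, List.concat_eq_append]⟩
    replace hlen : T'.length = n := by simpa using hlen
    -- the component of the last strand
    obtain ⟨c, hc, htc⟩ : ∃ c ∈ comps, t ∈ c.2 := by
      have : t ∈ comps.flatMap Prod.snd := hT.mem_iff.2 (by simp)
      simpa using this
    obtain ⟨C₁, C₂, rfl⟩ := List.append_of_mem hc
    obtain ⟨x, y, hxy⟩ := List.append_of_mem htc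
    obtain ⟨hc1, hc2, hc3⟩ := hcomps c hc
    -- The component is a cyclic list, so it may be read from `t` onwards.
    have hrot : c.2.rotate x.length = t :: (y ++ x) := by
      rw [hxy, List.rotate_append_length_eq]
      rfl
    have hcyc : IsCyc next (t :: (y ++ x)) := hrot ▸ hc2.rotate _
    have hcol : ∀ t' ∈ t :: (y ++ x), t'.color = c.1 := fun t' ht' => hc3 t' (by
      rw [hxy]
      simp only [List.mem_cons, List.mem_append] at ht' ⊢
      tauto)
    have hcycle : Cycle.ofList (c.2.flatMap Strand.word) =
        Cycle.ofList ((t :: (y ++ x)).flatMap Strand.word) := by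
      rw [Cycle.coe_eq_coe, hxy]
      simp only [List.flatMap_append, List.flatMap_cons]
      rw [← List.append_assoc (Strand.word t)]
      exact List.isRotated_append
    have hperm : ((y ++ x) ++ (C₁ ++ C₂).flatMap Prod.snd).Perm T' := by
      have h1 : (t :: ((y ++ x) ++ (C₁ ++ C₂).flatMap Prod.snd)).Perm (t :: T') := by
        refine List.Perm.trans ?_ (hT.trans (List.perm_append_singleton t T'))
        rw [← Multiset.coe_eq_coe]
        simp only [List.flatMap_append, List.flatMap_cons, hxy, ← Multiset.coe_add,
          ← Multiset.cons_coe, ← Multiset.singleton_add]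
        abel
      exact h1.cons_inv
    have hcomps' : ∀ c ∈ C₁ ++ C₂, c.2 ≠ [] ∧ IsCyc next c.2 ∧ ∀ t ∈ c.2, t.color = c.1 :=
      fun c hc => hcomps c (by simp only [List.mem_append, List.mem_cons] at hc ⊢; tauto)
    have hn' : (T'.map Strand.start).Nodup ∧ t.start ∉ T'.map Strand.start := by
      rw [List.map_append, List.nodup_append] at hn
      refine ⟨hn.1, fun h => hn.2.2 _ h t.start (by simp) rfl⟩
    have hpts : (T' ++ [t]).map (Strand.up arc) ++ (T' ++ [t]).reverse.map (Strand.down arc next) =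
        T'.map (Strand.up arc) ++ t.up arc :: t.down arc next ::
          T'.reverse.map (Strand.down arc next) := by simp
    have hword : closeWord ((T' ++ [t]).map Strand.color).reverse =
        ((T'.map (Strand.up arc)).length, .capL t.color) :: closeWord (T'.map Strand.color).reverse := by
      simp [closeWord]
    have hcolt := hcol t (by simp)
    have hms : ∀ (cs : List (Color g × List (Letter g))),
        Multiset.ofList (cs.map fun c => (c.1, Cycle.ofList c.2)) =
          (c.1, Cycle.ofList ((t :: (y ++ x)).flatMap Strand.word)) ::ₘ Multiset.ofList
            ((C₁ ++ C₂).map fun c => (c.1, Cycle.ofList (c.2.flatMap Strand.word))) →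
        Multiset.ofList (cs.map fun c => (c.1, Cycle.ofList c.2)) = Multiset.ofList
          ((C₁ ++ c :: C₂).map fun c => (c.1, Cycle.ofList (c.2.flatMap Strand.word))) := by
      intro cs h
      rw [h, Multiset.cons_coe, Multiset.coe_eq_coe, ← hcycle, ← List.map_cons
        (f := fun c : Color g × List (Strand X g) => (c.1, Cycle.ofList (c.2.flatMap Strand.word)))]
      exact (List.perm_middle.symm).map _
    rw [hpts, hword]
    -- If `t` is the only strand left of its component, the cap closes it; otherwise `t` is joined
    -- to its successor `t'`.
    rcases hyx : y ++ x with _ | ⟨t', r⟩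
    · rw [hyx] at hcyc hperm hms
      have hclose : arc t.start = arc (next t.fin) := by
        simp only [IsCyc, List.rotate_singleton, List.map_cons, List.map_nil, List.cons.injEq] at hcyc
        rw [← hcyc.1]
      obtain ⟨cs, h1, h2⟩ := ih T' (C₁ ++ C₂) (by simpa using hperm) hcomps' hn'.1 (k + 1)
        (closed ++ [(t.color, t.word)]) hlen
      refine ⟨(t.color, t.word) :: cs, ?_, hms _ ?_⟩
      · refine run_cons (Step.capL _ _ _ _ _ _ ⟨rfl, rfl⟩ ⟨rfl, rfl⟩) ?_
        rw [State.join, if_pos (by exact hclose)]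
        rw [List.append_assoc] at h1
        exact h1
      · rw [List.map_cons, ← Multiset.cons_coe, h2, hcolt]
        simp
    · rw [hyx] at hcyc hperm hms hcol
      have hnext : t'.start = next t.fin := by
        simp only [IsCyc, List.rotate_cons_succ, List.rotate_zero, List.map_cons, List.cons_append,
          List.cons.injEq] at hcyc
        exact hcyc.1
      have htT : t' ∈ T' := hperm.mem_iff.1 (by simp)
      obtain ⟨A, B, rfl⟩ := List.append_of_mem htT
      have hstart : ∀ t₁ ∈ A ++ B, t₁.start ≠ t'.start := by
        intro t₁ ht₁ he
        have := hn'.1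
        rw [List.map_append, List.map_cons, List.nodup_middle, List.nodup_cons,
          ← List.map_append] at this
        exact this.1 (List.mem_map.2 ⟨t₁, ht₁, he⟩)
      -- The joined strand starts where `t` starts and ends where `t'` ends, and it stands at the
      -- place of `t'`. The row of downward points is not affected, since it depends only on `fin`
      -- and the colour.
      obtain ⟨m, hm⟩ : ∃ m : Strand X g, m = ⟨t.start, t'.fin, t'.color, t.word ++ t'.word⟩ :=
        ⟨_, rfl⟩
      have hne : arc t.start ≠ arc (next t.fin) := by
        intro he
        refine hn'.2 (List.mem_map.2 ⟨t', by simp, ?_⟩)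
        rw [hnext, harc he]
      have hfix : ∀ l : List (Strand X g), (∀ t₁ ∈ l, t₁ ∈ A ++ B) →
          (l.map (Strand.up arc)).map (fun p => if p.up = true ∧ p.arc = (t.down arc next).arc then
            { p with arc := (t.up arc).arc, word := (t.up arc).word ++ p.word } else p) =
          l.map (Strand.up arc) := by
        intro l hl
        rw [List.map_map]
        refine List.map_congr_left fun t₁ ht₁ => ?_
        have : arc t₁.start ≠ arc (next t.fin) := fun he =>
          hstart t₁ (hl t₁ ht₁) (by rw [hnext]; exact harc he)
        simp [Strand.up, Strand.down, this]
      have hjoin : State.join (t.up arc) (t.down arc next)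
          ((A ++ t' :: B).map (Strand.up arc) ++
            (A ++ t' :: B).reverse.map (Strand.down arc next)) closed =
          ⟨(A ++ m :: B).map (Strand.up arc) ++ (A ++ m :: B).reverse.map (Strand.down arc next),
            closed⟩ := by
        rw [State.join, if_neg (by exact hne), List.map_append, List.map_append, List.map_cons,
          List.map_append, List.map_cons, hfix A (by simp +contextual), hfix B (by simp +contextual)]
        congr 2
        · have hup : (t'.up arc).up = true ∧ (t'.up arc).arc = (t.down arc next).arc :=
            ⟨rfl, by simp [Strand.up, Strand.down, hnext]⟩
          rw [List.map_append, List.map_cons, if_pos hup, hm]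
          rfl
        · have : m.down arc next = t'.down arc next := by rw [hm]; rfl
          simp only [List.reverse_append, List.reverse_cons, List.map_append, List.map_cons, this]
          simp [Function.comp_def, Strand.down_up]
      have hcolors : (A ++ t' :: B).map Strand.color = (A ++ m :: B).map Strand.color := by
        simp [hm]
      obtain ⟨cs, h1, h2⟩ := ih (A ++ m :: B) ((c.1, m :: r) :: (C₁ ++ C₂))
        (by
          have h3 : (t' :: (r ++ (C₁ ++ C₂).flatMap Prod.snd)).Perm (t' :: (A ++ B)) := by
            refine List.Perm.trans ?_ (hperm.trans List.perm_middle)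
            simp
          rw [List.flatMap_cons]
          exact (h3.cons_inv.cons m).trans List.perm_middle.symm)
        (by
          refine List.forall_mem_cons.2 ⟨⟨by simp, ?_, ?_⟩, hcomps'⟩
          · simp only [IsCyc, List.rotate_cons_succ, List.rotate_zero, List.map_cons,
              List.cons_append, List.cons.injEq, List.map_append, List.map_nil] at hcyc ⊢
            rw [hm]
            exact hcyc.2
          · refine List.forall_mem_cons.2 ⟨?_, fun t₁ ht₁ => hcol t₁ (by simp [ht₁])⟩
            rw [hm]
            exact hcol t' (by simp))
        (by
          have h3 := hn'.1
          rw [List.map_append, List.map_cons, List.nodup_middle, List.nodup_cons,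
            ← List.map_append] at h3
          rw [List.map_append, List.map_cons, List.nodup_middle, List.nodup_cons,
            ← List.map_append]
          refine ⟨fun h => hn'.2 ?_, h3.2⟩
          rw [hm] at h
          simp only [List.mem_map, List.mem_append, List.mem_cons] at h ⊢
          obtain ⟨t₁, ht₁, he⟩ := h
          exact ⟨t₁, by tauto, he⟩)
        (k + 1) closed (by simpa using hlen)
      refine ⟨cs, ?_, hms _ ?_⟩
      · refine run_cons (Step.capL _ _ _ _ _ _ ⟨rfl, rfl⟩ ⟨rfl, rfl⟩) ?_
        rw [hjoin, hcolors]
        exact h1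
      · rw [h2, List.map_cons, ← Multiset.cons_coe]
        simp [hm]

end Close

end PrismaticLink

namespace PrismaticLink

variable {g : ℕ}

/-! ### Words that can be put on top of any other -/

/-- There are words of pieces of a given kind, with any numbers, that lead from one state to another. -/
def Reaches (Q : Piece g → Prop) (S S' : State g) : Prop :=
  ∀ k, ∃ W : Word g, (∀ ℓ ∈ W, Q ℓ.2) ∧ S.run k W = some S'

theorem Reaches.refl (Q : Piece g → Prop) (S : State g) : Reaches Q S S :=
  fun _ => ⟨[], by simp, rfl⟩

theorem Reaches.trans {Q : Piece g → Prop} {S S₁ S' : State g} (h : Reaches Q S S₁)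
    (h' : Reaches Q S₁ S') : Reaches Q S S' := by
  intro k
  obtain ⟨W, hW, h1⟩ := h k
  obtain ⟨W', hW', h2⟩ := h' (k + W.length)
  exact ⟨W ++ W', fun ℓ hℓ => (List.mem_append.1 hℓ).elim (hW ℓ) (hW' ℓ), run_append h1 h2⟩

theorem Reaches.of_step {Q : Piece g → Prop} {S S' : State g} {ℓ : Layer g} (hQ : Q ℓ.2)
    (h : ∀ k, Step k S ℓ S') : Reaches Q S S' :=
  fun k => ⟨[ℓ], by simpa using hQ, run_cons (h k) rfl⟩

/-- Virtual crossings permute strands that go upwards. -/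
theorem reaches_of_perm {U U' : List (Pt g)} (h : U.Perm U') (hU : ∀ p ∈ U, p.up = true)
    (A B : List (Pt g)) (closed) :
    Reaches (fun _ => True) ⟨A ++ U ++ B, closed⟩ ⟨A ++ U' ++ B, closed⟩ := by
  induction h generalizing A with
  | nil => exact Reaches.refl _ _
  | cons p _ ih =>
    simpa using ih (fun p' hp' => hU p' (by simp [hp'])) (A ++ [p])
  | swap p p' l =>
    refine Reaches.of_step (ℓ := (A.length, .virt p'.color p.color)) trivial fun k => ?_
    simpa using Step.virt (k := k) _ _ A (l ++ B) p' p closed ⟨hU p' (by simp), rfl⟩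
      ⟨hU p (by simp), rfl⟩
  | trans h₁ _ ih₁ ih₂ => exact (ih₁ hU A).trans (ih₂ (fun p hp => hU p (h₁.mem_iff.2 hp)) A)

/-- The nested cups of given colours, from the outside to the inside. -/
def cupWord : ℕ → List (Color g) → Word g
  | _, [] => []
  | j, c :: cs => (j, .cupR c) :: cupWord (j + 1) cs

theorem run_cupWord {X : Type*} (col : X → Color g) (arc : X → ArcName g) (l : List X) (k : ℕ)
    (harc : ∀ (i : ℕ) (hi : i < l.length), arc l[i] = .inl (k + i)) (A B : List (Pt g)) (closed) :
    State.run ⟨A ++ B, closed⟩ k (cupWord A.length (l.map col)) =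
      some ⟨A ++ l.map (fun x => ⟨col x, true, arc x, []⟩) ++
        l.reverse.map (fun x => ⟨col x, false, arc x, []⟩) ++ B, closed⟩ := by
  induction l generalizing k A B with
  | nil => simp [cupWord, State.run]
  | cons x l ih =>
    have hx : arc x = .inl k := harc 0 (by simp)
    refine run_cons (Step.cupR _ A B closed) ?_
    have := ih (k + 1) (fun i hi => by
      have := harc (i + 1) (by simpa using hi)
      rw [List.getElem_cons_succ] at this
      rw [this]
      congr 1
      omega) (A ++ [⟨col x, true, .inl k, []⟩]) (⟨col x, false, .inl k, []⟩ :: B)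
    rw [List.length_append, List.append_assoc] at this
    rw [List.singleton_append, List.length_singleton] at this
    rw [this]
    simp [hx]

/-- Small circles. -/
def circleWord : ℕ → Word g
  | 0 => []
  | m + 1 => (0, .cupR none) :: (0, .capL none) :: circleWord m

theorem run_circleWord (m k : ℕ) (P : List (Pt g)) (closed) :
    State.run ⟨P, closed⟩ k (circleWord m) = some ⟨P, closed ++ List.replicate m (none, [])⟩ := by
  induction m generalizing k closed with
  | zero => simp [circleWord, State.run]
  | succ m ih =>
    refine run_cons (Step.cupR none [] P closed)
      (run_cons (Step.capL none [] P _ _ closed ⟨rfl, rfl⟩ ⟨rfl, rfl⟩) ?_)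
    rw [State.join, if_pos rfl]
    exact (ih _ _).trans (by simp [List.replicate_succ])

theorem isPlain_circleWord (m : ℕ) : ∀ ℓ ∈ circleWord (g := g) m, ℓ.2.isPlain := by
  induction m with
  | zero => simp [circleWord]
  | succ m ih => exact List.forall_mem_cons.2 ⟨rfl, List.forall_mem_cons.2 ⟨rfl, ih⟩⟩

theorem isPlain_cupWord (j : ℕ) (l : List (Color g)) (h : ∀ c ∈ l, c = none) :
    ∀ ℓ ∈ cupWord j l, ℓ.2.isPlain := by
  induction l generalizing j with
  | nil => simp [cupWord]
  | cons c l ih =>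
    simp only [List.forall_mem_cons] at h
    exact List.forall_mem_cons.2 ⟨h.1, ih _ h.2⟩

theorem isPlain_closeWord (l : List (Color g)) (h : ∀ c ∈ l, c = none) :
    ∀ ℓ ∈ closeWord l, ℓ.2.isPlain := by
  induction l with
  | nil => simp [closeWord]
  | cons c l ih =>
    simp only [List.forall_mem_cons] at h
    exact List.forall_mem_cons.2 ⟨h.1, ih h.2⟩

/-! ### The crossings of a link, side by side -/

namespace VirtualLink

variable (L : VirtualLink)

/-- The passages of crossings that are drawn side by side, in the order of the strands below. -/
def bottom (cs : List (Fin L.n)) : List (Fin L.n × Bool) :=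
  cs.flatMap fun c => [(c, L.sign c), (c, !L.sign c)]

/-- The passages of crossings that are drawn side by side, in the order of the strands above. -/
def top (cs : List (Fin L.n)) : List (Fin L.n × Bool) :=
  cs.flatMap fun c => [(c, !L.sign c), (c, L.sign c)]

/-- Crossings side by side. -/
def crossWord (g : ℕ) : ℕ → List (Fin L.n) → Word g
  | _, [] => []
  | j, c :: cs => (j, if L.sign c then .pos else .neg) :: crossWord g (j + 2) cs

variable {L}

theorem isPlain_crossWord (j : ℕ) (cs : List (Fin L.n)) :
    ∀ ℓ ∈ L.crossWord g j cs, ℓ.2.isPlain := by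
  induction cs generalizing j with
  | nil => simp [crossWord]
  | cons c cs ih =>
    refine List.forall_mem_cons.2 ⟨?_, ih _⟩
    cases L.sign c <;> trivial

/-- The label of a crossing is the number of its layer, so `κ` takes consecutive values along `cs`.
The order in `bottom` puts the over-strand on the left of a positive crossing and on the right of a
negative one. -/
theorem run_crossWord (κ : Fin L.n → ℕ) (P : Fin L.n × Bool → Pt g) (hP : ∀ p, (P p).IsUp none)
    (cs : List (Fin L.n)) (k : ℕ) (hκ : ∀ (i : ℕ) (hi : i < cs.length), κ cs[i] = k + i)
    (A B : List (Pt g)) (closed) :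
    State.run ⟨A ++ (L.bottom cs).map P ++ B, closed⟩ k (L.crossWord g A.length cs) =
      some ⟨A ++ (L.top cs).map (fun p => (P p).meet (L.letter g κ p)) ++ B, closed⟩ := by
  induction cs generalizing k A with
  | nil => simp [bottom, top, crossWord, State.run]
  | cons c cs ih =>
    have hc : κ c = k := hκ 0 (by simp)
    have hs : Step k (⟨A ++ (L.bottom (c :: cs)).map P ++ B, closed⟩ : State g)
        (A.length, if L.sign c then .pos else .neg)
        ⟨(A ++ [(P (c, !L.sign c)).meet (L.letter g κ (c, !L.sign c)),
          (P (c, L.sign c)).meet (L.letter g κ (c, L.sign c))]) ++ (L.bottom cs).map P ++ B,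
          closed⟩ := by
      rcases hε : L.sign c
      · simpa [bottom, hε, letter, hc] using
          Step.neg (k := k) A ((L.bottom cs).map P ++ B) _ _ closed (hP (c, false)) (hP (c, true))
      · simpa [bottom, hε, letter, hc] using
          Step.pos (k := k) A ((L.bottom cs).map P ++ B) _ _ closed (hP (c, true)) (hP (c, false))
    refine run_cons hs ?_
    have := ih (k + 1) (fun i hi => by
      have := hκ (i + 1) (by simpa using hi)
      rw [List.getElem_cons_succ] at this
      omega) (A ++ [(P (c, !L.sign c)).meet (L.letter g κ (c, !L.sign c)),
          (P (c, L.sign c)).meet (L.letter g κ (c, L.sign c))])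
    rw [List.length_append] at this
    refine this.trans ?_
    simp [top]

theorem nodup_bottom : (L.bottom (List.finRange L.n)).Nodup := by
  refine List.nodup_flatMap.2 ⟨fun c _ => by simp, ?_⟩
  refine (List.nodup_finRange L.n).imp fun {c c'} h => ?_
  simp [Function.onFun, List.disjoint_left, h]

theorem mem_bottom (p : Fin L.n × Bool) : p ∈ L.bottom (List.finRange L.n) := by
  refine List.mem_flatMap.2 ⟨p.1, by simp, ?_⟩
  obtain ⟨c, b⟩ := p
  cases b <;> cases L.sign c <;> simp

theorem perm_top (cs : List (Fin L.n)) : (L.top cs).Perm (L.bottom cs) :=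
  List.Perm.flatMap_left _ fun _ _ => List.Perm.swap _ _ _

end VirtualLink

end PrismaticLink

namespace PrismaticLink

variable {g : ℕ} {X : Type*}

/-! ### Passing strands through a handle -/

/-- The upper end of a strand of the link. -/
def upPt (arc : X → ArcName g) (word : X → List (Letter g)) (x : X) : Pt g :=
  ⟨none, true, arc x, word x⟩

/-- The lower end of a strand of the link. -/
def downPt (arc : X → ArcName g) (x : X) : Pt g := ⟨none, false, arc x, []⟩

variable [DecidableEq X]

/-- Nested caps that connect downward strands with upward strands of names `β`, which carry a letter. -/
theorem reaches_caps (ℓ : Letter g) (β : X → ArcName g) (U : List X) (M rest : List (Pt g))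
    (closed) (hM : ∀ p ∈ M, p.up = false) (r : List X) (hr : r.Nodup)
    (arc : X → ArcName g) (word : X → List (Letter g)) (h₁ : ∀ s ∈ r, ∀ x, arc x = arc s → x = s)
    (h₂ : ∀ s ∈ r, ∀ s' ∈ r, β s ≠ arc s')
    (hrest : ∀ p ∈ rest, p.up = true → ∀ s ∈ r, p.arc ≠ arc s) :
    Reaches Piece.isPlain
      ⟨U.map (upPt arc word) ++ M ++ r.map (downPt arc) ++
        r.reverse.map (fun s => ⟨none, true, β s, [ℓ]⟩) ++ rest, closed⟩
      ⟨U.map (upPt (fun x => if x ∈ r then β x else arc x)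
        (fun x => if x ∈ r then ℓ :: word x else word x)) ++ M ++ rest, closed⟩ := by
  -- The caps are nested, with the last strand of `r` innermost. The joined strand now begins at the
  -- point named `β s`, so the letter is put in front of its word.
  induction r using List.reverseRecOn generalizing arc word with
  | nil => simpa using Reaches.refl _ _
  | append_singleton r s ih =>
    obtain ⟨hr', hs⟩ : r.Nodup ∧ s ∉ r := by
      rw [List.nodup_append] at hr
      exact ⟨hr.1, fun h => hr.2.2 _ h s (by simp) rfl⟩
    have hne : ∀ s' ∈ r, s' ≠ s := fun s' h he => hs (he ▸ h)
    have hmem : ∀ s' ∈ r, s' ∈ r ++ [s] := fun s' h => List.mem_append_left _ h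
    have hsm : s ∈ r ++ [s] := by simp
    refine Reaches.trans (S₁ := ⟨U.map (upPt (fun x => if x = s then β x else arc x)
        (fun x => if x = s then ℓ :: word x else word x)) ++ M ++
        r.map (downPt fun x => if x = s then β x else arc x) ++
        r.reverse.map (fun s => ⟨none, true, β s, [ℓ]⟩) ++ rest, closed⟩) ?_ ?_
    · refine Reaches.of_step (ℓ := ((U.map (upPt arc word) ++ M ++ r.map (downPt arc)).length,
        .capR none)) rfl fun k => ?_
      have h := Step.capR (k := k) none (U.map (upPt arc word) ++ M ++ r.map (downPt arc))
        (r.reverse.map (fun s => ⟨none, true, β s, [ℓ]⟩) ++ rest) (downPt arc s)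
        ⟨none, true, β s, [ℓ]⟩ closed ⟨rfl, rfl⟩ ⟨rfl, rfl⟩
      convert h using 1
      · simp
      · rw [State.join, if_neg (by exact h₂ s hsm s hsm)]
        simp only [List.map_append, List.map_map, List.append_assoc]
        congr 1
        congr 1
        · refine List.map_congr_left fun x _ => ?_
          by_cases hx : x = s
          · simp [upPt, downPt, hx]
          · have : arc x ≠ arc s := fun h => hx (h₁ s hsm x h)
            simp [upPt, downPt, hx, this]
        congr 1
        · refine (List.map_id' M).symm.trans (List.map_congr_left fun p hp => ?_)
          simp [hM p hp]
        congr 1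
        · refine List.map_congr_left fun x hx => ?_
          simp [downPt, hne x hx]
        congr 1
        · refine List.map_congr_left fun x hx => ?_
          have := h₂ x (hmem x (by simpa using hx)) s hsm
          simp [downPt, this]
        · refine (List.map_id' rest).symm.trans (List.map_congr_left fun p hp => ?_)
          by_cases hp' : p.up = true
          · have := hrest p hp hp' s hsm
            simp [downPt, this]
          · simp [hp']
    · have h := ih hr' (fun x => if x = s then β x else arc x)
        (fun x => if x = s then ℓ :: word x else word x)
        (fun s' hs' x hx => by
          simp only [if_neg (hne s' hs')] at hx
          split_ifs at hx with h
          · subst h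
            exact absurd hx (h₂ x hsm s' (hmem s' hs'))
          · exact h₁ s' (hmem s' hs') x hx)
        (fun s₁ hs₁ s' hs' => by
          simp only [if_neg (hne s' hs')]
          exact h₂ s₁ (hmem s₁ hs₁) s' (hmem s' hs'))
        (fun p hp hp' s' hs' => by
          simp only [if_neg (hne s' hs')]
          exact hrest p hp hp' s' (hmem s' hs'))
      have hif : ∀ {α : Type _} (f f' : X → α), (fun x => if x ∈ r ++ [s] then f x else f' x) =
          fun x => if x ∈ r then f x else if x = s then f x else f' x := by
        intro α f f'
        funext x
        by_cases hx : x = s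
        · simp [hx]
        · simp [hx]
      have h' : ∀ x, (if x ∈ r then ℓ :: (if x = s then ℓ :: word x else word x) else
          if x = s then ℓ :: word x else word x) =
          if x ∈ r then ℓ :: word x else if x = s then ℓ :: word x else word x := by
        intro x
        by_cases hx : x ∈ r
        · simp [hx, hne x hx]
        · simp [hx]
      simp only [h'] at h
      rw [hif, hif]
      exact h

end PrismaticLink

namespace PrismaticLink

/-! ### One handle exchanges two neighbouring blocks of strands. -/

variable {g : ℕ} {X : Type*}

/-- The names of the intersections with the two curves of a handle are not in use. -/
def Fresh (arc : X → ArcName g) (i : Fin g) : Prop :=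
  ∀ x j, arc x ≠ .inr (.inl i, j) ∧ arc x ≠ .inr (.inr i, j)

/-- The part of the boundary of the polygon at a handle. -/
def handleBoundary (pts : Palette g → List Bool) (i : Fin g) : List (Pt g) :=
  backwardSide (.inl i) (pts (.inl i)) ++ backwardSide (.inr i) (pts (.inr i)) ++
    forwardSide (.inl i) (pts (.inl i)) ++ forwardSide (.inr i) (pts (.inr i))

theorem mem_handleBoundary_up {pts : Palette g → List Bool} {i : Fin g} {p : Pt g}
    (hp : p ∈ handleBoundary pts i) :
    ∃ j, p.arc = .inr (.inl i, j) ∨ p.arc = .inr (.inr i, j) := by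
  simp only [handleBoundary, backwardSide, forwardSide, List.mem_append, List.mem_reverse,
    List.mem_map] at hp
  obtain ((⟨a, -, rfl⟩ | ⟨a, -, rfl⟩) | ⟨a, -, rfl⟩) | ⟨a, -, rfl⟩ := hp <;>
    exact ⟨a.2, by simp [sidePt]⟩

variable [DecidableEq X]

theorem map_zipIdx_replicate {α : Type*} {r : List X} (hr : r.Nodup) (f : Bool × ℕ → α) :
    (List.replicate r.length true).zipIdx.map f = r.map fun s => f (true, r.idxOf s) := by
  refine List.ext_getElem (by simp) fun i h₁ h₂ => ?_
  simp [hr.idxOf_getElem]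

theorem backwardSide_replicate {r : List X} (hr : r.Nodup) (z : Palette g) :
    backwardSide z (List.replicate r.length true) =
      r.reverse.map fun s => ⟨none, true, .inr (z, r.idxOf s), [sideLetter z true]⟩ := by
  rw [backwardSide, map_zipIdx_replicate hr, List.map_reverse]
  rfl

theorem forwardSide_replicate {r : List X} (hr : r.Nodup) (z : Palette g) :
    forwardSide z (List.replicate r.length true) =
      r.map (downPt fun s => .inr (z, r.idxOf s)) := by
  rw [forwardSide, map_zipIdx_replicate hr]
  rfl

/-- The names of the strands after two neighbouring blocks have passed through a handle. -/
def handleArc (i : Fin g) (r₁ r₂ : List X) (arc : X → ArcName g) (x : X) : ArcName g :=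
  if x ∈ r₁ then .inr (.inr i, r₁.idxOf x) else if x ∈ r₂ then .inr (.inl i, r₂.idxOf x) else arc x

/-- The letters of the strands after two neighbouring blocks have passed through a handle. -/
def handleWord (i : Fin g) (r₁ r₂ : List X) (word : X → List (Letter g)) (x : X) :
    List (Letter g) :=
  if x ∈ r₁ then .omega (.inl i) false :: word x
  else if x ∈ r₂ then .omega (.inr i) true :: word x else word x

theorem handleArc_injective {i : Fin g} {r₁ r₂ : List X} {arc : X → ArcName g}
    (h : arc.Injective) (hf : Fresh arc i) : (handleArc i r₁ r₂ arc).Injective := by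
  intro x y hxy
  simp only [handleArc] at hxy
  split_ifs at hxy with h1 h2 h3 h4 h5 h6 h7 h8
  all_goals first
    | exact h hxy
    | exact absurd hxy (hf _ _).1
    | exact absurd hxy (hf _ _).2
    | exact absurd hxy.symm (hf _ _).1
    | exact absurd hxy.symm (hf _ _).2
    | simp at hxy
  · exact (List.idxOf_inj h1).1 hxy
  · exact (List.idxOf_inj ‹x ∈ r₂›).1 hxy

theorem fresh_handleArc {i i' : Fin g} {r₁ r₂ : List X} {arc : X → ArcName g}
    (hi : i ≠ i') (hf : Fresh arc i') : Fresh (handleArc i r₁ r₂ arc) i' := by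
  intro x j
  simp only [handleArc]
  split_ifs
  · simp [hi]
  · simp [hi]
  · exact hf x j

/-- The boundary of the handle reads `x⁻¹ y⁻¹ x y`. Caps connect `r₂` to the side `x⁻¹` and then
`r₁`, which has become adjacent, to `y⁻¹`. The blocks continue at the sides `x` and `y`, in this
order, so they have changed places. All intersections with `Ω` are positive: a crossing with `xᵢ`
gives a letter of colour `yᵢ` with sign `+`, one with `yᵢ` a letter of colour `xᵢ` with sign `-`. -/
theorem reaches_handle {i : Fin g} {m r₁ r₂ : List X} (hn : (m ++ r₁ ++ r₂).Nodup)
    {pts : Palette g → List Bool} (hx : pts (.inl i) = List.replicate r₂.length true)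
    (hy : pts (.inr i) = List.replicate r₁.length true) {arc : X → ArcName g}
    (harc : arc.Injective) (hf : Fresh arc i) (word : X → List (Letter g)) (U : List X)
    (rest : List (Pt g)) (hrest : ∀ p ∈ rest, ∀ s, p.arc ≠ arc s) (closed) :
    Reaches Piece.isPlain
      ⟨U.map (upPt arc word) ++ (m ++ r₁ ++ r₂).map (downPt arc) ++ (handleBoundary pts i ++ rest),
        closed⟩
      ⟨U.map (upPt (handleArc i r₁ r₂ arc) (handleWord i r₁ r₂ word)) ++
        (m ++ r₂ ++ r₁).map (downPt (handleArc i r₁ r₂ arc)) ++ rest, closed⟩ := by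
  obtain ⟨hm1, hr2, hd2⟩ := List.nodup_append.1 hn
  obtain ⟨-, hr1, hd1⟩ := List.nodup_append.1 hm1
  have h12 : ∀ s ∈ r₁, s ∉ r₂ := fun s h h' => hd2 s (by simp [h]) s h' rfl
  have h21 : ∀ s ∈ r₂, s ∉ r₁ := fun s h h' => h12 s h' h
  have hm : ∀ s ∈ m, s ∉ r₁ ∧ s ∉ r₂ := fun s h =>
    ⟨fun h' => hd1 s h s h' rfl, fun h' => hd2 s (by simp [h]) s h' rfl⟩
  have hdown : ∀ (l : List X), ∀ p ∈ l.map (downPt arc), p.up = false := by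
    intro l p hp
    obtain ⟨s, -, rfl⟩ := List.mem_map.1 hp
    rfl
  have hfwd : ∀ z, ∀ p ∈ forwardSide z (pts z), p.up = true → z = .inl i ∨ z = .inr i →
      ∀ s, p.arc ≠ arc s := by
    rintro z p hp - hz s he
    simp only [forwardSide, List.mem_map] at hp
    obtain ⟨a, -, rfl⟩ := hp
    rcases hz with rfl | rfl
    · exact (hf s _).1 he.symm
    · exact (hf s _).2 he.symm
  have c₁ := reaches_caps (.omega (.inr i) true) (fun s => .inr (.inl i, r₂.idxOf s)) U
    ((m ++ r₁).map (downPt arc)) (backwardSide (.inr i) (pts (.inr i)) ++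
      forwardSide (.inl i) (pts (.inl i)) ++ forwardSide (.inr i) (pts (.inr i)) ++ rest) closed
    (hdown _) r₂ hr2 arc word (fun s _ x h => harc h) (fun s _ s' _ h => (hf s' _).1 h.symm)
    (by
      intro p hp hp' s _
      simp only [List.mem_append] at hp
      rcases hp with ((hp | hp) | hp) | hp
      · obtain ⟨j, h | h⟩ := mem_handleBoundary_up (pts := pts) (i := i) (p := p)
          (by simp [handleBoundary, hp])
        · exact fun he => (hf s j).1 (he ▸ h)
        · exact fun he => (hf s j).2 (he ▸ h)
      · exact hfwd _ p hp hp' (by simp) s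
      · exact hfwd _ p hp hp' (by simp) s
      · exact hrest p hp s)
  have c₂ := reaches_caps (.omega (.inl i) false) (fun s => .inr (.inr i, r₁.idxOf s)) U
    (m.map (downPt arc)) (forwardSide (.inl i) (pts (.inl i)) ++
      forwardSide (.inr i) (pts (.inr i)) ++ rest) closed (hdown _) r₁ hr1
    (fun x => if x ∈ r₂ then .inr (.inl i, r₂.idxOf x) else arc x)
    (fun x => if x ∈ r₂ then .omega (.inr i) true :: word x else word x)
    (by
      intro s hs x hx
      simp only [if_neg (h12 s hs)] at hx
      split_ifs at hx with h
      · exact absurd hx.symm (hf s _).1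
      · exact harc hx)
    (by
      intro s _ s' hs' h
      simp only [if_neg (h12 s' hs')] at h
      exact (hf s' _).2 h.symm)
    (by
      intro p hp hp' s hs
      simp only [if_neg (h12 s hs)]
      simp only [List.mem_append] at hp
      rcases hp with (hp | hp) | hp
      · exact hfwd _ p hp hp' (by simp) s
      · exact hfwd _ p hp hp' (by simp) s
      · exact hrest p hp s)
  have hd : r₁.map (downPt fun x => if x ∈ r₂ then (.inr (.inl i, r₂.idxOf x) : ArcName g) else arc x)
      = r₁.map (downPt arc) :=
    List.map_congr_left fun s hs => by simp [downPt, h12 s hs]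
  rw [hd] at c₂
  convert c₁.trans (by convert c₂ using 2; simp [hy, backwardSide_replicate hr1, sideLetter]) using 2
  · simp [handleBoundary, hx, backwardSide_replicate hr2, sideLetter]
  · have e₁ : m.map (downPt (handleArc i r₁ r₂ arc)) = m.map (downPt arc) :=
      List.map_congr_left fun s hs => by simp [downPt, handleArc, hm s hs]
    have e₂ : r₂.map (downPt (handleArc i r₁ r₂ arc)) = forwardSide (.inl i) (pts (.inl i)) := by
      rw [hx, forwardSide_replicate hr2]
      exact List.map_congr_left fun s hs => by simp [downPt, handleArc, hs, h21 s hs]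
    have e₃ : r₁.map (downPt (handleArc i r₁ r₂ arc)) = forwardSide (.inr i) (pts (.inr i)) := by
      rw [hy, forwardSide_replicate hr1]
      exact List.map_congr_left fun s hs => by simp [downPt, handleArc, hs]
    rw [List.map_append, List.map_append, e₁, e₂, e₃]
    simp only [List.append_assoc]
    congr 1
    refine List.map_congr_left fun x _ => ?_
    by_cases h : x ∈ r₁
    · simp [upPt, handleArc, handleWord, h, h12 x h]
    · simp [upPt, handleArc, handleWord, h]

end PrismaticLink

namespace PrismaticLink

variable {g : ℕ} {X : Type*} [DecidableEq X]

/-! ### Reordering strands by means of handles -/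

/-- The exponents of strands after two neighbouring blocks have passed through a handle. -/
def moveExp (r₁ r₂ : List X) (e : X → ℤ) (x : X) : ℤ :=
  if x ∈ r₁ then e x - 1 else if x ∈ r₂ then e x + 1 else e x

/-- Lists of strands that can be obtained from each other by handles of given sizes, and the
exponents of the crossings with `Ω`. -/
inductive HandleMoves : List X → (X → ℤ) → List (ℕ × ℕ) → List X → (X → ℤ) → Prop
  | nil (D : List X) (e : X → ℤ) : HandleMoves D e [] D e
  | cons (m r₁ r₂ D' : List X) (e e' : X → ℤ) (H : List (ℕ × ℕ))
    (h : HandleMoves (m ++ r₂ ++ r₁) (moveExp r₁ r₂ e) H D' e') :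
    HandleMoves (m ++ r₁ ++ r₂) e ((r₂.length, r₁.length) :: H) D' e'

theorem HandleMoves.trans {D D₁ D' : List X} {e e₁ e' : X → ℤ} {H H' : List (ℕ × ℕ)}
    (h : HandleMoves D e H D₁ e₁) (h' : HandleMoves D₁ e₁ H' D' e') :
    HandleMoves D e (H ++ H') D' e' := by
  induction h with
  | nil => exact h'
  | cons m r₁ r₂ _ e _ H _ ih => exact HandleMoves.cons m r₁ r₂ _ e _ _ (ih h')

theorem HandleMoves.single {m r₁ r₂ D D' : List X} {e : X → ℤ} (hD : D = m ++ r₁ ++ r₂)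
    (hD' : D' = m ++ r₂ ++ r₁) :
    HandleMoves D e [(r₂.length, r₁.length)] D' (moveExp r₁ r₂ e) := by
  subst hD hD'
  exact HandleMoves.cons _ _ _ _ _ _ _ (HandleMoves.nil _ _)

/-- The exponent of the last strand can be changed at will. -/
theorem exists_handleMoves_last (D : List X) (x : X) (e : X → ℤ) (n : ℤ) :
    ∃ H, HandleMoves (D ++ [x]) e H (D ++ [x]) (Function.update e x n) := by
  obtain ⟨k, hk⟩ : ∃ k, (n - e x).natAbs = k := ⟨_, rfl⟩
  induction k generalizing e with
  | zero =>
    obtain rfl : n = e x := by omega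
    exact ⟨[], by rw [Function.update_eq_self]; exact HandleMoves.nil _ _⟩
  | succ k ih =>
    -- The last strand passes through the handle alone: as the first block if its exponent has to
    -- drop, as the second block if it has to grow. The other block is empty, so the order does not
    -- change.
    rcases lt_or_ge n (e x) with h | h
    · have h1 := HandleMoves.single (m := D) (r₁ := [x]) (r₂ := []) (e := e) (D := D ++ [x])
        (D' := D ++ [x]) (by simp) (by simp)
      obtain ⟨H, h2⟩ := ih (moveExp [x] [] e) (by simp [moveExp]; omega)
      refine ⟨_, h1.trans (e' := Function.update e x n) (H' := H) ?_⟩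
      convert h2 using 1
      funext y
      by_cases hy : y = x <;> simp [moveExp, hy]
    · have h1 := HandleMoves.single (m := D) (r₁ := []) (r₂ := [x]) (e := e) (D := D ++ [x])
        (D' := D ++ [x]) (by simp) (by simp)
      obtain ⟨H, h2⟩ := ih (moveExp [] [x] e) (by simp [moveExp]; omega)
      refine ⟨_, h1.trans (e' := Function.update e x n) (H' := H) ?_⟩
      convert h2 using 1
      funext y
      by_cases hy : y = x <;> simp [moveExp, hy]

/-- Handles can produce any order of the strands and any exponents. -/
theorem exists_handleMoves (p R R' : List X) (hR : R.Perm R') (hn : (p ++ R').Nodup)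
    (e e' : X → ℤ) (he : ∀ x ∈ p, e x = e' x) :
    ∃ H e₁, HandleMoves (p ++ R) e H (p ++ R') e₁ ∧ ∀ x ∈ p ++ R', e₁ x = e' x := by
  induction R' generalizing p R e with
  | nil =>
    rw [List.perm_nil] at hR
    subst hR
    exact ⟨[], e, HandleMoves.nil _ _, by simpa using he⟩
  | cons x R' ih =>
    obtain ⟨r₁, r₂, rfl⟩ := List.append_of_mem (hR.mem_iff.2 (by simp : x ∈ x :: R'))
    have hR' : (r₂ ++ r₁).Perm R' :=
      List.perm_append_comm.trans (List.perm_middle.symm.trans hR).cons_inv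
    obtain ⟨-, hn2, hd⟩ := List.nodup_append.1 hn
    have hx : x ∉ r₂ ++ r₁ := fun h => (List.nodup_cons.1 hn2).1 (hR'.mem_iff.1 h)
    have hp : ∀ y ∈ p, y ≠ x ∧ y ∉ r₂ ++ r₁ := fun y hy =>
      ⟨hd y hy x (by simp), fun h => hd y hy y (by simp [hR'.mem_iff.1 h]) rfl⟩
    -- The strand `x` is first moved to the end, where its exponent can be adjusted without touching
    -- any other one, and then to its final place behind `p`. The target is `e' x - 1` because the
    -- final move adds one. Strands in `p` are left alone, so finished exponents stay as they are.
    have h1 := HandleMoves.single (m := p) (r₁ := r₁ ++ [x]) (r₂ := r₂) (e := e)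
      (D := p ++ (r₁ ++ x :: r₂)) (D' := (p ++ (r₂ ++ r₁)) ++ [x]) (by simp) (by simp)
    obtain ⟨H, h2⟩ := exists_handleMoves_last (p ++ (r₂ ++ r₁)) x
      (moveExp (r₁ ++ [x]) r₂ e) (e' x - 1)
    have h3 := HandleMoves.single (m := p) (r₁ := r₂ ++ r₁) (r₂ := [x]) 
      (e := Function.update (moveExp (r₁ ++ [x]) r₂ e) x (e' x - 1))
      (D := (p ++ (r₂ ++ r₁)) ++ [x]) (D' := (p ++ [x]) ++ (r₂ ++ r₁)) (by simp) (by simp)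
    obtain ⟨H', e₁, h4, h5⟩ := ih (p ++ [x]) (r₂ ++ r₁) hR' (by simpa using hn)
      (moveExp (r₂ ++ r₁) [x] (Function.update (moveExp (r₁ ++ [x]) r₂ e) x (e' x - 1))) (by
      intro y hy
      rcases List.mem_append.1 hy with hy | hy
      · obtain ⟨h6, h7⟩ := hp y hy
        rw [moveExp, if_neg h7, if_neg (by simpa using h6), Function.update_of_ne h6]
        simp only [List.mem_append, not_or] at h7
        simp [moveExp, h6, h7.1, h7.2, he y hy]
      · obtain rfl := List.mem_singleton.1 hy
        rw [moveExp, if_neg hx, if_pos hy, Function.update_self]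
        ring)
    exact ⟨_, e₁, ((h1.trans h2).trans h3).trans (by simpa using h4), by simpa using h5⟩

/-- Passing strands through the handles of a surface, one after the other. -/
theorem HandleMoves.reaches {D D' : List X} {e e' : X → ℤ} {H : List (ℕ × ℕ)}
    (h : HandleMoves D e H D' e') (hD : D.Nodup) {pts : Palette g → List Bool} {I : List (Fin g)}
    (hI : I.Nodup) (hH : H = I.map fun i => ((pts (.inl i)).length, (pts (.inr i)).length))
    (hpts : ∀ z, ∀ b ∈ pts z, b = true) {arc : X → ArcName g} (harc : arc.Injective)
    (hf : ∀ i ∈ I, Fresh arc i) {om : X → List (Letter g)}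
    (hom : ∀ x, ∀ ℓ ∈ om x, ℓ.isClassical = false) (he : ∀ x, netExp (om x) = e x)
    (word : X → List (Letter g)) (U : List X) (closed) :
    ∃ (arc' : X → ArcName g) (om' : X → List (Letter g)), arc'.Injective ∧
      (∀ x, ∀ ℓ ∈ om' x, ℓ.isClassical = false) ∧ (∀ x, netExp (om' x) = e' x) ∧
      Reaches Piece.isPlain
        ⟨U.map (upPt arc fun x => om x ++ word x) ++ D.map (downPt arc) ++
          I.flatMap (handleBoundary pts), closed⟩
        ⟨U.map (upPt arc' fun x => om' x ++ word x) ++ D'.map (downPt arc'), closed⟩ := by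
  induction h generalizing I arc om with
  | nil D e =>
    obtain rfl : I = [] := by simpa using hH.symm
    exact ⟨arc, om, harc, hom, he, by simpa using Reaches.refl _ _⟩
  | cons m r₁ r₂ D' e e' H _ ih =>
    rcases I with _ | ⟨i, I⟩
    · simp at hH
    simp only [List.map_cons, List.cons.injEq, Prod.mk.injEq] at hH
    obtain ⟨⟨h1, h2⟩, h3⟩ := hH
    obtain ⟨hi, hI⟩ := List.nodup_cons.1 hI
    have hne : ∀ i' ∈ I, i ≠ i' := fun i' h he => hi (he ▸ h)
    have hh := reaches_handle hD (pts := pts) (i := i)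
      (by rw [h1]; exact List.eq_replicate_of_mem (hpts _))
      (by rw [h2]; exact List.eq_replicate_of_mem (hpts _)) harc (hf i (by simp))
      (fun x => om x ++ word x) U (I.flatMap (handleBoundary pts)) (by
        intro p hp s he
        obtain ⟨i', hi', hp⟩ := List.mem_flatMap.1 hp
        obtain ⟨j, h | h⟩ := mem_handleBoundary_up hp
        · exact (hf i' (by simp [hi']) s j).1 (he ▸ h)
        · exact (hf i' (by simp [hi']) s j).2 (he ▸ h)) closed
    obtain ⟨hm1, hr2, hd2⟩ := List.nodup_append.1 hD
    obtain ⟨arc', om', g1, g2, g3, g4⟩ := ih (I := I) (arc := handleArc i r₁ r₂ arc)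
      (om := handleWord i r₁ r₂ om)
      ((by
        rw [List.append_assoc]
        exact List.perm_append_comm.append_left m : (m ++ r₂ ++ r₁).Perm (m ++ (r₁ ++ r₂))).nodup_iff.2
          (by simpa using hD)) hI h3 (handleArc_injective harc (hf i (by simp)))
      (fun i' hi' => fresh_handleArc (hne i' hi') (hf i' (by simp [hi'])))
      (by
        intro x ℓ hℓ
        simp only [handleWord] at hℓ
        split_ifs at hℓ
        · exact (List.mem_cons.1 hℓ).elim (fun h => by rw [h]; rfl) (hom x ℓ)
        · exact (List.mem_cons.1 hℓ).elim (fun h => by rw [h]; rfl) (hom x ℓ)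
        · exact hom x ℓ hℓ)
      (by
        intro x
        simp only [handleWord, moveExp]
        split_ifs
        · simp [netExp, sgn, he]
          ring
        · simp [netExp, sgn, he]
          ring
        · exact he x)
    have hw : (fun x => handleWord i r₁ r₂ om x ++ word x) =
        handleWord i r₁ r₂ fun x => om x ++ word x := by
      funext x
      simp only [handleWord]
      split_ifs <;> rfl
    rw [hw] at g4
    exact ⟨arc', om', g1, g2, g3, hh.trans g4⟩

end PrismaticLink

namespace PrismaticLink

variable {g : ℕ}

/-! ### Diagrams of a link -/

theorem linkCode_diagram {cs : List (Color g × List (Letter g))} :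
    (linkCode cs).diagram = ((Multiset.ofList (cs.map fun c => (c.1, Cycle.ofList c.2))).filter
      fun c => c.1 = none).map Prod.snd := by
  rw [Multiset.filter_coe, Multiset.map_coe, List.filter_map, List.map_map, linkCode, Code.diagram,
    List.map_map]
  rfl

namespace VirtualLink

variable {L : VirtualLink}

theorem perm_comps (L : VirtualLink) :
    (List.replicate (L.comps.count []) [] ++ L.comps.filter (· ≠ [])).Perm L.comps := by
  have := List.filter_append_perm (fun c : List (Fin L.n × Bool) => c == []) L.comps
  rw [List.filter_beq] at this
  convert this using 3
  funext c
  cases c <;> rfl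

theorem decorate_diagram (κ : Fin L.n → ℕ) (om : Fin L.n × Bool → List (Letter g)) :
    (L.decorate κ om).diagram = Multiset.ofList (List.replicate (L.comps.count []) Cycle.nil ++
      (L.comps.filter (· ≠ [])).map fun c =>
        Cycle.ofList (c.flatMap fun p => om p ++ [L.letter g κ p])) := by
  rw [decorate, Code.diagram, List.map_map, Multiset.coe_eq_coe]
  refine (L.perm_comps.symm.map _).trans (List.Perm.of_eq ?_)
  rw [List.map_append, List.map_replicate]
  rfl

/-- The components of a link with crossings, as cyclic lists of strands. -/
def strandComps {Y : Type*} (st : Fin L.n × Bool → Strand Y g) : List (Color g × List (Strand Y g)) :=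
  (L.comps.filter (· ≠ [])).map fun c => (none, c.map st)

theorem strandComps_spec {Y : Type*} {st : Fin L.n × Bool → Strand Y g} {next : Y → Y}
    (hst : ∀ p, (st p).color = none) (hnext : ∀ p, (st (L.next p)).start = next (st p).fin) :
    ∀ c ∈ strandComps st, c.2 ≠ [] ∧ IsCyc next c.2 ∧ ∀ t ∈ c.2, t.color = c.1 := by
  intro c hc
  obtain ⟨c, h, rfl⟩ := List.mem_map.1 hc
  obtain ⟨h1, h2⟩ : c ∈ L.comps ∧ c ≠ [] := by simpa using h
  have hn : c.Nodup := (List.nodup_flatten.1 L.nodup).1 c h1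
  refine ⟨by simpa using h2, ?_, ?_⟩
  · rw [IsCyc, ← List.map_rotate, ← map_formPerm hn, List.map_map, List.map_map, List.map_map]
    refine List.map_congr_left fun p hp => ?_
    rw [Function.comp_apply, Function.comp_apply, Function.comp_apply, ← hnext, next_apply_eq,
      prod_formPerm_of_mem L.nodup h1 hp]
  · intro t ht
    obtain ⟨p, -, rfl⟩ := List.mem_map.1 ht
    exact hst p

theorem flatMap_strandComps {Y : Type*} (st : Fin L.n × Bool → Strand Y g) :
    (strandComps st).flatMap Prod.snd = L.comps.flatten.map st := by
  rw [strandComps, List.flatMap_map, ← List.flatten_filter_ne_nil, List.map_flatten,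
    List.flatMap_def]

theorem perm_flatten_top (L : VirtualLink) :
    L.comps.flatten.Perm (L.top (List.finRange L.n)) := by
  have hb : (L.top (List.finRange L.n)).Nodup := (perm_top _).nodup_iff.2 nodup_bottom
  refine (List.perm_ext_iff_of_nodup L.nodup hb).2 fun p => ?_
  simp [L.complete p, (perm_top _).mem_iff, mem_bottom p]

/-- Each passage gets its own strand, the crossings are drawn side by side, and all the topology is
left to the lower ends: handles put them in the order in which nested caps join each strand to the
next one, and give them the prescribed exponents on the way. Components without crossings are small
circles. -/
theorem exists_surfaceDiagram (L : VirtualLink) :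
    ∃ g, 0 < g ∧ ∃ (D : SurfaceDiagram g) (k : ℕ) (om : Fin L.n × Bool → List (Letter g)),
      (∀ p, ∀ ℓ ∈ om p, ℓ.isClassical = false) ∧ (∀ p, netExp (om p) = L.exponent p) ∧
      D.code.diagram = (L.decorate (fun c : Fin L.n => k + (c : ℕ)) om).diagram := by
  have hb := nodup_bottom (L := L)
  have ht : (L.top (List.finRange L.n)).Nodup := (perm_top _).nodup_iff.2 hb
  have htm : ∀ p, p ∈ L.top (List.finRange L.n) := fun p => (perm_top _).mem_iff.2 (mem_bottom p)
  have htn : ((L.top (List.finRange L.n)).reverse.map L.next).Nodup :=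
    (List.nodup_reverse.2 ht).map L.next.injective
  -- Nested caps pair the upper ends, read from the right, with the lower ends, read from the left.
  -- So below the end of `p` the strand `L.next p` must be waiting, and the lower ends have to be
  -- brought from the order of `bottom` reversed to `L.next` of `top` reversed.
  obtain ⟨H, e₁, hH, he₁⟩ := exists_handleMoves [] (L.bottom (List.finRange L.n)).reverse
    ((L.top (List.finRange L.n)).reverse.map L.next)
    ((List.perm_ext_iff_of_nodup (List.nodup_reverse.2 hb) htn).2 fun p => by
      simp only [List.mem_reverse, mem_bottom, List.mem_map, true_iff]
      exact ⟨L.next⁻¹ p, htm _, by simp⟩) (by simpa using htn) (fun _ => 0) L.exponent (by simp)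
  obtain rfl : e₁ = L.exponent := by
    funext p
    refine he₁ p ?_
    simp only [List.nil_append, List.mem_reverse, List.mem_map]
    exact ⟨L.next⁻¹ p, htm _, by simp⟩
  -- One more handle, which the diagram does not meet, guarantees positive genus.
  replace hH := hH.trans (HandleMoves.single (m := (L.top (List.finRange L.n)).reverse.map L.next)
    (r₁ := []) (r₂ := []) (e := L.exponent) (by simp) rfl)
  simp only [List.nil_append, List.append_nil] at hH
  obtain ⟨g, hg⟩ : ∃ g, g = (H ++ [(0, 0)]).length := ⟨_, rfl⟩
  refine ⟨g, by simp [hg], ?_⟩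
  subst hg
  obtain ⟨K, hK⟩ : ∃ K, K = H ++ [(0, 0)] := ⟨_, rfl⟩
  rw [List.length_nil] at hH
  rw [← hK] at hH ⊢
  -- The curves of a handle are crossed once by each strand of the corresponding block, always
  -- positively.
  obtain ⟨pts, hpts⟩ : ∃ pts : Palette K.length → List Bool, pts = Sum.elim
      (fun i => List.replicate K[i].1 true) (fun i => List.replicate K[i].2 true) := ⟨_, rfl⟩
  obtain ⟨k, hk⟩ : ∃ k, k = 0 + (circleWord (g := K.length) (L.comps.count [])).length := ⟨_, rfl⟩
  obtain ⟨arc, harc⟩ : ∃ arc : Fin L.n × Bool → ArcName K.length,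
    arc = fun p => .inl (k + (L.bottom (List.finRange L.n)).idxOf p) := ⟨_, rfl⟩
  have hinj : arc.Injective := by
    intro p p' h
    simp only [harc, Sum.inl.injEq, add_right_inj] at h
    exact (List.idxOf_inj (mem_bottom p)).1 h
  obtain ⟨κ₀, hκ₀⟩ : ∃ κ₀, κ₀ = k + (cupWord (g := K.length) 0
      ((L.bottom (List.finRange L.n)).map fun _ => none)).length := ⟨_, rfl⟩
  obtain ⟨κ, hκ⟩ : ∃ κ : Fin L.n → ℕ, κ = fun c : Fin L.n => κ₀ + (c : ℕ) := ⟨_, rfl⟩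
  have r₁ := run_circleWord (L.comps.count []) 0 (boundary pts) []
  have r₂ := run_cupWord (fun _ => none) arc (L.bottom (List.finRange L.n)) k
    (fun i hi => by simp [harc, hb.idxOf_getElem]) [] (boundary pts)
    (List.replicate (L.comps.count []) (none, []))
  have r₃ := run_crossWord κ (upPt arc fun _ => []) (fun _ => ⟨rfl, rfl⟩) (List.finRange L.n) κ₀
    (fun i hi => by simp [hκ]) [] ((L.bottom (List.finRange L.n)).reverse.map (downPt arc) ++
      boundary pts) (List.replicate (L.comps.count []) (none, []))
  obtain ⟨arc', om, hinj', hom, hexp, r₄⟩ := hH.reaches (List.nodup_reverse.2 hb) (pts := pts)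
    (I := List.finRange K.length) (List.nodup_finRange _)
    (by
      simp only [hpts, Sum.elim_inl, Sum.elim_inr, List.length_replicate]
      exact (List.ext_getElem (by simp) fun i _ _ => by simp))
    (by rintro (i | i) b hb <;> exact List.eq_of_mem_replicate (by simpa [hpts] using hb)) hinj
    (fun i _ x j => by simp [harc]) (om := fun _ => []) (by simp) (fun _ => rfl)
    (fun p => [L.letter K.length κ p]) (L.top (List.finRange L.n))
    (List.replicate (L.comps.count []) (none, []))
  obtain ⟨W₄, p₄, r₄⟩ := r₄ (κ₀ + (L.crossWord K.length 0 (List.finRange L.n)).length)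
  obtain ⟨T, hT⟩ : ∃ T, T = (L.top (List.finRange L.n)).map fun p =>
    (⟨p, p, none, om p ++ [L.letter K.length κ p]⟩ : Strand _ K.length) := ⟨_, rfl⟩
  obtain ⟨cs, r₅, hcs⟩ := run_closeWord hinj' T
    (strandComps fun p => ⟨p, p, none, om p ++ [L.letter K.length κ p]⟩)
    (by
      rw [flatMap_strandComps, hT]
      exact L.perm_flatten_top.map _)
    (strandComps_spec (next := L.next) (fun _ => rfl) fun _ => rfl)
    (by simpa [hT, Function.comp_def] using ht)
    (κ₀ + (L.crossWord K.length 0 (List.finRange L.n)).length + W₄.length)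
    (List.replicate (L.comps.count []) (none, []))
  have hmid : State.run ⟨boundary pts, []⟩ 0 (circleWord (L.comps.count []) ++
      (cupWord 0 ((L.bottom (List.finRange L.n)).map fun _ => none) ++
      (L.crossWord K.length 0 (List.finRange L.n) ++
      (W₄ ++ closeWord (T.map Strand.color).reverse)))) =
      some ⟨[], List.replicate (L.comps.count []) (none, []) ++ cs⟩ := by
    refine run_append r₁ ?_
    rw [← hk]
    refine run_append r₂ ?_
    rw [← hκ₀]
    refine run_append (S₁ := ⟨(L.top (List.finRange L.n)).map (upPt arc fun x =>
      [] ++ [L.letter K.length κ x]) ++ (L.bottom (List.finRange L.n)).reverse.map (downPt arc) ++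
      (List.finRange K.length).flatMap (handleBoundary pts), _⟩) ?_ (run_append r₄ ?_)
    · rw [List.append_assoc]
      refine Eq.trans r₃ ?_
      rw [← List.append_assoc]
      rfl
    · convert r₅ using 4
      · rw [hT, List.map_map]
        rfl
      · rw [hT, ← List.map_reverse, List.map_map, List.map_map]
        rfl
  obtain ⟨D, hD⟩ : ∃ D : SurfaceDiagram K.length,
      D.comps = List.replicate (L.comps.count []) (none, []) ++ cs := by
    refine ⟨⟨pts, _, ?_, _, hmid⟩, rfl⟩
    have hTc : ∀ c ∈ (T.map Strand.color).reverse, c = none := by simp [hT]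
    have hbc : ∀ c ∈ (L.bottom (List.finRange L.n)).map (fun _ => (none : Color K.length)),
      c = none := by simp
    intro ℓ hℓ
    simp only [List.mem_append] at hℓ
    rcases hℓ with h | h | h | h | h
    · exact isPlain_circleWord _ ℓ h
    · exact isPlain_cupWord _ _ hbc ℓ h
    · exact isPlain_crossWord _ _ ℓ h
    · exact p₄ ℓ h
    · exact isPlain_closeWord _ hTc ℓ h
  refine ⟨D, κ₀, om, hom, fun p => by rw [hexp]; simp [moveExp], ?_⟩
  rw [SurfaceDiagram.code, hD, linkCode_diagram, List.map_append, ← Multiset.coe_add, hcs,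
    ← hκ, decorate_diagram, ← Multiset.coe_add, Multiset.filter_add, Multiset.map_add,
    strandComps, List.map_map, List.map_replicate, Multiset.filter_coe, Multiset.filter_coe,
    List.filter_eq_self.2, List.filter_eq_self.2, Multiset.map_coe, Multiset.map_coe,
    List.map_replicate, List.map_map]
  · simp only [Function.comp_def, List.flatMap_map]
    rfl
  · intro c hc
    obtain ⟨c', -, rfl⟩ := List.mem_map.1 hc
    simp
  · simp

end VirtualLink

end PrismaticLink

namespace PrismaticLink

variable {g : ℕ}

/-! ### Planar diagrams of the homotopy `Zh`-construction -/

section Zh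

theorem countP_eq_one {Y : Type*} [DecidableEq Y] {l : List Y} (hl : l.Nodup) {y : Y} (hy : y ∈ l) :
    l.countP (fun x => x = y) = 1 := by
  rw [← List.count_eq_one_of_mem hl hy, List.count]
  congr

theorem exists_perm_cons_cons {Y : Type*} {l : List Y} {a b : Y} (ha : a ∈ l) (hb : b ∈ l)
    (h : a ≠ b) : ∃ V, l.Perm (a :: b :: V) := by
  classical
  exact ⟨_, (List.perm_cons_erase ha).trans
    ((List.perm_cons_erase ((List.mem_erase_of_ne h.symm).2 hb)).cons _)⟩

theorem exists_arcName {Y : Type*} {l : List Y} (hl : l.Nodup) (hm : ∀ y, y ∈ l) (k : ℕ) :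
    ∃ arc : Y → ArcName g, arc.Injective ∧
      ∀ (i : ℕ) (hi : i < l.length), arc l[i] = .inl (k + i) := by
  classical
  refine ⟨fun y => .inl (k + l.idxOf y), fun y y' h => ?_, fun i hi => by simp [hl.idxOf_getElem]⟩
  simp only [Sum.inl.injEq, add_right_inj] at h
  exact (List.idxOf_inj (hm y)).1 h

variable {X : Type*}

/-- The colour of a strand of the link, or of a strand of a given colour in the palette. -/
def strandColor : X ⊕ Palette g → Color g := Sum.elim (fun _ => none) some

/-- The upper end of a strand. -/
def colorUp (arc : X ⊕ Palette g → ArcName g) (word : X ⊕ Palette g → List (Letter g))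
    (y : X ⊕ Palette g) : Pt g :=
  ⟨strandColor y, true, arc y, word y⟩

/-- The lower end of a strand. -/
def colorDown (arc : X ⊕ Palette g → ArcName g) (y : X ⊕ Palette g) : Pt g :=
  ⟨strandColor y, false, arc y, []⟩

variable [DecidableEq X] {arc : X ⊕ Palette g → ArcName g}

/-- Virtual crossings bring the two strands side by side and back again. Up to detour moves, the
strand of colour `z` can therefore pass over any strand of the link with either sign. -/
theorem reaches_omega {U : List (X ⊕ Palette g)} (hU : U.Nodup) {p : X} {z : Palette g}
    (hp : .inl p ∈ U) (hz : .inr z ∈ U) (ε : Bool) (word : X ⊕ Palette g → List (Letter g))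
    (R : List (Pt g)) (closed) :
    Reaches (fun _ => True) ⟨U.map (colorUp arc word) ++ R, closed⟩
      ⟨U.map (colorUp arc (Function.update word (.inl p) (word (.inl p) ++ [.omega z ε]))) ++ R,
        closed⟩ := by
  obtain ⟨w, hw⟩ : ∃ w, w = Function.update word (.inl p) (word (.inl p) ++ [.omega z ε]) := ⟨_, rfl⟩
  obtain ⟨V, hV⟩ : ∃ V, U.Perm (.inl p :: .inr z :: V) :=
    exists_perm_cons_cons hp hz (by simp)
  have hn := hV.nodup_iff.1 hU
  have hVw : V.map (colorUp arc word) = V.map (colorUp arc w) :=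
    List.map_congr_left fun y hy => by
      have : y ≠ .inl p := by
        rintro rfl
        exact (List.nodup_cons.1 hn).1 (by simp [hy])
      simp [colorUp, hw, this]
  have hup : ∀ (w : X ⊕ Palette g → List (Letter g)) (l : List (X ⊕ Palette g)),
      ∀ p ∈ l.map (colorUp arc w), p.up = true := by
    intro w l p hp
    obtain ⟨y, -, rfl⟩ := List.mem_map.1 hp
    rfl
  have hmeet : (colorUp arc word (.inl p)).meet (.omega z ε) = colorUp arc w (.inl p) := by
    simp [colorUp, Pt.meet, hw]
  have hz' : colorUp arc word (.inr z) = colorUp arc w (.inr z) := by simp [colorUp, hw]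
  have h₁ : ∀ {U'}, U.Perm U' → Reaches (fun _ => True) ⟨U.map (colorUp arc word) ++ R, closed⟩
      ⟨U'.map (colorUp arc word) ++ R, closed⟩ := fun h => by
    simpa using reaches_of_perm (h.map (colorUp arc word)) (hup _ _) [] R closed
  have h₂ : ∀ {U'}, U.Perm U' → Reaches (fun _ => True) ⟨U'.map (colorUp arc w) ++ R, closed⟩
      ⟨U.map (colorUp arc w) ++ R, closed⟩ := fun h => by
    simpa using reaches_of_perm (h.symm.map (colorUp arc w)) (hup _ _) [] R closed
  rw [← hw]
  have hV' := hV.trans (List.Perm.swap _ _ _)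
  cases ε
  · refine (h₁ hV).trans (Reaches.trans ?_ (h₂ hV'))
    refine Reaches.of_step (ℓ := (([] : List (Pt g)).length, .overNeg z)) trivial fun k => ?_
    have := Step.overNeg (k := k) z [] (V.map (colorUp arc word) ++ R) (colorUp arc word (.inl p))
      (colorUp arc word (.inr z)) closed ⟨rfl, rfl⟩ ⟨rfl, rfl⟩
    rw [hmeet, hz', hVw] at this
    rw [List.map_cons, List.map_cons, hz', hVw]
    exact this
  · refine (h₁ hV').trans (Reaches.trans ?_ (h₂ hV))
    refine Reaches.of_step (ℓ := (([] : List (Pt g)).length, .overPos z)) trivial fun k => ?_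
    have := Step.overPos (k := k) z [] (V.map (colorUp arc word) ++ R) (colorUp arc word (.inr z))
      (colorUp arc word (.inl p)) closed ⟨rfl, rfl⟩ ⟨rfl, rfl⟩
    rw [hmeet, hz', hVw] at this
    rw [List.map_cons, List.map_cons, hz', hVw]
    exact this

theorem reaches_omegas {U : List (X ⊕ Palette g)} (hU : U.Nodup) {p : X} (hp : .inl p ∈ U)
    (hz : ∀ z, .inr z ∈ U) {om : List (Letter g)} (hom : ∀ ℓ ∈ om, ℓ.isClassical = false)
    (word : X ⊕ Palette g → List (Letter g)) (R : List (Pt g)) (closed) :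
    Reaches (fun _ => True) ⟨U.map (colorUp arc word) ++ R, closed⟩
      ⟨U.map (colorUp arc (Function.update word (.inl p) (word (.inl p) ++ om))) ++ R, closed⟩ := by
  induction om generalizing word with
  | nil =>
    rw [List.append_nil, Function.update_eq_self]
    exact Reaches.refl _ _
  | cons ℓ om ih =>
    obtain ⟨h1, h2⟩ := List.forall_mem_cons.1 hom
    rcases ℓ with ⟨c, ε⟩ | ⟨c, ε⟩ | ⟨z, ε⟩
    · cases h1
    · cases h1
    · simpa using (reaches_omega hU hp (hz z) ε word R closed).trans (ih h2 _)

theorem reaches_all_omegas {U : List (X ⊕ Palette g)} (hU : U.Nodup) (hz : ∀ z, .inr z ∈ U)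
    {om : X → List (Letter g)} (hom : ∀ p, ∀ ℓ ∈ om p, ℓ.isClassical = false) {ps : List X}
    (hps : ps.Nodup) (hp : ∀ p ∈ ps, .inl p ∈ U) (R : List (Pt g)) (closed) :
    Reaches (fun _ => True) ⟨U.map (colorUp arc fun _ => []) ++ R, closed⟩
      ⟨U.map (colorUp arc (Sum.elim (fun p => if p ∈ ps then om p else []) fun _ => [])) ++ R,
        closed⟩ := by
  induction ps with
  | nil =>
    have : (Sum.elim (fun p => if p ∈ [] then om p else []) fun _ => [] :
        X ⊕ Palette g → List (Letter g)) = fun _ => [] := by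
      funext y
      rcases y with y | y <;> simp
    rw [this]
    exact Reaches.refl _ _
  | cons p ps ih =>
    obtain ⟨hn, hps'⟩ := List.nodup_cons.1 hps
    refine (ih hps' fun p' hp' => hp p' (by simp [hp'])).trans ?_
    have h := reaches_omegas (arc := arc) hU (hp p (by simp)) hz (hom p)
      (Sum.elim (fun p => if p ∈ ps then om p else []) fun _ => []) R closed
    have : (Sum.elim (fun p' => if p' ∈ p :: ps then om p' else []) fun _ => [] :
        X ⊕ Palette g → List (Letter g)) = Function.update
          (Sum.elim (fun p => if p ∈ ps then om p else []) fun _ => []) (.inl p)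
          ((if p ∈ ps then om p else []) ++ om p) := by
      funext y
      rcases y with y | y
      · by_cases h : y = p
        · subst h
          simp [hn]
        · simp [h]
      · simp
    rw [this]
    exact h

end Zh

namespace VirtualLink

variable {L : VirtualLink}

/-- In the plane virtual crossings take over the role of the handles. One extra strand for each
colour in `Ω` supplies all over-crossings of that colour. -/
theorem exists_isLink (L : VirtualLink) {om : Fin L.n × Bool → List (Letter g)}
    (hom : ∀ p, ∀ ℓ ∈ om p, ℓ.isClassical = false) :
    ∃ (W : Word g) (cs : _) (k : ℕ), W.IsLink cs ∧
      (linkCode cs).diagram = (L.decorate (fun c : Fin L.n => k + (c : ℕ)) om).diagram ∧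
      ∀ z : Palette g, cs.countP (fun c => c.1 = some z) = 1 := by
  obtain ⟨pal, hpal⟩ : ∃ pal, pal = (Finset.univ : Finset (Palette g)).toList := ⟨_, rfl⟩
  have hpn : pal.Nodup := hpal ▸ Finset.nodup_toList _
  have hpm : ∀ z, z ∈ pal := by simp [hpal]
  obtain ⟨bot, hbot⟩ : ∃ bot, bot = L.bottom (List.finRange L.n) := ⟨_, rfl⟩
  have hb : bot.Nodup := hbot ▸ nodup_bottom
  have hbm : ∀ p, p ∈ bot := fun p => hbot ▸ mem_bottom p
  obtain ⟨l, hl⟩ : ∃ l : List ((Fin L.n × Bool) ⊕ Palette g), l = bot.map .inl ++ pal.map .inr :=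
    ⟨_, rfl⟩
  have hln : l.Nodup := by
    rw [hl, List.nodup_append]
    refine ⟨hb.map Sum.inl_injective, hpn.map Sum.inr_injective, ?_⟩
    simp
  have hlm : ∀ y, y ∈ l := by
    rintro (p | z)
    · simp [hl, hbm]
    · simp [hl, hpm]
  obtain ⟨k, hk⟩ : ∃ k, k = 0 + (circleWord (g := g) (L.comps.count [])).length := ⟨_, rfl⟩
  obtain ⟨arc, hinj, harc⟩ := exists_arcName (g := g) hln hlm k
  have r₁ := run_circleWord (g := g) (L.comps.count []) 0 [] []
  have r₂ := run_cupWord strandColor arc l k harc [] []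
    (List.replicate (L.comps.count []) (none, []))
  obtain ⟨k₂, hk₂⟩ : ∃ k₂, k₂ = k + (cupWord 0 (l.map strandColor)).length := ⟨_, rfl⟩
  obtain ⟨W₃, -, r₃⟩ := reaches_all_omegas (arc := arc) hln (fun z => hlm _) hom hb
    (fun p _ => hlm _) (l.reverse.map (colorDown arc))
    (List.replicate (L.comps.count []) (none, [])) k₂
  simp only [hbm, if_true] at r₃
  obtain ⟨κ₀, hκ₀⟩ : ∃ κ₀, κ₀ = k₂ + W₃.length := ⟨_, rfl⟩
  obtain ⟨κ, hκ⟩ : ∃ κ : Fin L.n → ℕ, κ = fun c : Fin L.n => κ₀ + (c : ℕ) := ⟨_, rfl⟩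
  obtain ⟨w, hw⟩ : ∃ w : (Fin L.n × Bool) ⊕ Palette g → List (Letter g),
    w = Sum.elim (fun p => om p ++ [L.letter g κ p]) fun _ => [] := ⟨_, rfl⟩
  have r₄ := run_crossWord κ (fun p => colorUp arc (Sum.elim om fun _ => []) (.inl p))
    (fun _ => ⟨rfl, rfl⟩) (List.finRange L.n) κ₀ (fun i hi => by simp [hκ]) []
    (pal.map (fun z => colorUp arc w (.inr z)) ++ l.reverse.map (colorDown arc))
    (List.replicate (L.comps.count []) (none, []))
  -- A strand with a colour in `Ω` is followed by itself, so it closes to exactly one component.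
  obtain ⟨nx, hnx⟩ : ∃ nx : Equiv.Perm ((Fin L.n × Bool) ⊕ Palette g),
    nx = Equiv.sumCongr L.next (Equiv.refl _) := ⟨_, rfl⟩
  -- The order of the upper ends is chosen so that the lower ends, which stay where the cups put
  -- them, are already those of the following strands.
  obtain ⟨T, hT⟩ : ∃ T, T = (l.map nx.symm).map fun y =>
    (⟨y, y, strandColor y, w y⟩ : Strand ((Fin L.n × Bool) ⊕ Palette g) g) := ⟨_, rfl⟩
  have hln' : (l.map nx.symm).Nodup := hln.map nx.symm.injective
  have hlm' : ∀ y, y ∈ l.map nx.symm := fun y => List.mem_map.2 ⟨nx y, hlm _, by simp⟩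
  have hperm : ((L.top (List.finRange L.n)).map Sum.inl ++ pal.map Sum.inr).Perm (l.map nx.symm) := by
    refine (((perm_top _).map _).append_right _).trans ?_
    rw [← hbot, ← hl]
    exact (List.perm_ext_iff_of_nodup hln hln').2 fun y => by simp only [hlm y, hlm' y]
  obtain ⟨W₅, -, r₅⟩ := reaches_of_perm (hperm.map (colorUp arc w)) (by
    intro p hp
    obtain ⟨y, -, rfl⟩ := List.mem_map.1 hp
    rfl) [] (l.reverse.map (colorDown arc)) (List.replicate (L.comps.count []) (none, []))
    (κ₀ + (L.crossWord g 0 (List.finRange L.n)).length)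
  have hpermT : (L.comps.flatten.map (fun p => (.inl p : (Fin L.n × Bool) ⊕ Palette g)) ++
      pal.map Sum.inr).Perm (l.map nx.symm) :=
    ((L.perm_flatten_top.map _).append_right _).trans hperm
  obtain ⟨cs, r₆, hcs⟩ := run_closeWord (next := nx) hinj T
    (strandComps (fun p => ⟨.inl p, .inl p, none, om p ++ [L.letter g κ p]⟩) ++
      pal.map fun z => (some z, [⟨.inr z, .inr z, some z, []⟩]))
    (by
      rw [List.flatMap_append, flatMap_strandComps, hT]
      convert hpermT.map _ using 1
      rw [List.map_append, List.map_map, List.map_map, List.flatMap_map, hw,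
        List.map_eq_flatMap (l := pal)]
      rfl)
    (by
      intro c hc
      rcases List.mem_append.1 hc with hc | hc
      · exact strandComps_spec (next := nx) (fun _ => rfl) (fun _ => by simp [hnx]) c hc
      · obtain ⟨z, -, rfl⟩ := List.mem_map.1 hc
        simp [IsCyc, hnx])
    (by simpa [hT, Function.comp_def] using hln')
    (κ₀ + (L.crossWord g 0 (List.finRange L.n)).length + W₅.length)
    (List.replicate (L.comps.count []) (none, []))
  refine ⟨circleWord (L.comps.count []) ++ (cupWord 0 (l.map strandColor) ++ (W₃ ++
    (L.crossWord g 0 (List.finRange L.n) ++ (W₅ ++ closeWord (T.map Strand.color).reverse)))),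
    List.replicate (L.comps.count []) (none, []) ++ cs, κ₀, ?_, ?_, ?_⟩
  · refine run_append r₁ ?_
    rw [← hk]
    refine run_append r₂ ?_
    rw [← hk₂]
    refine run_append (S₁ := ⟨l.map (colorUp arc (Sum.elim om fun _ => [])) ++
      l.reverse.map (colorDown arc),
        List.replicate (L.comps.count []) (none, [])⟩) ?_ ?_
    · rw [List.append_nil]
      exact r₃
    rw [← hκ₀]
    refine run_append (S₁ := ⟨[] ++ ((L.top (List.finRange L.n)).map Sum.inl ++
      pal.map Sum.inr).map (colorUp arc w) ++ l.reverse.map (colorDown arc),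
        List.replicate (L.comps.count []) (none, [])⟩) ?_
      (run_append r₅ ?_)
    · have e₁ : l.map (colorUp arc (Sum.elim om fun _ => [])) ++ l.reverse.map (colorDown arc) =
          [] ++ (L.bottom (List.finRange L.n)).map
            (fun p => colorUp arc (Sum.elim om fun _ => []) (.inl p)) ++
            (pal.map (fun z => colorUp arc w (.inr z)) ++ l.reverse.map (colorDown arc)) := by
        rw [List.nil_append, ← List.append_assoc]
        congr 1
        rw [hl, hbot, List.map_append, List.map_map, List.map_map, hw]
        rfl
      have e₂ : [] ++ ((L.top (List.finRange L.n)).map Sum.inl ++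
          pal.map Sum.inr).map (colorUp arc w) ++ l.reverse.map (colorDown arc) =
          [] ++ (L.top (List.finRange L.n)).map (fun p => (colorUp arc (Sum.elim om fun _ => [])
            (.inl p)).meet (L.letter g κ p)) ++
            (pal.map (fun z => colorUp arc w (.inr z)) ++ l.reverse.map (colorDown arc)) := by
        rw [List.nil_append, List.nil_append, ← List.append_assoc, List.map_append, List.map_map,
          List.map_map, hw]
        rfl
      rw [e₁, e₂]
      exact r₄
    · convert r₆ using 4
      · rw [hT, List.map_map, List.map_map, List.map_map]
        rfl
      · rw [hT, ← List.map_reverse, ← List.map_reverse, List.map_map, List.map_map]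
        refine List.map_congr_left fun y _ => ?_
        rcases y with y | y <;> simp [colorDown, Strand.down, hnx, strandColor]
  · rw [linkCode_diagram, List.map_append, ← Multiset.coe_add, hcs,
      ← hκ, decorate_diagram, ← Multiset.coe_add, Multiset.filter_add, Multiset.map_add,
      List.map_append, ← Multiset.coe_add, Multiset.filter_add, Multiset.map_add, strandComps]
    simp [List.filter_map, Function.comp_def, List.flatMap_map]
  · intro z
    have hcount : ∀ cs : List (Color g × List (Letter g)),
        cs.countP (fun c => c.1 = some z) = Multiset.countP (fun c => c.1 = some z)
          (Multiset.ofList (cs.map fun c => (c.1, Cycle.ofList c.2))) := by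
      intro cs
      rw [Multiset.coe_countP, List.countP_map]
      rfl
    rw [hcount, List.map_append, ← Multiset.coe_add, hcs, Multiset.countP_add,
      Multiset.coe_countP, Multiset.coe_countP, List.map_append, List.countP_append, strandComps,
      List.map_map, List.map_map, List.countP_map, List.countP_map, List.countP_map]
    simpa [Function.comp_def, List.countP_replicate] using countP_eq_one hpn (hpm z)

end VirtualLink

end PrismaticLink

namespace PrismaticLink

variable {g : ℕ}

/-! ### Equivalence of Gauss codes -/

theorem diagram_map_relabel (σ : ℕ → ℕ) (C : Code g) :
    Code.diagram (C.map (List.map (Letter.relabel σ))) =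
      C.diagram.map (Cycle.map (Letter.relabel σ)) := by
  rw [Code.diagram, Code.diagram, Multiset.map_coe, List.map_map, List.map_map]
  rfl

theorem isRotated_filter {α : Type*} (f : α → Bool) {w w' : List α} (h : w ~r w') :
    w.filter f ~r w'.filter f := by
  obtain ⟨n, rfl⟩ := h
  rw [List.rotate_eq_drop_append_take_mod, List.filter_append]
  conv_lhs => rw [← List.take_append_drop (n % w.length) w, List.filter_append]
  exact List.isRotated_append

/-- Forget the crossings of a cyclic word with `Ω`-coloured strands. -/
def eraseCycle : Cycle (Letter g) → Cycle (Letter g) :=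
  Quotient.map' (s₁ := List.IsRotated.setoid _) (s₂ := List.IsRotated.setoid _)
    (List.filter Letter.isClassical) fun _ _ h => isRotated_filter _ h

theorem diagram_erase_eq {C C' : Code g} (h : C.diagram = C'.diagram) :
    C.erase.diagram = C'.erase.diagram := by
  have e : ∀ C : Code g, C.erase.diagram = C.diagram.map eraseCycle := by
    intro C
    rw [Code.erase, Code.diagram, Code.diagram, Multiset.map_coe, List.map_map, List.map_map]
    rfl
  rw [e, e, h]

/-- Exchange the blocks `[0, k)` and `[k, k + n)`. Diagrams number their crossings from different
layers on, and this compares the numberings. -/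
theorem exists_perm_shift (k n : ℕ) : ∃ σ : Equiv.Perm ℕ, ∀ c < n, σ (k + c) = c := by
  refine ⟨⟨fun x => if x < k then x + n else if x < k + n then x - k else x,
    fun x => if x < n then x + k else if x < k + n then x - n else x, fun x => ?_, fun x => ?_⟩,
    fun c hc => ?_⟩
  · dsimp only
    split_ifs <;> omega
  · dsimp only
    split_ifs <;> omega
  · simp only [Equiv.coe_fn_mk]
    split_ifs <;> omega

theorem perm_flatMap_of_forall₂ {C C' : Code g} (h : List.Forall₂ List.IsRotated C C') :
    (C.flatMap overLabels).Perm (C'.flatMap overLabels) := by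
  induction h with
  | nil => exact List.Perm.refl _
  | @cons w w' _ _ hw _ ih =>
    obtain ⟨n, rfl⟩ := hw
    rw [List.flatMap_cons, List.flatMap_cons]
    refine List.Perm.append ?_ ih
    rw [List.rotate_eq_drop_append_take_mod, overLabels_append]
    conv_lhs => rw [← List.take_append_drop (n % w.length) w, overLabels_append]
    exact List.perm_append_comm

theorem exists_isRotated_of_mem {C C' : Code g} (h : C.diagram = C'.diagram) {w : List (Letter g)}
    (hw : w ∈ C) : ∃ w' ∈ C', w' ~r w := by
  have : (w : Cycle (Letter g)) ∈ C'.diagram := by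
    rw [← h]
    exact Multiset.mem_coe.2 (List.mem_map.2 ⟨w, hw, rfl⟩)
  obtain ⟨w', h1, h2⟩ := List.mem_map.1 (Multiset.mem_coe.1 this)
  exact ⟨w', h1, Cycle.coe_eq_coe.1 h2⟩

theorem Code.WellFormed.of_diagram_eq {C C' : Code g} (h : C.diagram = C'.diagram)
    (hC : C'.WellFormed) : C.WellFormed := by
  refine ⟨?_, fun w hw c ε hc => ?_⟩
  · obtain ⟨C'', h1, h2⟩ := exists_forall₂_of_diagram_eq h
    exact ((perm_flatMap_of_forall₂ h2).trans (h1.symm.flatMap_right _)).nodup_iff.2 hC.nodup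
  · obtain ⟨w', h1, h2⟩ := exists_isRotated_of_mem h hw
    obtain ⟨v, h3, h4⟩ := hC.exists_over w' h1 c ε (h2.mem_iff.2 hc)
    obtain ⟨v', h5, h6⟩ := exists_isRotated_of_mem h.symm h3
    exact ⟨v', h5, h6.mem_iff.2 h4⟩

namespace VirtualLink

variable {L : VirtualLink} {om : Fin L.n × Bool → List (Letter g)}

theorem map_relabel_decorate (hom : ∀ p, ∀ ℓ ∈ om p, ℓ.isClassical = false) (σ : ℕ → ℕ)
    (κ : Fin L.n → ℕ) :
    (L.decorate κ om).map (List.map (Letter.relabel σ)) = L.decorate (σ ∘ κ) om := by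
  rw [decorate, decorate, List.map_map]
  refine List.map_congr_left fun c _ => ?_
  rw [Function.comp_apply, List.map_flatMap]
  congr 1
  funext p
  rw [List.map_append]
  congr 1
  · refine (List.map_congr_left fun ℓ hℓ => ?_).trans (List.map_id _)
    have := hom p ℓ hℓ
    rcases ℓ with ⟨c, ε⟩ | ⟨c, ε⟩ | ⟨z, ε⟩
    · cases this
    · cases this
    · rfl
  · obtain ⟨c, b⟩ := p
    cases b <;> rfl

theorem erase_decorate (hom : ∀ p, ∀ ℓ ∈ om p, ℓ.isClassical = false) (κ : Fin L.n → ℕ) :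
    (L.decorate κ om).erase = L.decorate κ fun _ => [] := by
  rw [decorate, decorate, Code.erase, List.map_map]
  refine List.map_congr_left fun c _ => ?_
  rw [Function.comp_apply, List.filter_flatMap]
  congr 1
  funext p
  rw [List.filter_append, List.filter_eq_nil_iff.2 fun ℓ hℓ => by simp [hom p ℓ hℓ]]
  obtain ⟨c, b⟩ := p
  cases b <;> rfl

theorem code_eq_decorate (L : VirtualLink) :
    L.code g = L.decorate (fun c : Fin L.n => (c : ℕ)) fun _ => [] := by
  rw [decorate, code]
  refine List.map_congr_left fun c _ => ?_
  rw [List.map_eq_flatMap]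
  rfl

theorem equivalent_of_diagram_eq {C C' : Code g} {k k' : ℕ}
    (hom : ∀ p, ∀ ℓ ∈ om p, ℓ.isClassical = false)
    (h : C.diagram = (L.decorate (fun c : Fin L.n => k + (c : ℕ)) om).diagram)
    (h' : C'.diagram = (L.decorate (fun c : Fin L.n => k' + (c : ℕ)) om).diagram) :
    Code.Equivalent C C' := by
  obtain ⟨σ, hσ⟩ := exists_perm_shift k L.n
  obtain ⟨σ', hσ'⟩ := exists_perm_shift k' L.n
  refine ⟨σ.trans σ'.symm, ?_⟩
  rw [diagram_map_relabel, h, ← diagram_map_relabel, map_relabel_decorate hom, h']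
  congr 2
  funext c
  rw [Function.comp_apply, Equiv.trans_apply, hσ c c.2, Equiv.symm_apply_eq, hσ' c c.2]

theorem wellFormed_decorate (hom : ∀ p, ∀ ℓ ∈ om p, ℓ.isClassical = false) {κ : Fin L.n → ℕ}
    (hκ : κ.Injective) : (L.decorate κ om).WellFormed := by
  refine ⟨?_, fun w hw c ε hc => ?_⟩
  · have e : (L.decorate κ om).flatMap overLabels =
        L.comps.flatten.flatMap fun p => if p.2 then [κ p.1] else [] := by
      have e₁ : ∀ l : List (Fin L.n × Bool), overLabels (l.flatMap fun p => om p ++ [L.letter g κ p])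
          = l.flatMap fun p => if p.2 then [κ p.1] else [] := by
        intro l
        induction l with
        | nil => rfl
        | cons p l ih =>
          rw [List.flatMap_cons, List.flatMap_cons, overLabels_append, overLabels_append,
            overLabels_omega (hom p), ih]
          obtain ⟨c, b⟩ := p
          cases b <;> rfl
      rw [decorate, List.flatMap_map]
      simp only [e₁]
      induction L.comps with
      | nil => rfl
      | cons c cs ih => rw [List.flatMap_cons, List.flatten_cons, List.flatMap_append, ih]
    rw [e, List.nodup_flatMap]
    refine ⟨fun p _ => by split_ifs <;> simp, L.nodup.imp fun {p p'} h => ?_⟩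
    obtain ⟨c, b⟩ := p
    obtain ⟨c', b'⟩ := p'
    cases b <;> cases b' <;> simp [Function.onFun]
    exact fun h' => h (by rw [hκ h'])
  · obtain ⟨l, hl, rfl⟩ := List.mem_map.1 hw
    obtain ⟨p, hp, h⟩ := List.mem_flatMap.1 hc
    rcases List.mem_append.1 h with h | h
    · cases hom p _ h
    · obtain ⟨c', b⟩ := p
      obtain ⟨l', hl', hp'⟩ := List.mem_flatten.1 (L.complete (c', true))
      refine ⟨_, List.mem_map.2 ⟨l', hl', rfl⟩, List.mem_flatMap.2 ⟨_, hp', List.mem_append_right _ ?_⟩⟩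
      cases b
      · simp only [letter, List.mem_singleton, Bool.false_eq_true, if_false,
          Letter.under.injEq] at h
        simp [letter, h]
      · simp [letter] at h

end VirtualLink

/-! ### Substitutions -/

theorem map_mono {A B : Type*} [AddCommGroup A] [AddCommGroup B] (f : A →+ B) (a : A) :
    Units.map (AddMonoidAlgebra.mapDomainRingHom ℤ f).toMonoidHom (mono a) = mono (f a) := by
  refine Units.ext ?_
  simp [mono, AddMonoidAlgebra.of]

theorem mono_add {A : Type*} [AddCommGroup A] (a b : A) : mono (a + b) = mono a * mono b := by
  rw [mono, ofAdd_add, map_mul]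
  rfl

theorem mono_neg {A : Type*} [AddCommGroup A] (a : A) : mono (-a) = (mono a)⁻¹ := by
  rw [mono, ofAdd_neg, map_inv]
  rfl

theorem mono_zsmul {A : Type*} [AddCommGroup A] (n : ℤ) (a : A) : mono (n • a) = mono a ^ n := by
  rw [mono, ofAdd_zsmul, map_zpow]
  rfl

theorem sum_single (z : Palette g) : ∑ z', (Pi.single z 1 : Palette g → ℤ) z' = 1 :=
  (Finset.sum_pi_single' z 1 _).trans (if_pos (Finset.mem_univ _))

/-- The substitution is `s = q⁻²w⁻¹`, `t = w`, so the parameters of the determinant are `s t = q⁻²`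
and `t = w`. -/
theorem signEq_gap {L : VirtualLink} {k : ℕ} {om : Fin L.n × Bool → List (Letter g)}
    (hom : ∀ p, ∀ ℓ ∈ om p, ℓ.isClassical = false) (hexp : ∀ p, netExp (om p) = L.exponent p)
    {C : Code g} (h : C.diagram = (L.decorate (fun c : Fin L.n => k + (c : ℕ)) om).diagram) :
    SignEq (codeDet (mono ((-2, 0) : ℤ × ℤ)) (fun _ => mono ((0, 1) : ℤ × ℤ)) C)
      (gapSubst L.gap) := by
  refine (signEq_codeDet_of_diagram_eq h).trans ?_
  have := signEq_codeDet_decorate gapSubst (L := L) (g := g)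
    (κ := fun c : Fin L.n => k + (c : ℕ)) (fun a b hab => Fin.ext (by simpa using hab)) hom hexp
    (s := mono ((-2, -1) : ℤ × ℤ)) (t := mono ((0, 1) : ℤ × ℤ))
    ((map_mono _ _).trans (by simp)) ((map_mono _ _).trans (by simp))
  rwa [← mono_add] at this

theorem signEq_cswSubst {L : VirtualLink} {k : ℕ} {om : Fin L.n × Bool → List (Letter g)}
    (hom : ∀ p, ∀ ℓ ∈ om p, ℓ.isClassical = false) (hexp : ∀ p, netExp (om p) = L.exponent p)
    {C : Code g} (h : C.diagram = (L.decorate (fun c : Fin L.n => k + (c : ℕ)) om).diagram) :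
    SignEq (cswSubst g (codeDet (uVar g)⁻¹ zVar C)) (gapSubst L.gap) := by
  have h₁ : Units.map (cswSubst g).toMonoidHom (uVar g)⁻¹ = mono ((-2, 0) : ℤ × ℤ) := by
    rw [uVar, ← mono_neg, cswSubst, map_mono]
    simp
  have h₂ : (fun z => Units.map (cswSubst g).toMonoidHom (zVar z)) = fun _ => mono ((0, 1) : ℤ × ℤ) := by
    funext z
    rw [zVar, cswSubst, map_mono]
    simp only [AddMonoidHom.coe_mk, ZeroHom.coe_mk, sum_single, mul_zero]
  rw [map_codeDet, h₁, h₂]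
  exact signEq_gap hom hexp h

/-- The inversion of `q` and of the colours turns the parameters `q²` and `z⁻¹` of the functor into
`q⁻²` and `w`, the ones for `G_L`. The unit `q^m` becomes `q^(-m)`, and no power of `w` appears. -/
theorem quantumSubst_eq {L : VirtualLink} {k : ℕ} {om : Fin L.n × Bool → List (Letter g)}
    (hom : ∀ p, ∀ ℓ ∈ om p, ℓ.isClassical = false) (hexp : ∀ p, netExp (om p) = L.exponent p)
    {C : Code g} (h : C.diagram = (L.decorate (fun c : Fin L.n => k + (c : ℕ)) om).diagram)
    {W : Word g} {cs : List (Color g × List (Letter g))} (hW : W.IsLink cs)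
    (hcs : Code.Equivalent (linkCode cs) C) :
    ∃ (ε : ℤˣ) (m : ℤ), quantumSubst g (quantumPoly W) =
      ((ε : ℤ) : LaurentTwo) * (mono ((m, 0) : ℤ × ℤ) : LaurentTwoˣ) * gapSubst L.gap := by
  obtain ⟨ε, m, hm⟩ := word_eval_eq_codeDet (uVar g) zVar hW
  have hmap : quantumSubst g (codeDet (uVar g ^ 2) (fun z => (zVar z)⁻¹) (linkCode cs)) =
      codeDet (mono ((-2, 0) : ℤ × ℤ)) (fun _ => mono ((0, 1) : ℤ × ℤ)) (linkCode cs) := by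
    rw [map_codeDet, map_pow, quantumSubst, uVar, map_mono, ← zpow_natCast, ← mono_zsmul]
    congr 1
    · simp
    · funext z
      rw [map_inv, zVar, map_mono, ← mono_neg]
      simp only [AddMonoidHom.coe_mk, ZeroHom.coe_mk, sum_single]
      simp
  obtain ⟨ε', hε'⟩ := (signEq_codeDet_of_equivalent hcs).trans (signEq_gap hom hexp h)
  have hq : quantumSubst g (((uVar g) ^ m : (LaurentPalette g)ˣ) : LaurentPalette g) =
      (mono ((-m, 0) : ℤ × ℤ) : LaurentTwoˣ) := by
    have : Units.map (quantumSubst g).toMonoidHom (uVar g ^ m) = mono ((-m, 0) : ℤ × ℤ) := by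
      rw [map_zpow, quantumSubst, uVar, map_mono, ← mono_zsmul]
      simp
    rw [← this]
    rfl
  refine ⟨ε * ε', -m, ?_⟩
  rw [quantumPoly, hm, map_mul, map_mul, map_intCast, hq, hmap, hε']
  push_cast
  ring

end PrismaticLink

theorem theorem7p2 (L : VirtualLink) :
    ∃ g : ℕ, 0 < g ∧ ∃ D : SurfaceDiagram g,
      D.Represents L ∧
      (∃ W : Word g, D.IsZh W) ∧
      (∀ W : Word g, D.IsZh W → ∃ (ε : ℤˣ) (k : ℤ),
        quantumSubst g (quantumPoly W)
          = ((ε : ℤ) : LaurentTwo) * (mono ((k, 0) : ℤ × ℤ) : LaurentTwoˣ) * gapSubst L.gap) ∧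
      (∃ Δ : LaurentPalette g, D.IsCSW Δ) ∧
      (∀ Δ : LaurentPalette g, D.IsCSW Δ →
        Associated (cswSubst g Δ) (gapSubst L.gap)) := by
  obtain ⟨g, hg, D, k, om, hom, hexp, hD⟩ := L.exists_surfaceDiagram
  have hideal : zerothIdeal (LaurentPalette g) (AlexanderModule D.code) =
      Ideal.span {codeDet (uVar g)⁻¹ zVar D.code} :=
    zerothIdeal_alexanderModule (.of_diagram_eq hD (VirtualLink.wellFormed_decorate hom
      fun a b hab => Fin.ext (by simpa using hab)))
  refine ⟨g, hg, D, ?_, ?_, ?_, ⟨_, hideal⟩, ?_⟩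
  · have h := diagram_erase_eq hD
    rw [VirtualLink.erase_decorate hom] at h
    exact VirtualLink.equivalent_of_diagram_eq (k' := 0) (om := fun _ => []) (by simp) h
      (by simp [VirtualLink.code_eq_decorate])
  -- The planar diagram is built from the same `Ω`-words `om` as the surface diagram, so the
  -- decorated Gauss diagrams agree up to names.
  · obtain ⟨W, cs, k', hW, hcs, hcount⟩ := L.exists_isLink hom
    exact ⟨W, cs, hW, VirtualLink.equivalent_of_diagram_eq hom hcs hD, hcount⟩
  · rintro W ⟨cs, hW, hcs, -⟩
    exact quantumSubst_eq hom hexp hD hW hcs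
  · intro Δ hΔ
    -- The Laurent polynomial ring is a domain, so two generators of a principal ideal differ by a
    -- unit, and the substitution takes units to units.
    rw [SurfaceDiagram.IsCSW, hideal, Ideal.span_singleton_eq_span_singleton] at hΔ
    exact (hΔ.symm.map (cswSubst g)).trans (signEq_cswSubst hom hexp hD).associated
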